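/- Let $M$ be a smooth $3$-manifold, let $\mathfrak{iso}(2,1)=\mathbb R^{2,1}\rtimes\mathfrak{so}(2,1)$ be the Poincaré Lie algebra, and let $\nabla\in\Omega^1(M)\otimes\mathfrak{iso}(2,1)$ be a flat connection on the trivial bundle, i.e. $d\nabla+\tfrac12[\nabla,\nabla]=0$. Put $$\mathfrak g=\Omega^*(M)\otimes\mathfrak{iso}(2,1),\qquad d_\nabla=d_{dR}+[\nabla,\cdot\,],\qquad [\alpha\otimes X,\beta\otimes Y]=(\alpha\wedge\beta)\otimes[X,Y].$$ A dg Artinian algebra $(R,\mathfrak m_R)$ over $\mathbb R$ is a graded commutative dg algebra in degrees $\le 0$ with finite-dimensional homogeneous parts, only finitely many of them non-zero, which has a unique maximal ideal $\mathfrak m_R$; this ideal is nilpotent and stable under the differential, and $R/\mathfrak m_R=\mathbb R$. Morphisms are maps of dg algebras. For such $R$ let $\mathcal B\mathfrak g(R)$ be the simplicial set with $$\mathcal B\mathfrak g(R)_n=\Big\{A\in\bigoplus_{p+q+r=1}\mathfrak g^p\otimes\mathfrak m_R^q\otimes\Omega^r(\Delta^n)\ :\ d_{tot}A+\tfrac12[A,A]=0\Big\},$$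 where $\Omega^*(\Delta^n)$ is the algebra of smooth forms on the $n$-simplex, $d_{tot}=d_\nabla+(-1)^p d_R+(-1)^{p+q}d_{dR,\Delta^n}$ on $\mathfrak g^p\otimes R^q\otimes\Omega^r(\Delta^n)$, and the bracket is extended with the Koszul sign rule. Then: 1. $(\mathfrak g,d_\nabla,[\cdot,\cdot])$ is a differential graded Lie algebra. 2. $R\mapsto\mathcal B\mathfrak g(R)$ is a formal moduli problem, i.e. a functor $F$ from dg Artinian algebras to simplicial sets such that: $F$ sends quasi-isomorphisms to weak homotopy equivalences; $F(\mathbb R)$ is contractible; $F$ sends surjections to Kan fibrations; and for all surjections $B\to A$ and $C\to A$ the fibre product $B\times_AC$ exists and $F(B\times_AC)\to F(B)\times_{F(A)}F(C)$ is a weak homotopy equivalence. 3. Let $R$ be an ordinary Artinian algebra, i.e. $R$ is concentrated in degree $0$. (a) The map $A\mapsto A\otimes 1$ is a bijection $$\big\{A\in\Omega^1(M,\mathfrak{iso}(2,1))\otimes\mathfrak m_R : d_\nabla A+\tfrac12[A,A]=0\big\}\ \cong\ \mathcal B\mathfrak g(R)_0 .$$ (b) For $A\in\Omega^1(M,\mathfrak{iso}(2,1))\otimes\mathfrak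 m_R$, the equation $d_\nabla A+\tfrac12[A,A]=0$ holds if and only if the deformed connection $\nabla+A$ is flat, i.e. $d(\nabla+A)+\tfrac12[\nabla+A,\nabla+A]=0$. (c) For $A\in\Omega^1(M,\mathfrak{iso}(2,1))\otimes R$ with $\mathfrak{so}(2,1)$-part $\omega$ and $\mathbb R^{2,1}$-part $e$, one has $dA+\tfrac12[A,A]=0$ if and only if $d\omega+\tfrac12[\omega,\omega]=0$ (flatness) and $de+\omega\wedge e=0$ (zero torsion). 4. In particular, for $A=\omega+e\in\Omega^1(M,\mathfrak{iso}(2,1))$ the curvature $F_A=dA+\tfrac12[A,A]$ vanishes if and only if $\Omega[\omega]=d\omega+\tfrac12[\omega,\omega]=0$ and $d_\omega e=de+\omega\wedge e=0$. -/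

import Mathlib

open CategoryTheory
open scoped TensorProduct DirectSum ContDiff Manifold

universe u

noncomputable section

namespace Gravity

section Graded

variable {V : Type*} [AddCommGroup V] [Module ℝ V]

/-- The grading involution `x ↦ (-1)^{deg x} x` of a `ℤ`-graded real vector space. -/
def parity (𝒱 : ℤ → Submodule ℝ V) [DirectSum.Decomposition 𝒱] : V →ₗ[ℝ] V :=
  DirectSum.coeLinearMap 𝒱 ∘ₗ
    DirectSum.lmap (fun n : ℤ => ((-1 : ℝ) ^ n) • (LinearMap.id : 𝒱 n →ₗ[ℝ] 𝒱 n)) ∘ₗ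
      (DirectSum.decomposeLinearEquiv 𝒱).toLinearMap

lemma parity_of_mem (𝒱 : ℤ → Submodule ℝ V) [DirectSum.Decomposition 𝒱] {n : ℤ} {x : V}
    (hx : x ∈ 𝒱 n) : parity 𝒱 x = ((-1 : ℝ) ^ n) • x := by
  lift x to 𝒱 n using hx
  simp [parity]

/-- A degree preserving linear map commutes with the grading involutions. -/
lemma map_parity {V' : Type*} [AddCommGroup V'] [Module ℝ V'] (𝒱 : ℤ → Submodule ℝ V)
    [DirectSum.Decomposition 𝒱] (𝒱' : ℤ → Submodule ℝ V') [DirectSum.Decomposition 𝒱']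
    (f : V →ₗ[ℝ] V') (hf : ∀ n, ∀ x ∈ 𝒱 n, f x ∈ 𝒱' n) (x : V) :
    f (parity 𝒱 x) = parity 𝒱' (f x) := by
  have : f ∘ₗ parity 𝒱 = parity 𝒱' ∘ₗ f := by
    apply DirectSum.decompose_lhom_ext 𝒱
    intro n
    ext ⟨y, hy⟩
    simp [parity_of_mem 𝒱 hy, parity_of_mem 𝒱' (hf n y hy)]
  exact LinearMap.congr_fun this x

/-- The Koszul sign operator on `U ⊗ V`: with `ε`, `ε'` the grading involutions of `U` and `V`, it
is `u ⊗ v ↦ (-1)^{deg u deg v} u ⊗ v` on homogeneous elements, see `koszul_tmul`. -/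
def koszul {U : Type*} [AddCommGroup U] [Module ℝ U] (ε : U →ₗ[ℝ] U) (ε' : V →ₗ[ℝ] V) :
    U ⊗[ℝ] V →ₗ[ℝ] U ⊗[ℝ] V :=
  (1 / 2 : ℝ) • (LinearMap.id + TensorProduct.map ε LinearMap.id +
    TensorProduct.map LinearMap.id ε' - TensorProduct.map ε ε')

lemma koszul_tmul {U : Type*} [AddCommGroup U] [Module ℝ U] (𝒰 : ℤ → Submodule ℝ U)
    [DirectSum.Decomposition 𝒰] (𝒱 : ℤ → Submodule ℝ V) [DirectSum.Decomposition 𝒱]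
    {p q : ℤ} {x : U} {y : V} (hx : x ∈ 𝒰 p) (hy : y ∈ 𝒱 q) :
    koszul (parity 𝒰) (parity 𝒱) (x ⊗ₜ[ℝ] y) = ((-1 : ℝ) ^ (p * q)) • (x ⊗ₜ[ℝ] y) := by
  simp only [koszul, LinearMap.smul_apply, LinearMap.sub_apply, LinearMap.add_apply,
    LinearMap.id_apply, TensorProduct.map_tmul, parity_of_mem 𝒰 hx, parity_of_mem 𝒱 hy,
    TensorProduct.smul_tmul', TensorProduct.tmul_smul]
  rcases Int.even_or_odd p with hp | hp <;> rcases Int.even_or_odd q with hq | hq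
  · simp [hp.neg_one_zpow, hq.neg_one_zpow, (hp.mul_right q).neg_one_zpow]; module
  · simp [hp.neg_one_zpow, hq.neg_one_zpow, (hp.mul_right q).neg_one_zpow]; module
  · simp [hp.neg_one_zpow, hq.neg_one_zpow, (hq.mul_left p).neg_one_zpow]; module
  · simp [hp.neg_one_zpow, hq.neg_one_zpow, (hp.mul hq).neg_one_zpow]; module

/-- A linear isomorphism `V ≅ ⨁ₙ Xₙ` decomposes `V` into the images of the summands. -/
@[reducible] def rangeDecomposition {X : ℤ → Type*} [∀ n, AddCommGroup (X n)]
    [∀ n, Module ℝ (X n)] (j : ∀ n, X n →ₗ[ℝ] V) (dec : V →ₗ[ℝ] ⨁ n, X n)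
    (h₁ : DirectSum.toModule ℝ ℤ V j ∘ₗ dec = LinearMap.id)
    (h₂ : ∀ n x, dec (j n x) = DirectSum.lof ℝ ℤ X n x) :
    DirectSum.Decomposition (fun n => LinearMap.range (j n)) :=
  DirectSum.Decomposition.ofLinearMap _
    (DirectSum.lmap (fun n => (j n).rangeRestrict) ∘ₗ dec)
    (by
      have : DirectSum.coeLinearMap (fun n => LinearMap.range (j n)) ∘ₗ
          DirectSum.lmap (fun n => (j n).rangeRestrict) = DirectSum.toModule ℝ ℤ V j := by
        ext n x
        rw [LinearMap.comp_apply, LinearMap.comp_apply, DirectSum.lmap_lof,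
          DirectSum.coeLinearMap_lof, LinearMap.comp_apply, DirectSum.toModule_lof]
        rfl
      rw [← LinearMap.comp_assoc, this, h₁])
    (by
      apply DirectSum.linearMap_ext
      intro n
      ext1 ⟨x, z, hz⟩
      subst hz
      rw [LinearMap.comp_apply, LinearMap.comp_apply, DirectSum.coeLinearMap_lof,
        LinearMap.comp_apply, h₂, DirectSum.lmap_lof]
      rfl)

/-- The grading of `V ⊗ N` induced by a grading of `V`. -/
def tensorGrading (𝒱 : ℤ → Submodule ℝ V) (N : Type*) [AddCommGroup N] [Module ℝ N] (n : ℤ) :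
    Submodule ℝ (V ⊗[ℝ] N) :=
  LinearMap.range ((𝒱 n).subtype.rTensor N)

instance tensorDecomposition (𝒱 : ℤ → Submodule ℝ V) [DirectSum.Decomposition 𝒱]
    (N : Type*) [AddCommGroup N] [Module ℝ N] :
    DirectSum.Decomposition (tensorGrading 𝒱 N) :=
  rangeDecomposition (fun n => (𝒱 n).subtype.rTensor N)
    ((TensorProduct.directSumLeft ℝ ℝ (fun n => ↥(𝒱 n)) N).toLinearMap ∘ₗ
      (DirectSum.decomposeLinearEquiv 𝒱).toLinearMap.rTensor N)
    (by
      apply TensorProduct.ext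
      apply DirectSum.decompose_lhom_ext 𝒱
      intro n
      ext x y
      simp)
    (by
      intro n x
      induction x using TensorProduct.induction_on with
      | zero => simp
      | add a b ha hb => simp only [map_add, ha, hb]
      | tmul a b => simp)

/-- The grading of a direct sum `⨁ₙ Xₙ` by its summands. -/
def sumGrading (X : ℤ → Type*) [∀ n, AddCommGroup (X n)] [∀ n, Module ℝ (X n)] (n : ℤ) :
    Submodule ℝ (⨁ n, X n) :=
  LinearMap.range (DirectSum.lof ℝ ℤ X n)

instance sumDecomposition (X : ℤ → Type*) [∀ n, AddCommGroup (X n)] [∀ n, Module ℝ (X n)] :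
    DirectSum.Decomposition (sumGrading X) :=
  rangeDecomposition (DirectSum.lof ℝ ℤ X) LinearMap.id
    (by ext n x : 2; simp) (fun _ _ => rfl)

/-- The grading of an exterior algebra, indexed by the integers. -/
def extGrading (W : Type*) [AddCommGroup W] [Module ℝ W] :
    ℤ → Submodule ℝ (ExteriorAlgebra ℝ W)
  | Int.ofNat n => ⋀[ℝ]^n W
  | Int.negSucc _ => ⊥

/-- The decomposition of an element of the exterior algebra into homogeneous components. -/
def extDecompose (W : Type*) [AddCommGroup W] [Module ℝ W] :
    ExteriorAlgebra ℝ W →ₗ[ℝ] ⨁ n, extGrading W n :=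
  DirectSum.toModule ℝ ℕ _
      (fun n : ℕ => (DirectSum.lof ℝ ℤ (fun k => extGrading W k) (Int.ofNat n) :
        ⋀[ℝ]^n W →ₗ[ℝ] ⨁ n, extGrading W n)) ∘ₗ
    (DirectSum.decomposeLinearEquiv (fun n : ℕ => ⋀[ℝ]^n W)).toLinearMap

lemma extDecompose_of_mem (W : Type*) [AddCommGroup W] [Module ℝ W] (n : ℕ) (x : ⋀[ℝ]^n W) :
    extDecompose W x = DirectSum.lof ℝ ℤ (fun k => extGrading W k) (Int.ofNat n) x := by
  refine (congrArg (DirectSum.toModule ℝ ℕ (⨁ n, extGrading W n) _)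
    (DirectSum.decomposeLinearEquiv_apply_coe (fun n : ℕ => ⋀[ℝ]^n W) n x)).trans ?_
  exact DirectSum.toModule_lof (R := ℝ) (M := fun n : ℕ => ↥(⋀[ℝ]^n W)) n x

instance extDecomposition (W : Type*) [AddCommGroup W] [Module ℝ W] :
    DirectSum.Decomposition (extGrading W) :=
  DirectSum.Decomposition.ofLinearMap _ (extDecompose W)
    (by
      apply DirectSum.decompose_lhom_ext (fun n : ℕ => ⋀[ℝ]^n W)
      intro n
      refine LinearMap.ext fun x => ?_
      simp only [LinearMap.comp_apply, Submodule.subtype_apply, extDecompose_of_mem]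
      exact DirectSum.coeLinearMap_lof (extGrading W) (Int.ofNat n) x)
    (by
      apply DirectSum.linearMap_ext
      intro n
      refine LinearMap.ext fun x => ?_
      cases n with
      | ofNat n =>
        rw [LinearMap.comp_apply, LinearMap.comp_apply, DirectSum.coeLinearMap_lof]
        exact extDecompose_of_mem W n x
      | negSucc n =>
        have : x = 0 := Subtype.ext ((Submodule.mem_bot ℝ).1 x.2)
        rw [this, map_zero, map_zero])

end Graded

section Forms

/-- Differential forms with constant-coefficient part in the exterior algebra of `W` (spanned by
the differentials of coordinates) and coefficient functions in the algebra `A`. -/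
abbrev Forms (W A : Type*) [AddCommGroup W] [Module ℝ W] [CommRing A] [Algebra ℝ A] : Type _ :=
  ExteriorAlgebra ℝ W ⊗[ℝ] A

variable {W A W' B J : Type*} [AddCommGroup W] [Module ℝ W] [CommRing A] [Algebra ℝ A]
  [AddCommGroup W'] [Module ℝ W'] [CommRing B] [Algebra ℝ B] [Fintype J]

variable (W A) in
/-- The forms of degree `n`. -/
abbrev formsGrading : ℤ → Submodule ℝ (Forms W A) := tensorGrading (extGrading W) A

/-- `w ⊗ a ↦ a w` as a differential form of degree one. -/
def oneForm : W ⊗[ℝ] A →ₗ[ℝ] Forms W A := (ExteriorAlgebra.ι ℝ).rTensor A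

/-- The exterior derivative `d(a λ) = ∑ⱼ (∂ⱼ a) dxⱼ ∧ λ`, where `dxⱼ = w j`. -/
def extD (w : J → W) (D : J → Derivation ℝ A A) : Forms W A →ₗ[ℝ] Forms W A :=
  ∑ j, TensorProduct.map (LinearMap.mulLeft ℝ (ExteriorAlgebra.ι ℝ (w j))) (D j : A →ₗ[ℝ] A)

lemma extD_tmul (w : J → W) (D : J → Derivation ℝ A A) (l : ExteriorAlgebra ℝ W) (a : A) :
    extD w D (l ⊗ₜ a) = ∑ j, (ExteriorAlgebra.ι ℝ (w j) * l) ⊗ₜ[ℝ] (D j a) := by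
  simp [extD]

lemma ι_anticomm (x y : W) : ExteriorAlgebra.ι ℝ x * ExteriorAlgebra.ι ℝ y =
    -(ExteriorAlgebra.ι ℝ y * ExteriorAlgebra.ι ℝ x) :=
  eq_neg_of_add_eq_zero_left (ExteriorAlgebra.ι_add_mul_swap x y)

lemma oneForm_anticomm (x y : W ⊗[ℝ] A) : oneForm x * oneForm y = -(oneForm y * oneForm x) := by
  induction x using TensorProduct.induction_on with
  | zero => simp
  | add a b ha hb => rw [map_add, add_mul, mul_add, ha, hb, neg_add]
  | tmul a b =>
    induction y using TensorProduct.induction_on with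
    | zero => simp
    | add c d hc hd => rw [map_add, add_mul, mul_add, hc, hd, neg_add]
    | tmul c d =>
      simp only [oneForm, LinearMap.rTensor_tmul, Algebra.TensorProduct.tmul_mul_tmul]
      rw [ι_anticomm, TensorProduct.neg_tmul, mul_comm]

lemma oneForm_sq (x : W ⊗[ℝ] A) : oneForm x * oneForm x = 0 := by
  have h := oneForm_anticomm x x
  have h2 : (2 : ℝ) • (oneForm x * oneForm x) = 0 := by
    rw [two_smul]; nth_rewrite 1 [h]; simp
  exact (smul_eq_zero.1 h2).resolve_left two_ne_zero

/-- The pullback of forms which is `φ` on functions and `ψ` on the differentials in `W`. -/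
def formsPullback (φ : A →ₐ[ℝ] B) (ψ : W →ₗ[ℝ] W' ⊗[ℝ] B) : Forms W A →ₐ[ℝ] Forms W' B :=
  Algebra.TensorProduct.lift
    (ExteriorAlgebra.lift ℝ ⟨oneForm ∘ₗ ψ, fun m => oneForm_sq (ψ m)⟩)
    (Algebra.TensorProduct.includeRight.comp φ)
    (fun x y => by
      change _ * ((1 : ExteriorAlgebra ℝ W') ⊗ₜ[ℝ] φ y) = ((1 : ExteriorAlgebra ℝ W') ⊗ₜ[ℝ] φ y) * _
      generalize (ExteriorAlgebra.lift ℝ ⟨oneForm ∘ₗ ψ, fun m => oneForm_sq (ψ m)⟩) x = z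
      induction z using TensorProduct.induction_on with
      | zero => simp
      | add a b ha hb => rw [add_mul, mul_add, ha, hb]
      | tmul a b => simp [mul_comm])

lemma formsPullback_tmul (φ : A →ₐ[ℝ] B) (ψ : W →ₗ[ℝ] W' ⊗[ℝ] B) (l : ExteriorAlgebra ℝ W)
    (a : A) : formsPullback φ ψ (l ⊗ₜ a) =
      formsPullback φ ψ (l ⊗ₜ 1) * ((1 : ExteriorAlgebra ℝ W') ⊗ₜ[ℝ] φ a) := by
  simp [formsPullback, ← Algebra.TensorProduct.one_def]

lemma formsPullback_ι (φ : A →ₐ[ℝ] B) (ψ : W →ₗ[ℝ] W' ⊗[ℝ] B) (x : W) :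
    formsPullback φ ψ (ExteriorAlgebra.ι ℝ x ⊗ₜ 1) = oneForm (ψ x) := by
  simp [formsPullback, ← Algebra.TensorProduct.one_def]

lemma formsGrading_mul_mem {m n : ℤ} {x y : Forms W A} (hx : x ∈ formsGrading W A m)
    (hy : y ∈ formsGrading W A n) : x * y ∈ formsGrading W A (m + n) := by
  obtain ⟨x, rfl⟩ := hx
  obtain ⟨y, rfl⟩ := hy
  induction x using TensorProduct.induction_on with
  | zero => simp
  | add a b ha hb => rw [map_add, add_mul]; exact Submodule.add_mem _ ha hb
  | tmul a b =>
    induction y using TensorProduct.induction_on with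
    | zero => simp
    | add c d hc hd => rw [map_add, mul_add]; exact Submodule.add_mem _ hc hd
    | tmul c d =>
      have h : (a : ExteriorAlgebra ℝ W) * c ∈ extGrading W (m + n) := by
        cases m with
        | negSucc m =>
          have : (a : ExteriorAlgebra ℝ W) = 0 := (Submodule.mem_bot ℝ).1 a.2
          simp [this]
        | ofNat m =>
          cases n with
          | negSucc n =>
            have : (c : ExteriorAlgebra ℝ W) = 0 := (Submodule.mem_bot ℝ).1 c.2
            simp [this]
          | ofNat n =>
            exact SetLike.mul_mem_graded (A := fun n : ℕ => ⋀[ℝ]^n W) a.2 c.2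
      exact ⟨⟨_, h⟩ ⊗ₜ (b * d), by simp⟩

lemma tmul_mem_formsGrading {n : ℤ} {l : ExteriorAlgebra ℝ W} (hl : l ∈ extGrading W n) (a : A) :
    l ⊗ₜ[ℝ] a ∈ formsGrading W A n :=
  ⟨⟨l, hl⟩ ⊗ₜ a, by simp⟩

lemma one_mem_extGrading : (1 : ExteriorAlgebra ℝ W) ∈ extGrading W 0 :=
  SetLike.one_mem_graded (fun n : ℕ => ⋀[ℝ]^n W)

lemma ι_mem_extGrading (x : W) : ExteriorAlgebra.ι ℝ x ∈ extGrading W 1 := by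
  change _ ∈ ⋀[ℝ]^1 W
  simp

instance formsGradedMonoid : SetLike.GradedMonoid (formsGrading W A) where
  one_mem := tmul_mem_formsGrading one_mem_extGrading 1
  mul_mem _ _ _ _ hx hy := formsGrading_mul_mem hx hy

lemma extD_mem (w : J → W) (D : J → Derivation ℝ A A) {n : ℤ} {x : Forms W A}
    (hx : x ∈ formsGrading W A n) : extD w D x ∈ formsGrading W A (n + 1) := by
  obtain ⟨x, rfl⟩ := hx
  induction x using TensorProduct.induction_on with
  | zero => simp
  | add a b ha hb => rw [map_add, map_add]; exact Submodule.add_mem _ ha hb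
  | tmul a b =>
    rw [LinearMap.rTensor_tmul, extD_tmul]
    refine Submodule.sum_mem _ fun j _ => ?_
    have h := formsGrading_mul_mem (tmul_mem_formsGrading (ι_mem_extGrading (w j)) (1 : A))
      (tmul_mem_formsGrading a.2 (D j b))
    rw [add_comm] at h
    simpa using h

lemma formsPullback_mem (φ : A →ₐ[ℝ] B) (ψ : W →ₗ[ℝ] W' ⊗[ℝ] B) {n : ℤ} {x : Forms W A}
    (hx : x ∈ formsGrading W A n) : formsPullback φ ψ x ∈ formsGrading W' B n := by
  have key : ∀ (k : ℕ) (l : ExteriorAlgebra ℝ W), l ∈ ⋀[ℝ]^k W →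
      formsPullback φ ψ (l ⊗ₜ 1) ∈ formsGrading W' B (k : ℤ) := by
    intro k
    induction k with
    | zero =>
      intro l hl
      rw [ExteriorAlgebra.exteriorPower, pow_zero] at hl
      obtain ⟨r, rfl⟩ := Submodule.mem_one.1 hl
      have : ((algebraMap ℝ (ExteriorAlgebra ℝ W) r) ⊗ₜ[ℝ] (1 : A)) = r • (1 : Forms W A) := by
        rw [Algebra.algebraMap_eq_smul_one, ← TensorProduct.smul_tmul',
          Algebra.TensorProduct.one_def]
      rw [this, map_smul, map_one]
      exact Submodule.smul_mem _ r (tmul_mem_formsGrading one_mem_extGrading 1)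
    | succ k ih =>
      intro l hl
      rw [ExteriorAlgebra.exteriorPower, pow_succ'] at hl
      induction hl using Submodule.mul_induction_on' with
      | mem_mul_mem a ha b hb =>
        obtain ⟨v, rfl⟩ := ha
        have : (ExteriorAlgebra.ι ℝ v * b) ⊗ₜ[ℝ] (1 : A) =
            ((ExteriorAlgebra.ι ℝ v) ⊗ₜ[ℝ] (1 : A)) * (b ⊗ₜ[ℝ] (1 : A)) := by
          rw [Algebra.TensorProduct.tmul_mul_tmul, one_mul]
        rw [this, map_mul, formsPullback_ι]
        have h : oneForm (ψ v) ∈ formsGrading W' B 1 := by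
          generalize ψ v = z
          induction z using TensorProduct.induction_on with
          | zero => simp
          | add x y hx hy => rw [map_add]; exact Submodule.add_mem _ hx hy
          | tmul x y => exact tmul_mem_formsGrading (ι_mem_extGrading x) y
        have := formsGrading_mul_mem h (ih b hb)
        rw [add_comm] at this
        exact_mod_cast this
      | add a _ b _ ha hb =>
        rw [TensorProduct.add_tmul, map_add]
        exact Submodule.add_mem _ ha hb
  obtain ⟨x, rfl⟩ := hx
  induction x using TensorProduct.induction_on with
  | zero => simp
  | add a b ha hb => rw [map_add, map_add]; exact Submodule.add_mem _ ha hb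
  | tmul a b =>
    cases n with
    | negSucc n =>
      have : (a : ExteriorAlgebra ℝ W) = 0 := (Submodule.mem_bot ℝ).1 a.2
      simp [this]
    | ofNat n =>
      rw [LinearMap.rTensor_tmul, formsPullback_tmul]
      have h := formsGrading_mul_mem (key n a a.2)
        (tmul_mem_formsGrading (one_mem_extGrading (W := W')) (φ b))
      rw [add_zero] at h
      exact h

lemma extD_fun_mul (w : J → W) (D : J → Derivation ℝ A A) (a : A) (x : Forms W A) :
    extD w D ((1 : ExteriorAlgebra ℝ W) ⊗ₜ[ℝ] a * x) =
      extD w D ((1 : ExteriorAlgebra ℝ W) ⊗ₜ[ℝ] a) * x +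
        (1 : ExteriorAlgebra ℝ W) ⊗ₜ[ℝ] a * extD w D x := by
  induction x using TensorProduct.induction_on with
  | zero => simp
  | add x y hx hy => simp only [mul_add, map_add, hx, hy]; abel
  | tmul l b =>
    simp only [Algebra.TensorProduct.tmul_mul_tmul, extD_tmul, one_mul, mul_one, Finset.sum_mul,
      Finset.mul_sum, Derivation.leibniz, smul_eq_mul, TensorProduct.tmul_add,
      Finset.sum_add_distrib]
    rw [add_comm]
    simp only [mul_comm]

lemma extD_oneForm_mul (w : J → W) (D : J → Derivation ℝ A A) (η : W ⊗[ℝ] A) (x : Forms W A) :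
    extD w D (oneForm η * x) = extD w D (oneForm η) * x - oneForm η * extD w D x := by
  induction η using TensorProduct.induction_on with
  | zero => simp
  | add η ζ hη hζ => simp only [map_add, add_mul, hη, hζ]; abel
  | tmul v b =>
    induction x using TensorProduct.induction_on with
    | zero => simp
    | add x y hx hy => simp only [mul_add, map_add, hx, hy]; abel
    | tmul l c =>
      simp only [oneForm, LinearMap.rTensor_tmul, Algebra.TensorProduct.tmul_mul_tmul, extD_tmul,
        Finset.sum_mul, Finset.mul_sum, Derivation.leibniz, smul_eq_mul, TensorProduct.tmul_add,
        Finset.sum_add_distrib]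
      rw [add_comm, sub_eq_add_neg, ← Finset.sum_neg_distrib]
      congr 1
      · refine Finset.sum_congr rfl fun j _ => ?_
        rw [mul_assoc, mul_comm c]
      · refine Finset.sum_congr rfl fun j _ => ?_
        rw [← mul_assoc, ι_anticomm, neg_mul, TensorProduct.neg_tmul, mul_assoc]

/-- Pullback commutes with the exterior derivative as soon as it does so on functions and sends the
constant one-forms to closed forms. -/
lemma extD_formsPullback {J' : Type*} [Fintype J'] (w : J → W) (D : J → Derivation ℝ A A)
    (w' : J' → W') (D' : J' → Derivation ℝ B B) (φ : A →ₐ[ℝ] B) (ψ : W →ₗ[ℝ] W' ⊗[ℝ] B)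
    (h₁ : ∀ a, ∑ j, oneForm (ψ (w j)) * (1 : ExteriorAlgebra ℝ W') ⊗ₜ[ℝ] φ (D j a) =
      extD w' D' ((1 : ExteriorAlgebra ℝ W') ⊗ₜ[ℝ] φ a))
    (h₂ : ∀ v, extD w' D' (oneForm (ψ v)) = 0) (x : Forms W A) :
    extD w' D' (formsPullback φ ψ x) = formsPullback φ ψ (extD w D x) := by
  have key : ∀ l : ExteriorAlgebra ℝ W, extD w' D' (formsPullback φ ψ (l ⊗ₜ 1)) = 0 := by
    intro l
    induction l using CliffordAlgebra.left_induction with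
    | algebraMap r =>
      have : ((algebraMap ℝ (ExteriorAlgebra ℝ W) r) ⊗ₜ[ℝ] (1 : A)) = r • (1 : Forms W A) := by
        rw [Algebra.algebraMap_eq_smul_one, ← TensorProduct.smul_tmul',
          Algebra.TensorProduct.one_def]
      erw [this]
      rw [map_smul, map_one, map_smul, Algebra.TensorProduct.one_def, extD_tmul]
      simp
    | add a b ha hb => rw [TensorProduct.add_tmul, map_add, map_add, ha, hb, add_zero]
    | ι_mul l v hl =>
      have : (CliffordAlgebra.ι 0 v * l) ⊗ₜ[ℝ] (1 : A) =
          ((ExteriorAlgebra.ι ℝ v) ⊗ₜ[ℝ] (1 : A)) * (l ⊗ₜ[ℝ] (1 : A)) := by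
        rw [Algebra.TensorProduct.tmul_mul_tmul, one_mul]
      erw [this]
      rw [map_mul, formsPullback_ι, extD_oneForm_mul, h₂]
      erw [hl]
      simp
  have comm : ∀ (b : B) (y : Forms W' B), y * (1 : ExteriorAlgebra ℝ W') ⊗ₜ[ℝ] b =
      (1 : ExteriorAlgebra ℝ W') ⊗ₜ[ℝ] b * y := by
    intro b y
    induction y using TensorProduct.induction_on with
    | zero => simp
    | add a b ha hb => rw [add_mul, mul_add, ha, hb]
    | tmul a b => simp [mul_comm]
  induction x using TensorProduct.induction_on with
  | zero => simp
  | add a b ha hb => rw [map_add, map_add, map_add, map_add, ha, hb]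
  | tmul l a =>
    rw [formsPullback_tmul, comm, extD_fun_mul, key, mul_zero, add_zero, ← h₁, extD_tmul, map_sum,
      Finset.sum_mul]
    refine Finset.sum_congr rfl fun j _ => ?_
    have : (ExteriorAlgebra.ι ℝ (w j) * l) ⊗ₜ[ℝ] (D j a) =
        ((ExteriorAlgebra.ι ℝ (w j)) ⊗ₜ[ℝ] (1 : A)) * (l ⊗ₜ[ℝ] (D j a)) := by
      rw [Algebra.TensorProduct.tmul_mul_tmul, one_mul]
    rw [this, map_mul, formsPullback_ι, formsPullback_tmul φ ψ l (D j a), mul_assoc, comm]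

end Forms

section Smooth

/-- The algebra of smooth functions on an open subset of a finite-dimensional real vector space. -/
def smoothFun {E : Type*} [NormedAddCommGroup E] [NormedSpace ℝ E] (U : TopologicalSpace.Opens E) :
    Subalgebra ℝ (U → ℝ) where
  carrier := {f | ContDiffOn ℝ ∞ (Function.extend Subtype.val f 0) U}
  mul_mem' {f g} hf hg := (hf.mul hg).congr fun x hx => by
    lift x to U using hx
    simp
  add_mem' {f g} hf hg := (hf.add hg).congr fun x hx => by
    lift x to U using hx
    simp
  algebraMap_mem' r := (contDiffOn_const (c := r)).congr fun x hx => by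
    lift x to U using hx
    simp

/-- Euclidean space of dimension `n`. -/
abbrev Euc (n : ℕ) : Type := EuclideanSpace ℝ (Fin n)

variable {n : ℕ} {U V : TopologicalSpace.Opens (Euc n)}

/-- A smooth function on `U`, extended by zero. -/
abbrev extendFun (f : smoothFun U) : Euc n → ℝ := Function.extend Subtype.val f.1 0

lemma extendFun_apply (f : smoothFun U) (x : U) : extendFun f x = f.1 x :=
  Subtype.val_injective.extend_apply f.1 0 x

lemma contDiffAt_extendFun (f : smoothFun U) (x : U) : ContDiffAt ℝ ∞ (extendFun f) x :=
  (f.2).contDiffAt (U.isOpen.mem_nhds x.2)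

lemma differentiableAt_extendFun (f : smoothFun U) (x : U) :
    DifferentiableAt ℝ (extendFun f) x :=
  (contDiffAt_extendFun f x).differentiableAt (by simp)

/-- Functions that agree near `x` with a smooth function have the same derivative at `x`. -/
lemma fderiv_extendFun_congr (f : smoothFun U) (g : Euc n → ℝ) (h : ∀ y : U, f.1 y = g y) (x : U) :
    fderiv ℝ (extendFun f) x = fderiv ℝ g x := by
  apply Filter.EventuallyEq.fderiv_eq
  filter_upwards [U.isOpen.mem_nhds x.2] with y hy
  exact (extendFun_apply f ⟨y, hy⟩).trans (h ⟨y, hy⟩)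

/-- The `j`-th partial derivative on smooth functions on `U`. -/
def pderiv (U : TopologicalSpace.Opens (Euc n)) (j : Fin n) :
    Derivation ℝ (smoothFun U) (smoothFun U) :=
  Derivation.mk'
    { toFun := fun f => ⟨fun x => fderiv ℝ (extendFun f) x (EuclideanSpace.single j 1), by
        have h : ContDiffOn ℝ ∞ (fun x => fderiv ℝ (extendFun f) x (EuclideanSpace.single j 1)) U :=
          (f.2.fderiv_of_isOpen U.isOpen (m := ∞) (by simp)).clm_apply contDiffOn_const
        refine h.congr fun x hx => ?_
        lift x to U using hx
        exact Subtype.val_injective.extend_apply _ (0 : Euc n → ℝ) x⟩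
      map_add' := fun f g => by
        ext x
        change fderiv ℝ (extendFun (f + g)) x _ =
          fderiv ℝ (extendFun f) x _ + fderiv ℝ (extendFun g) x _
        rw [fderiv_extendFun_congr (f + g) (extendFun f + extendFun g) (fun y => by
          simp) x, fderiv_add (differentiableAt_extendFun f x)
          (differentiableAt_extendFun g x)]
        rfl
      map_smul' := fun r f => by
        ext x
        change fderiv ℝ (extendFun (r • f)) x _ = r • fderiv ℝ (extendFun f) x _
        rw [fderiv_extendFun_congr (r • f) (r • extendFun f) (fun y => by
          simp) x, fderiv_const_smul (differentiableAt_extendFun f x)]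
        rfl }
    (fun f g => by
      ext x
      change fderiv ℝ (extendFun (f * g)) x _ =
        f.1 x * fderiv ℝ (extendFun g) x _ + g.1 x * fderiv ℝ (extendFun f) x _
      rw [fderiv_extendFun_congr (f * g) (extendFun f * extendFun g) (fun y => by
        simp) x, fderiv_mul (differentiableAt_extendFun f x)
        (differentiableAt_extendFun g x)]
      simp)

lemma pderiv_apply (j : Fin n) (f : smoothFun U) (x : U) :
    (pderiv U j f).1 x = fderiv ℝ (extendFun f) x (EuclideanSpace.single j 1) := rfl

/-- Partial derivatives commute. -/
lemma pderiv_comm (i j : Fin n) (f : smoothFun U) :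
    pderiv U i (pderiv U j f) = pderiv U j (pderiv U i f) := by
  have key : ∀ (i j : Fin n) (x : U), (pderiv U i (pderiv U j f)).1 x =
      fderiv ℝ (fderiv ℝ (extendFun f)) x (EuclideanSpace.single i 1)
        (EuclideanSpace.single j 1) := by
    intro i j x
    rw [pderiv_apply, fderiv_extendFun_congr (pderiv U j f)
      (fun y => fderiv ℝ (extendFun f) y (EuclideanSpace.single j 1)) (fun y => rfl) x]
    have hd : DifferentiableAt ℝ (fderiv ℝ (extendFun f)) x :=
      ((contDiffAt_extendFun f x).fderiv_right (m := 1) (by norm_cast)).differentiableAt (by simp)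
    rw [fderiv_clm_apply hd (differentiableAt_const _)]
    simp
  ext x
  rw [key, key]
  have := (contDiffAt_extendFun f x).isSymmSndFDerivAt
    (by simp only [minSmoothness_of_isRCLikeNormedField]; exact WithTop.coe_le_coe.2 le_top)
  exact this _ _

/-- Composition of smooth functions with a smooth map `τ : V → U`. -/
def smoothComp (τ : Euc n → Euc n) (hτ : ContDiffOn ℝ ∞ τ V) (hm : Set.MapsTo τ V U) :
    smoothFun U →ₐ[ℝ] smoothFun V where
  toFun f := ⟨fun x => f.1 ⟨τ x, hm x.2⟩, by
    refine (ContDiffOn.comp f.2 hτ hm).congr fun x hx => ?_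
    exact (Subtype.val_injective.extend_apply _ (0 : Euc n → ℝ) (⟨x, hx⟩ : V)).trans
      (extendFun_apply f ⟨τ x, hm hx⟩).symm⟩
  map_one' := rfl
  map_mul' _ _ := rfl
  map_zero' := rfl
  map_add' _ _ := rfl
  commutes' _ := rfl

/-- The `i`-th component of a smooth map `τ` as a smooth function on `V`. -/
def smoothCoord (τ : Euc n → Euc n) (hτ : ContDiffOn ℝ ∞ τ V) (i : Fin n) : smoothFun V :=
  ⟨fun x => τ x i, by
    refine ((contDiffOn_euclidean.1 hτ) i).congr fun x hx => ?_
    exact Subtype.val_injective.extend_apply _ (0 : Euc n → ℝ) (⟨x, hx⟩ : V)⟩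

/-- The standard basis vector `dxⱼ` of the space of constant one-forms on `ℝⁿ`. -/
abbrev dx (j : Fin n) : Fin n → ℝ := Pi.single j 1

/-- The graded algebra `Ω*(U)` of differential forms on an open set `U ⊆ ℝⁿ`. -/
def OpenForms (U : TopologicalSpace.Opens (Euc n)) : Type := Forms (Fin n → ℝ) (smoothFun U)

instance : Ring (OpenForms U) := inferInstanceAs (Ring (Forms (Fin n → ℝ) (smoothFun U)))

instance : Algebra ℝ (OpenForms U) :=
  inferInstanceAs (Algebra ℝ (Forms (Fin n → ℝ) (smoothFun U)))

/-- The forms of degree `p` on `U`. -/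
def openGrading (U : TopologicalSpace.Opens (Euc n)) (p : ℤ) : Submodule ℝ (OpenForms U) :=
  formsGrading (Fin n → ℝ) (smoothFun U) p

lemma one_mem_openGrading : (1 : OpenForms U) ∈ openGrading U 0 :=
  tmul_mem_formsGrading one_mem_extGrading (1 : smoothFun U)

lemma mul_mem_openGrading {p q : ℤ} {x y : OpenForms U} (hx : x ∈ openGrading U p)
    (hy : y ∈ openGrading U q) : x * y ∈ openGrading U (p + q) :=
  formsGrading_mul_mem (W := Fin n → ℝ) (A := smoothFun U) hx hy

/-- The exterior derivative on `Ω*(U)`. -/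
def openD (U : TopologicalSpace.Opens (Euc n)) : OpenForms U →ₗ[ℝ] OpenForms U :=
  extD dx (pderiv U)

/-- The pullback `Ω*(U) → Ω*(V)` along a smooth map `τ : V → U`; it sends `dxᵢ` to
`dτᵢ = ∑ⱼ (∂ⱼ τᵢ) dxⱼ`. -/
def openPullback (τ : Euc n → Euc n) (hτ : ContDiffOn ℝ ∞ τ V) (hm : Set.MapsTo τ V U) :
    OpenForms U →ₐ[ℝ] OpenForms V :=
  formsPullback (smoothComp τ hτ hm)
    (∑ i, (LinearMap.proj i : (Fin n → ℝ) →ₗ[ℝ] ℝ).smulRight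
      (∑ j, dx j ⊗ₜ[ℝ] pderiv V j (smoothCoord τ hτ i)))

lemma openD_mem {p : ℤ} {x : OpenForms U} (hx : x ∈ openGrading U p) :
    openD U x ∈ openGrading U (p + 1) :=
  extD_mem _ _ hx

lemma openD_openPullback (τ : Euc n → Euc n) (hτ : ContDiffOn ℝ ∞ τ V) (hm : Set.MapsTo τ V U)
    (α : OpenForms U) : openD V (openPullback τ hτ hm α) = openPullback τ hτ hm (openD U α) := by
  have hψ : ∀ v : Fin n → ℝ, (∑ i, (LinearMap.proj i : (Fin n → ℝ) →ₗ[ℝ] ℝ).smulRight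
      (∑ j, dx j ⊗ₜ[ℝ] pderiv V j (smoothCoord τ hτ i))) v =
      ∑ i, v i • ∑ j, dx j ⊗ₜ[ℝ] pderiv V j (smoothCoord τ hτ i) := by
    intro v
    simp [LinearMap.sum_apply]
  refine extD_formsPullback _ _ _ _ _ _ ?_ ?_ α
  · intro f
    rw [extD_tmul]
    have chain : ∀ j, pderiv V j (smoothComp τ hτ hm f) =
        ∑ i, pderiv V j (smoothCoord τ hτ i) * smoothComp τ hτ hm (pderiv U i f) := by
      intro j
      ext x
      have hτx : DifferentiableAt ℝ τ x :=
        ((hτ x x.2).contDiffAt (V.isOpen.mem_nhds x.2)).differentiableAt (by simp)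
      have hi : ∀ i, (pderiv V j (smoothCoord τ hτ i)).1 x =
          fderiv ℝ τ x (EuclideanSpace.single j 1) i := by
        intro i
        rw [pderiv_apply, fderiv_extendFun_congr (smoothCoord τ hτ i)
          ((EuclideanSpace.proj i : Euc n →L[ℝ] ℝ) ∘ τ) (fun y => rfl) x,
          ((EuclideanSpace.proj i : Euc n →L[ℝ] ℝ).hasFDerivAt.comp (x : Euc n)
            hτx.hasFDerivAt).fderiv]
        rfl
      have h : (pderiv V j (smoothComp τ hτ hm f)).1 x =
          fderiv ℝ (extendFun f) (τ x) (fderiv ℝ τ x (EuclideanSpace.single j 1)) := by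
        rw [pderiv_apply, fderiv_extendFun_congr (smoothComp τ hτ hm f) (extendFun f ∘ τ)
          (fun y => (extendFun_apply f ⟨τ y, hm y.2⟩).symm) x,
          ((differentiableAt_extendFun f ⟨τ x, hm x.2⟩).hasFDerivAt.comp (x : Euc n)
            hτx.hasFDerivAt).fderiv]
        rfl
      have hsum : fderiv ℝ τ x (EuclideanSpace.single j 1) =
          ∑ i, (fderiv ℝ τ x (EuclideanSpace.single j 1) i) •
            (EuclideanSpace.single i (1 : ℝ) : Euc n) := by
        ext k
        simp [Pi.single_apply]
      rw [h, hsum, map_sum]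
      simp only [AddSubmonoidClass.coe_finsetSum, Finset.sum_apply]
      refine Finset.sum_congr rfl fun i _ => ?_
      rw [map_smul, smul_eq_mul, ← hi]
      rfl
    have hdx : ∀ i, (∑ k, (dx i : Fin n → ℝ) k • ∑ j, dx j ⊗ₜ[ℝ] pderiv V j (smoothCoord τ hτ k)) =
        ∑ j, dx j ⊗ₜ[ℝ] pderiv V j (smoothCoord τ hτ i) := by
      intro i
      rw [Finset.sum_eq_single i]
      · simp
      · intro k _ hk
        simp [hk]
      · simp
    simp only [hψ, hdx, chain, map_sum, Finset.sum_mul, TensorProduct.tmul_sum]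
    rw [Finset.sum_comm]
    simp [oneForm]
  · intro v
    rw [hψ, map_sum, map_sum]
    refine Finset.sum_eq_zero fun i _ => ?_
    rw [map_smul, map_smul]
    generalize smoothCoord τ hτ i = t
    have hS : extD dx (pderiv V) (oneForm (∑ j, dx j ⊗ₜ[ℝ] pderiv V j t)) =
        ∑ j, ∑ k, (ExteriorAlgebra.ι ℝ (dx k) * ExteriorAlgebra.ι ℝ (dx j)) ⊗ₜ[ℝ]
          pderiv V k (pderiv V j t) := by
      simp [oneForm, extD_tmul]
    have hneg : extD dx (pderiv V) (oneForm (∑ j, dx j ⊗ₜ[ℝ] pderiv V j t)) =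
        -extD dx (pderiv V) (oneForm (∑ j, dx j ⊗ₜ[ℝ] pderiv V j t)) := by
      rw [hS]
      conv_lhs => rw [Finset.sum_comm]
      simp only [← Finset.sum_neg_distrib]
      refine Finset.sum_congr rfl fun j _ => Finset.sum_congr rfl fun k _ => ?_
      rw [ι_anticomm, TensorProduct.neg_tmul, pderiv_comm]
    have h2 : (2 : ℝ) • extD dx (pderiv V) (oneForm (∑ j, dx j ⊗ₜ[ℝ] pderiv V j t)) = 0 := by
      rw [two_smul]
      nth_rewrite 1 [hneg]
      simp
    rw [(smul_eq_zero.1 h2).resolve_left two_ne_zero, smul_zero]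

end Smooth

section Manifold

variable {n : ℕ} (M : Type u) [TopologicalSpace M] [ChartedSpace (Euc n) M]

/-- The image of a chart, as an open subset of `ℝⁿ`. -/
def chartOpen (e : atlas (Euc n) M) : TopologicalSpace.Opens (Euc n) :=
  ⟨e.1.target, e.1.open_target⟩

/-- The part of the image of the chart `e` that corresponds to the overlap of the domains of `e`
and `e'`. -/
def overlap (e e' : atlas (Euc n) M) : TopologicalSpace.Opens (Euc n) :=
  ⟨(e.1.symm.trans e'.1).source, (e.1.symm.trans e'.1).open_source⟩

lemma overlap_subset (e e' : atlas (Euc n) M) :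
    Set.MapsTo id (overlap M e e' : Set (Euc n)) (chartOpen M e) := by
  intro x hx
  have hx : x ∈ (e.1.symm.trans e'.1).source := hx
  rw [OpenPartialHomeomorph.trans_source] at hx
  exact hx.1

lemma transition_mapsTo (e e' : atlas (Euc n) M) :
    Set.MapsTo (e.1.symm.trans e'.1) (overlap M e e' : Set (Euc n)) (chartOpen M e') := by
  intro x hx
  have hx := (e.1.symm.trans e'.1).map_source hx
  rw [OpenPartialHomeomorph.trans_target] at hx
  exact hx.1

lemma transition_contDiffOn [IsManifold (𝓡 n) ∞ M] (e e' : atlas (Euc n) M) :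
    ContDiffOn ℝ ∞ (e.1.symm.trans e'.1) (overlap M e e') := by
  have h := HasGroupoid.compatible (G := contDiffGroupoid ∞ (𝓡 n)) e.2 e'.2
  have h' := (contDiffGroupoid ∞ (𝓡 n)).mem_of_eqOnSource h (Setoid.refl _)
  rw [contDiffGroupoid, mem_groupoid_of_pregroupoid, contDiffPregroupoid] at h'
  have h'' := h'.1
  simp at h''
  exact h''

variable [IsManifold (𝓡 n) ∞ M]

/-- A differential `p`-form on a smooth manifold: a family of `p`-forms, one on the image of each
chart, that match under pullback along the transition maps. -/
def manifoldForms (p : ℤ) : Submodule ℝ (∀ e : atlas (Euc n) M, OpenForms (chartOpen M e)) where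
  carrier := {α | (∀ e, α e ∈ openGrading (chartOpen M e) p) ∧
    ∀ e e', openPullback id contDiffOn_id (overlap_subset M e e') (α e) =
      openPullback (e.1.symm.trans e'.1) (transition_contDiffOn M e e') (transition_mapsTo M e e')
        (α e')}
  add_mem' {α β} hα hβ := ⟨fun e => Submodule.add_mem _ (hα.1 e) (hβ.1 e), fun e e' => by
    rw [Pi.add_apply, Pi.add_apply, map_add, map_add, hα.2, hβ.2]⟩
  zero_mem' := ⟨fun e => Submodule.zero_mem _, fun e e' => by
    rw [Pi.zero_apply, Pi.zero_apply, map_zero, map_zero]⟩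
  smul_mem' r α hα := ⟨fun e => Submodule.smul_mem _ r (hα.1 e), fun e e' => by
    rw [Pi.smul_apply, Pi.smul_apply, map_smul, map_smul, hα.2]⟩

instance manifoldFormsGradedMonoid : SetLike.GradedMonoid (manifoldForms (n := n) M) where
  one_mem := by
    refine ⟨fun e => one_mem_openGrading, fun e e' => ?_⟩
    rw [Pi.one_apply, Pi.one_apply, map_one, map_one]
  mul_mem _ _ α β hα hβ := by
    refine ⟨fun e => mul_mem_openGrading (hα.1 e) (hβ.1 e), fun e e' => ?_⟩
    rw [Pi.mul_apply, Pi.mul_apply, map_mul, map_mul, hα.2, hβ.2]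

/-- The graded algebra `Ω*(M) = ⨁ₚ Ωᵖ(M)` of differential forms on `M`, with the wedge product as
multiplication. -/
def DeRham : Type u := ⨁ p : ℤ, manifoldForms (n := n) M p

instance : Ring (DeRham (n := n) M) :=
  inferInstanceAs (Ring (⨁ p : ℤ, manifoldForms (n := n) M p))

instance : Algebra ℝ (DeRham (n := n) M) :=
  inferInstanceAs (Algebra ℝ (⨁ p : ℤ, manifoldForms (n := n) M p))

/-- The exterior derivative `Ωᵖ(M) → Ωᵖ⁺¹(M)`, computed in charts. -/
def manifoldD (p : ℤ) : manifoldForms (n := n) M p →ₗ[ℝ] manifoldForms (n := n) M (p + 1) :=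
  (LinearMap.pi (fun e => openD (chartOpen M e) ∘ₗ LinearMap.proj e)).restrict
    (fun α hα => ⟨fun e => openD_mem (hα.1 e), fun e e' => by
      simp only [LinearMap.pi_apply, LinearMap.comp_apply, LinearMap.proj_apply]
      rw [← openD_openPullback, ← openD_openPullback, hα.2]⟩)

/-- The exterior derivative on `Ω*(M)`. -/
def deRhamD : DeRham (n := n) M →ₗ[ℝ] DeRham (n := n) M :=
  DirectSum.toModule ℝ ℤ (⨁ p : ℤ, manifoldForms (n := n) M p) (fun p =>
    DirectSum.lof ℝ ℤ (fun q => manifoldForms (n := n) M q) (p + 1) ∘ₗ manifoldD M p)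

/-- The forms of degree `p` inside `Ω*(M)`. -/
def deRhamGrading : ℤ → Submodule ℝ (DeRham (n := n) M) :=
  sumGrading (fun p => manifoldForms (n := n) M p)

instance : DirectSum.Decomposition (deRhamGrading (n := n) M) :=
  sumDecomposition (fun p => manifoldForms (n := n) M p)

end Manifold

section Iso

/-- The Lorentz algebra `so(2,1)`: the matrices that are skew-adjoint for `diag(1, 1, -1)`. -/
abbrev Lorentz : Type := LieAlgebra.Orthogonal.so' (Fin 2) (Fin 1) ℝ

/-- The translation algebra `ℝ^{2,1}`, with zero bracket. -/
def Translation : Type := Fin 2 ⊕ Fin 1 → ℝ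

instance : AddCommGroup Translation := inferInstanceAs (AddCommGroup (Fin 2 ⊕ Fin 1 → ℝ))

instance : Module ℝ Translation := inferInstanceAs (Module ℝ (Fin 2 ⊕ Fin 1 → ℝ))

instance : LieRing Translation where
  bracket _ _ := 0
  add_lie _ _ _ := (add_zero _).symm
  lie_add _ _ _ := (add_zero _).symm
  lie_self _ := rfl
  leibniz_lie _ _ _ := (add_zero _).symm

instance : LieAlgebra ℝ Translation where
  lie_smul r _ _ := (smul_zero r).symm

/-- The action of a Lorentz matrix on translations, `v ↦ X v`. -/
def lorentzMulVec : Lorentz →ₗ[ℝ] Translation →ₗ[ℝ] Translation :=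
  LinearMap.mk₂ ℝ (fun (X : Lorentz) (v : Translation) => (X.1.mulVec v : Fin 2 ⊕ Fin 1 → ℝ))
    (fun X Y v => Matrix.add_mulVec X.1 Y.1 v) (fun r X v => Matrix.smul_mulVec r X.1 v)
    (fun X v w => Matrix.mulVec_add X.1 v w) (fun r X v => Matrix.mulVec_smul X.1 r v)

lemma lorentzMulVec_lie (X Y : Lorentz) (v : Translation) : lorentzMulVec ⁅X, Y⁆ v =
    lorentzMulVec X (lorentzMulVec Y v) - lorentzMulVec Y (lorentzMulVec X v) := by
  have h (w : Fin 2 ⊕ Fin 1 → ℝ) : (X.1 * Y.1 - Y.1 * X.1).mulVec w =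
      X.1.mulVec (Y.1.mulVec w) - Y.1.mulVec (X.1.mulVec w) := by
    rw [Matrix.sub_mulVec, Matrix.mulVec_mulVec, Matrix.mulVec_mulVec]
  exact h v

/-- The action of the Lorentz algebra on translations by derivations. -/
def lorentzAction : Lorentz →ₗ⁅ℝ⁆ LieDerivation ℝ Translation Translation where
  toFun X :=
    { toLinearMap := lorentzMulVec X
      leibniz' := fun v w => by
        change lorentzMulVec X 0 = (0 : Translation) - 0
        rw [map_zero, sub_zero] }
  map_add' X Y := by ext v; exact LinearMap.congr_fun (map_add lorentzMulVec X Y) v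
  map_smul' r X := by ext v; exact LinearMap.congr_fun (map_smul lorentzMulVec r X) v
  map_lie' {X Y} := by
    ext v
    rw [LieDerivation.lie_apply]
    exact lorentzMulVec_lie X Y v

open LieAlgebra in
/-- The Lie algebra `iso(2,1)` of the Poincaré group of `ℝ^{2,1}`: the semidirect sum of the
translations and the Lorentz algebra. -/
abbrev Iso21 : Type := Translation ⋊⁅lorentzAction⁆ Lorentz

/-- The bracket of a real Lie algebra as a bilinear map. -/
def lieBilin (h : Type*) [LieRing h] [LieAlgebra ℝ h] : h →ₗ[ℝ] h →ₗ[ℝ] h :=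
  LinearMap.mk₂ ℝ (fun x y => ⁅x, y⁆) add_lie smul_lie lie_add (fun r x y => lie_smul r x y)

end Iso

section DGLA

/-- The data underlying a differential graded Lie algebra: a graded vector space with a linear
operator `d` and a bilinear bracket. -/
structure DGLAData where
  /-- The total space. -/
  carrier : Type u
  [addCommGroup : AddCommGroup carrier]
  [module : Module ℝ carrier]
  /-- The homogeneous parts. -/
  gr : ℤ → Submodule ℝ carrier
  [decomposition : DirectSum.Decomposition gr]
  /-- The differential. -/
  d : carrier →ₗ[ℝ] carrier
  /-- The bracket. -/
  br : carrier →ₗ[ℝ] carrier →ₗ[ℝ] carrier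

attribute [instance] DGLAData.addCommGroup DGLAData.module DGLAData.decomposition

/-- The axioms of a differential graded Lie algebra. -/
structure DGLAData.IsDGLA (g : DGLAData.{u}) : Prop where
  d_mem : ∀ p, ∀ x ∈ g.gr p, g.d x ∈ g.gr (p + 1)
  d_d : ∀ x, g.d (g.d x) = 0
  br_mem : ∀ p q, ∀ x ∈ g.gr p, ∀ y ∈ g.gr q, g.br x y ∈ g.gr (p + q)
  antisymm : ∀ p q, ∀ x ∈ g.gr p, ∀ y ∈ g.gr q, g.br x y = -((-1 : ℝ) ^ (p * q)) • g.br y x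
  leibniz : ∀ p, ∀ x ∈ g.gr p, ∀ y, g.d (g.br x y) = g.br (g.d x) y + (-1 : ℝ) ^ p • g.br x (g.d y)
  jacobi : ∀ p q, ∀ x ∈ g.gr p, ∀ y ∈ g.gr q, ∀ z,
    g.br x (g.br y z) = g.br (g.br x y) z + (-1 : ℝ) ^ (p * q) • g.br y (g.br x z)

end DGLA

section Gravity

variable (M : Type u) [TopologicalSpace M] [ChartedSpace (Euc 3) M] [IsManifold (𝓡 3) ∞ M]

/-- Differential forms on `M` with values in a vector space `h`. -/
abbrev FormsIn (h : Type) [AddCommGroup h] [Module ℝ h] : Type u := DeRham (n := 3) M ⊗[ℝ] h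

/-- The `h`-valued forms of degree `p`. -/
abbrev formsInGrading (h : Type) [AddCommGroup h] [Module ℝ h] :
    ℤ → Submodule ℝ (FormsIn M h) :=
  tensorGrading (deRhamGrading (n := 3) M) h

/-- The exterior derivative `α ⊗ X ↦ dα ⊗ X` of forms with values in `h`. -/
def formsInD (h : Type) [AddCommGroup h] [Module ℝ h] : FormsIn M h →ₗ[ℝ] FormsIn M h :=
  (deRhamD (n := 3) M).rTensor h

/-- The wedge product of vector valued forms, `(α ⊗ X, β ⊗ Y) ↦ (α ∧ β) ⊗ b(X, Y)`, for a bilinear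
map `b`. -/
def wedge {h₁ h₂ h₃ : Type} [AddCommGroup h₁] [Module ℝ h₁] [AddCommGroup h₂] [Module ℝ h₂]
    [AddCommGroup h₃] [Module ℝ h₃] (b : h₁ →ₗ[ℝ] h₂ →ₗ[ℝ] h₃) :
    FormsIn M h₁ →ₗ[ℝ] FormsIn M h₂ →ₗ[ℝ] FormsIn M h₃ :=
  TensorProduct.map₂ (LinearMap.mul ℝ (DeRham (n := 3) M)) b

/-- The bracket of Lie algebra valued forms, `[α ⊗ X, β ⊗ Y] = (α ∧ β) ⊗ [X, Y]`. -/
abbrev wedgeLie (h : Type) [LieRing h] [LieAlgebra ℝ h] :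
    FormsIn M h →ₗ[ℝ] FormsIn M h →ₗ[ℝ] FormsIn M h :=
  wedge M (lieBilin h)

/-- The curvature `dA + ½ [A, A]` of a Lie algebra valued one-form. -/
def curvature (h : Type) [LieRing h] [LieAlgebra ℝ h] (A : FormsIn M h) : FormsIn M h :=
  formsInD M h A + (1 / 2 : ℝ) • wedgeLie M h A A

/-- A flat connection in the trivial bundle: a one-form with vanishing curvature. -/
structure IsFlatConnection (h : Type) [LieRing h] [LieAlgebra ℝ h] (A : FormsIn M h) : Prop where
  mem : A ∈ formsInGrading M h 1
  flat : curvature M h A = 0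

/-- The graded vector space `Ω*(M) ⊗ iso(2,1)` with the twisted differential
`d_∇ = d + [∇, ·]` and the bracket of forms. -/
def gravity (conn : FormsIn M Iso21) : DGLAData.{u} where
  carrier := FormsIn M Iso21
  gr := formsInGrading M Iso21
  d := formsInD M Iso21 + wedgeLie M Iso21 conn
  br := wedgeLie M Iso21

end Gravity

section Simplex

set_option linter.unusedSectionVars false

variable {J J' J'' : Type} [Fintype J] [DecidableEq J] [Fintype J'] [DecidableEq J']
  [Fintype J''] [DecidableEq J'']

variable (J) in
/-- The algebra of smooth functions on the standard simplex with vertex set `J`: the functions that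
extend to a smooth function on `ℝ^J`. -/
def simplexFun : Subalgebra ℝ (stdSimplex ℝ J → ℝ) where
  carrier := {f | ∃ g : (J → ℝ) → ℝ, ContDiff ℝ ∞ g ∧ ∀ x : stdSimplex ℝ J, f x = g x.1}
  mul_mem' := by
    rintro f f' ⟨g, hg, hf⟩ ⟨g', hg', hf'⟩
    exact ⟨fun x => g x * g' x, hg.mul hg', fun x => by rw [Pi.mul_apply, hf, hf']⟩
  add_mem' := by
    rintro f f' ⟨g, hg, hf⟩ ⟨g', hg', hf'⟩
    exact ⟨fun x => g x + g' x, hg.add hg', fun x => by rw [Pi.add_apply, hf, hf']⟩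
  algebraMap_mem' r := ⟨fun _ => r, contDiff_const, fun _ => rfl⟩

/-- A smooth extension of a smooth function on the simplex. -/
def simplexExt (f : simplexFun J) : (J → ℝ) → ℝ := f.2.choose

lemma contDiff_simplexExt (f : simplexFun J) : ContDiff ℝ ∞ (simplexExt f) := f.2.choose_spec.1

lemma simplexExt_apply (f : simplexFun J) (x : stdSimplex ℝ J) : f.1 x = simplexExt f x.1 :=
  f.2.choose_spec.2 x

/-- The derivative in the direction from a point of the simplex to a vertex does not depend on the
extension. -/
lemma fderiv_simplex_congr {g g' : (J → ℝ) → ℝ} (hg : ContDiff ℝ ∞ g) (hg' : ContDiff ℝ ∞ g')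
    (h : ∀ x ∈ stdSimplex ℝ J, g x = g' x) {x y : J → ℝ} (hx : x ∈ stdSimplex ℝ J)
    (hy : y ∈ stdSimplex ℝ J) : fderiv ℝ g x (y - x) = fderiv ℝ g' x (y - x) := by
  have key : ∀ {k : (J → ℝ) → ℝ}, ContDiff ℝ ∞ k →
      HasDerivWithinAt (fun t : ℝ => k (x + t • (y - x))) (fderiv ℝ k x (y - x)) (Set.Icc 0 1) 0 := by
    intro k hk
    have h₁ : HasDerivAt (fun t : ℝ => x + t • (y - x)) (y - x) 0 := by
      simpa using ((hasDerivAt_id (0 : ℝ)).smul_const (y - x)).const_add x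
    have h₂ : HasFDerivAt k (fderiv ℝ k x) (x + (0 : ℝ) • (y - x)) := by
      simpa using (hk.differentiable (by simp) x).hasFDerivAt
    exact (h₂.comp_hasDerivAt (0 : ℝ) h₁).hasDerivWithinAt
  have hseg : ∀ t ∈ Set.Icc (0 : ℝ) 1, x + t • (y - x) ∈ stdSimplex ℝ J := fun t ht =>
    (convex_stdSimplex ℝ J).add_smul_sub_mem hx hy ht
  have h₁ := (key hg').congr_of_mem (fun t ht => h _ (hseg t ht)) (Set.left_mem_Icc.2 zero_le_one)
  exact (uniqueDiffOn_Icc zero_lt_one 0 (Set.left_mem_Icc.2 zero_le_one)).eq_deriv _ (key hg) h₁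

/-- The derivative of smooth functions on the simplex along the vector field that points to the
`j`-th vertex, `(Dⱼ f)(x) = df(x)(eⱼ - x)`. -/
def simplexDeriv (j : J) : Derivation ℝ (simplexFun J) (simplexFun J) :=
  Derivation.mk'
    { toFun := fun f => ⟨fun x => fderiv ℝ (simplexExt f) x.1 (Pi.single j 1 - x.1),
        fun x => fderiv ℝ (simplexExt f) x (Pi.single j 1 - x),
        ((contDiff_simplexExt f).fderiv_right (m := ∞) (by simp)).clm_apply
          (contDiff_const.sub contDiff_id), fun _ => rfl⟩
      map_add' := fun f g => by
        ext x
        change fderiv ℝ (simplexExt (f + g)) x.1 _ =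
          fderiv ℝ (simplexExt f) x.1 _ + fderiv ℝ (simplexExt g) x.1 _
        have hf := contDiff_simplexExt f
        have hg := contDiff_simplexExt g
        rw [fderiv_simplex_congr (contDiff_simplexExt (f + g)) (hf.add hg)
          (fun y hy => by
            have := simplexExt_apply (f + g) ⟨y, hy⟩
            have h₁ := simplexExt_apply f ⟨y, hy⟩
            have h₂ := simplexExt_apply g ⟨y, hy⟩
            simp only at this h₁ h₂
            rw [← this, ← h₁, ← h₂]; rfl) x.2 (single_mem_stdSimplex ℝ j)]
        change fderiv ℝ (simplexExt f + simplexExt g) x.1 _ = _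
        rw [fderiv_add (hf.differentiable (by simp) _) (hg.differentiable (by simp) _)]
        rfl
      map_smul' := fun r f => by
        ext x
        change fderiv ℝ (simplexExt (r • f)) x.1 _ = r • fderiv ℝ (simplexExt f) x.1 _
        have hf := contDiff_simplexExt f
        rw [fderiv_simplex_congr (contDiff_simplexExt (r • f)) (hf.const_smul r)
          (fun y hy => by
            have := simplexExt_apply (r • f) ⟨y, hy⟩
            have h₁ := simplexExt_apply f ⟨y, hy⟩
            simp only at this h₁
            rw [← this, ← h₁]; rfl) x.2 (single_mem_stdSimplex ℝ j)]
        change fderiv ℝ (r • simplexExt f) x.1 _ = _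
        rw [fderiv_const_smul (hf.differentiable (by simp) _)]
        rfl }
    (fun f g => by
      ext x
      change fderiv ℝ (simplexExt (f * g)) x.1 _ =
        f.1 x * fderiv ℝ (simplexExt g) x.1 _ + g.1 x * fderiv ℝ (simplexExt f) x.1 _
      have hf := contDiff_simplexExt f
      have hg := contDiff_simplexExt g
      rw [fderiv_simplex_congr (contDiff_simplexExt (f * g)) (hf.mul hg)
        (fun y hy => by
          have := simplexExt_apply (f * g) ⟨y, hy⟩
          have h₁ := simplexExt_apply f ⟨y, hy⟩
          have h₂ := simplexExt_apply g ⟨y, hy⟩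
          simp only at this h₁ h₂
          rw [← this, ← h₁, ← h₂]; rfl) x.2 (single_mem_stdSimplex ℝ j)]
      change fderiv ℝ (simplexExt f * simplexExt g) x.1 _ = _
      rw [fderiv_mul (hf.differentiable (by simp) _) (hg.differentiable (by simp) _),
        simplexExt_apply f x, simplexExt_apply g x]
      simp)

lemma simplexDeriv_apply (j : J) (f : simplexFun J) (x : stdSimplex ℝ J) :
    (simplexDeriv j f).1 x = fderiv ℝ (simplexExt f) x.1 (Pi.single j 1 - x.1) := rfl

/-- Composition of smooth functions with the map of simplices induced by a map of vertices. -/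
def simplexComp (f : J → J') : simplexFun J' →ₐ[ℝ] simplexFun J where
  toFun a := ⟨fun x => a.1 (stdSimplex.map f x), by
    refine ⟨fun x => simplexExt a (FunOnFinite.linearMap ℝ ℝ f x), ?_, fun x => ?_⟩
    · exact (contDiff_simplexExt a).comp
        (LinearMap.toContinuousLinearMap (FunOnFinite.linearMap ℝ ℝ f)).contDiff
    · exact simplexExt_apply a _⟩
  map_one' := rfl
  map_mul' _ _ := rfl
  map_zero' := rfl
  map_add' _ _ := rfl
  commutes' _ := rfl

lemma simplexComp_apply (f : J → J') (a : simplexFun J') (x : stdSimplex ℝ J) :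
    (simplexComp f a).1 x = a.1 (stdSimplex.map f x) := rfl

lemma simplexDeriv_comp (f : J → J') (j : J) (a : simplexFun J') :
    simplexDeriv j (simplexComp f a) = simplexComp f (simplexDeriv (f j) a) := by
  ext x
  rw [simplexDeriv_apply, simplexComp_apply, simplexDeriv_apply]
  set L := LinearMap.toContinuousLinearMap (FunOnFinite.linearMap ℝ ℝ f) with hL
  have ha := contDiff_simplexExt a
  rw [fderiv_simplex_congr (contDiff_simplexExt (simplexComp f a)) (ha.comp L.contDiff)
    (fun y hy => (simplexExt_apply (simplexComp f a) ⟨y, hy⟩).symm.trans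
      (simplexExt_apply a (stdSimplex.map f ⟨y, hy⟩))) x.2 (single_mem_stdSimplex ℝ j),
    ((ha.differentiable (by simp) (L x.1)).hasFDerivAt.comp x.1 L.hasFDerivAt).fderiv]
  change fderiv ℝ (simplexExt a) (L x.1) (L (Pi.single j 1 - x.1)) =
    fderiv ℝ (simplexExt a) (L x.1) (Pi.single (f j) 1 - L x.1)
  have h : L (Pi.single j 1) = Pi.single (f j) 1 := FunOnFinite.linearMap_piSingle ℝ ℝ f j 1
  rw [map_sub, h]

variable (J) in
/-- The space of constant one-forms on the simplex with vertex set `J`: linear forms in the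
coordinates of `ℝ^J`, modulo the sum of the coordinates. -/
abbrev Cotangent : Type := (J → ℝ) ⧸ Submodule.span ℝ {(1 : J → ℝ)}

/-- The differential of the `j`-th barycentric coordinate. -/
def dt (j : J) : Cotangent J := Submodule.Quotient.mk (Pi.single j 1)

/-- The pullback of constant one-forms along a map of simplices. -/
def cotangentMap (f : J → J') : Cotangent J' →ₗ[ℝ] Cotangent J :=
  Submodule.mapQ _ _ (LinearMap.funLeft ℝ ℝ f) (by
    rw [Submodule.span_le, Set.singleton_subset_iff]
    exact Submodule.subset_span rfl)

lemma cotangentMap_mk (f : J → J') (v : J' → ℝ) :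
    cotangentMap f (Submodule.Quotient.mk v) = Submodule.Quotient.mk (fun j => v (f j)) := rfl

lemma cotangentMap_dt (f : J → J') (j' : J') :
    cotangentMap f (dt j') = ∑ j, if f j = j' then dt j else 0 := by
  have h : (fun j => (Pi.single j' 1 : J' → ℝ) (f j)) =
      ∑ j, if f j = j' then (Pi.single j 1 : J → ℝ) else 0 := by
    ext k
    rw [Finset.sum_apply, Finset.sum_eq_single k]
    · by_cases hk : f k = j' <;> simp [hk]
    · intro j _ hj
      by_cases hk : f j = j' <;> simp [hk, hj.symm]
    · simp
  rw [dt, cotangentMap_mk, h]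
  change Submodule.mkQ _ _ = _
  rw [map_sum]
  refine Finset.sum_congr rfl fun j _ => ?_
  by_cases hk : f j = j' <;> simp [hk, dt]

variable (J) in
/-- The graded algebra `Ω*(Δ)` of smooth differential forms on the simplex with vertex set `J`. -/
def SimplexForms : Type := Forms (Cotangent J) (simplexFun J)

instance : Ring (SimplexForms J) := inferInstanceAs (Ring (Forms (Cotangent J) (simplexFun J)))

instance : Algebra ℝ (SimplexForms J) :=
  inferInstanceAs (Algebra ℝ (Forms (Cotangent J) (simplexFun J)))

variable (J) in
/-- The forms of degree `r` on the simplex. -/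
def simplexGrading : ℤ → Submodule ℝ (SimplexForms J) :=
  formsGrading (Cotangent J) (simplexFun J)

instance : DirectSum.Decomposition (simplexGrading J) :=
  tensorDecomposition (extGrading (Cotangent J)) (simplexFun J)

variable (J) in
/-- The exterior derivative on the simplex, `d(a λ) = ∑ⱼ (Dⱼ a) dtⱼ ∧ λ`. -/
def simplexD : SimplexForms J →ₗ[ℝ] SimplexForms J := extD dt simplexDeriv

/-- The pullback of forms along the map of simplices induced by a map of vertices. -/
def simplexPullback (f : J → J') : SimplexForms J' →ₐ[ℝ] SimplexForms J :=
  formsPullback (simplexComp f)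
    ((TensorProduct.mk ℝ (Cotangent J) (simplexFun J)).flip 1 ∘ₗ cotangentMap f)

lemma simplexPullback_mem (f : J → J') {r : ℤ} {x : SimplexForms J'}
    (hx : x ∈ simplexGrading J' r) : simplexPullback f x ∈ simplexGrading J r :=
  formsPullback_mem _ _ hx

lemma simplexD_pullback (f : J → J') (x : SimplexForms J') :
    simplexD J (simplexPullback f x) = simplexPullback f (simplexD J' x) := by
  refine extD_formsPullback _ _ _ _ _ _ (fun a => ?_) (fun v => ?_) x
  · rw [extD_tmul]
    simp only [LinearMap.comp_apply, LinearMap.flip_apply, TensorProduct.mk_apply, cotangentMap_dt,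
      oneForm, LinearMap.rTensor_tmul, simplexDeriv_comp, map_sum,
      Finset.sum_mul]
    rw [Finset.sum_comm]
    refine Finset.sum_congr rfl fun j _ => ?_
    rw [Finset.sum_eq_single (f j)]
    · simp
    · intro j' _ hj'
      simp [hj'.symm]
    · simp
  · simp [oneForm, extD_tmul]

lemma simplexPullback_id : simplexPullback (id : J → J) = AlgHom.id ℝ _ := by
  have h₁ : simplexComp (id : J → J) = AlgHom.id ℝ _ := by
    ext a x
    simp [simplexComp_apply]
  have h₂ : cotangentMap (id : J → J) = LinearMap.id := by
    apply Submodule.linearMap_qext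
    rfl
  refine Algebra.TensorProduct.ext (ExteriorAlgebra.hom_ext ?_) ?_
  · refine LinearMap.ext fun v => ?_
    exact (formsPullback_ι _ _ v).trans (by rw [h₂]; rfl)
  · ext1 a
    exact (formsPullback_tmul _ _ 1 a).trans (by
      rw [h₁, ← Algebra.TensorProduct.one_def, map_one, one_mul]; rfl)

lemma simplexPullback_comp (f : J → J') (g : J' → J'') :
    simplexPullback (g ∘ f) = (simplexPullback f).comp (simplexPullback g) := by
  have h₁ : simplexComp (g ∘ f) = (simplexComp f).comp (simplexComp g) := by
    ext a x
    change a.1 _ = a.1 _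
    rw [stdSimplex.map_comp_apply]
  have h₂ : cotangentMap (g ∘ f) = cotangentMap f ∘ₗ cotangentMap g := by
    apply Submodule.linearMap_qext
    rfl
  refine Algebra.TensorProduct.ext (ExteriorAlgebra.hom_ext ?_) ?_
  · refine LinearMap.ext fun v => ?_
    refine (formsPullback_ι _ _ v).trans ?_
    refine Eq.trans ?_ (congrArg (simplexPullback f) (formsPullback_ι (simplexComp g) _ v)).symm
    refine Eq.trans ?_ (formsPullback_ι (simplexComp f) _ (cotangentMap g v)).symm
    rw [h₂]; rfl
  · ext1 a
    have h : ∀ {I I' : Type} [Fintype I] [DecidableEq I] [Fintype I'] [DecidableEq I'] (k : I → I')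
        (b : simplexFun I'), simplexPullback k ((1 : ExteriorAlgebra ℝ (Cotangent I')) ⊗ₜ[ℝ] b) =
          (1 : ExteriorAlgebra ℝ (Cotangent I)) ⊗ₜ[ℝ] simplexComp k b := by
      intro I I' _ _ _ _ k b
      refine (formsPullback_tmul _ _ 1 b).trans ?_
      rw [← Algebra.TensorProduct.one_def, map_one, one_mul]
    refine (h _ a).trans ?_
    refine Eq.trans ?_ (congrArg (simplexPullback f) (h g a)).symm
    refine Eq.trans ?_ (h f (simplexComp g a)).symm
    rw [h₁]; rfl

end Simplex

section Artinian

/-- A dg Artinian algebra over `ℝ`: a graded commutative dg algebra in non-positive degrees, with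
finite-dimensional homogeneous parts of which only finitely many are non-zero, that is local with
residue field `ℝ` and with a nilpotent maximal ideal `m`, stable under the differential. By graded
commutativity, `m` is two-sided. -/
structure DGArt where
  /-- The underlying algebra. -/
  carrier : Type u
  [ring : Ring carrier]
  [algebra : Algebra ℝ carrier]
  /-- The homogeneous parts. -/
  gr : ℤ → Submodule ℝ carrier
  [graded : GradedAlgebra gr]
  /-- The differential. -/
  d : carrier →ₗ[ℝ] carrier
  d_mem : ∀ q, ∀ a ∈ gr q, d a ∈ gr (q + 1)
  d_d : ∀ a, d (d a) = 0
  leibniz : ∀ q, ∀ a ∈ gr q, ∀ b, d (a * b) = d a * b + (-1 : ℝ) ^ q • (a * d b)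
  graded_comm : ∀ p q, ∀ a ∈ gr p, ∀ b ∈ gr q, a * b = (-1 : ℝ) ^ (p * q) • (b * a)
  nonpos : ∀ q, 0 < q → gr q = ⊥
  finite : ∀ q, FiniteDimensional ℝ (gr q)
  bounded : ∃ N : ℤ, ∀ q < N, gr q = ⊥
  /-- The maximal ideal. -/
  m : Ideal carrier
  isMaximal : m.IsMaximal
  eq_of_isMaximal : ∀ I : Ideal carrier, I.IsMaximal → I = m
  residue : ∀ a, ∃ c : ℝ, a - algebraMap ℝ carrier c ∈ m
  nilpotent : ∃ N : ℕ, ∀ l : List carrier, l.length = N → (∀ a ∈ l, a ∈ m) → l.prod = 0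
  d_mem_m : ∀ a ∈ m, d a ∈ m

attribute [instance] DGArt.ring DGArt.algebra DGArt.graded

namespace DGArt

/-- Morphisms of dg Artinian algebras: maps of dg algebras. -/
@[ext]
structure Hom (A B : DGArt.{u}) where
  /-- The underlying map of algebras. -/
  toAlgHom : A.carrier →ₐ[ℝ] B.carrier
  map_gr : ∀ q, ∀ a ∈ A.gr q, toAlgHom a ∈ B.gr q
  map_d : ∀ a, toAlgHom (A.d a) = B.d (toAlgHom a)

instance : Category DGArt.{u} where
  Hom := Hom
  id A := ⟨AlgHom.id ℝ _, fun _ _ h => h, fun _ => rfl⟩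
  comp f g := ⟨g.toAlgHom.comp f.toAlgHom, fun q a h => g.map_gr q _ (f.map_gr q a h),
    fun a => by rw [AlgHom.comp_apply, AlgHom.comp_apply, f.map_d, g.map_d]⟩

/-- The map of algebras underlying a morphism. -/
def algHom {A B : DGArt.{u}} (f : A ⟶ B) : A.carrier →ₐ[ℝ] B.carrier := Hom.toAlgHom f

lemma algHom_mem {A B : DGArt.{u}} (f : A ⟶ B) {q : ℤ} {a : A.carrier} (ha : a ∈ A.gr q) :
    algHom f a ∈ B.gr q := Hom.map_gr f q a ha

lemma algHom_d {A B : DGArt.{u}} (f : A ⟶ B) (a : A.carrier) :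
    algHom f (A.d a) = B.d (algHom f a) := Hom.map_d f a

lemma algHom_id (A : DGArt.{u}) : algHom (𝟙 A) = AlgHom.id ℝ _ := rfl

lemma algHom_comp {A B C : DGArt.{u}} (f : A ⟶ B) (g : B ⟶ C) :
    algHom (f ≫ g) = (algHom g).comp (algHom f) := rfl

/-- Maps of dg Artinian algebras are local. -/
lemma algHom_mem_m {A B : DGArt.{u}} (f : A ⟶ B) {a : A.carrier} (ha : a ∈ A.m) :
    algHom f a ∈ B.m := by
  obtain ⟨c, hc⟩ := B.residue (algHom f a)
  obtain ⟨N, hN⟩ := A.nilpotent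
  have hpow : (algHom f a) ^ N = 0 := by
    have := hN (List.replicate N a) (by simp) (fun b hb => by rwa [List.eq_of_mem_replicate hb])
    rw [List.prod_replicate] at this
    rw [← map_pow, this, map_zero]
  have hcN : algebraMap ℝ B.carrier (c ^ N) ∈ B.m := by
    have h := (Algebra.commute_algebraMap_right c (algHom f a)).geom_sum₂_mul N
    have h' := B.m.mul_mem_left (∑ i ∈ Finset.range N, (algHom f a) ^ i *
      algebraMap ℝ B.carrier c ^ (N - 1 - i)) hc
    rw [h, hpow, zero_sub, ← map_pow] at h'
    exact neg_mem_iff.1 h'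
  have hc0 : c = 0 := by
    by_contra hne
    refine B.isMaximal.ne_top ((Ideal.eq_top_iff_one _).2 ?_)
    have h := B.m.mul_mem_left (algebraMap ℝ B.carrier (c ^ N)⁻¹) hcN
    rwa [← map_mul, inv_mul_cancel₀ (pow_ne_zero N hne), map_one] at h
  rwa [hc0, map_zero, sub_zero] at hc

/-- Quasi-isomorphisms: the induced map on cohomology is injective and surjective. -/
def IsQuasiIso {A B : DGArt.{u}} (f : A ⟶ B) : Prop :=
  (∀ a, A.d a = 0 → (∃ b, algHom f a = B.d b) → ∃ a', a = A.d a') ∧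
    ∀ b, B.d b = 0 → ∃ a, A.d a = 0 ∧ ∃ b', b = algHom f a + B.d b'

/-- Ordinary Artinian algebras are those concentrated in degree zero. -/
def IsOrdinary (A : DGArt.{u}) : Prop := A.gr 0 = ⊤

end DGArt

end Artinian

section MaurerCartan

set_option linter.unusedSectionVars false

/-- The tensor product `g ⊗ A ⊗ Ω*(Δ)`. -/
abbrev Triple (g : DGLAData.{u}) (A : DGArt.{u}) (J : Type) [Fintype J] : Type u :=
  g.carrier ⊗[ℝ] (A.carrier ⊗[ℝ] SimplexForms J)

variable (g : DGLAData.{u}) (A : DGArt.{u}) (J : Type) [Fintype J] [DecidableEq J]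

/-- The total differential on `g ⊗ A ⊗ Ω*(Δ)`:
`x ⊗ a ⊗ w ↦ dx ⊗ a ⊗ w + (-1)^p x ⊗ da ⊗ w + (-1)^(p+q) x ⊗ a ⊗ dw` for `x` of degree `p` and `a`
of degree `q`. -/
def totalD : Triple g A J →ₗ[ℝ] Triple g A J :=
  TensorProduct.map g.d LinearMap.id +
    TensorProduct.map (parity g.gr) (TensorProduct.map A.d LinearMap.id) +
    TensorProduct.map (parity g.gr) (TensorProduct.map (parity A.gr) (simplexD J))

/-- The product `(a ⊗ w)(b ⊗ v) = (-1)^(deg w deg b) ab ⊗ wv` on `A ⊗ Ω*(Δ)`. -/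
def coeffMul : (A.carrier ⊗[ℝ] SimplexForms J) ⊗[ℝ] (A.carrier ⊗[ℝ] SimplexForms J) →ₗ[ℝ]
    A.carrier ⊗[ℝ] SimplexForms J :=
  TensorProduct.map (LinearMap.mul' ℝ A.carrier) (LinearMap.mul' ℝ (SimplexForms J)) ∘ₗ
    (TensorProduct.tensorTensorTensorComm ℝ _ _ _ _).toLinearMap ∘ₗ
      koszul (TensorProduct.map LinearMap.id (parity (simplexGrading J)))
        (TensorProduct.map (parity A.gr) LinearMap.id)

/-- The bracket `[x ⊗ r, y ⊗ s] = (-1)^(deg r deg y) [x, y] ⊗ rs` on `g ⊗ A ⊗ Ω*(Δ)`, where `r` and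
`s` are homogeneous elements of `A ⊗ Ω*(Δ)`. -/
def totalBr : Triple g A J ⊗[ℝ] Triple g A J →ₗ[ℝ] Triple g A J :=
  TensorProduct.map (TensorProduct.lift g.br) (coeffMul A J) ∘ₗ
    (TensorProduct.tensorTensorTensorComm ℝ _ _ _ _).toLinearMap ∘ₗ
      koszul (TensorProduct.map LinearMap.id
          (TensorProduct.map (parity A.gr) (parity (simplexGrading J))))
        (TensorProduct.map (parity g.gr) LinearMap.id)

/-- The subspace `⨁_{p+q+r=1} gᵖ ⊗ m^q ⊗ Ωʳ(Δ)`, where `m` is the maximal ideal of `A`. -/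
def degreeOne : Submodule ℝ (Triple g A J) :=
  Submodule.span ℝ {α | ∃ p q r : ℤ, p + q + r = 1 ∧ ∃ x ∈ g.gr p, ∃ a ∈ A.gr q,
    a ∈ A.m ∧ ∃ w ∈ simplexGrading J r, α = x ⊗ₜ[ℝ] (a ⊗ₜ[ℝ] w)}

/-- The Maurer–Cartan elements of degree one in `g ⊗ m ⊗ Ω*(Δ)`. -/
def maurerCartan : Set (Triple g A J) :=
  {α | α ∈ degreeOne g A J ∧
    totalD g A J α + (1 / 2 : ℝ) • totalBr g A J (α ⊗ₜ[ℝ] α) = 0}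

variable {A J} {B : DGArt.{u}} {J' : Type} [Fintype J'] [DecidableEq J']

/-- The map `g ⊗ A ⊗ Ω*(Δ) → g ⊗ B ⊗ Ω*(Δ')` induced by a map of dg algebras and a map of
simplices. -/
def tripleMap (f : A ⟶ B) (θ : J' → J) : Triple g A J →ₗ[ℝ] Triple g B J' :=
  TensorProduct.map LinearMap.id
    (TensorProduct.map (DGArt.algHom f).toLinearMap (simplexPullback θ).toLinearMap)

lemma algHom_parity (f : A ⟶ B) (a : A.carrier) :
    DGArt.algHom f (parity A.gr a) = parity B.gr (DGArt.algHom f a) :=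
  map_parity A.gr B.gr (DGArt.algHom f).toLinearMap (fun _ _ h => DGArt.algHom_mem f h) a

lemma simplexPullback_parity (θ : J' → J) (w : SimplexForms J) :
    simplexPullback θ (parity (simplexGrading J) w) =
      parity (simplexGrading J') (simplexPullback θ w) :=
  map_parity (simplexGrading J) (simplexGrading J') (simplexPullback θ).toLinearMap
    (fun _ _ h => simplexPullback_mem θ h) w

lemma totalD_tripleMap (f : A ⟶ B) (θ : J' → J) (α : Triple g A J) :
    totalD g B J' (tripleMap g f θ α) = tripleMap g f θ (totalD g A J α) := by
  have h : totalD g B J' ∘ₗ tripleMap g f θ = tripleMap g f θ ∘ₗ totalD g A J := by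
    ext x a w
    simp [totalD, tripleMap, algHom_parity, DGArt.algHom_d, simplexD_pullback]
  exact LinearMap.congr_fun h α

lemma totalBr_tripleMap (f : A ⟶ B) (θ : J' → J) (α β : Triple g A J) :
    totalBr g B J' (tripleMap g f θ α ⊗ₜ tripleMap g f θ β) =
      tripleMap g f θ (totalBr g A J (α ⊗ₜ β)) := by
  have h : totalBr g B J' ∘ₗ TensorProduct.map (tripleMap g f θ) (tripleMap g f θ) =
      tripleMap g f θ ∘ₗ totalBr g A J := by
    ext x a w y b v
    simp [totalBr, coeffMul, koszul, tripleMap, algHom_parity, simplexPullback_parity]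
  exact LinearMap.congr_fun h (α ⊗ₜ β)

lemma tripleMap_degreeOne (f : A ⟶ B) (θ : J' → J) {α : Triple g A J}
    (hα : α ∈ degreeOne g A J) : tripleMap g f θ α ∈ degreeOne g B J' := by
  induction hα using Submodule.span_induction with
  | mem α h =>
    obtain ⟨p, q, r, hpqr, x, hx, a, ha, ham, w, hw, rfl⟩ := h
    exact Submodule.subset_span ⟨p, q, r, hpqr, x, hx, DGArt.algHom f a, DGArt.algHom_mem f ha,
      DGArt.algHom_mem_m f ham, simplexPullback θ w, simplexPullback_mem θ hw, rfl⟩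
  | zero => rw [map_zero]; exact Submodule.zero_mem _
  | add α β _ _ hα hβ => rw [map_add]; exact Submodule.add_mem _ hα hβ
  | smul c α _ hα => rw [map_smul]; exact Submodule.smul_mem _ c hα

lemma tripleMap_maurerCartan (f : A ⟶ B) (θ : J' → J) {α : Triple g A J}
    (hα : α ∈ maurerCartan g A J) : tripleMap g f θ α ∈ maurerCartan g B J' := by
  refine ⟨tripleMap_degreeOne g f θ hα.1, ?_⟩
  rw [totalD_tripleMap, totalBr_tripleMap, ← map_smul, ← map_add, hα.2, map_zero]

lemma tripleMap_id (α : Triple g A J) : tripleMap g (𝟙 A) (id : J → J) α = α := by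
  have h : tripleMap g (𝟙 A) (id : J → J) = LinearMap.id := by
    ext x a w
    simp [tripleMap, DGArt.algHom_id, simplexPullback_id]
  exact LinearMap.congr_fun h α

lemma tripleMap_comp {C : DGArt.{u}} {J'' : Type} [Fintype J''] [DecidableEq J''] (f : A ⟶ B)
    (f' : B ⟶ C) (θ : J' → J) (θ' : J'' → J') (α : Triple g A J) :
    tripleMap g f' θ' (tripleMap g f θ α) = tripleMap g (f ≫ f') (θ ∘ θ') α := by
  have h : tripleMap g f' θ' ∘ₗ tripleMap g f θ = tripleMap g (f ≫ f') (θ ∘ θ') := by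
    ext x a w
    simp [tripleMap, DGArt.algHom_comp, simplexPullback_comp]
  exact LinearMap.congr_fun h α

/-- The map on Maurer–Cartan elements induced by a map of dg algebras and a map of simplices. -/
def maurerCartanMap (f : A ⟶ B) (θ : J' → J) (α : maurerCartan g A J) : maurerCartan g B J' :=
  ⟨tripleMap g f θ α.1, tripleMap_maurerCartan g f θ α.2⟩

variable (A) in
/-- The simplicial set of Maurer–Cartan elements of `g ⊗ m ⊗ Ω*(Δⁿ)`. -/
def mcSSet : SSet.{u} where
  obj n := maurerCartan g A (Fin (n.unop.len + 1))
  map θ := TypeCat.ofHom (maurerCartanMap g (𝟙 A) θ.unop.toOrderHom)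
  map_id n := by
    ext α
    exact tripleMap_id g α.1
  map_comp θ θ' := by
    ext α
    exact (tripleMap_comp g (𝟙 A) (𝟙 A) θ.unop.toOrderHom θ'.unop.toOrderHom α.1).symm

/-- The Maurer–Cartan functor `Bg` of `g`, from dg Artinian algebras to simplicial sets. -/
def mcFunctor : DGArt.{u} ⥤ SSet.{u} where
  obj A := mcSSet g A
  map {A B} f :=
    { app := fun n => TypeCat.ofHom (maurerCartanMap g f id)
      naturality := fun n n' θ => by
        ext α
        exact Subtype.ext ((tripleMap_comp g (𝟙 A) f θ.unop.toOrderHom id α.1).trans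
          (tripleMap_comp g f (𝟙 B) id θ.unop.toOrderHom α.1).symm) }
  map_id A := by
    ext n α
    exact Subtype.ext (tripleMap_id g α.1)
  map_comp f f' := by
    ext n α
    exact Subtype.ext (tripleMap_comp g f f' id id α.1).symm

end MaurerCartan

section ModuliProblem

/-- Homotopy classes of maps of simplicial sets: maps modulo the equivalence relation generated by
homotopy. -/
def HomotopyClasses (X Y : SSet.{u}) : Type u :=
  Quot (fun f f' : X ⟶ Y => Nonempty (SSet.Homotopy f f'))

/-- Weak homotopy equivalences of simplicial sets: the maps `f : X → Y` such that for every Kan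
complex `K` precomposition with `f` is a bijection from homotopy classes of maps `Y → K` to homotopy
classes of maps `X → K`. -/
def IsWeakEquivalence {X Y : SSet.{u}} (f : X ⟶ Y) : Prop :=
  ∀ K : SSet.{u}, SSet.KanComplex K → ∃ φ : HomotopyClasses Y K → HomotopyClasses X K,
    (∀ k : Y ⟶ K, φ (Quot.mk _ k) = Quot.mk _ (f ≫ k)) ∧ Function.Bijective φ

/-- A simplicial set is contractible if the map to the point is a weak homotopy equivalence. -/
def IsContractible (X : SSet.{u}) : Prop := IsWeakEquivalence (Limits.terminal.from X)

/-- Kan fibrations: the maps with the right lifting property for horn inclusions. -/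
def IsKanFibration {X Y : SSet.{u}} (f : X ⟶ Y) : Prop := SSet.modelCategoryQuillen.J.rlp f

/-- A formal moduli problem: a functor `F` from dg Artinian algebras to simplicial sets that
* respects weak equivalences, that is, sends quasi-isomorphisms to weak homotopy equivalences,
* sends the ground field to a contractible simplicial set,
* sends surjections to Kan fibrations, and
* is compatible with fibre products of surjections `B → A ← C`, up to weak homotopy equivalence. -/
structure IsFormalModuliProblem (F : DGArt.{u} ⥤ SSet.{u}) : Prop where
  map_quasiIso : ∀ {A B : DGArt.{u}} (f : A ⟶ B), DGArt.IsQuasiIso f → IsWeakEquivalence (F.map f)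
  contractible : ∀ A : DGArt.{u}, Function.Bijective (algebraMap ℝ A.carrier) →
    IsContractible (F.obj A)
  fibration : ∀ {A B : DGArt.{u}} (f : B ⟶ A), Function.Surjective (DGArt.algHom f) →
    IsKanFibration (F.map f)
  exists_pullback : ∀ {A B C : DGArt.{u}} (f : B ⟶ A) (f' : C ⟶ A),
    Function.Surjective (DGArt.algHom f) → Function.Surjective (DGArt.algHom f') →
      ∃ (P : DGArt.{u}) (p : P ⟶ B) (p' : P ⟶ C), IsPullback p p' f f'
  pullback : ∀ {A B C P : DGArt.{u}} (f : B ⟶ A) (f' : C ⟶ A) (p : P ⟶ B) (p' : P ⟶ C),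
    Function.Surjective (DGArt.algHom f) → Function.Surjective (DGArt.algHom f') →
      ∀ h : IsPullback p p' f f', IsWeakEquivalence (Limits.pullback.lift (F.map p) (F.map p')
        (by rw [← F.map_comp, ← F.map_comp, h.w]))

end ModuliProblem

section FieldEquations

variable (M : Type u) [TopologicalSpace M] [ChartedSpace (Euc 3) M] [IsManifold (𝓡 3) ∞ M]

/-- The torsion `de + ω ∧ e` of an `ℝ^{2,1}`-valued one-form `e` with respect to an
`so(2,1)`-valued one-form `ω`. -/
def torsion (spin : FormsIn M Lorentz) (e : FormsIn M Translation) : FormsIn M Translation :=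
  formsInD M Translation e + wedge M lorentzMulVec spin e

/-- The `so(2,1)`-part `ω` of `A = ω + e`. -/
def lorentzPart : FormsIn M Iso21 →ₗ[ℝ] FormsIn M Lorentz :=
  ((LieAlgebra.SemiDirectSum.projr lorentzAction : Iso21 →ₗ⁅ℝ⁆ Lorentz) : Iso21 →ₗ[ℝ] Lorentz).lTensor
    (DeRham (n := 3) M)

/-- The `ℝ^{2,1}`-part `e` of `A = ω + e`. -/
def translationPart : FormsIn M Iso21 →ₗ[ℝ] FormsIn M Translation :=
  (LieAlgebra.SemiDirectSum.projl lorentzAction : Iso21 →ₗ[ℝ] Translation).lTensor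
    (DeRham (n := 3) M)

variable (R : DGArt.{u})

/-- The wedge product of vector valued forms with coefficients in `R`. -/
def wedgeCoeff {h₁ h₂ h₃ : Type} [AddCommGroup h₁] [Module ℝ h₁] [AddCommGroup h₂] [Module ℝ h₂]
    [AddCommGroup h₃] [Module ℝ h₃] (b : h₁ →ₗ[ℝ] h₂ →ₗ[ℝ] h₃) :
    FormsIn M h₁ ⊗[ℝ] R.carrier →ₗ[ℝ] FormsIn M h₂ ⊗[ℝ] R.carrier →ₗ[ℝ]
      FormsIn M h₃ ⊗[ℝ] R.carrier :=
  TensorProduct.map₂ (wedge M b) (LinearMap.mul ℝ R.carrier)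

/-- The curvature `dA + ½ [A, A]` for one-forms with coefficients in `R`. -/
def curvatureCoeff (h : Type) [LieRing h] [LieAlgebra ℝ h] (A : FormsIn M h ⊗[ℝ] R.carrier) :
    FormsIn M h ⊗[ℝ] R.carrier :=
  (formsInD M h).rTensor R.carrier A + (1 / 2 : ℝ) • wedgeCoeff M R (lieBilin h) A A

/-- The torsion `de + ω ∧ e` for one-forms with coefficients in `R`. -/
def torsionCoeff (spin : FormsIn M Lorentz ⊗[ℝ] R.carrier)
    (e : FormsIn M Translation ⊗[ℝ] R.carrier) : FormsIn M Translation ⊗[ℝ] R.carrier :=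
  (formsInD M Translation).rTensor R.carrier e + wedgeCoeff M R lorentzMulVec spin e

/-- The covariant derivative `d_∇ = d + [∇, ·]` on forms with coefficients in `R`. -/
def twistedD (conn : FormsIn M Iso21) :
    FormsIn M Iso21 ⊗[ℝ] R.carrier →ₗ[ℝ] FormsIn M Iso21 ⊗[ℝ] R.carrier :=
  (formsInD M Iso21 + wedgeLie M Iso21 conn).rTensor R.carrier

/-- The space `Ω¹(M, h) ⊗ I` for a subspace `I` of `R`. -/
def oneFormsCoeff (h : Type) [AddCommGroup h] [Module ℝ h] (I : Submodule ℝ R.carrier) :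
    Submodule ℝ (FormsIn M h ⊗[ℝ] R.carrier) :=
  LinearMap.range (TensorProduct.map (formsInGrading M h 1).subtype I.subtype)

/-- The solutions `A ∈ Ω¹(M, iso(2,1)) ⊗ m` of `d_∇ A + ½ [A, A] = 0`. -/
def flatDeformations (conn : FormsIn M Iso21) : Set (FormsIn M Iso21 ⊗[ℝ] R.carrier) :=
  {A | A ∈ oneFormsCoeff M R Iso21 (R.m.restrictScalars ℝ) ∧
    twistedD M R conn A + (1 / 2 : ℝ) • wedgeCoeff M R (lieBilin Iso21) A A = 0}

/-- The inclusion `g ⊗ R → g ⊗ R ⊗ Ω*(Δ⁰)`, `x ⊗ r ↦ x ⊗ r ⊗ 1`. -/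
def toPoint (g : DGLAData.{u}) : g.carrier ⊗[ℝ] R.carrier →ₗ[ℝ] Triple g R (Fin 1) :=
  ((TensorProduct.mk ℝ R.carrier (SimplexForms (Fin 1))).flip 1).lTensor g.carrier

end FieldEquations

end Gravity

end

open Gravity

/-! The dg Lie algebra axioms come from those of `Ω*(M)`, which are checked in charts, and from
those of `iso(2,1)`. The twisted differential squares to the bracket with the curvature of `∇`,
which is zero.

The Maurer–Cartan functor of every dg Lie algebra is a formal moduli problem
(`isFormalModuliProblem_mcFunctor`). The heart of this is a lifting problem. Given are a surjection
`C → C'` of nilpotent coefficient algebras, a Maurer–Cartan element over `C'` on a simplex, and a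
lift of it over some of the faces. Choose any lift of degree one that extends the one on the faces.
Its curvature has coefficients in the kernel and vanishes on the faces. Filter the kernel so that
multiplication by `C` raises the filtration. By the Bianchi identity the curvature is closed modulo
the next step, so a contraction of the subquotients gives a correction that pushes the curvature one
step further, and after finitely many steps it is zero (`DGLie.exists_curv_sub_eq_zero`,
`exists_mc_lift`).

The contraction has two sources. For a horn it is the Poincaré lemma: forms are contracted to the
vertex `k`, which lies on every face of the horn, so surjections give Kan fibrations
(`mcSpaceMap_isKanFibration`). For a full boundary the kernel has to be acyclic, and it has a
filtration with contractible subquotients (`exists_kernelFiltration_contraction`), so acyclic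
surjections give trivial fibrations (`mcSpaceMap_rlp_boundary`) and hence weak equivalences.

A quasi-isomorphism `f : C → C'` is factored through the algebra of pairs of an element `a` of `C`
and a path in `C'` that starts at `f a`. The projection to `C` and the end point in `C'` are both
acyclic surjections, and the constant paths are a section of the first, so `f` induces a weak
equivalence (`mcSpaceMap_isWeakEquivalence`). The path algebra need not have finite-dimensional
parts, so the lifting theorems are stated for non-unital algebras `DGComm` with `IsArtin`, in the
role of the maximal ideal. Fibre products are preserved up to isomorphism, because a graded linear
section of one surjection splits the fibre product linearly.

Over an ordinary `R`, forms on the point are constants, and degrees force a Maurer–Cartan vertex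
into `Ω¹ ⊗ m`. The curvature of `∇ + A` expands to `d_∇ A + ½[A, A]`. The two components of the
curvature of `ω + e` are the curvature of `ω` and the torsion, since translations commute and the
two mixed terms of the bracket agree on one-forms. -/

noncomputable section

namespace Gravity

/-! ### Weak equivalences, trivial fibrations and lifting criteria for simplicial sets. -/

section WeakEquivalence

open Simplicial MonoidalCategory CartesianMonoidalCategory SSet Opposite

variable {X Y Z : SSet.{u}}

/-- Precomposition with a map of simplicial sets on homotopy classes of maps. -/
def HomotopyClasses.precomp (f : X ⟶ Y) (K : SSet.{u}) : HomotopyClasses Y K → HomotopyClasses X K :=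
  Quot.map (fun k => f ≫ k) (by
    rintro k k' ⟨H⟩
    exact ⟨{ h := (f ▷ Δ[1] : X ⊗ Δ[1] ⟶ Y ⊗ Δ[1]) ≫ H.h
             h₀ := congrArg (fun l => f ≫ l) H.h₀
             h₁ := congrArg (fun l => f ≫ l) H.h₁
             -- The homotopy is relative to a subcomplex without simplices, so this condition has no
             -- cases.
             rel := by
               ext _ ⟨⟨x, hx⟩, _⟩
               simp at hx }⟩)

/-- The map asked for in the definition is determined by its values on classes of maps, so it can
only be precomposition. -/
lemma isWeakEquivalence_iff (f : X ⟶ Y) : IsWeakEquivalence f ↔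
    ∀ K : SSet.{u}, SSet.KanComplex K → Function.Bijective (HomotopyClasses.precomp f K) := by
  refine forall₂_congr fun K _ => ⟨?_, fun h => ⟨_, fun _ => rfl, h⟩⟩
  rintro ⟨φ, hφ, h⟩
  have : φ = HomotopyClasses.precomp f K := by
    ext ⟨k⟩
    exact hφ k
  rwa [← this]

lemma HomotopyClasses.precomp_comp (f : X ⟶ Y) (g : Y ⟶ Z) (K : SSet.{u}) :
    precomp (f ≫ g) K = precomp f K ∘ precomp g K := by
  ext ⟨k⟩
  exact congrArg (Quot.mk _) (Category.assoc f g k)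

lemma HomotopyClasses.precomp_id (K : SSet.{u}) : precomp (𝟙 X) K = id := by
  ext ⟨k⟩
  exact congrArg (Quot.mk _) (Category.id_comp k)

lemma HomotopyClasses.precomp_eq_id_of_homotopy {f : X ⟶ X} (H : SSet.Homotopy f (𝟙 X))
    (K : SSet.{u}) : precomp f K = id := by
  ext ⟨k⟩
  refine Quot.sound ⟨{ h := H.h ≫ k, h₀ := ?_, h₁ := ?_, rel := ?_ }⟩
  · have := H.h₀
    change (ι₀ ≫ H.h) ≫ k = f ≫ k
    rw [this]
  · have := H.h₁
    change (ι₁ ≫ H.h) ≫ k = k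
    rw [this, Category.id_comp]
  · ext _ ⟨⟨x, hx⟩, _⟩
    simp at hx

lemma IsWeakEquivalence.comp {f : X ⟶ Y} {g : Y ⟶ Z} (hf : IsWeakEquivalence f)
    (hg : IsWeakEquivalence g) : IsWeakEquivalence (f ≫ g) := by
  rw [isWeakEquivalence_iff] at *
  intro K hK
  rw [HomotopyClasses.precomp_comp]
  exact (hf K hK).comp (hg K hK)

/-- A one-sided inverse of a weak equivalence is a weak equivalence. -/
lemma IsWeakEquivalence.of_section {f : X ⟶ Y} {s : Y ⟶ X} (hf : IsWeakEquivalence f)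
    (h : s ≫ f = 𝟙 Y) : IsWeakEquivalence s := by
  rw [isWeakEquivalence_iff] at *
  intro K hK
  have := HomotopyClasses.precomp_comp s f K
  rw [h, HomotopyClasses.precomp_id] at this
  refine (Function.Bijective.of_comp_iff _ (hf K hK)).1 ?_
  rw [← this]
  exact Function.bijective_id

lemma isWeakEquivalence_of_homotopy_inverse {f : X ⟶ Y} {s : Y ⟶ X} (h : s ≫ f = 𝟙 Y)
    (H : SSet.Homotopy (f ≫ s) (𝟙 X)) : IsWeakEquivalence f := by
  rw [isWeakEquivalence_iff]
  intro K _
  have h₁ := HomotopyClasses.precomp_comp s f K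
  have h₂ := HomotopyClasses.precomp_comp f s K
  rw [h, HomotopyClasses.precomp_id] at h₁
  rw [HomotopyClasses.precomp_eq_id_of_homotopy H] at h₂
  exact Function.bijective_iff_has_inverse.2 ⟨_, fun x => (congrFun h₁ x).symm,
    fun x => (congrFun h₂ x).symm⟩

lemma isWeakEquivalence_of_isIso (f : X ⟶ Y) [IsIso f] : IsWeakEquivalence f := by
  rw [isWeakEquivalence_iff]
  intro K _
  have h₁ := HomotopyClasses.precomp_comp (inv f) f K
  have h₂ := HomotopyClasses.precomp_comp f (inv f) K
  rw [IsIso.inv_hom_id, HomotopyClasses.precomp_id] at h₁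
  rw [IsIso.hom_inv_id, HomotopyClasses.precomp_id] at h₂
  exact Function.bijective_iff_has_inverse.2 ⟨_, fun x => (congrFun h₁ x).symm,
    fun x => (congrFun h₂ x).symm⟩

/-- The map `X × ∂Δ[1] → X` that is `f` on the end `0` and the identity on the end `1`. -/
def endsMap (f : X ⟶ X) : ((⊤ : X.Subcomplex).prod (boundary 1) : SSet.{u}) ⟶ X where
  app n := TypeCat.ofHom fun x =>
    if stdSimplex.asOrderHom x.1.2 0 = 0 then f.app n x.1.1 else x.1.1
  naturality n n' θ := by
    ext ⟨⟨x, t⟩, -, ht⟩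
    have hc : stdSimplex.asOrderHom ((Δ[1] : SSet.{u}).map θ t) 0 = stdSimplex.asOrderHom t 0 := by
      change stdSimplex.asOrderHom t (θ.unop.toOrderHom 0) = _
      -- A simplex of `∂Δ[1]` is not surjective on vertices, hence constant. If its first value
      -- changed under `θ`, both vertices would occur.
      by_contra hne
      refine ht fun i => ?_
      have h0 : ∀ a b i : Fin 2, a ≠ b → a = i ∨ b = i := by decide
      rcases h0 _ _ i hne with h | h
      · exact ⟨_, h⟩
      · exact ⟨_, h⟩
    change (if stdSimplex.asOrderHom ((Δ[1] : SSet.{u}).map θ t) 0 = 0 then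
        f.app n' (X.map θ x) else X.map θ x) =
      X.map θ (if stdSimplex.asOrderHom t 0 = 0 then f.app n x else x)
    rw [hc]
    split_ifs
    · exact ConcreteCategory.congr_hom (f.naturality θ) x
    · rfl

/-- Maps with the right lifting property for boundary inclusions are weak equivalences. -/
lemma isWeakEquivalence_of_rlp {p : X ⟶ Y} (hp : modelCategoryQuillen.I.rlp p) :
    IsWeakEquivalence p := by
  rw [← rlp_monomorphisms] at hp
  -- Lifting against boundary inclusions gives lifting against all monomorphisms. The inclusion of
  -- the empty subcomplex of `Y` yields a section, and `X × ∂Δ[1] → X × Δ[1]` yields a homotopy over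
  -- `Y` from `p ≫ s` to the identity.
  have hs : ∃ s : Y ⟶ X, s ≫ p = 𝟙 Y := by
    have := hp (⊥ : Y.Subcomplex).ι (MorphismProperty.monomorphisms.infer_property _)
    have sq : CommSq (Subcomplex.isInitialBot.to X) (⊥ : Y.Subcomplex).ι p (𝟙 Y) :=
      ⟨Subcomplex.isInitialBot.hom_ext _ _⟩
    exact ⟨sq.lift, sq.fac_right⟩
  obtain ⟨s, hs⟩ := hs
  have := hp ((⊤ : X.Subcomplex).prod (boundary 1)).ι
    (MorphismProperty.monomorphisms.infer_property _)
  have sq : CommSq (endsMap (p ≫ s)) ((⊤ : X.Subcomplex).prod (boundary 1)).ι p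
      (fst X Δ[1] ≫ p) := by
    refine ⟨?_⟩
    ext n ⟨⟨x, t⟩, ht⟩
    change p.app n (if stdSimplex.asOrderHom t 0 = 0 then s.app n (p.app n x) else x) = p.app n x
    split_ifs
    · exact ConcreteCategory.congr_hom (congr_app hs n) (p.app n x)
    · rfl
  have hmem : ∀ (i : Fin 2) (n : SimplexCategoryᵒᵖ) (x : X.obj n),
      ((x, (const (stdSimplex.obj₀Equiv.{u}.symm i) : X ⟶ Δ[1]).app n x) : (X ⊗ Δ[1]).obj n) ∈
        ((⊤ : X.Subcomplex).prod (boundary 1)).obj n := by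
    intro i n x
    -- The constant simplex at the vertex `i` misses the vertex `1 - i`, so it lies in the boundary.
    refine ⟨trivial, fun h => ?_⟩
    obtain ⟨a, ha⟩ := h (1 - i)
    change i = 1 - i at ha
    revert ha
    fin_cases i <;> decide
  refine isWeakEquivalence_of_homotopy_inverse hs
    { h := sq.lift, h₀ := ?_, h₁ := ?_, rel := ?_ }
  · ext n x
    refine (ConcreteCategory.congr_hom (congr_app sq.fac_left n) ⟨_, hmem 0 n x⟩).trans ?_
    change (if (0 : Fin 2) = 0 then s.app n (p.app n x) else x) = s.app n (p.app n x)
    exact if_pos rfl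
  · ext n x
    refine (ConcreteCategory.congr_hom (congr_app sq.fac_left n) ⟨_, hmem 1 n x⟩).trans ?_
    change (if (1 : Fin 2) = 0 then s.app n (p.app n x) else x) = x
    exact if_neg (by decide)
  · ext _ ⟨⟨x, hx⟩, _⟩
    simp at hx

/-- A family of `n`-simplices indexed by a set of faces of the `(n+1)`-simplex that agree on common
faces. -/
def IsCompatibleFamily (X : SSet.{u}) {n : ℕ} (S : Set (Fin (n + 2)))
    (a : Fin (n + 2) → X.obj (op ⦋n⦌)) : Prop :=
  ∀ i ∈ S, ∀ j ∈ S, ∀ (m : ℕ) (θ θ' : ⦋m⦌ ⟶ ⦋n⦌),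
    θ ≫ SimplexCategory.δ i = θ' ≫ SimplexCategory.δ j → X.map θ.op (a i) = X.map θ'.op (a j)

/-- A map out of `∂Δ[n + 1]` amounts to a family of simplices, one for each face, that agree on
common faces. The boundary of the point is empty, which leaves surjectivity on vertices. -/
lemma rlp_boundary_of_exists (p : X ⟶ Y) (h₀ : Function.Surjective (p.app (op ⦋0⦌)))
    (h : ∀ (n : ℕ) (a : Fin (n + 2) → X.obj (op ⦋n⦌)) (b : Y.obj (op ⦋n + 1⦌)),
      IsCompatibleFamily X Set.univ a →
      (∀ i, p.app _ (a i) = Y.map (SimplexCategory.δ i).op b) →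
      ∃ x : X.obj (op ⦋n + 1⦌), (∀ i, X.map (SimplexCategory.δ i).op x = a i) ∧
        p.app _ x = b) :
    modelCategoryQuillen.I.rlp p := by
  rintro _ _ _ ⟨n⟩
  refine ⟨fun {α β} sq => ?_⟩
  cases n with
  | zero =>
    obtain ⟨x, hx⟩ := h₀ (SSet.yonedaEquiv β)
    refine ⟨⟨⟨SSet.yonedaEquiv.symm x, boundary.hom_ext₀, ?_⟩⟩⟩
    apply SSet.yonedaEquiv.injective
    rw [SSet.yonedaEquiv_comp, Equiv.apply_symm_apply, hx]
  | succ n =>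
    obtain ⟨x, hx, hx'⟩ := h n (fun i => SSet.yonedaEquiv (boundary.ι i ≫ α)) (SSet.yonedaEquiv β) (by
        intro i _ j _ m θ θ' hθ
        rw [SSet.yonedaEquiv_naturality, SSet.yonedaEquiv_naturality]
        congr 1
        rw [← Category.assoc, ← Category.assoc]
        congr 1
        rw [← cancel_mono (boundary.{u} (n + 1)).ι, Category.assoc, Category.assoc, boundary.ι_ι,
          boundary.ι_ι]
        exact (SSet.stdSimplex.map_comp θ _).symm.trans
          ((congrArg SSet.stdSimplex.map hθ).trans (SSet.stdSimplex.map_comp θ' _)))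
      (by
        intro i
        rw [← SSet.yonedaEquiv_comp, Category.assoc, sq.w, boundary.ι_ι_assoc, SSet.yonedaEquiv_naturality]
        rfl)
    refine ⟨⟨⟨SSet.yonedaEquiv.symm x, ?_, ?_⟩⟩⟩
    · apply boundary.hom_ext
      intro i
      apply SSet.yonedaEquiv.injective
      rw [boundary.ι_ι_assoc, ← hx i]
      change SSet.yonedaEquiv (SSet.stdSimplex.map (SimplexCategory.δ i) ≫ SSet.yonedaEquiv.symm x) = _
      rw [← SSet.yonedaEquiv_naturality, Equiv.apply_symm_apply]
    · apply SSet.yonedaEquiv.injective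
      rw [SSet.yonedaEquiv_comp, Equiv.apply_symm_apply, hx']

/-- A map out of a horn amounts to a compatible family on the faces other than the `k`-th. -/
lemma isKanFibration_of_exists (p : X ⟶ Y)
    (h : ∀ (n : ℕ) (k : Fin (n + 2)) (a : Fin (n + 2) → X.obj (op ⦋n⦌)) (b : Y.obj (op ⦋n + 1⦌)),
      IsCompatibleFamily X {k}ᶜ a →
      (∀ i ≠ k, p.app _ (a i) = Y.map (SimplexCategory.δ i).op b) →
      ∃ x : X.obj (op ⦋n + 1⦌), (∀ i ≠ k, X.map (SimplexCategory.δ i).op x = a i) ∧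
        p.app _ x = b) :
    IsKanFibration p := by
  intro _ _ _ hJ
  simp only [modelCategoryQuillen.J, MorphismProperty.iSup_iff] at hJ
  obtain ⟨n, ⟨k⟩⟩ := hJ
  refine ⟨fun {α β} sq => ?_⟩
  -- The family is indexed by all faces, so it needs some value at the missing face `k`; the
  -- restriction to another face `j₀` serves as the default.
  have hne : ∃ j : Fin (n + 2), j ≠ k := exists_ne k
  obtain ⟨j₀, hj₀⟩ := hne
  obtain ⟨x, hx, hx'⟩ := h n k
    (fun i => if hi : i ≠ k then SSet.yonedaEquiv (horn.ι k i hi ≫ α)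
      else SSet.yonedaEquiv (horn.ι k j₀ hj₀ ≫ α)) (SSet.yonedaEquiv β) (by
      intro i hi j hj m θ θ' hθ
      have hi : i ≠ k := hi
      have hj : j ≠ k := hj
      beta_reduce
      rw [dif_pos hi, dif_pos hj, SSet.yonedaEquiv_naturality, SSet.yonedaEquiv_naturality]
      congr 1
      rw [← Category.assoc, ← Category.assoc]
      congr 1
      rw [← cancel_mono (horn.{u} (n + 1) k).ι, Category.assoc, Category.assoc, horn.ι_ι,
        horn.ι_ι]
      exact (SSet.stdSimplex.map_comp θ _).symm.trans
          ((congrArg SSet.stdSimplex.map hθ).trans (SSet.stdSimplex.map_comp θ' _)))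
    (by
      intro i hi
      rw [dif_pos hi, ← SSet.yonedaEquiv_comp, Category.assoc, sq.w, horn.ι_ι_assoc,
        SSet.yonedaEquiv_naturality]
      rfl)
  refine ⟨⟨⟨SSet.yonedaEquiv.symm x, ?_, ?_⟩⟩⟩
  · apply horn.hom_ext'
    intro i hi
    apply SSet.yonedaEquiv.injective
    have := hx i hi
    rw [dif_pos hi] at this
    rw [horn.ι_ι_assoc, ← this]
    change SSet.yonedaEquiv (SSet.stdSimplex.map (SimplexCategory.δ i) ≫ SSet.yonedaEquiv.symm x) = _
    rw [← SSet.yonedaEquiv_naturality, Equiv.apply_symm_apply]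
  · apply SSet.yonedaEquiv.injective
    rw [SSet.yonedaEquiv_comp, Equiv.apply_symm_apply, hx']

end WeakEquivalence

/-! ### Graded commutativity, Leibniz rule and `d² = 0` for forms with function coefficients. -/

section GradedForms

variable {W A J : Type*} [AddCommGroup W] [Module ℝ W] [CommRing A] [Algebra ℝ A] [Fintype J]

lemma ι_mul_of_mem_exteriorPower (v : W) (k : ℕ) (l : ExteriorAlgebra ℝ W) (hl : l ∈ ⋀[ℝ]^k W) :
    l * ExteriorAlgebra.ι ℝ v = ((-1 : ℝ) ^ k) • (ExteriorAlgebra.ι ℝ v * l) := by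
  induction k generalizing l with
  | zero =>
    rw [ExteriorAlgebra.exteriorPower, pow_zero] at hl
    obtain ⟨r, rfl⟩ := Submodule.mem_one.1 hl
    rw [pow_zero, one_smul, Algebra.commutes]
  | succ k ih =>
    rw [ExteriorAlgebra.exteriorPower, pow_succ'] at hl
    induction hl using Submodule.mul_induction_on' with
    | mem_mul_mem a ha b hb =>
      obtain ⟨u, rfl⟩ := ha
      rw [mul_assoc, ih b hb, mul_smul_comm, ← mul_assoc, ← mul_assoc, ι_anticomm u v, pow_succ,
        mul_neg_one, neg_smul, neg_mul, smul_neg]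
    | add a _ b _ ha hb => rw [add_mul, mul_add, ha, hb, smul_add]

lemma exteriorPower_mul_comm (k n : ℕ) (l m : ExteriorAlgebra ℝ W) (hl : l ∈ ⋀[ℝ]^k W)
    (hm : m ∈ ⋀[ℝ]^n W) : l * m = ((-1 : ℝ) ^ (k * n)) • (m * l) := by
  induction n generalizing m with
  | zero =>
    rw [ExteriorAlgebra.exteriorPower, pow_zero] at hm
    obtain ⟨r, rfl⟩ := Submodule.mem_one.1 hm
    rw [mul_zero, pow_zero, one_smul, Algebra.commutes]
  | succ n ih =>
    rw [ExteriorAlgebra.exteriorPower, pow_succ'] at hm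
    induction hm using Submodule.mul_induction_on' with
    | mem_mul_mem a ha b hb =>
      obtain ⟨u, rfl⟩ := ha
      rw [← mul_assoc, ι_mul_of_mem_exteriorPower u k l hl, smul_mul_assoc, mul_assoc, ih b hb,
        mul_smul_comm, smul_smul, ← mul_assoc, ← pow_add, mul_add, mul_one, add_comm]
    | add a _ b _ ha hb => rw [add_mul, mul_add, ha, hb, smul_add]

lemma extGrading_mul_comm {p q : ℤ} {l m : ExteriorAlgebra ℝ W} (hl : l ∈ extGrading W p)
    (hm : m ∈ extGrading W q) : l * m = ((-1 : ℝ) ^ (p * q)) • (m * l) := by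
  cases p with
  | negSucc p =>
    have : l = 0 := (Submodule.mem_bot ℝ).1 hl
    simp [this]
  | ofNat p =>
    cases q with
    | negSucc q =>
      have : m = 0 := (Submodule.mem_bot ℝ).1 hm
      simp [this]
    | ofNat q =>
      have := exteriorPower_mul_comm p q l m hl hm
      rw [this]
      congr 1

/-- Homogeneous forms are spanned by the products of homogeneous elements of the exterior algebra
with functions. -/
lemma formsGrading_induction {p : ℤ} {P : Forms W A → Prop} {x : Forms W A}
    (hx : x ∈ formsGrading W A p) (h₀ : P 0) (hadd : ∀ a b, P a → P b → P (a + b))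
    (h : ∀ l ∈ extGrading W p, ∀ a : A, P (l ⊗ₜ a)) : P x := by
  obtain ⟨x, rfl⟩ := hx
  induction x using TensorProduct.induction_on with
  | zero => rwa [map_zero]
  | add a b ha hb => rw [map_add]; exact hadd _ _ ha hb
  | tmul a b => exact h a a.2 b

lemma forms_mul_comm {p q : ℤ} {x y : Forms W A} (hx : x ∈ formsGrading W A p)
    (hy : y ∈ formsGrading W A q) : x * y = ((-1 : ℝ) ^ (p * q)) • (y * x) := by
  refine formsGrading_induction (P := fun x => x * y = ((-1 : ℝ) ^ (p * q)) • (y * x)) hx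
    (by simp) (fun a b ha hb => by
    rw [add_mul, mul_add, ha, hb, smul_add]) fun l hl a => ?_
  refine formsGrading_induction (P := fun y => l ⊗ₜ[ℝ] a * y = ((-1 : ℝ) ^ (p * q)) • (y * l ⊗ₜ[ℝ] a))
    hy (by simp) (fun a b ha hb => by
    rw [add_mul, mul_add, ha, hb, smul_add]) fun m hm b => ?_
  rw [Algebra.TensorProduct.tmul_mul_tmul, Algebra.TensorProduct.tmul_mul_tmul,
    extGrading_mul_comm hl hm, mul_comm a b, TensorProduct.smul_tmul']

lemma extD_leibniz (w : J → W) (D : J → Derivation ℝ A A) {p : ℤ} {x : Forms W A}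
    (hx : x ∈ formsGrading W A p) (y : Forms W A) :
    extD w D (x * y) = extD w D x * y + ((-1 : ℝ) ^ p) • (x * extD w D y) := by
  refine formsGrading_induction (P := fun x => extD w D (x * y) =
    extD w D x * y + ((-1 : ℝ) ^ p) • (x * extD w D y)) hx (by simp) (fun a b ha hb => by
    rw [add_mul, map_add, map_add, ha, hb, add_mul, add_mul, smul_add]; abel) fun l hl a => ?_
  induction y using TensorProduct.induction_on with
  | zero => simp
  | add y z hy hz => rw [mul_add, map_add, map_add, hy, hz, mul_add, mul_add, smul_add]; abel
  | tmul m b =>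
    simp only [Algebra.TensorProduct.tmul_mul_tmul, extD_tmul, Finset.sum_mul, Finset.mul_sum,
      Derivation.leibniz, smul_eq_mul, TensorProduct.tmul_add, Finset.sum_add_distrib,
      Finset.smul_sum]
    rw [add_comm]
    congr 1
    · refine Finset.sum_congr rfl fun j _ => ?_
      rw [mul_assoc, mul_comm b]
    · refine Finset.sum_congr rfl fun j _ => ?_
      -- Moving the one-form past `l` costs `(-1)^p`, which cancels the sign in the Leibniz rule.
      rw [← mul_assoc, ← mul_assoc, extGrading_mul_comm hl (ι_mem_extGrading (w j)), mul_one,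
        smul_mul_assoc, TensorProduct.smul_tmul', smul_smul, ← mul_zpow]
      simp

/-- Constant forms are closed, so `d²(a λ)` is `(d² a) ∧ λ` and only functions need checking. The
derivations are not assumed to commute, because on the simplex they do not. -/
lemma extD_extD (w : J → W) (D : J → Derivation ℝ A A)
    (h : ∀ a, ∑ i, ∑ j, (ExteriorAlgebra.ι ℝ (w i) * ExteriorAlgebra.ι ℝ (w j)) ⊗ₜ[ℝ]
      D i (D j a) = 0) (x : Forms W A) : extD w D (extD w D x) = 0 := by
  induction x using TensorProduct.induction_on with
  | zero => simp
  | add y z hy hz => rw [map_add, map_add, hy, hz, add_zero]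
  | tmul l a =>
    have := congrArg (fun y => y * (l ⊗ₜ[ℝ] (1 : A))) (h a)
    simp only [Finset.sum_mul, Algebra.TensorProduct.tmul_mul_tmul, mul_one, zero_mul] at this
    rw [extD_tmul, map_sum]
    simp only [extD_tmul]
    rw [Finset.sum_comm]
    simpa only [mul_assoc] using this

/-- An antisymmetric expression is summed against a symmetric one: exchanging the indices changes
the sign of the sum. -/
lemma sum_ι_mul_ι_eq_zero {B : Type*} [AddCommGroup B] [Module ℝ B] (w : J → W) (b : J → J → B)
    (hb : ∀ i j, b i j = b j i) :
    ∑ i, ∑ j, (ExteriorAlgebra.ι ℝ (w i) * ExteriorAlgebra.ι ℝ (w j)) ⊗ₜ[ℝ] b i j = 0 := by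
  have hneg : ∑ i, ∑ j, (ExteriorAlgebra.ι ℝ (w i) * ExteriorAlgebra.ι ℝ (w j)) ⊗ₜ[ℝ] b i j =
      -∑ i, ∑ j, (ExteriorAlgebra.ι ℝ (w i) * ExteriorAlgebra.ι ℝ (w j)) ⊗ₜ[ℝ] b i j := by
    conv_lhs => rw [Finset.sum_comm]
    simp only [← Finset.sum_neg_distrib]
    refine Finset.sum_congr rfl fun i _ => Finset.sum_congr rfl fun j _ => ?_
    rw [ι_anticomm, TensorProduct.neg_tmul, hb]
  have h2 : (2 : ℝ) • ∑ i, ∑ j, (ExteriorAlgebra.ι ℝ (w i) * ExteriorAlgebra.ι ℝ (w j)) ⊗ₜ[ℝ]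
      b i j = 0 := by
    rw [two_smul]
    nth_rewrite 1 [hneg]
    simp
  exact (smul_eq_zero.1 h2).resolve_left two_ne_zero

end GradedForms

/-! ### The dg algebra of forms on an open subset of `ℝⁿ`. -/

section OpenForms

variable {n : ℕ} {U : TopologicalSpace.Opens (Euc n)}

lemma openForms_mul_comm {p q : ℤ} {x y : OpenForms U} (hx : x ∈ openGrading U p)
    (hy : y ∈ openGrading U q) : x * y = ((-1 : ℝ) ^ (p * q)) • (y * x) :=
  forms_mul_comm (W := Fin n → ℝ) (A := smoothFun U) hx hy

lemma openD_leibniz {p : ℤ} {x : OpenForms U} (hx : x ∈ openGrading U p) (y : OpenForms U) :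
    openD U (x * y) = openD U x * y + ((-1 : ℝ) ^ p) • (x * openD U y) :=
  extD_leibniz dx (pderiv U) hx y

lemma openD_openD (x : OpenForms U) : openD U (openD U x) = 0 :=
  extD_extD dx (pderiv U) (fun a => sum_ι_mul_ι_eq_zero _ (fun i j => pderiv U i (pderiv U j a))
    (fun i j => pderiv_comm i j a)) x

end OpenForms

/-! ### The dg algebra of forms on a simplex. -/

section SimplexForms

set_option linter.unusedSectionVars false

variable {J : Type} [Fintype J] [DecidableEq J]

lemma simplexForms_mul_comm {p q : ℤ} {x y : SimplexForms J} (hx : x ∈ simplexGrading J p)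
    (hy : y ∈ simplexGrading J q) : x * y = ((-1 : ℝ) ^ (p * q)) • (y * x) :=
  forms_mul_comm (W := Cotangent J) (A := simplexFun J) hx hy

lemma simplexD_leibniz {p : ℤ} {x : SimplexForms J} (hx : x ∈ simplexGrading J p)
    (y : SimplexForms J) :
    simplexD J (x * y) = simplexD J x * y + ((-1 : ℝ) ^ p) • (x * simplexD J y) :=
  extD_leibniz dt simplexDeriv hx y

lemma simplexD_mem {p : ℤ} {x : SimplexForms J} (hx : x ∈ simplexGrading J p) :
    simplexD J x ∈ simplexGrading J (p + 1) :=
  extD_mem _ _ hx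

lemma mul_mem_simplexGrading {p q : ℤ} {x y : SimplexForms J} (hx : x ∈ simplexGrading J p)
    (hy : y ∈ simplexGrading J q) : x * y ∈ simplexGrading J (p + q) :=
  formsGrading_mul_mem (W := Cotangent J) (A := simplexFun J) hx hy

/-- The barycentric coordinates sum to one, so their differentials sum to zero; this is the relation
by which `Cotangent` is a quotient. -/
lemma sum_dt : ∑ j : J, dt j = 0 := by
  have h : ∑ j : J, (Pi.single j 1 : J → ℝ) = 1 := by
    ext k
    simp [Finset.sum_apply, Pi.single_apply]
  change ∑ j : J, (Submodule.mkQ (Submodule.span ℝ {(1 : J → ℝ)})) (Pi.single j 1) = 0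
  rw [← map_sum, h]
  exact (Submodule.Quotient.mk_eq_zero _).2 (Submodule.subset_span rfl)

/-- The derivative of a smooth function on the simplex can be computed with any extension. -/
lemma simplexDeriv_eq (j : J) (f : simplexFun J) {g : (J → ℝ) → ℝ} (hg : ContDiff ℝ ∞ g)
    (h : ∀ x : stdSimplex ℝ J, f.1 x = g x.1) (x : stdSimplex ℝ J) :
    (simplexDeriv j f).1 x = fderiv ℝ g x.1 (Pi.single j 1 - x.1) := by
  rw [simplexDeriv_apply]
  exact fderiv_simplex_congr (contDiff_simplexExt f) hg
    (fun y hy => (simplexExt_apply f ⟨y, hy⟩).symm.trans (h ⟨y, hy⟩)) x.2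
    (single_mem_stdSimplex ℝ j)

/-- The vector field `eⱼ - x` has derivative `-id`, so `Dᵢ Dⱼ f` is the Hessian on two such fields
minus `Dᵢ f`. Symmetry holds only after adding the correction back. -/
lemma simplexDeriv_comm (i j : J) (f : simplexFun J) :
    simplexDeriv i (simplexDeriv j f) + simplexDeriv i f =
      simplexDeriv j (simplexDeriv i f) + simplexDeriv j f := by
  have hf := contDiff_simplexExt f
  have hf' : ContDiff ℝ ∞ (fderiv ℝ (simplexExt f)) := hf.fderiv_right (by simp)
  have key : ∀ (i j : J) (x : stdSimplex ℝ J), (simplexDeriv i (simplexDeriv j f)).1 x =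
      fderiv ℝ (fderiv ℝ (simplexExt f)) x.1 (Pi.single i 1 - x.1) (Pi.single j 1 - x.1) -
        fderiv ℝ (simplexExt f) x.1 (Pi.single i 1 - x.1) := by
    intro i j x
    rw [simplexDeriv_eq i (simplexDeriv j f)
      (g := fun y => fderiv ℝ (simplexExt f) y (Pi.single j 1 - y))
      (hf'.clm_apply (contDiff_const.sub contDiff_id)) (fun y => rfl) x]
    have hsub : fderiv ℝ (fun y : J → ℝ => Pi.single j 1 - y) x.1 =
        -ContinuousLinearMap.id ℝ (J → ℝ) := by
      rw [fderiv_const_sub, fderiv_fun_id]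
    rw [fderiv_clm_apply (hf'.differentiable (by simp) x.1) (by fun_prop), hsub]
    simp
    abel
  ext x
  change (simplexDeriv i (simplexDeriv j f)).1 x + (simplexDeriv i f).1 x =
    (simplexDeriv j (simplexDeriv i f)).1 x + (simplexDeriv j f).1 x
  rw [key, key, simplexDeriv_apply, simplexDeriv_apply, sub_add_cancel, sub_add_cancel]
  exact (hf.contDiffAt (x := x.1)).isSymmSndFDerivAt
    (by simp only [minSmoothness_of_isRCLikeNormedField]; exact WithTop.coe_le_coe.2 le_top) _ _

lemma simplexD_simplexD (x : SimplexForms J) : simplexD J (simplexD J x) = 0 := by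
  refine extD_extD dt simplexDeriv (fun a => ?_) x
  have h := sum_ι_mul_ι_eq_zero dt
    (fun i j => simplexDeriv i (simplexDeriv j a) + simplexDeriv i a)
    (fun i j => simplexDeriv_comm i j a)
  simp only [TensorProduct.tmul_add, Finset.sum_add_distrib] at h
  -- The correction terms do not involve `j`, so they vanish by `sum_dt`.
  have h' : ∑ i, ∑ j : J, (ExteriorAlgebra.ι ℝ (dt i) * ExteriorAlgebra.ι ℝ (dt j)) ⊗ₜ[ℝ]
      simplexDeriv i a = 0 := by
    refine Finset.sum_eq_zero fun i _ => ?_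
    rw [← TensorProduct.sum_tmul, ← Finset.mul_sum, ← map_sum, sum_dt, map_zero, mul_zero,
      TensorProduct.zero_tmul]
  rwa [h', add_zero] at h

end SimplexForms

/-! ### Smooth dependence of integrals over `[0, 1]` on parameters. -/

section ParametricIntegral

open MeasureTheory intervalIntegral

variable {E G : Type} [NormedAddCommGroup E] [NormedSpace ℝ E] [FiniteDimensional ℝ E]
  [NormedAddCommGroup G] [NormedSpace ℝ G]

lemma hasFDerivAt_integral_of_contDiff {F : E × ℝ → G} (hF : ContDiff ℝ ∞ F) (x₀ : E) :
    HasFDerivAt (fun x => ∫ s in (0 : ℝ)..1, F (x, s))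
      (∫ s in (0 : ℝ)..1, (fderiv ℝ F (x₀, s)).comp (ContinuousLinearMap.inl ℝ E ℝ)) x₀ := by
  have hF' : Continuous (fun q : E × ℝ => (fderiv ℝ F q).comp (ContinuousLinearMap.inl ℝ E ℝ)) :=
    (hF.continuous_fderiv (by simp)).clm_comp continuous_const
  have : ProperSpace E := FiniteDimensional.proper ℝ E
  -- The dominating function is a constant: the derivative is bounded on the compact product of the
  -- unit ball around `x₀` with `[0, 1]`.
  obtain ⟨C, hC⟩ := ((isCompact_closedBall x₀ 1).prod (isCompact_Icc (a := (0 : ℝ)) (b := 1))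
    ).exists_bound_of_continuousOn hF'.continuousOn
  refine hasFDerivAt_integral_of_dominated_of_fderiv_le (𝕜 := ℝ) (μ := volume)
    (F := fun x s => F (x, s))
    (F' := fun x s => (fderiv ℝ F (x, s)).comp (ContinuousLinearMap.inl ℝ E ℝ))
    (s := Metric.closedBall x₀ 1) (bound := fun _ => C)
    (Metric.closedBall_mem_nhds x₀ one_pos) ?_ ?_ ?_ ?_ ?_ ?_
  · exact Filter.Eventually.of_forall fun x =>
      (hF.continuous.comp (by fun_prop : Continuous fun s : ℝ => (x, s))).aestronglyMeasurable
  · exact (hF.continuous.comp (by fun_prop : Continuous fun s : ℝ => (x₀, s))).intervalIntegrable _ _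
  · exact (hF'.comp (by fun_prop : Continuous fun s : ℝ => (x₀, s))).aestronglyMeasurable
  · refine Filter.Eventually.of_forall fun s hs x hx => hC (x, s) ⟨hx, ?_⟩
    rw [Set.uIoc_of_le zero_le_one] at hs
    exact ⟨hs.1.le, hs.2⟩
  · exact intervalIntegrable_const
  · refine Filter.Eventually.of_forall fun s hs x hx => ?_
    exact ((hF.differentiable (by simp) (x, s)).hasFDerivAt).comp x (hasFDerivAt_prodMk_left x s)

lemma contDiff_integral_of_contDiff {F : E × ℝ → G} (hF : ContDiff ℝ ∞ F) :
    ContDiff ℝ ∞ (fun x => ∫ s in (0 : ℝ)..1, F (x, s)) := by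
  rw [contDiff_infty]
  intro n
  -- The target is generalised because the derivative is an integral of the same kind with values in
  -- linear maps.
  induction n generalizing G with
  | zero =>
    rw [Nat.cast_zero, contDiff_zero]
    exact continuous_iff_continuousAt.2 fun x =>
      (hasFDerivAt_integral_of_contDiff hF x).continuousAt
  | succ n ih =>
    rw [Nat.cast_succ, contDiff_succ_iff_fderiv]
    refine ⟨fun x => (hasFDerivAt_integral_of_contDiff hF x).differentiableAt, by simp, ?_⟩
    have h : fderiv ℝ (fun x => ∫ s in (0 : ℝ)..1, F (x, s)) =
        fun x => ∫ s in (0 : ℝ)..1, (fderiv ℝ F (x, s)).comp (ContinuousLinearMap.inl ℝ E ℝ) :=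
      funext fun x => (hasFDerivAt_integral_of_contDiff hF x).fderiv
    rw [h]
    exact ih (F := fun q => (fderiv ℝ F q).comp (ContinuousLinearMap.inl ℝ E ℝ))
      ((hF.fderiv_right (m := ∞) (by simp)).clm_comp contDiff_const)

end ParametricIntegral

/-! ### Integration of functions along rays from a vertex. -/

section RadialIntegral

set_option linter.unusedSectionVars false

open intervalIntegral

variable {J J' : Type} [Fintype J] [DecidableEq J] [Fintype J'] [DecidableEq J']

/-- The point at time `s` on the segment from the `k`-th vertex to `x`. -/
def ray (k : J) (s : ℝ) (x : J → ℝ) : J → ℝ := Pi.single k 1 + s • (x - Pi.single k 1)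

lemma ray_mem (k : J) {s : ℝ} (hs : s ∈ Set.Icc (0 : ℝ) 1) {x : J → ℝ} (hx : x ∈ stdSimplex ℝ J) :
    ray k s x ∈ stdSimplex ℝ J :=
  (convex_stdSimplex ℝ J).add_smul_sub_mem (single_mem_stdSimplex ℝ k) hx hs

/-- The integral `∫₀¹ sʳ g(eₖ + s (x - eₖ)) ds`. -/
def radialInt (k : J) (r : ℕ) (g : (J → ℝ) → ℝ) (x : J → ℝ) : ℝ :=
  ∫ s in (0 : ℝ)..1, s ^ r * g (ray k s x)

lemma contDiff_radialIntegrand (k : J) (r : ℕ) {g : (J → ℝ) → ℝ} (hg : ContDiff ℝ ∞ g) :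
    ContDiff ℝ ∞ (fun q : (J → ℝ) × ℝ => q.2 ^ r * g (ray k q.2 q.1)) := by
  unfold ray
  fun_prop

lemma contDiff_radialInt (k : J) (r : ℕ) {g : (J → ℝ) → ℝ} (hg : ContDiff ℝ ∞ g) :
    ContDiff ℝ ∞ (radialInt k r g) :=
  contDiff_integral_of_contDiff (contDiff_radialIntegrand k r hg)

/-- Moving `x` by `v` moves the point at time `s` of the ray by `s v`. This is where the exponent
goes up by one. -/
lemma fderiv_radialInt (k : J) (r : ℕ) {g : (J → ℝ) → ℝ} (hg : ContDiff ℝ ∞ g) (x v : J → ℝ) :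
    fderiv ℝ (radialInt k r g) x v = radialInt k (r + 1) (fun y => fderiv ℝ g y v) x := by
  have hF := contDiff_radialIntegrand k r hg
  have hI : fderiv ℝ (radialInt k r g) x = _ := (hasFDerivAt_integral_of_contDiff hF x).fderiv
  rw [hI, ContinuousLinearMap.intervalIntegral_apply]
  · refine integral_congr fun s _ => ?_
    have h₁ : HasFDerivAt (fun y : J → ℝ => ray k s y) (s • ContinuousLinearMap.id ℝ (J → ℝ)) x :=
      (((hasFDerivAt_id x).sub_const _).const_smul s).const_add _
    have h₂ : HasFDerivAt (fun y : J → ℝ => s ^ r * g (ray k s y))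
        (s ^ r • (fderiv ℝ g (ray k s x)).comp (s • ContinuousLinearMap.id ℝ (J → ℝ))) x :=
      (((hg.differentiable (by simp) (ray k s x)).hasFDerivAt.comp x h₁)).const_mul _
    have h₀ : HasFDerivAt (fun y : J → ℝ => (y, s)) (ContinuousLinearMap.inl ℝ (J → ℝ) ℝ) x :=
      hasFDerivAt_prodMk_left x s
    have h₃ := (hF.differentiable (by simp) (x, s)).hasFDerivAt.comp x h₀
    change ((fderiv ℝ (fun q : (J → ℝ) × ℝ => q.2 ^ r * g (ray k q.2 q.1)) (x, s)).comp
      (ContinuousLinearMap.inl ℝ (J → ℝ) ℝ)) v = _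
    rw [h₃.unique h₂]
    simp [pow_succ, mul_assoc]
  · refine Continuous.intervalIntegrable ?_ _ _
    exact ((hF.continuous_fderiv (by simp)).comp (by fun_prop)).clm_comp continuous_const

/-- The ray from a vertex to a point of the simplex stays in the simplex, so the integral does not
see how a function is extended. -/
lemma radialInt_congr (k : J) (r : ℕ) {g g' : (J → ℝ) → ℝ} (h : ∀ x ∈ stdSimplex ℝ J, g x = g' x)
    {x : J → ℝ} (hx : x ∈ stdSimplex ℝ J) : radialInt k r g x = radialInt k r g' x := by
  refine integral_congr fun s hs => ?_
  rw [Set.uIcc_of_le zero_le_one] at hs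
  rw [h _ (ray_mem k hs hx)]

/-- The operator `a ↦ ∫₀¹ sʳ a(eₖ + s (x - eₖ)) ds` on smooth functions on the simplex. -/
def radial (k : J) (r : ℕ) : simplexFun J →ₗ[ℝ] simplexFun J where
  toFun a := ⟨fun x => radialInt k r (simplexExt a) x.1,
    radialInt k r (simplexExt a), contDiff_radialInt k r (contDiff_simplexExt a), fun _ => rfl⟩
  map_add' a b := by
    have h : ∀ c : simplexFun J, ∀ x, IntervalIntegrable
        (fun s => s ^ r * simplexExt c (ray k s x)) MeasureTheory.volume 0 1 := fun c x =>
      ((contDiff_radialIntegrand k r (contDiff_simplexExt c)).continuous.comp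
        (by fun_prop : Continuous fun s : ℝ => (x, s))).intervalIntegrable _ _
    ext x
    change radialInt k r (simplexExt (a + b)) x.1 =
      radialInt k r (simplexExt a) x.1 + radialInt k r (simplexExt b) x.1
    rw [radialInt_congr k r (g' := fun y => simplexExt a y + simplexExt b y) (fun y hy => by
      rw [← simplexExt_apply (a + b) ⟨y, hy⟩, ← simplexExt_apply a ⟨y, hy⟩,
        ← simplexExt_apply b ⟨y, hy⟩]; rfl) x.2]
    simp only [radialInt, mul_add]
    exact integral_add (h a x.1) (h b x.1)
  map_smul' c a := by
    ext x
    change radialInt k r (simplexExt (c • a)) x.1 = c * radialInt k r (simplexExt a) x.1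
    rw [radialInt_congr k r (g' := fun y => c * simplexExt a y) (fun y hy => by
      rw [← simplexExt_apply (c • a) ⟨y, hy⟩, ← simplexExt_apply a ⟨y, hy⟩]; rfl) x.2]
    simp only [radialInt, mul_left_comm _ c]
    exact integral_const_mul c _

lemma radial_apply (k : J) (r : ℕ) (a : simplexFun J) {g : (J → ℝ) → ℝ}
    (h : ∀ x : stdSimplex ℝ J, a.1 x = g x.1) (x : stdSimplex ℝ J) :
    (radial k r a).1 x = radialInt k r g x.1 :=
  radialInt_congr k r (fun y hy => (simplexExt_apply a ⟨y, hy⟩).symm.trans (h ⟨y, hy⟩)) x.2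

lemma simplexDeriv_sub_apply (i k : J) (a : simplexFun J) {g : (J → ℝ) → ℝ} (hg : ContDiff ℝ ∞ g)
    (h : ∀ x : stdSimplex ℝ J, a.1 x = g x.1) (x : stdSimplex ℝ J) :
    (simplexDeriv i a - simplexDeriv k a).1 x =
      fderiv ℝ g x.1 (Pi.single i 1 - Pi.single k 1) := by
  change (simplexDeriv i a).1 x - (simplexDeriv k a).1 x = _
  rw [simplexDeriv_eq i a hg h, simplexDeriv_eq k a hg h, ← map_sub, sub_sub_sub_cancel_right]

/-- The difference `Dᵢ - Dₖ` differentiates in the constant direction `eᵢ - eₖ`, so it passes under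
the integral at the price of one factor `s`. The single `Dᵢ` does not. -/
lemma simplexDeriv_sub_radial (i k : J) (r : ℕ) (a : simplexFun J) :
    simplexDeriv i (radial k r a) - simplexDeriv k (radial k r a) =
      radial k (r + 1) (simplexDeriv i a - simplexDeriv k a) := by
  ext x
  have ha := contDiff_simplexExt a
  rw [simplexDeriv_sub_apply i k _ (contDiff_radialInt k r ha)
    (fun y => radial_apply k r a (simplexExt_apply a) y) x, fderiv_radialInt k r ha]
  exact (radial_apply k (r + 1) _
    (fun y => simplexDeriv_sub_apply i k a ha (simplexExt_apply a) y) x).symm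

lemma hasDerivAt_comp_ray (k : J) {g : (J → ℝ) → ℝ} (hg : ContDiff ℝ ∞ g) (x : J → ℝ) (s : ℝ) :
    HasDerivAt (fun s => g (ray k s x)) (fderiv ℝ g (ray k s x) (x - Pi.single k 1)) s := by
  have h₁ : HasDerivAt (fun s : ℝ => ray k s x) (x - Pi.single k 1) s := by
    have := ((hasDerivAt_id s).smul_const (x - Pi.single k 1)).const_add (Pi.single k 1)
    rwa [one_smul] at this
  exact ((hg.differentiable (by simp) (ray k s x)).hasFDerivAt).comp_hasDerivAt s h₁

lemma continuous_fderiv_ray (k : J) {g : (J → ℝ) → ℝ} (hg : ContDiff ℝ ∞ g) (x v : J → ℝ) :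
    Continuous (fun s : ℝ => fderiv ℝ g (ray k s x) v) := by
  have : Continuous (fun s : ℝ => ray k s x) := by unfold ray; fun_prop
  exact ((hg.continuous_fderiv (by simp)).comp this).clm_apply continuous_const

/-- The operator `r + 1 + E`, where `E` is the radial vector field at the `k`-th vertex, inverts the
radial integral. -/
lemma smul_radial_sub_simplexDeriv (k : J) (r : ℕ) (a : simplexFun J) :
    ((r + 1 : ℕ) : ℝ) • radial k r a - simplexDeriv k (radial k r a) = a := by
  ext x
  have ha := contDiff_simplexExt a
  change ((r + 1 : ℕ) : ℝ) * radialInt k r (simplexExt a) x.1 -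
    (simplexDeriv k (radial k r a)).1 x = a.1 x
  rw [simplexDeriv_eq k _ (contDiff_radialInt k r ha)
    (fun y => radial_apply k r a (simplexExt_apply a) y) x, fderiv_radialInt k r ha,
    simplexExt_apply a x, ← neg_sub (x.1) (Pi.single k 1)]
  -- This integrates the derivative of `s^(r+1) a(eₖ + s(x - eₖ))` over `[0, 1]`. The lower end
  -- contributes zero, the upper end `a(x)`; the minus sign in the statement arises because `Dₖ`
  -- points from `x` to `eₖ`.
  have h := integral_eq_sub_of_hasDerivAt (a := (0 : ℝ)) (b := 1)
    (f := fun s => s ^ (r + 1) * simplexExt a (ray k s x.1))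
    (f' := fun s => ((r + 1 : ℕ) : ℝ) * (s ^ r * simplexExt a (ray k s x.1)) +
      s ^ (r + 1) * fderiv ℝ (simplexExt a) (ray k s x.1) (x.1 - Pi.single k 1))
    (fun s _ => by
      have := (hasDerivAt_pow (r + 1) s).mul (hasDerivAt_comp_ray k ha x.1 s)
      rw [mul_assoc] at this
      exact this)
    (by
      have h₁ := continuous_fderiv_ray k ha x.1 (x.1 - Pi.single k 1)
      have h₂ : Continuous fun s : ℝ => simplexExt a (ray k s x.1) :=
        ha.continuous.comp (by unfold ray; fun_prop)
      exact Continuous.intervalIntegrable (by fun_prop) _ _)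
  have h₁ : Continuous fun s : ℝ => s ^ r * simplexExt a (ray k s x.1) :=
    (contDiff_radialIntegrand k r ha).continuous.comp (by fun_prop : Continuous fun s : ℝ => (x.1, s))
  have h₂ : Continuous fun s : ℝ => s ^ (r + 1) *
      fderiv ℝ (simplexExt a) (ray k s x.1) (x.1 - Pi.single k 1) :=
    (continuous_pow (r + 1)).mul (continuous_fderiv_ray k ha x.1 _)
  rw [integral_add (h₁.const_mul _ |>.intervalIntegrable _ _)
    (h₂.intervalIntegrable _ _),
    integral_const_mul] at h
  have h1 : ray k 1 x.1 = x.1 := by simp [ray]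
  simp only [map_neg, radialInt, mul_neg, integral_neg, sub_neg_eq_add]
  rw [h]
  simp [h1]

/-- The `j`-th barycentric coordinate as a smooth function on the simplex. -/
def baryCoord (j : J) : simplexFun J :=
  ⟨fun x => x.1 j, fun x => x j, contDiff_apply ℝ ℝ j, fun _ => rfl⟩

lemma sum_baryCoord : ∑ j : J, baryCoord j = 1 := by
  ext x
  rw [AddSubmonoidClass.coe_finsetSum, Finset.sum_apply]
  exact x.2.2

lemma simplexDeriv_baryCoord (i j : J) :
    simplexDeriv i (baryCoord j) = algebraMap ℝ _ (if i = j then 1 else 0) - baryCoord j := by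
  ext x
  rw [simplexDeriv_eq i (baryCoord j) (g := fun x => x j) (contDiff_apply ℝ ℝ j) (fun _ => rfl) x]
  have : fderiv ℝ (fun x : J → ℝ => x j) x.1 = ContinuousLinearMap.proj j :=
    (ContinuousLinearMap.proj (R := ℝ) (φ := fun _ : J => ℝ) j).hasFDerivAt.fderiv
  rw [this]
  change (Pi.single i (1 : ℝ) : J → ℝ) j - x.1 j = (if i = j then 1 else 0) - x.1 j
  rw [Pi.single_apply]
  simp only [eq_comm]

/-- The vector `∑ xⱼ (eⱼ - x)` is zero. -/
lemma sum_baryCoord_mul_simplexDeriv (a : simplexFun J) :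
    ∑ j, baryCoord j * simplexDeriv j a = 0 := by
  ext x
  rw [AddSubmonoidClass.coe_finsetSum, Finset.sum_apply]
  change ∑ j, x.1 j * fderiv ℝ (simplexExt a) x.1 (Pi.single j 1 - x.1) = 0
  have h : ∑ j, x.1 j • (Pi.single j 1 - x.1 : J → ℝ) = 0 := by
    simp only [smul_sub, Finset.sum_sub_distrib, ← Finset.sum_smul, x.2.2, one_smul]
    rw [sub_eq_zero]
    ext i
    simp [Finset.sum_apply, Pi.single_apply]
  simp only [← smul_eq_mul, ← map_smul, ← map_sum, h, map_zero]

/-- The fundamental theorem of calculus along rays from the `k`-th vertex. -/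
lemma sum_baryCoord_mul_radial (k : J) (a : simplexFun J) :
    ∑ j, baryCoord j * radial k 0 (simplexDeriv j a - simplexDeriv k a) =
      a - simplexComp (fun _ : J => k) a := by
  have ha := contDiff_simplexExt a
  ext x
  rw [AddSubmonoidClass.coe_finsetSum, Finset.sum_apply]
  have hk : stdSimplex.map (fun _ : J => k) x = ⟨Pi.single k 1, single_mem_stdSimplex ℝ k⟩ := by
    ext i
    rw [stdSimplex.map_coe, FunOnFinite.linearMap_apply_apply]
    by_cases h : k = i
    · subst h; simp
    · have h' : i ≠ k := fun hh => h hh.symm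
      simp [h, h']
  change ∑ j, x.1 j * (radial k 0 (simplexDeriv j a - simplexDeriv k a)).1 x =
    a.1 x - a.1 (stdSimplex.map (fun _ : J => k) x)
  rw [hk, simplexExt_apply, simplexExt_apply]
  have h := integral_eq_sub_of_hasDerivAt (a := (0 : ℝ)) (b := 1)
    (fun s _ => hasDerivAt_comp_ray k ha x.1 s)
    ((continuous_fderiv_ray k ha x.1 _).intervalIntegrable _ _)
  have h1 : ray k 1 x.1 = x.1 := by simp [ray]
  have h0 : ray k 0 x.1 = Pi.single k 1 := by simp [ray]
  rw [h1, h0] at h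
  rw [← h]
  have hv : x.1 - Pi.single k 1 = ∑ j, x.1 j • (Pi.single j 1 - Pi.single k 1 : J → ℝ) := by
    simp only [smul_sub, Finset.sum_sub_distrib, ← Finset.sum_smul, x.2.2, one_smul]
    congr 1
    ext i
    simp [Finset.sum_apply, Pi.single_apply]
  simp only [hv, map_sum, map_smul, smul_eq_mul]
  rw [integral_finsetSum fun j _ =>
    ((continuous_fderiv_ray k ha x.1 _).const_mul (x.1 j)).intervalIntegrable _ _]
  refine Finset.sum_congr rfl fun j _ => ?_
  rw [integral_const_mul, radial_apply k 0 _
    (g := fun y => fderiv ℝ (simplexExt a) y (Pi.single j 1 - Pi.single k 1)) (fun y => simplexDeriv_sub_apply j k a ha (simplexExt_apply a) y) x]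
  simp [radialInt]

/-- Maps of simplices are affine, so they carry rays from `k'` to rays from `f k'` with the same
parameter. -/
lemma simplexComp_radial (f : J' → J) {k' : J'} {k : J} (hk : f k' = k) (r : ℕ)
    (a : simplexFun J) : simplexComp f (radial k r a) = radial k' r (simplexComp f a) := by
  subst hk
  ext x
  set L := FunOnFinite.linearMap ℝ ℝ f with hL
  rw [simplexComp_apply, radial_apply _ r a (simplexExt_apply a),
    radial_apply k' r (simplexComp f a) (g := fun y => simplexExt a (L y))
      (fun y => simplexExt_apply a (stdSimplex.map f y))]
  refine integral_congr fun s _ => ?_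
  have : L (ray k' s x.1) = ray (f k') s (L x.1) := by
    have h : L (Pi.single k' 1) = Pi.single (f k') 1 := FunOnFinite.linearMap_piSingle ℝ ℝ f k' 1
    simp [ray, h]
  beta_reduce
  rw [this]
  rfl

lemma simplexComp_baryCoord (f : J' → J) (j : J) :
    simplexComp f (baryCoord j) = ∑ i, if f i = j then baryCoord i else 0 := by
  ext x
  rw [AddSubmonoidClass.coe_finsetSum, Finset.sum_apply]
  change FunOnFinite.linearMap ℝ ℝ f x.1 j = _
  rw [FunOnFinite.linearMap_apply_apply, Finset.sum_filter]
  refine Finset.sum_congr rfl fun i _ => ?_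
  split_ifs <;> rfl

end RadialIntegral

/-! ### Contraction and degreewise operators on exterior algebras. -/

section Contraction

variable {W W' : Type*} [AddCommGroup W] [Module ℝ W] [AddCommGroup W'] [Module ℝ W']

/-- Contraction of an element of the exterior algebra with a linear form. -/
abbrev contract (ξ : Module.Dual ℝ W) : ExteriorAlgebra ℝ W →ₗ[ℝ] ExteriorAlgebra ℝ W :=
  CliffordAlgebra.contractLeft (Q := (0 : QuadraticForm ℝ W)) ξ

lemma contract_ι_mul (ξ : Module.Dual ℝ W) (v : W) (l : ExteriorAlgebra ℝ W) :
    contract ξ (ExteriorAlgebra.ι ℝ v * l) = ξ v • l - ExteriorAlgebra.ι ℝ v * contract ξ l :=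
  CliffordAlgebra.contractLeft_ι_mul ξ v l

lemma contract_mem_zero (ξ : Module.Dual ℝ W) {l : ExteriorAlgebra ℝ W} (hl : l ∈ ⋀[ℝ]^0 W) :
    contract ξ l = 0 := by
  rw [ExteriorAlgebra.exteriorPower, pow_zero] at hl
  obtain ⟨r, rfl⟩ := Submodule.mem_one.1 hl
  exact CliffordAlgebra.contractLeft_algebraMap _ ξ r

lemma ι_mul_mem_exteriorPower (v : W) {n : ℕ} {l : ExteriorAlgebra ℝ W} (hl : l ∈ ⋀[ℝ]^n W) :
    ExteriorAlgebra.ι ℝ v * l ∈ ⋀[ℝ]^(n + 1) W := by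
  rw [ExteriorAlgebra.exteriorPower, pow_succ']
  exact Submodule.mul_mem_mul ⟨v, rfl⟩ hl

/-- Induction on the exterior degree. -/
lemma exteriorPower_induction {P : ℕ → ExteriorAlgebra ℝ W → Prop}
    (h₀ : ∀ r : ℝ, P 0 (algebraMap ℝ _ r)) (hadd : ∀ n a b, P n a → P n b → P n (a + b))
    (hmul : ∀ n v, ∀ b ∈ ⋀[ℝ]^n W, P n b → P (n + 1) (ExteriorAlgebra.ι ℝ v * b)) {n : ℕ}
    {l : ExteriorAlgebra ℝ W} (hl : l ∈ ⋀[ℝ]^n W) : P n l := by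
  induction n generalizing l with
  | zero =>
    rw [ExteriorAlgebra.exteriorPower, pow_zero] at hl
    obtain ⟨r, rfl⟩ := Submodule.mem_one.1 hl
    exact h₀ r
  | succ n ih =>
    rw [ExteriorAlgebra.exteriorPower, pow_succ'] at hl
    induction hl using Submodule.mul_induction_on' with
    | mem_mul_mem a ha b hb =>
      obtain ⟨v, rfl⟩ := ha
      exact hmul n v b hb (ih hb)
    | add a _ b _ ha hb => exact hadd _ a b ha hb

lemma contract_mem_succ (ξ : Module.Dual ℝ W) {n : ℕ} {l : ExteriorAlgebra ℝ W}
    (hl : l ∈ ⋀[ℝ]^(n + 1) W) : contract ξ l ∈ ⋀[ℝ]^n W := by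
  -- The induction starts in degree zero, where there is nothing to prove; the quantified `m` makes
  -- that case vacuous.
  refine exteriorPower_induction
    (P := fun n l => ∀ m, n = m + 1 → contract ξ l ∈ ⋀[ℝ]^m W) ?_ ?_ ?_ hl n rfl
  · intro r m hm
    omega
  · intro n a b ha hb m hm
    rw [map_add]
    exact Submodule.add_mem _ (ha m hm) (hb m hm)
  · intro n v b hb ih m hm
    obtain rfl : n = m := by omega
    rw [contract_ι_mul]
    refine Submodule.sub_mem _ (Submodule.smul_mem _ _ hb) ?_
    cases n with
    | zero => rw [contract_mem_zero ξ hb, mul_zero]; exact Submodule.zero_mem _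
    | succ n => exact ι_mul_mem_exteriorPower v (ih n rfl)

lemma contract_map (f : W →ₗ[ℝ] W') (ξ : Module.Dual ℝ W') (l : ExteriorAlgebra ℝ W) :
    contract ξ (ExteriorAlgebra.map f l) = ExteriorAlgebra.map f (contract (ξ ∘ₗ f) l) := by
  induction l using CliffordAlgebra.left_induction with
  | algebraMap r =>
    have h₁ : contract (ξ ∘ₗ f) (algebraMap ℝ (ExteriorAlgebra ℝ W) r) = 0 :=
      CliffordAlgebra.contractLeft_algebraMap _ _ r
    have h₂ : contract ξ (algebraMap ℝ (ExteriorAlgebra ℝ W') r) = 0 :=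
      CliffordAlgebra.contractLeft_algebraMap _ _ r
    exact (congrArg (contract ξ) (AlgHom.commutes (ExteriorAlgebra.map f) r)).trans
      (h₂.trans ((congrArg (ExteriorAlgebra.map f) h₁).trans (map_zero _)).symm)
  | add a b ha hb => rw [map_add, map_add, map_add, map_add, ha, hb]
  | ι_mul l v hl =>
    change contract ξ (ExteriorAlgebra.map f (ExteriorAlgebra.ι ℝ v * l)) =
      ExteriorAlgebra.map f (contract (ξ ∘ₗ f) (ExteriorAlgebra.ι ℝ v * l))
    rw [map_mul, ExteriorAlgebra.map_apply_ι, contract_ι_mul, contract_ι_mul, map_sub, map_smul,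
      map_mul, ExteriorAlgebra.map_apply_ι, hl]
    rfl

lemma map_mem_exteriorPower (f : W →ₗ[ℝ] W') {n : ℕ} {l : ExteriorAlgebra ℝ W}
    (hl : l ∈ ⋀[ℝ]^n W) : ExteriorAlgebra.map f l ∈ ⋀[ℝ]^n W' := by
  refine exteriorPower_induction (P := fun n l => ExteriorAlgebra.map f l ∈ ⋀[ℝ]^n W') ?_ ?_ ?_ hl
  · intro r
    rw [AlgHom.commutes, ExteriorAlgebra.exteriorPower, pow_zero]
    exact Submodule.mem_one.2 ⟨r, rfl⟩
  · intro n a b ha hb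
    rw [map_add]
    exact Submodule.add_mem _ ha hb
  · intro n v b _ hb
    rw [map_mul, ExteriorAlgebra.map_apply_ι]
    exact ι_mul_mem_exteriorPower _ hb

/-- The operator on `Λ ⊗ A` that applies `T n` to the coefficients of forms of degree `n`. -/
def coeffOp {A : Type*} [AddCommGroup A] [Module ℝ A] (T : ℕ → A →ₗ[ℝ] A) :
    ExteriorAlgebra ℝ W ⊗[ℝ] A →ₗ[ℝ] ExteriorAlgebra ℝ W ⊗[ℝ] A :=
  TensorProduct.lift (DirectSum.toModule ℝ ℕ (A →ₗ[ℝ] ExteriorAlgebra ℝ W ⊗[ℝ] A)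
    (fun n => ((TensorProduct.mk ℝ (ExteriorAlgebra ℝ W) A).compl₂ (T n)) ∘ₗ
      (⋀[ℝ]^n W).subtype) ∘ₗ
    (DirectSum.decomposeLinearEquiv (fun n : ℕ => ⋀[ℝ]^n W)).toLinearMap)

lemma coeffOp_tmul {A : Type*} [AddCommGroup A] [Module ℝ A] (T : ℕ → A →ₗ[ℝ] A) {n : ℕ}
    {l : ExteriorAlgebra ℝ W} (hl : l ∈ ⋀[ℝ]^n W) (a : A) :
    coeffOp T (l ⊗ₜ[ℝ] a) = l ⊗ₜ[ℝ] T n a := by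
  have h : DirectSum.decomposeLinearEquiv (fun n : ℕ => ⋀[ℝ]^n W) l =
      DirectSum.lof ℝ ℕ (fun n : ℕ => ⋀[ℝ]^n W) n ⟨l, hl⟩ :=
    DirectSum.decomposeLinearEquiv_apply_coe (fun n : ℕ => ⋀[ℝ]^n W) n ⟨l, hl⟩
  simp only [coeffOp, TensorProduct.lift.tmul, LinearMap.comp_apply, LinearEquiv.coe_coe]
  erw [h, DirectSum.toModule_lof]
  rfl

/-- The tensor product of an exterior algebra with `A` is spanned by homogeneous elements. -/
lemma forms_induction {A : Type*} [AddCommGroup A] [Module ℝ A]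
    {P : ExteriorAlgebra ℝ W ⊗[ℝ] A → Prop} (hadd : ∀ x y, P x → P y → P (x + y))
    (h : ∀ n : ℕ, ∀ l ∈ ⋀[ℝ]^n W, ∀ a : A, P (l ⊗ₜ a)) (x : ExteriorAlgebra ℝ W ⊗[ℝ] A) :
    P x := by
  induction x using TensorProduct.induction_on with
  | zero => simpa using h 0 0 (Submodule.zero_mem _) 0
  | add x y hx hy => exact hadd _ _ hx hy
  | tmul l a =>
    induction l using DirectSum.Decomposition.inductionOn (fun n : ℕ => ⋀[ℝ]^n W) with
    | zero => simpa using h 0 0 (Submodule.zero_mem _) 0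
    | homogeneous l => exact h _ l l.2 a
    | add l m hl hm => rw [TensorProduct.add_tmul]; exact hadd _ _ hl hm

end Contraction

/-! ### The Poincaré lemma on the simplex, natural in maps of vertices. -/

section Poincare

set_option linter.unusedSectionVars false

variable {J J' : Type} [Fintype J] [DecidableEq J] [Fintype J'] [DecidableEq J']

/-- The linear form `v ↦ vⱼ - vₖ` on constant one-forms on the simplex. -/
def edgeForm (j k : J) : Module.Dual ℝ (Cotangent J) :=
  Submodule.liftQ _ (LinearMap.proj j - LinearMap.proj k : (J → ℝ) →ₗ[ℝ] ℝ) (by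
    rw [Submodule.span_le, Set.singleton_subset_iff]
    exact LinearMap.mem_ker.2 ((LinearMap.sub_apply _ _ _).trans (sub_self (1 : ℝ))))

lemma edgeForm_mk (j k : J) (v : J → ℝ) : edgeForm j k (Submodule.Quotient.mk v) = v j - v k := by
  rw [edgeForm]
  exact (Submodule.liftQ_apply _ _ _).trans (LinearMap.sub_apply _ _ _)

/-- Subtracting `vₖ` from all coefficients does not change the class, by `sum_dt`. So the edge forms
at `k` behave like coordinates dual to the `dtⱼ`. -/
lemma sum_edgeForm_smul_dt (k : J) (v : Cotangent J) : ∑ j, edgeForm j k v • dt j = v := by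
  induction v using Submodule.Quotient.induction_on with
  | H v =>
    simp only [edgeForm_mk, sub_smul, Finset.sum_sub_distrib, ← Finset.smul_sum, sum_dt, smul_zero,
      sub_zero]
    change ∑ j, v j • Submodule.mkQ (Submodule.span ℝ {(1 : J → ℝ)}) (Pi.single j 1) =
      Submodule.mkQ _ v
    simp only [← map_smul, ← map_sum]
    congr 1
    ext i
    simp [Finset.sum_apply, Pi.single_apply]

lemma edgeForm_comp_cotangentMap (f : J' → J) (j k : J') :
    edgeForm j k ∘ₗ cotangentMap f = edgeForm (f j) (f k) := by
  apply Submodule.linearMap_qext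
  refine LinearMap.ext fun v => ?_
  exact (edgeForm_mk j k _).trans (edgeForm_mk (f j) (f k) v).symm

lemma edgeForm_dt (j k i : J) :
    edgeForm j k (dt i) = (if j = i then 1 else 0) - (if k = i then 1 else 0) := by
  rw [dt, edgeForm_mk, Pi.single_apply, Pi.single_apply]

/-- This is the degree operator: contracting with each coordinate and multiplying it back counts the
factors. The induction anticommutes one factor past `dtⱼ`. -/
lemma sum_ι_dt_mul_contract (k : J) {n : ℕ} {l : ExteriorAlgebra ℝ (Cotangent J)}
    (hl : l ∈ ⋀[ℝ]^n (Cotangent J)) :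
    ∑ j, ExteriorAlgebra.ι ℝ (dt j) * contract (edgeForm j k) l = (n : ℝ) • l := by
  refine exteriorPower_induction (P := fun n l =>
    ∑ j, ExteriorAlgebra.ι ℝ (dt j) * contract (edgeForm j k) l = (n : ℝ) • l) ?_ ?_ ?_ hl
  · intro r
    refine (Finset.sum_eq_zero fun j _ => ?_).trans (by simp)
    have : contract (edgeForm j k) (algebraMap ℝ (ExteriorAlgebra ℝ (Cotangent J)) r) = 0 :=
      CliffordAlgebra.contractLeft_algebraMap _ _ r
    rw [this, mul_zero]
  · intro n a b ha hb
    simp only [map_add, mul_add, Finset.sum_add_distrib, ha, hb, smul_add]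
  · intro n v b _ hb
    simp only [contract_ι_mul, mul_sub, Finset.sum_sub_distrib, mul_smul_comm, ← mul_assoc]
    have h₁ : ∑ j, edgeForm j k v • (ExteriorAlgebra.ι ℝ (dt j) * b) =
        ExteriorAlgebra.ι ℝ v * b := by
      simp only [← smul_mul_assoc, ← map_smul, ← Finset.sum_mul, ← map_sum, sum_edgeForm_smul_dt]
    have h₂ : ∑ j, ExteriorAlgebra.ι ℝ (dt j) * ExteriorAlgebra.ι ℝ v * contract (edgeForm j k) b =
        -((n : ℝ) • (ExteriorAlgebra.ι ℝ v * b)) := by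
      rw [← mul_smul_comm, ← hb, Finset.mul_sum, ← Finset.sum_neg_distrib]
      refine Finset.sum_congr rfl fun j _ => ?_
      rw [ι_anticomm, neg_mul, mul_assoc]
    rw [h₁, h₂, sub_neg_eq_add, Nat.cast_succ, add_smul, one_smul, add_comm]

/-- Contraction of forms on the simplex with the radial vector field at the `k`-th vertex. -/
def radialContract (k : J) : Forms (Cotangent J) (simplexFun J) →ₗ[ℝ]
    Forms (Cotangent J) (simplexFun J) :=
  ∑ j, TensorProduct.map (contract (edgeForm j k)) (LinearMap.mulLeft ℝ (baryCoord j))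

lemma radialContract_tmul (k : J) (l : ExteriorAlgebra ℝ (Cotangent J)) (a : simplexFun J) :
    radialContract k (l ⊗ₜ[ℝ] a) = ∑ j, contract (edgeForm j k) l ⊗ₜ[ℝ] (baryCoord j * a) := by
  simp [radialContract]

lemma sum_ι_dt_mul_tmul (l : ExteriorAlgebra ℝ (Cotangent J)) (a : simplexFun J) :
    ∑ j, (ExteriorAlgebra.ι ℝ (dt j) * l) ⊗ₜ[ℝ] a = 0 := by
  rw [← TensorProduct.sum_tmul, ← Finset.sum_mul, ← map_sum, sum_dt, map_zero, zero_mul,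
    TensorProduct.zero_tmul]

variable (J) in
/-- The exterior derivative on the simplex. -/
def formsD : Forms (Cotangent J) (simplexFun J) →ₗ[ℝ] Forms (Cotangent J) (simplexFun J) :=
  extD dt simplexDeriv

lemma formsD_tmul (l : ExteriorAlgebra ℝ (Cotangent J)) (a : simplexFun J) :
    formsD J (l ⊗ₜ[ℝ] a) = ∑ j, (ExteriorAlgebra.ι ℝ (dt j) * l) ⊗ₜ[ℝ] simplexDeriv j a :=
  extD_tmul _ _ l a

/-- Cartan's formula for the radial vector field. -/
lemma cartan_radial (k : J) {n : ℕ} {l : ExteriorAlgebra ℝ (Cotangent J)}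
    (hl : l ∈ ⋀[ℝ]^n (Cotangent J)) (a : simplexFun J) :
    formsD J (radialContract k (l ⊗ₜ[ℝ] a)) +
      radialContract k (formsD J (l ⊗ₜ[ℝ] a)) =
        l ⊗ₜ[ℝ] ((n : ℝ) • a - simplexDeriv k a) := by
  rw [radialContract_tmul, formsD_tmul, map_sum, map_sum]
  simp only [formsD_tmul, radialContract_tmul, contract_ι_mul, TensorProduct.sub_tmul,
    Derivation.leibniz, smul_eq_mul, TensorProduct.tmul_add, Finset.sum_add_distrib,
    Finset.sum_sub_distrib, edgeForm_dt, sub_smul, TensorProduct.smul_tmul]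
  -- After the mixed terms cancel, three sums remain. Differentiating the coordinates of the radial
  -- field counts the degree, `∑ tⱼ Dⱼ a` vanishes, and `∑ tⱼ = 1` leaves `Dₖ a`.
  have h₁ : ∑ j, ∑ i, (ExteriorAlgebra.ι ℝ (dt i) * contract (edgeForm j k) l) ⊗ₜ[ℝ]
      (a * simplexDeriv i (baryCoord j)) = l ⊗ₜ[ℝ] ((n : ℝ) • a) := by
    rw [TensorProduct.tmul_smul, TensorProduct.smul_tmul', ← sum_ι_dt_mul_contract k hl,
      TensorProduct.sum_tmul]
    refine Finset.sum_congr rfl fun j _ => ?_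
    simp only [simplexDeriv_baryCoord, mul_sub, TensorProduct.tmul_sub, Finset.sum_sub_distrib,
      sum_ι_dt_mul_tmul, sub_zero]
    rw [Finset.sum_eq_single j]
    · simp
    · intro i _ hi
      simp [hi]
    · simp
  have h₂ : ∑ i, ∑ j, l ⊗ₜ[ℝ] ((if j = i then (1 : ℝ) else 0) • (baryCoord j * simplexDeriv i a)) =
      0 := by
    simp only [ite_smul, one_smul, zero_smul]
    simp only [← TensorProduct.tmul_sum, Finset.sum_ite_eq', Finset.mem_univ, if_true,
      sum_baryCoord_mul_simplexDeriv, TensorProduct.tmul_zero]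
  have h₃ : ∑ i, ∑ j, l ⊗ₜ[ℝ] ((if k = i then (1 : ℝ) else 0) • (baryCoord j * simplexDeriv i a)) =
      l ⊗ₜ[ℝ] simplexDeriv k a := by
    simp only [← TensorProduct.tmul_sum, ← Finset.smul_sum, ← Finset.sum_mul, sum_baryCoord, one_mul]
    simp only [ite_smul, one_smul, zero_smul, Finset.sum_ite_eq, Finset.mem_univ, if_true]
  rw [h₁, h₂, h₃, Finset.sum_comm, TensorProduct.tmul_sub]
  abel

/-- The radial integral on the coefficients of forms of positive degree. -/
def radialOp (k : J) : Forms (Cotangent J) (simplexFun J) →ₗ[ℝ]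
    Forms (Cotangent J) (simplexFun J) :=
  coeffOp (fun n => Nat.casesOn n 0 (radial k))

lemma radialOp_zero (k : J) {l : ExteriorAlgebra ℝ (Cotangent J)} (hl : l ∈ ⋀[ℝ]^0 (Cotangent J))
    (a : simplexFun J) : radialOp k (l ⊗ₜ[ℝ] a) = 0 :=
  (coeffOp_tmul _ hl a).trans (TensorProduct.tmul_zero _ _)

/-- Forms of degree `n + 1` get the exponent `n`: the pullback along the dilation by `s` contributes
`s^(n+1)`, and the homotopy is integrated against `ds / s`. -/
lemma radialOp_succ (k : J) {n : ℕ} {l : ExteriorAlgebra ℝ (Cotangent J)}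
    (hl : l ∈ ⋀[ℝ]^(n + 1) (Cotangent J)) (a : simplexFun J) :
    radialOp k (l ⊗ₜ[ℝ] a) = l ⊗ₜ[ℝ] radial k n a :=
  coeffOp_tmul _ hl a

/-- Radial integration commutes with the exterior derivative, the exponent growing with the degree.
By `sum_dt` each `Dⱼ` may be replaced with `Dⱼ - Dₖ`, for which `simplexDeriv_sub_radial` applies.
-/
lemma extD_radial (k : J) (n : ℕ) (l : ExteriorAlgebra ℝ (Cotangent J)) (a : simplexFun J) :
    ∑ j, (ExteriorAlgebra.ι ℝ (dt j) * l) ⊗ₜ[ℝ] radial k (n + 1) (simplexDeriv j a) =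
      formsD J (l ⊗ₜ[ℝ] radial k n a) := by
  rw [formsD_tmul, ← sub_eq_zero, ← Finset.sum_sub_distrib]
  rw [← sum_ι_dt_mul_tmul l (radial k (n + 1) (simplexDeriv k a) - simplexDeriv k (radial k n a))]
  refine Finset.sum_congr rfl fun j _ => ?_
  rw [← TensorProduct.tmul_sub]
  congr 1
  have h := simplexDeriv_sub_radial j k n a
  rw [map_sub] at h
  rw [sub_eq_sub_iff_sub_eq_sub, h]

/-- Pullback of forms on simplices as a map of tensor products. -/
def formsMap (f : J' → J) : Forms (Cotangent J) (simplexFun J) →ₗ[ℝ]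
    Forms (Cotangent J') (simplexFun J') :=
  TensorProduct.map (ExteriorAlgebra.map (cotangentMap f)).toLinearMap (simplexComp f).toLinearMap

lemma formsMap_tmul (f : J' → J) (l : ExteriorAlgebra ℝ (Cotangent J)) (a : simplexFun J) :
    formsMap f (l ⊗ₜ[ℝ] a) = ExteriorAlgebra.map (cotangentMap f) l ⊗ₜ[ℝ] simplexComp f a := rfl

/-- Both sides are algebra maps with the same values on generators. The form as a tensor product of
maps is the convenient one for operators that act on the coefficients. -/
lemma simplexPullback_eq_formsMap (f : J' → J) (x : SimplexForms J) :
    simplexPullback f x = formsMap f x := by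
  have h : simplexPullback f = Algebra.TensorProduct.map (ExteriorAlgebra.map (cotangentMap f))
      (simplexComp f) := by
    refine Algebra.TensorProduct.ext (ExteriorAlgebra.hom_ext ?_) ?_
    · refine LinearMap.ext fun v => ?_
      refine (formsPullback_ι _ _ v).trans ?_
      refine Eq.trans ?_ (Algebra.TensorProduct.map_tmul (ExteriorAlgebra.map (cotangentMap f))
        (simplexComp f) (ExteriorAlgebra.ι ℝ v) 1).symm
      rw [ExteriorAlgebra.map_apply_ι, map_one (simplexComp f)]
      rfl
    · ext1 a
      refine (formsPullback_tmul _ _ 1 a).trans ?_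
      refine (congrArg (· * _) (map_one (formsPullback (simplexComp f) _))).trans ?_
      refine (one_mul _).trans ?_
      refine Eq.trans ?_ (Algebra.TensorProduct.map_tmul (ExteriorAlgebra.map (cotangentMap f))
        (simplexComp f) 1 a).symm
      rw [map_one (ExteriorAlgebra.map (cotangentMap f))]
  rw [h]
  rfl

/-- An affine map sends the radial field at `k'` to the one at `f k'`, so contraction commutes with
pullback. -/
lemma radialContract_formsMap (f : J' → J) (k' : J') (x : Forms (Cotangent J) (simplexFun J)) :
    radialContract k' (formsMap f x) = formsMap f (radialContract (f k') x) := by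
  induction x using TensorProduct.induction_on with
  | zero => simp only [map_zero]
  | add x y hx hy => simp only [map_add, hx, hy]
  | tmul l a =>
    rw [formsMap_tmul, radialContract_tmul, radialContract_tmul, map_sum]
    simp only [formsMap_tmul, contract_map, edgeForm_comp_cotangentMap, map_mul,
      simplexComp_baryCoord, Finset.sum_mul, TensorProduct.tmul_sum]
    rw [Finset.sum_comm]
    refine Finset.sum_congr rfl fun i _ => ?_
    rw [Finset.sum_eq_single (f i)]
    · rw [if_pos rfl]
    · intro j _ hj
      rw [if_neg hj.symm, zero_mul, TensorProduct.tmul_zero]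
    · simp

lemma radialOp_formsMap (f : J' → J) (k' : J') (x : Forms (Cotangent J) (simplexFun J)) :
    radialOp k' (formsMap f x) = formsMap f (radialOp (f k') x) := by
  induction x using forms_induction with
  | hadd x y hx hy => simp only [map_add, hx, hy]
  | h n l hl a =>
    rw [formsMap_tmul]
    cases n with
    | zero => rw [radialOp_zero _ hl, radialOp_zero _ (map_mem_exteriorPower _ hl), map_zero]
    | succ n =>
      rw [radialOp_succ _ hl, radialOp_succ _ (map_mem_exteriorPower _ hl), formsMap_tmul,
        simplexComp_radial f rfl]

lemma cotangentMap_const (k : J) : cotangentMap (fun _ : J => k) = 0 := by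
  apply Submodule.linearMap_qext
  refine LinearMap.ext fun v => ?_
  refine (Submodule.Quotient.mk_eq_zero _).2 ?_
  have : (LinearMap.funLeft ℝ ℝ fun _ : J => k) v = v k • (1 : J → ℝ) := by
    ext j
    simp [LinearMap.funLeft]
  rw [this]
  exact Submodule.smul_mem _ _ (Submodule.subset_span rfl)

/-- Radial integration commutes with `d`, so Cartan's formula turns the left side into an operator
on coefficients. In positive degree that operator undoes the radial integral, and the pullback to a
vertex is zero. In degree zero the claim is the fundamental theorem of calculus along rays. -/
lemma extD_radialContract_radialOp (k : J) (x : Forms (Cotangent J) (simplexFun J)) :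
    formsD J (radialContract k (radialOp k x)) +
      radialContract k (radialOp k (formsD J x)) =
        x - formsMap (fun _ : J => k) x := by
  induction x using forms_induction with
  | hadd x y hx hy =>
    simp only [map_add]
    rw [add_add_add_comm, hx, hy]
    abel
  | h n l hl a =>
    cases n with
    | zero =>
      rw [radialOp_zero k hl, map_zero, map_zero, zero_add, formsD_tmul, map_sum, map_sum,
        formsMap_tmul]
      simp only [radialOp_succ k (ι_mul_mem_exteriorPower _ hl), radialContract_tmul,
        contract_ι_mul, contract_mem_zero _ hl, mul_zero, sub_zero, edgeForm_dt]
      -- A form of degree zero has a scalar as its exterior part, so only the function matters.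
      rw [ExteriorAlgebra.exteriorPower, pow_zero] at hl
      obtain ⟨c, rfl⟩ := Submodule.mem_one.1 hl
      rw [AlgHom.commutes, ← TensorProduct.tmul_sub, ← sum_baryCoord_mul_radial k a,
        TensorProduct.tmul_sum]
      simp only [sub_smul, TensorProduct.sub_tmul, Finset.sum_sub_distrib, map_sub, mul_sub,
        TensorProduct.tmul_sub, ite_smul, one_smul, zero_smul, TensorProduct.ite_tmul]
      simp only [Finset.sum_ite_eq', Finset.mem_univ, if_true]
      congr 1
      rw [Finset.sum_comm]
      refine Finset.sum_congr rfl fun i _ => ?_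
      rw [Finset.sum_ite_eq, if_pos (Finset.mem_univ k)]
    | succ n =>
      rw [radialOp_succ k hl, formsD_tmul l a, map_sum (radialOp k)]
      simp only [radialOp_succ k (ι_mul_mem_exteriorPower _ hl)]
      rw [extD_radial, cartan_radial k hl, smul_radial_sub_simplexDeriv,
        formsMap_tmul]
      -- A constant map kills one-forms, hence every product with a factor of degree one.
      have h : ExteriorAlgebra.map (cotangentMap fun _ : J => k) l = 0 := by
        rw [cotangentMap_const]
        rw [ExteriorAlgebra.exteriorPower, pow_succ'] at hl
        induction hl using Submodule.mul_induction_on' with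
        | mem_mul_mem a ha b hb =>
          obtain ⟨v, rfl⟩ := ha
          rw [map_mul, ExteriorAlgebra.map_apply_ι, LinearMap.zero_apply, map_zero, zero_mul]
        | add a _ b _ ha hb => rw [map_add, ha, hb, add_zero]
      rw [h, TensorProduct.zero_tmul, sub_zero]

lemma radialContract_radialOp_mem (k : J) {r : ℤ} {x : Forms (Cotangent J) (simplexFun J)}
    (hx : x ∈ formsGrading (Cotangent J) (simplexFun J) r) :
    radialContract k (radialOp k x) ∈ formsGrading (Cotangent J) (simplexFun J) (r - 1) := by
  refine formsGrading_induction (P := fun x => radialContract k (radialOp k x) ∈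
    formsGrading (Cotangent J) (simplexFun J) (r - 1)) hx
    (by simp only [map_zero]; exact Submodule.zero_mem _)
    (fun x y hx hy => by simp only [map_add]; exact Submodule.add_mem _ hx hy) fun l hl a => ?_
  · cases r with
    | negSucc n =>
      rw [(Submodule.mem_bot ℝ).1 hl, TensorProduct.zero_tmul, map_zero, map_zero]
      exact Submodule.zero_mem _
    | ofNat n =>
      cases n with
      | zero => rw [radialOp_zero k hl, map_zero]; exact Submodule.zero_mem _
      | succ n =>
        rw [radialOp_succ k hl, radialContract_tmul]
        refine Submodule.sum_mem _ fun j _ => ?_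
        have h : ((Int.ofNat (n + 1)) - 1 : ℤ) = Int.ofNat n := by simp
        rw [h]
        exact tmul_mem_formsGrading (contract_mem_succ _ hl) _

/-- The homotopy operator of the Poincaré lemma for the contraction to the `k`-th vertex. -/
def poincare (k : J) : SimplexForms J →ₗ[ℝ] SimplexForms J :=
  (radialContract k ∘ₗ radialOp k : Forms (Cotangent J) (simplexFun J) →ₗ[ℝ]
    Forms (Cotangent J) (simplexFun J))

lemma poincare_mem (k : J) {r : ℤ} {x : SimplexForms J} (hx : x ∈ simplexGrading J r) :
    poincare k x ∈ simplexGrading J (r - 1) :=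
  radialContract_radialOp_mem k hx

lemma poincare_pullback (f : J' → J) (k' : J') (x : SimplexForms J) :
    poincare k' (simplexPullback f x) = simplexPullback f (poincare (f k') x) := by
  rw [simplexPullback_eq_formsMap, simplexPullback_eq_formsMap]
  exact (congrArg (radialContract k') (radialOp_formsMap f k' x)).trans
    (radialContract_formsMap f k' _)

/-- The Poincaré lemma: forms on the simplex are contracted to the `k`-th vertex. -/
lemma simplexD_poincare (k : J) (x : SimplexForms J) :
    simplexD J (poincare k x) + poincare k (simplexD J x) =
      x - simplexPullback (fun _ : J => k) x := by
  rw [simplexPullback_eq_formsMap]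
  exact extD_radialContract_radialOp k x

end Poincare

/-! ### Calculus of Koszul signs. -/

section Signs

lemma neg_one_zpow_congr {a b : ℤ} (h : Even a ↔ Even b) : (-1 : ℝ) ^ a = (-1) ^ b := by
  rcases Int.even_or_odd a with ha | ha
  · rw [ha.neg_one_zpow, (h.1 ha).neg_one_zpow]
  · have hb : Odd b := Int.not_even_iff_odd.1 fun hb => Int.not_even_iff_odd.2 ha (h.2 hb)
    rw [ha.neg_one_zpow, hb.neg_one_zpow]

lemma neg_one_zpow_mul (a b : ℤ) : (-1 : ℝ) ^ a * (-1) ^ b = (-1) ^ (a + b) :=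
  (zpow_add₀ (by norm_num) a b).symm

lemma neg_one_zpow_succ (a : ℤ) : (-1 : ℝ) ^ (a + 1) = -(-1) ^ a := by
  rw [zpow_add_one₀ (by norm_num), mul_neg_one]

lemma neg_one_zpow_sq (a : ℤ) : (-1 : ℝ) ^ a * (-1) ^ a = 1 := by
  rw [neg_one_zpow_mul]
  exact (Even.add_self a).neg_one_zpow

/-- Only the eigenvalues of the two involutions at the given elements matter, so this covers
operators such as `id ⊗ ε` that are not the involution of the total grading. -/
lemma koszul_tmul_of_eq {U V : Type*} [AddCommGroup U] [Module ℝ U] [AddCommGroup V] [Module ℝ V]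
    {ε : U →ₗ[ℝ] U} {ε' : V →ₗ[ℝ] V} {p q : ℤ} {x : U} {y : V} (hx : ε x = (-1 : ℝ) ^ p • x)
    (hy : ε' y = (-1 : ℝ) ^ q • y) :
    koszul ε ε' (x ⊗ₜ[ℝ] y) = ((-1 : ℝ) ^ (p * q)) • (x ⊗ₜ[ℝ] y) := by
  simp only [koszul, LinearMap.smul_apply, LinearMap.sub_apply, LinearMap.add_apply,
    LinearMap.id_apply, TensorProduct.map_tmul, hx, hy,
    TensorProduct.smul_tmul', TensorProduct.tmul_smul]
  rcases Int.even_or_odd p with hp | hp <;> rcases Int.even_or_odd q with hq | hq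
  · simp [hp.neg_one_zpow, hq.neg_one_zpow, (hp.mul_right q).neg_one_zpow]; module
  · simp [hp.neg_one_zpow, hq.neg_one_zpow, (hp.mul_right q).neg_one_zpow]; module
  · simp [hp.neg_one_zpow, hq.neg_one_zpow, (hq.mul_left p).neg_one_zpow]; module
  · simp [hp.neg_one_zpow, hq.neg_one_zpow, (hp.mul hq).neg_one_zpow]; module

end Signs

/-! ### The total grading of a tensor product. -/

section GradedTensor

variable {V V' W W' : Type*} [AddCommGroup V] [Module ℝ V] [AddCommGroup V'] [Module ℝ V']
  [AddCommGroup W] [Module ℝ W] [AddCommGroup W'] [Module ℝ W']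

/-- The total grading of a tensor product. -/
def gradedTensor (P : ℤ → Submodule ℝ V) (Q : ℤ → Submodule ℝ V') (n : ℤ) :
    Submodule ℝ (V ⊗[ℝ] V') :=
  Submodule.span ℝ {z | ∃ p q : ℤ, p + q = n ∧ ∃ x ∈ P p, ∃ y ∈ Q q, z = x ⊗ₜ[ℝ] y}

variable {P : ℤ → Submodule ℝ V} {Q : ℤ → Submodule ℝ V'} {P' : ℤ → Submodule ℝ W}
  {Q' : ℤ → Submodule ℝ W'}

lemma tmul_mem_gradedTensor {p q n : ℤ} (h : p + q = n) {x : V} (hx : x ∈ P p) {y : V'}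
    (hy : y ∈ Q q) : x ⊗ₜ[ℝ] y ∈ gradedTensor P Q n :=
  Submodule.subset_span ⟨p, q, h, x, hx, y, hy, rfl⟩

lemma gradedTensor_induction {n : ℤ} {M : V ⊗[ℝ] V' → Prop}
    (h : ∀ p q : ℤ, p + q = n → ∀ x ∈ P p, ∀ y ∈ Q q, M (x ⊗ₜ y))
    (hadd : ∀ x y, M x → M y → M (x + y)) {z : V ⊗[ℝ] V'} (hz : z ∈ gradedTensor P Q n) : M z := by
  have h₀ : M 0 := by
    simpa using h n 0 (add_zero n) 0 (Submodule.zero_mem _) 0 (Submodule.zero_mem _)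
  refine Submodule.closure_induction (p := fun z _ => M z) h₀ (fun x y _ _ hx hy => hadd x y hx hy)
    ?_ hz
  rintro r _ ⟨p, q, hpq, x, hx, y, hy, rfl⟩
  rw [TensorProduct.smul_tmul']
  exact h p q hpq _ (Submodule.smul_mem _ r hx) y hy

/-- Homogeneous maps act on the total grading. -/
lemma map_mem_gradedTensor {f : V →ₗ[ℝ] W} {f' : V' →ₗ[ℝ] W'} {a b n m : ℤ}
    (hf : ∀ p, ∀ x ∈ P p, f x ∈ P' (p + a)) (hf' : ∀ q, ∀ y ∈ Q q, f' y ∈ Q' (q + b))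
    (hm : n + a + b = m) {z : V ⊗[ℝ] V'} (hz : z ∈ gradedTensor P Q n) :
    TensorProduct.map f f' z ∈ gradedTensor P' Q' m := by
  refine gradedTensor_induction (M := fun z => TensorProduct.map f f' z ∈ gradedTensor P' Q' m)
    (fun p q hpq x hx y hy => ?_) (fun x y hx hy => ?_) hz
  · exact tmul_mem_gradedTensor (by omega) (hf p x hx) (hf' q y hy)
  · rw [map_add]
    exact Submodule.add_mem _ hx hy

lemma gradedTensor_mono {P₁ : ℤ → Submodule ℝ V} {Q₁ : ℤ → Submodule ℝ V'} (hP : ∀ p, P p ≤ P₁ p)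
    (hQ : ∀ q, Q q ≤ Q₁ q) (n : ℤ) : gradedTensor P Q n ≤ gradedTensor P₁ Q₁ n := by
  refine Submodule.span_mono ?_
  rintro _ ⟨p, q, h, x, hx, y, hy, rfl⟩
  exact ⟨p, q, h, x, hP p hx, y, hQ q hy, rfl⟩

end GradedTensor

/-! ### Complexes, commutative dg algebras, dg Lie algebras and their tensor products. -/

/-- A complex of real vector spaces, with its grading involution. -/
structure DGModule (V : Type*) [AddCommGroup V] [Module ℝ V] where
  gr : ℤ → Submodule ℝ V
  iSup_gr : ⨆ n, gr n = ⊤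
  sgn : V →ₗ[ℝ] V
  sgn_of_mem : ∀ {n x}, x ∈ gr n → sgn x = (-1 : ℝ) ^ n • x
  d : V →ₗ[ℝ] V
  d_mem : ∀ {n x}, x ∈ gr n → d x ∈ gr (n + 1)
  d_d : ∀ x, d (d x) = 0

/-- A graded commutative dg algebra, not necessarily unital. -/
structure DGComm (C : Type*) [AddCommGroup C] [Module ℝ C] extends DGModule C where
  mul : C →ₗ[ℝ] C →ₗ[ℝ] C
  mul_mem : ∀ {p q x y}, x ∈ gr p → y ∈ gr q → mul x y ∈ gr (p + q)
  leibniz : ∀ {p x}, x ∈ gr p → ∀ y, d (mul x y) = mul (d x) y + (-1 : ℝ) ^ p • mul x (d y)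
  comm : ∀ {p q x y}, x ∈ gr p → y ∈ gr q → mul x y = (-1 : ℝ) ^ (p * q) • mul y x
  assoc : ∀ x y z, mul (mul x y) z = mul x (mul y z)

/-- A differential graded Lie algebra. -/
structure DGLie (L : Type*) [AddCommGroup L] [Module ℝ L] extends DGModule L where
  br : L →ₗ[ℝ] L →ₗ[ℝ] L
  br_mem : ∀ {p q x y}, x ∈ gr p → y ∈ gr q → br x y ∈ gr (p + q)
  leibniz : ∀ {p x}, x ∈ gr p → ∀ y, d (br x y) = br (d x) y + (-1 : ℝ) ^ p • br x (d y)
  antisymm : ∀ {p q x y}, x ∈ gr p → y ∈ gr q → br x y = -(-1 : ℝ) ^ (p * q) • br y x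
  jacobi : ∀ {p q x y}, x ∈ gr p → y ∈ gr q → ∀ z,
    br x (br y z) = br (br x y) z + (-1 : ℝ) ^ (p * q) • br y (br x z)

namespace DGModule

variable {V V' : Type*} [AddCommGroup V] [Module ℝ V] [AddCommGroup V'] [Module ℝ V']
  (S : DGModule V) (S' : DGModule V')

/-- The homogeneous parts of a `DGModule` are only required to span; identities between linear
operators need no more than this. -/
lemma induction {M : V → Prop} (h : ∀ n, ∀ x ∈ S.gr n, M x) (hadd : ∀ x y, M x → M y → M (x + y))
    (x : V) : M x := by
  have hx : x ∈ ⨆ n, S.gr n := by rw [S.iSup_gr]; exact Submodule.mem_top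
  exact Submodule.iSup_induction S.gr (motive := M) hx h (h 0 0 (Submodule.zero_mem _)) hadd

lemma sgn_mem {n : ℤ} {x : V} (hx : x ∈ S.gr n) : S.sgn x ∈ S.gr n := by
  rw [S.sgn_of_mem hx]
  exact Submodule.smul_mem _ _ hx

lemma sgn_sgn (x : V) : S.sgn (S.sgn x) = x := by
  induction x using S.induction with
  | h n x hx => rw [S.sgn_of_mem hx, map_smul, S.sgn_of_mem hx, smul_smul, neg_one_zpow_sq, one_smul]
  | hadd x y hx hy => rw [map_add, map_add, hx, hy]

lemma sgn_d (x : V) : S.sgn (S.d x) = -S.d (S.sgn x) := by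
  induction x using S.induction with
  | h n x hx =>
    rw [S.sgn_of_mem hx, S.sgn_of_mem (S.d_mem hx), map_smul, neg_one_zpow_succ, neg_smul]
  | hadd x y hx hy => rw [map_add, map_add, hx, hy, map_add, map_add, neg_add]

lemma tensor_induction {M : V ⊗[ℝ] V' → Prop}
    (h : ∀ p q, ∀ x ∈ S.gr p, ∀ y ∈ S'.gr q, M (x ⊗ₜ y))
    (hadd : ∀ x y, M x → M y → M (x + y)) (z : V ⊗[ℝ] V') : M z := by
  induction z using TensorProduct.induction_on with
  | zero => simpa using h 0 0 0 (Submodule.zero_mem _) 0 (Submodule.zero_mem _)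
  | add x y hx hy => exact hadd x y hx hy
  | tmul x y =>
    induction x using S.induction with
    | hadd x x' hx hx' => rw [TensorProduct.add_tmul]; exact hadd _ _ hx hx'
    | h p x hx =>
      induction y using S'.induction with
      | hadd y y' hy hy' => rw [TensorProduct.tmul_add]; exact hadd _ _ hy hy'
      | h q y hy => exact h p q x hx y hy

/-- The tensor product of complexes. -/
def tensor : DGModule (V ⊗[ℝ] V') where
  gr := gradedTensor S.gr S'.gr
  iSup_gr := by
    refine eq_top_iff.2 fun z _ => ?_
    induction z using S.tensor_induction S' with
    | h p q x hx y hy => exact Submodule.mem_iSup_of_mem (p + q) (tmul_mem_gradedTensor rfl hx hy)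
    | hadd x y hx hy => exact Submodule.add_mem _ (hx trivial) (hy trivial)
  sgn := TensorProduct.map S.sgn S'.sgn
  sgn_of_mem {n z} hz := by
    refine gradedTensor_induction (M := fun z => TensorProduct.map S.sgn S'.sgn z =
      (-1 : ℝ) ^ n • z) (fun p q hpq x hx y hy => ?_) (fun x y hx hy => ?_) hz
    · rw [TensorProduct.map_tmul, S.sgn_of_mem hx, S'.sgn_of_mem hy, TensorProduct.smul_tmul_smul,
        neg_one_zpow_mul, hpq]
    · rw [map_add, hx, hy, smul_add]
  d := TensorProduct.map S.d LinearMap.id + TensorProduct.map S.sgn S'.d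
  d_mem {n z} hz := by
    rw [LinearMap.add_apply]
    refine Submodule.add_mem _ ?_ ?_
    · exact map_mem_gradedTensor (a := 1) (b := 0) (fun p x hx => S.d_mem hx)
        (fun q y hy => by simpa using hy) (by omega) hz
    · exact map_mem_gradedTensor (a := 0) (b := 1)
        (fun p x hx => by simpa using S.sgn_mem hx) (fun q y hy => S'.d_mem hy) (by omega) hz
  d_d z := by
    induction z using TensorProduct.induction_on with
    | zero => rw [map_zero, map_zero]
    | add x y hx hy => rw [map_add, map_add, hx, hy, add_zero]
    | tmul x y =>
      simp only [LinearMap.add_apply, TensorProduct.map_tmul, map_add, S.d_d, S'.d_d,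
        TensorProduct.zero_tmul, TensorProduct.tmul_zero, LinearMap.id_apply, S.sgn_d,
        zero_add, add_zero]
      rw [← TensorProduct.add_tmul, neg_add_cancel, TensorProduct.zero_tmul]

lemma tensor_d_tmul (x : V) (y : V') :
    (S.tensor S').d (x ⊗ₜ y) = S.d x ⊗ₜ y + S.sgn x ⊗ₜ S'.d y := rfl

end DGModule

section KoszulBilin

variable {V V' : Type*} [AddCommGroup V] [Module ℝ V] [AddCommGroup V'] [Module ℝ V']

/-- The tensor product `(x ⊗ x', y ⊗ y') ↦ (-1)^(deg x' deg y) b(x, y) ⊗ b'(x', y')` of bilinear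
operations. -/
def koszulBilin (S : DGModule V) (S' : DGModule V') (b : V →ₗ[ℝ] V →ₗ[ℝ] V)
    (b' : V' →ₗ[ℝ] V' →ₗ[ℝ] V') : V ⊗[ℝ] V' →ₗ[ℝ] V ⊗[ℝ] V' →ₗ[ℝ] V ⊗[ℝ] V' :=
  TensorProduct.curry (TensorProduct.map (TensorProduct.lift b) (TensorProduct.lift b') ∘ₗ
    (TensorProduct.tensorTensorTensorComm ℝ _ _ _ _).toLinearMap ∘ₗ
      koszul (TensorProduct.map LinearMap.id S'.sgn) (TensorProduct.map S.sgn LinearMap.id))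

variable {S : DGModule V} {S' : DGModule V'} {b : V →ₗ[ℝ] V →ₗ[ℝ] V} {b' : V' →ₗ[ℝ] V' →ₗ[ℝ] V'}

lemma koszulBilin_tmul {q p' : ℤ} (x : V) {x' : V'} (hx' : x' ∈ S'.gr q) {y : V}
    (hy : y ∈ S.gr p') (y' : V') : koszulBilin S S' b b' (x ⊗ₜ x') (y ⊗ₜ y') =
      (-1 : ℝ) ^ (q * p') • (b x y ⊗ₜ[ℝ] b' x' y') := by
  have h := koszul_tmul_of_eq (ε := TensorProduct.map LinearMap.id S'.sgn)
    (ε' := TensorProduct.map S.sgn LinearMap.id) (x := x ⊗ₜ x') (y := y ⊗ₜ y') (p := q) (q := p')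
    (by rw [TensorProduct.map_tmul, S'.sgn_of_mem hx', TensorProduct.tmul_smul, LinearMap.id_apply])
    (by rw [TensorProduct.map_tmul, S.sgn_of_mem hy, TensorProduct.smul_tmul', LinearMap.id_apply])
  rw [koszulBilin, TensorProduct.curry_apply, LinearMap.comp_apply, LinearMap.comp_apply, h,
    map_smul, map_smul]
  rfl

/-- Separate gradings for the two factors and the value make this apply to filtration steps, where
one factor ranges over an ideal. Homogeneity is needed only for the two inner factors, whose degrees
enter the sign. -/
lemma koszulBilin_mem {P₁ P₂ P₃ : ℤ → Submodule ℝ V} {Q₁ Q₂ Q₃ : ℤ → Submodule ℝ V'}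
    (hP₂ : ∀ p, P₂ p ≤ S.gr p) (hQ₁ : ∀ q, Q₁ q ≤ S'.gr q)
    (hb : ∀ p q, ∀ x ∈ P₁ p, ∀ y ∈ P₂ q, b x y ∈ P₃ (p + q))
    (hb' : ∀ p q, ∀ x ∈ Q₁ p, ∀ y ∈ Q₂ q, b' x y ∈ Q₃ (p + q)) {m n : ℤ} {z w : V ⊗[ℝ] V'}
    (hz : z ∈ gradedTensor P₁ Q₁ m) (hw : w ∈ gradedTensor P₂ Q₂ n) :
    koszulBilin S S' b b' z w ∈ gradedTensor P₃ Q₃ (m + n) := by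
  refine gradedTensor_induction (M := fun z => koszulBilin S S' b b' z w ∈
    gradedTensor P₃ Q₃ (m + n)) (fun p q hpq x hx x' hx' => ?_) (fun x y hx hy => ?_) hz
  · refine gradedTensor_induction (M := fun w => koszulBilin S S' b b' (x ⊗ₜ x') w ∈
      gradedTensor P₃ Q₃ (m + n)) (fun p' q' hpq' y hy y' hy' => ?_) (fun x y hx hy => ?_) hw
    · rw [koszulBilin_tmul x (hQ₁ _ hx') (hP₂ _ hy)]
      exact Submodule.smul_mem _ _ (tmul_mem_gradedTensor (by omega) (hb _ _ _ hx _ hy)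
        (hb' _ _ _ hx' _ hy'))
    · rw [map_add]
      exact Submodule.add_mem _ hx hy
  · rw [map_add, LinearMap.add_apply]
    exact Submodule.add_mem _ hx hy

lemma koszulBilin_leibniz
    (hmem : ∀ {p q x y}, x ∈ S.gr p → y ∈ S.gr q → b x y ∈ S.gr (p + q))
    (hb : ∀ {p x}, x ∈ S.gr p → ∀ y, S.d (b x y) = b (S.d x) y + (-1 : ℝ) ^ p • b x (S.d y))
    (hb' : ∀ {p x}, x ∈ S'.gr p → ∀ y,
      S'.d (b' x y) = b' (S'.d x) y + (-1 : ℝ) ^ p • b' x (S'.d y))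
    {n : ℤ} {z : V ⊗[ℝ] V'} (hz : z ∈ gradedTensor S.gr S'.gr n) (w : V ⊗[ℝ] V') :
    (S.tensor S').d (koszulBilin S S' b b' z w) =
      koszulBilin S S' b b' ((S.tensor S').d z) w +
        (-1 : ℝ) ^ n • koszulBilin S S' b b' z ((S.tensor S').d w) := by
  refine gradedTensor_induction (M := fun z => (S.tensor S').d (koszulBilin S S' b b' z w) =
      koszulBilin S S' b b' ((S.tensor S').d z) w +
        (-1 : ℝ) ^ n • koszulBilin S S' b b' z ((S.tensor S').d w))
    (fun p q hpq x hx x' hx' => ?_) (fun x y hx hy => ?_) hz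
  · induction w using S.tensor_induction S' with
    | hadd u v hu hv => simp only [map_add, hu, hv, smul_add]; abel
    | h p' q' y hy y' hy' =>
      simp only [koszulBilin_tmul x hx' hy, DGModule.tensor_d_tmul, map_smul, map_add,
        LinearMap.add_apply, koszulBilin_tmul _ hx' hy, koszulBilin_tmul _ (S'.d_mem hx') hy,
        koszulBilin_tmul _ hx' (S.d_mem hy),
        hb hx, hb' hx', S.sgn_of_mem hx, S.sgn_of_mem hy, S.sgn_of_mem (hmem hx hy),
        TensorProduct.add_tmul, TensorProduct.tmul_add, ← TensorProduct.smul_tmul',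
        TensorProduct.tmul_smul, LinearMap.smul_apply, smul_add, smul_smul, ← hpq]
      simp only [add_mul, mul_add, one_mul, mul_one, ← neg_one_zpow_mul]
      -- All signs are now monomials in powers of `-1`, and this is the only relation between them
      -- that is needed.
      have h₁ := neg_one_zpow_sq q
      match_scalars
      all_goals first
        | ring1
        | linear_combination (-((-1 : ℝ) ^ (q * p') * (-1) ^ p)) * h₁
  · simp only [map_add, LinearMap.add_apply, hx, hy, smul_add]
    abel

/-- The constant is `1` for commutative products and `-1` for Lie brackets. -/
lemma koszulBilin_comm {c : ℝ}
    (hb : ∀ {p q x y}, x ∈ S.gr p → y ∈ S.gr q → b x y = (c * (-1 : ℝ) ^ (p * q)) • b y x)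
    (hb' : ∀ {p q x y}, x ∈ S'.gr p → y ∈ S'.gr q → b' x y = (-1 : ℝ) ^ (p * q) • b' y x)
    {m n : ℤ} {z w : V ⊗[ℝ] V'} (hz : z ∈ gradedTensor S.gr S'.gr m)
    (hw : w ∈ gradedTensor S.gr S'.gr n) :
    koszulBilin S S' b b' z w = (c * (-1 : ℝ) ^ (m * n)) • koszulBilin S S' b b' w z := by
  refine gradedTensor_induction (M := fun z => koszulBilin S S' b b' z w =
    (c * (-1 : ℝ) ^ (m * n)) • koszulBilin S S' b b' w z)
    (fun p q hpq x hx x' hx' => ?_) (fun x y hx hy => ?_) hz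
  · refine gradedTensor_induction (M := fun w => koszulBilin S S' b b' (x ⊗ₜ x') w =
      (c * (-1 : ℝ) ^ (m * n)) • koszulBilin S S' b b' w (x ⊗ₜ x'))
      (fun p' q' hpq' y hy y' hy' => ?_) (fun x y hx hy => ?_) hw
    · rw [koszulBilin_tmul x hx' hy, koszulBilin_tmul y hy' hx, hb hx hy, hb' hx' hy',
        TensorProduct.smul_tmul_smul, smul_smul, smul_smul]
      congr 1
      have h : (-1 : ℝ) ^ (q * p') * ((-1) ^ (p * p') * (-1) ^ (q * q')) =
          (-1) ^ (m * n) * (-1) ^ (q' * p) := by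
        rw [neg_one_zpow_mul, neg_one_zpow_mul, neg_one_zpow_mul]
        refine neg_one_zpow_congr ?_
        rw [← hpq, ← hpq']
        simp only [Int.even_add, Int.even_mul]
        tauto
      linear_combination c * h
    · simp only [map_add, LinearMap.add_apply, hx, hy, smul_add]
  · simp only [map_add, LinearMap.add_apply, hx, hy, smul_add]

lemma koszulBilin_assoc (hmem : ∀ {p q x y}, x ∈ S.gr p → y ∈ S.gr q → b x y ∈ S.gr (p + q))
    (hmem' : ∀ {p q x y}, x ∈ S'.gr p → y ∈ S'.gr q → b' x y ∈ S'.gr (p + q))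
    (hb : ∀ x y z, b (b x y) z = b x (b y z)) (hb' : ∀ x y z, b' (b' x y) z = b' x (b' y z))
    (u v w : V ⊗[ℝ] V') : koszulBilin S S' b b' (koszulBilin S S' b b' u v) w =
      koszulBilin S S' b b' u (koszulBilin S S' b b' v w) := by
  induction u using S.tensor_induction S' with
  | hadd u u' hu hu' => simp only [map_add, LinearMap.add_apply, hu, hu']
  | h p q x hx x' hx' =>
    induction v using S.tensor_induction S' with
    | hadd u u' hu hu' => simp only [map_add, LinearMap.add_apply, hu, hu']
    | h p' q' y hy y' hy' =>
      induction w using S.tensor_induction S' with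
      | hadd u u' hu hu' => simp only [map_add, hu, hu']
      | h p'' q'' z hz z' hz' =>
        rw [koszulBilin_tmul x hx' hy, koszulBilin_tmul y hy' hz, map_smul, map_smul,
          LinearMap.smul_apply, koszulBilin_tmul _ (hmem' hx' hy') hz,
          koszulBilin_tmul _ hx' (hmem hy hz), hb, hb', smul_smul, smul_smul]
        congr 1
        rw [neg_one_zpow_mul, neg_one_zpow_mul]
        congr 1
        ring

lemma koszulBilin_jacobi (hmem : ∀ {p q x y}, x ∈ S.gr p → y ∈ S.gr q → b x y ∈ S.gr (p + q))
    (hmem' : ∀ {p q x y}, x ∈ S'.gr p → y ∈ S'.gr q → b' x y ∈ S'.gr (p + q))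
    (hb : ∀ {p q x y}, x ∈ S.gr p → y ∈ S.gr q → ∀ z,
      b x (b y z) = b (b x y) z + (-1 : ℝ) ^ (p * q) • b y (b x z))
    (hc : ∀ {p q x y}, x ∈ S'.gr p → y ∈ S'.gr q → b' x y = (-1 : ℝ) ^ (p * q) • b' y x)
    (ha : ∀ x y z, b' (b' x y) z = b' x (b' y z))
    {m n : ℤ} {u v : V ⊗[ℝ] V'} (hu : u ∈ gradedTensor S.gr S'.gr m)
    (hv : v ∈ gradedTensor S.gr S'.gr n) (w : V ⊗[ℝ] V') :
    koszulBilin S S' b b' u (koszulBilin S S' b b' v w) =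
      koszulBilin S S' b b' (koszulBilin S S' b b' u v) w +
        (-1 : ℝ) ^ (m * n) • koszulBilin S S' b b' v (koszulBilin S S' b b' u w) := by
  refine gradedTensor_induction (M := fun u => koszulBilin S S' b b' u
      (koszulBilin S S' b b' v w) = koszulBilin S S' b b' (koszulBilin S S' b b' u v) w +
        (-1 : ℝ) ^ (m * n) • koszulBilin S S' b b' v (koszulBilin S S' b b' u w))
    (fun p q hpq x hx x' hx' => ?_) (fun x y hx hy => ?_) hu
  · refine gradedTensor_induction (M := fun v => koszulBilin S S' b b' (x ⊗ₜ x')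
        (koszulBilin S S' b b' v w) = koszulBilin S S' b b' (koszulBilin S S' b b' (x ⊗ₜ x') v) w +
          (-1 : ℝ) ^ (m * n) • koszulBilin S S' b b' v (koszulBilin S S' b b' (x ⊗ₜ x') w))
      (fun p' q' hpq' y hy y' hy' => ?_) (fun x y hx hy => ?_) hv
    · induction w using S.tensor_induction S' with
      | hadd u u' hu hu' => simp only [map_add, hu, hu', smul_add]; abel
      | h p'' q'' z hz z' hz' =>
        -- The coefficients are brought into one common order; then the Jacobi identity of the first
        -- factor applies.
        have h₀ : b' y' (b' x' z') = (-1 : ℝ) ^ (q * q') • b' x' (b' y' z') := by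
          rw [← ha, ← ha, hc hx' hy', map_smul, LinearMap.smul_apply, smul_smul, neg_one_zpow_sq,
            one_smul]
        rw [koszulBilin_tmul x hx' hy, koszulBilin_tmul y hy' hz, koszulBilin_tmul x hx' hz,
          map_smul, map_smul, map_smul, LinearMap.smul_apply, koszulBilin_tmul _ (hmem' hx' hy') hz,
          koszulBilin_tmul _ hx' (hmem hy hz), koszulBilin_tmul _ hy' (hmem hx hz), ha, h₀,
          hb hx hy, TensorProduct.add_tmul, TensorProduct.tmul_smul, ← TensorProduct.smul_tmul',
          smul_add, smul_add]
        simp only [smul_smul, neg_one_zpow_mul]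
        congr 2
        · congr 1
          ring
        · subst hpq hpq'
          refine neg_one_zpow_congr (Int.even_sub.1 ⟨-(p * q' + q * q'), ?_⟩)
          ring
    · simp only [map_add, LinearMap.add_apply, hx, hy, smul_add]
      abel
  · simp only [map_add, LinearMap.add_apply, hx, hy, smul_add]
    abel

end KoszulBilin

section Tensor

variable {V V' : Type*} [AddCommGroup V] [Module ℝ V] [AddCommGroup V'] [Module ℝ V']

/-- The tensor product of graded commutative dg algebras. -/
def DGComm.tensor (S : DGComm V) (S' : DGComm V') : DGComm (V ⊗[ℝ] V') where
  toDGModule := S.toDGModule.tensor S'.toDGModule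
  mul := koszulBilin S.toDGModule S'.toDGModule S.mul S'.mul
  mul_mem hx hy := koszulBilin_mem (fun _ => le_rfl) (fun _ => le_rfl)
    (fun _ _ _ hx _ hy => S.mul_mem hx hy) (fun _ _ _ hx _ hy => S'.mul_mem hx hy) hx hy
  leibniz hx y := koszulBilin_leibniz S.mul_mem S.leibniz S'.leibniz hx y
  comm hx hy := (koszulBilin_comm (c := 1) (fun hx hy => by rw [one_mul]; exact S.comm hx hy)
    S'.comm hx hy).trans (by rw [one_mul])
  assoc := koszulBilin_assoc S.mul_mem S'.mul_mem S.assoc S'.assoc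

/-- The tensor product of a dg Lie algebra with a graded commutative dg algebra. -/
def DGLie.tensor (S : DGLie V) (S' : DGComm V') : DGLie (V ⊗[ℝ] V') where
  toDGModule := S.toDGModule.tensor S'.toDGModule
  br := koszulBilin S.toDGModule S'.toDGModule S.br S'.mul
  br_mem hx hy := koszulBilin_mem (fun _ => le_rfl) (fun _ => le_rfl)
    (fun _ _ _ hx _ hy => S.br_mem hx hy) (fun _ _ _ hx _ hy => S'.mul_mem hx hy) hx hy
  leibniz hx y := koszulBilin_leibniz S.br_mem S.leibniz S'.leibniz hx y
  antisymm hx hy := (koszulBilin_comm (c := -1)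
    (fun hx hy => by rw [neg_one_mul]; exact S.antisymm hx hy)
    S'.comm hx hy).trans (by rw [neg_one_mul])
  jacobi hx hy := koszulBilin_jacobi S.br_mem S'.mul_mem S.jacobi S'.comm S'.assoc hx hy

end Tensor

/-! ### Curvature, the Bianchi identity and successive correction. -/

section MaurerCartanEquation

namespace DGLie

variable {L : Type*} [AddCommGroup L] [Module ℝ L] (G : DGLie L)

/-- The curvature `dx + ½ [x, x]`. -/
def curv (x : L) : L := G.d x + (1 / 2 : ℝ) • G.br x x

lemma br_comm {x y : L} (hx : x ∈ G.gr 1) (hy : y ∈ G.gr 1) : G.br x y = G.br y x := by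
  rw [G.antisymm hx hy]
  simp

lemma curv_mem {x : L} (hx : x ∈ G.gr 1) : G.curv x ∈ G.gr 2 :=
  Submodule.add_mem _ (G.d_mem hx) (Submodule.smul_mem _ _ (G.br_mem hx hx))

lemma curv_sub {x y : L} (hx : x ∈ G.gr 1) (hy : y ∈ G.gr 1) :
    G.curv (x - y) = G.curv x - G.d y - G.br x y + (1 / 2 : ℝ) • G.br y y := by
  simp only [curv, map_sub, LinearMap.sub_apply, G.br_comm hy hx]
  module

/-- The Bianchi identity. -/
lemma bianchi {x : L} (hx : x ∈ G.gr 1) : G.d (G.curv x) = -G.br x (G.curv x) := by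
  have h₁ : G.br (G.d x) x = -G.br x (G.d x) := by
    rw [G.antisymm (G.d_mem hx) hx]
    norm_num
  -- For `x` of degree one the Jacobi identity says that three times this bracket vanishes.
  have h₂ : G.br x (G.br x x) = 0 := by
    have h := G.jacobi hx hx x
    have h₃ : G.br (G.br x x) x = -G.br x (G.br x x) := by
      rw [G.antisymm (G.br_mem hx hx) hx]
      norm_num
    rw [h₃] at h
    norm_num at h
    have h₄ : (3 : ℝ) • G.br x (G.br x x) = 0 := by
      have : (3 : ℝ) • G.br x (G.br x x) = G.br x (G.br x x) -
        (-G.br x (G.br x x) + -G.br x (G.br x x)) := by module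
      rw [this, ← h, sub_self]
    exact (smul_eq_zero.1 h₄).resolve_left (by norm_num)
  simp only [curv, map_add, map_smul, G.d_d, zero_add, G.leibniz hx, h₁, h₂, smul_zero, add_zero]
  norm_num
  module

/-- An approximate solution of the Maurer–Cartan equation can be corrected to a solution, if the
obstructions vanish successively along a filtration. -/
lemma exists_curv_sub_eq_zero {N : ℕ} (K : ℕ → ℤ → Submodule ℝ L) (hgr : ∀ s, K s 1 ≤ G.gr 1)
    (hanti : ∀ s, K (s + 1) 1 ≤ K s 1)
    (hbr : ∀ s, s < N → ∀ x ∈ G.gr 1, ∀ n, 1 ≤ n → ∀ y ∈ K s n, G.br x y ∈ K (s + 1) (n + 1))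
    (hac : ∀ s, s < N → ∀ x ∈ K s 2, G.d x ∈ K (s + 1) 3 → ∃ y ∈ K s 1, x - G.d y ∈ K (s + 1) 2)
    (hN : K N 2 = ⊥) {x : L} (hx : x ∈ G.gr 1) (hx0 : G.curv x ∈ K 0 2) :
    ∃ y ∈ K 0 1, G.curv (x - y) = 0 := by
  have hanti' : ∀ s, K s 1 ≤ K 0 1 := fun s => by
    induction s with
    | zero => exact le_rfl
    | succ s ih => exact (hanti s).trans ih
  -- The invariant is that after `s` corrections the curvature lies in the `s`-th step.
  have key : ∀ s, s ≤ N → ∃ y ∈ K 0 1, G.curv (x - y) ∈ K s 2 := by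
    intro s
    induction s with
    | zero => exact fun _ => ⟨0, Submodule.zero_mem _, by rwa [sub_zero]⟩
    | succ s ih =>
      intro hs
      obtain ⟨y, hy, h⟩ := ih (by omega)
      have hxy : x - y ∈ G.gr 1 := Submodule.sub_mem _ hx (hgr 0 hy)
      -- By the Bianchi identity the differential of the curvature is a bracket with it, and so lies
      -- one step deeper. Hence the curvature is exact up to the next step.
      obtain ⟨w, hw, hw'⟩ := hac s (by omega) _ h (by
        rw [G.bianchi hxy]
        exact Submodule.neg_mem _ (hbr s (by omega) _ hxy 2 (by norm_num) _ h))
      refine ⟨y + w, Submodule.add_mem _ hy (hanti' s hw), ?_⟩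
      -- The linear part of the change cancels the curvature modulo the next step; the brackets with
      -- `w` lie in the next step already.
      rw [← sub_sub, G.curv_sub hxy (hgr s hw)]
      exact Submodule.add_mem _ (Submodule.sub_mem _ hw'
        (hbr s (by omega) _ hxy 1 le_rfl _ hw))
        (Submodule.smul_mem _ _ (hbr s (by omega) _ (hgr s hw) 1 le_rfl _ hw))
  obtain ⟨y, hy, h⟩ := key N le_rfl
  refine ⟨y, hy, ?_⟩
  rwa [hN, Submodule.mem_bot] at h

end DGLie

end MaurerCartanEquation

/-! ### Maps of complexes and of algebras, and their tensor products. -/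

section Maps

variable {V V' W W' : Type*} [AddCommGroup V] [Module ℝ V] [AddCommGroup V'] [Module ℝ V']
  [AddCommGroup W] [Module ℝ W] [AddCommGroup W'] [Module ℝ W']

/-- Chain maps. -/
structure DGModule.IsHom (S : DGModule V) (T : DGModule W) (f : V →ₗ[ℝ] W) : Prop where
  map_gr : ∀ {n x}, x ∈ S.gr n → f x ∈ T.gr n
  map_d : ∀ x, f (S.d x) = T.d (f x)

/-- Maps of graded commutative dg algebras. -/
structure DGComm.IsHom (S : DGComm V) (T : DGComm W) (f : V →ₗ[ℝ] W) : Prop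
    extends DGModule.IsHom S.toDGModule T.toDGModule f where
  map_mul : ∀ x y, f (S.mul x y) = T.mul (f x) (f y)

lemma DGModule.map_sgn (S : DGModule V) (T : DGModule W) {f : V →ₗ[ℝ] W}
    (hf : ∀ {n x}, x ∈ S.gr n → f x ∈ T.gr n) (x : V) : f (S.sgn x) = T.sgn (f x) := by
  induction x using S.induction with
  | h n x hx => rw [S.sgn_of_mem hx, T.sgn_of_mem (hf hx), map_smul]
  | hadd x y hx hy => rw [map_add, map_add, map_add, map_add, hx, hy]

lemma DGModule.isHom_id (S : DGModule V) : S.IsHom S LinearMap.id where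
  map_gr h := h
  map_d _ := rfl

lemma DGModule.IsHom.tensor {S : DGModule V} {S' : DGModule V'} {T : DGModule W} {T' : DGModule W'}
    {f : V →ₗ[ℝ] W} {f' : V' →ₗ[ℝ] W'} (hf : S.IsHom T f) (hf' : S'.IsHom T' f') :
    (S.tensor S').IsHom (T.tensor T') (TensorProduct.map f f') where
  map_gr hx := map_mem_gradedTensor (a := 0) (b := 0)
    (fun p x hx => by simpa using hf.map_gr hx) (fun p x hx => by simpa using hf'.map_gr hx)
    (by omega) hx
  map_d z := by
    induction z using TensorProduct.induction_on with
    | zero => simp only [map_zero]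
    | add x y hx hy => simp only [map_add, hx, hy]
    | tmul x y =>
      simp only [DGModule.tensor_d_tmul, map_add, TensorProduct.map_tmul, hf.map_d, hf'.map_d,
        S.map_sgn T hf.map_gr]

lemma koszulBilin_map {S : DGModule V} {S' : DGModule V'} {T : DGModule W} {T' : DGModule W'}
    {b : V →ₗ[ℝ] V →ₗ[ℝ] V} {b' : V' →ₗ[ℝ] V' →ₗ[ℝ] V'} {c : W →ₗ[ℝ] W →ₗ[ℝ] W}
    {c' : W' →ₗ[ℝ] W' →ₗ[ℝ] W'} {f : V →ₗ[ℝ] W} {f' : V' →ₗ[ℝ] W'} (hf : S.IsHom T f)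
    (hf' : S'.IsHom T' f') (h : ∀ x y, f (b x y) = c (f x) (f y))
    (h' : ∀ x y, f' (b' x y) = c' (f' x) (f' y)) (z w : V ⊗[ℝ] V') :
    TensorProduct.map f f' (koszulBilin S S' b b' z w) =
      koszulBilin T T' c c' (TensorProduct.map f f' z) (TensorProduct.map f f' w) := by
  induction z using S.tensor_induction S' with
  | hadd u u' hu hu' => simp only [map_add, LinearMap.add_apply, hu, hu']
  | h p q x hx x' hx' =>
    induction w using S.tensor_induction S' with
    | hadd u u' hu hu' => simp only [map_add, hu, hu']
    | h p' q' y hy y' hy' =>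
      rw [koszulBilin_tmul x hx' hy, TensorProduct.map_tmul, TensorProduct.map_tmul,
        koszulBilin_tmul _ (hf'.map_gr hx') (hf.map_gr hy), map_smul, TensorProduct.map_tmul, h, h']

lemma DGComm.IsHom.tensor {S : DGComm V} {S' : DGComm V'} {T : DGComm W} {T' : DGComm W'}
    {f : V →ₗ[ℝ] W} {f' : V' →ₗ[ℝ] W'} (hf : S.IsHom T f) (hf' : S'.IsHom T' f') :
    (S.tensor S').IsHom (T.tensor T') (TensorProduct.map f f') where
  toIsHom := hf.toIsHom.tensor hf'.toIsHom
  map_mul := koszulBilin_map hf.toIsHom hf'.toIsHom hf.map_mul hf'.map_mul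

end Maps

/-! ### The dg algebra of the simplex and its functoriality. -/

section SimplexAlgebra

variable {J J' : Type} [Fintype J] [DecidableEq J] [Fintype J'] [DecidableEq J']

lemma iSup_of_decomposition {V : Type*} [AddCommGroup V] [Module ℝ V] (𝒱 : ℤ → Submodule ℝ V)
    [DirectSum.Decomposition 𝒱] : ⨆ n, 𝒱 n = ⊤ :=
  (DirectSum.Decomposition.isInternal 𝒱).submodule_iSup_eq_top

variable (J) in
/-- The dg algebra of forms on a simplex. -/
def simplexAlg : DGComm (SimplexForms J) where
  gr := simplexGrading J
  iSup_gr := iSup_of_decomposition _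
  sgn := parity (simplexGrading J)
  sgn_of_mem hx := parity_of_mem _ hx
  d := simplexD J
  d_mem hx := simplexD_mem hx
  d_d := simplexD_simplexD
  mul := LinearMap.mul ℝ (SimplexForms J)
  mul_mem hx hy := mul_mem_simplexGrading hx hy
  leibniz hx y := simplexD_leibniz hx y
  comm hx hy := simplexForms_mul_comm hx hy
  assoc := mul_assoc

lemma simplexPullback_isHom (θ : J' → J) :
    (simplexAlg J).IsHom (simplexAlg J') (simplexPullback θ).toLinearMap where
  map_gr hx := simplexPullback_mem θ hx
  map_d x := (simplexD_pullback θ x).symm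
  map_mul := map_mul (simplexPullback θ)

end SimplexAlgebra

/-! ### The dg Lie algebra of forms on a simplex with coefficients, and the lifting lemma. -/

section SimplexTensor

set_option linter.unusedSectionVars false

variable {L C C' C'' : Type*} [AddCommGroup L] [Module ℝ L] [AddCommGroup C] [Module ℝ C]
  [AddCommGroup C'] [Module ℝ C'] [AddCommGroup C''] [Module ℝ C'']

/-- The dg Lie algebra `g ⊗ C ⊗ Ω*(Δ)`. -/
abbrev DGLie.onSimplex (G : DGLie L) (S : DGComm C) (J : Type) [Fintype J] [DecidableEq J] :
    DGLie (L ⊗[ℝ] (C ⊗[ℝ] SimplexForms J)) :=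
  G.tensor (S.tensor (simplexAlg J))

variable {J J' J'' : Type} [Fintype J] [DecidableEq J] [Fintype J'] [DecidableEq J'] [Fintype J'']
  [DecidableEq J'']

variable (L) in
/-- The map `g ⊗ C ⊗ Ω*(Δ) → g ⊗ C' ⊗ Ω*(Δ')` induced by a linear map and a map of simplices. -/
def coeffMap (f : C →ₗ[ℝ] C') (θ : J' → J) :
    L ⊗[ℝ] (C ⊗[ℝ] SimplexForms J) →ₗ[ℝ] L ⊗[ℝ] (C' ⊗[ℝ] SimplexForms J') :=
  TensorProduct.map LinearMap.id (TensorProduct.map f (simplexPullback θ).toLinearMap)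

lemma coeffMap_comp (f : C →ₗ[ℝ] C') (f' : C' →ₗ[ℝ] C'') (θ : J' → J) (θ' : J'' → J')
    (x : L ⊗[ℝ] (C ⊗[ℝ] SimplexForms J)) :
    coeffMap L f' θ' (coeffMap L f θ x) = coeffMap L (f' ∘ₗ f) (θ ∘ θ') x := by
  have h : coeffMap L f' θ' ∘ₗ coeffMap L f θ = coeffMap L (f' ∘ₗ f) (θ ∘ θ') := by
    ext x a w
    simp [coeffMap, simplexPullback_comp]
  exact LinearMap.congr_fun h x

lemma coeffMap_id (x : L ⊗[ℝ] (C ⊗[ℝ] SimplexForms J)) :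
    coeffMap L (LinearMap.id : C →ₗ[ℝ] C) (id : J → J) x = x := by
  have h : coeffMap L (LinearMap.id : C →ₗ[ℝ] C) (id : J → J) = LinearMap.id := by
    ext x a w
    simp [coeffMap, simplexPullback_id]
  exact LinearMap.congr_fun h x

lemma coeffMap_sub (f f' : C →ₗ[ℝ] C') (θ : J' → J) (x : L ⊗[ℝ] (C ⊗[ℝ] SimplexForms J)) :
    coeffMap L (f - f') θ x = coeffMap L f θ x - coeffMap L f' θ x := by
  have h : coeffMap L (f - f') θ = coeffMap L f θ - coeffMap L f' θ := by
    ext x a w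
    simp [coeffMap, TensorProduct.sub_tmul, TensorProduct.tmul_sub]
  exact LinearMap.congr_fun h x

lemma coeffMap_add (f f' : C →ₗ[ℝ] C') (θ : J' → J) (x : L ⊗[ℝ] (C ⊗[ℝ] SimplexForms J)) :
    coeffMap L (f + f') θ x = coeffMap L f θ x + coeffMap L f' θ x := by
  have h : coeffMap L (f + f') θ = coeffMap L f θ + coeffMap L f' θ := by
    ext x a w
    simp [coeffMap, TensorProduct.add_tmul, TensorProduct.tmul_add]
  exact LinearMap.congr_fun h x

/-- The part of total degree `n` of `g ⊗ Q ⊗ Ω*(Δ)`, for a graded subspace `Q` of `C`. -/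
abbrev DGLie.part (G : DGLie L) (Q : ℤ → Submodule ℝ C) (J : Type) [Fintype J] [DecidableEq J]
    (n : ℤ) : Submodule ℝ (L ⊗[ℝ] (C ⊗[ℝ] SimplexForms J)) :=
  gradedTensor G.gr (gradedTensor Q (simplexAlg J).gr) n

variable (G : DGLie L) {S : DGComm C} {S' : DGComm C'}

lemma coeffMap_mem {Q : ℤ → Submodule ℝ C} {Q' : ℤ → Submodule ℝ C'} {f : C →ₗ[ℝ] C'}
    (hf : ∀ n, ∀ x ∈ Q n, f x ∈ Q' n) (θ : J' → J) {n : ℤ} {x : L ⊗[ℝ] (C ⊗[ℝ] SimplexForms J)}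
    (hx : x ∈ G.part Q J n) : coeffMap L f θ x ∈ G.part Q' J' n :=
  map_mem_gradedTensor (a := 0) (b := 0) (fun p x hx => by simpa using hx)
    (fun p x hx => map_mem_gradedTensor (a := 0) (b := 0) (fun q y hy => by simpa using hf q y hy)
      (fun q y hy => by rw [add_zero]; exact simplexPullback_mem θ hy) (by omega) hx) (by omega) hx

lemma coeffMap_isHom {f : C →ₗ[ℝ] C'} (hf : S.IsHom S' f) (θ : J' → J) :
    (G.onSimplex S J).toDGModule.IsHom (G.onSimplex S' J').toDGModule (coeffMap L f θ) :=
  DGModule.IsHom.tensor G.toDGModule.isHom_id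
    (DGModule.IsHom.tensor hf.toIsHom (simplexPullback_isHom θ).toIsHom)

lemma coeffMap_br {f : C →ₗ[ℝ] C'} (hf : S.IsHom S' f) (θ : J' → J)
    (x y : L ⊗[ℝ] (C ⊗[ℝ] SimplexForms J)) : coeffMap L f θ ((G.onSimplex S J).br x y) =
      (G.onSimplex S' J').br (coeffMap L f θ x) (coeffMap L f θ y) :=
  koszulBilin_map G.toDGModule.isHom_id
    (DGModule.IsHom.tensor hf.toIsHom (simplexPullback_isHom θ).toIsHom)
    (fun _ _ => rfl) (hf.tensor (simplexPullback_isHom θ)).map_mul x y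

lemma coeffMap_curv {f : C →ₗ[ℝ] C'} (hf : S.IsHom S' f) (θ : J' → J)
    (x : L ⊗[ℝ] (C ⊗[ℝ] SimplexForms J)) : coeffMap L f θ ((G.onSimplex S J).curv x) =
      (G.onSimplex S' J').curv (coeffMap L f θ x) := by
  rw [DGLie.curv, DGLie.curv, map_add, map_smul, coeffMap_br G hf, (coeffMap_isHom G hf θ).map_d]

lemma DGComm.isHom_id (S : DGComm C) : S.IsHom S LinearMap.id :=
  { map_gr := fun h => h, map_d := fun _ => rfl, map_mul := fun _ _ => rfl }

/-- This turns the rule that multiplication raises the filtration of coefficients into the same rule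
for brackets. -/
lemma br_mem_part {Q Q' : ℤ → Submodule ℝ C} (hQ : ∀ n, Q n ≤ S.gr n)
    (hmul : ∀ p n, ∀ c ∈ S.gr p, ∀ x ∈ Q n, S.mul c x ∈ Q' (p + n)) {m n : ℤ}
    {x y : L ⊗[ℝ] (C ⊗[ℝ] SimplexForms J)} (hx : x ∈ (G.onSimplex S J).gr m)
    (hy : y ∈ G.part Q J n) : (G.onSimplex S J).br x y ∈ G.part Q' J (m + n) := by
  have h : ∀ p q, ∀ a ∈ (S.tensor (simplexAlg J)).gr p,
      ∀ b ∈ gradedTensor Q (simplexAlg J).gr q,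
        (S.tensor (simplexAlg J)).mul a b ∈ gradedTensor Q' (simplexAlg J).gr (p + q) :=
    fun p q a ha b hb => koszulBilin_mem hQ (fun _ => le_rfl)
      (fun _ _ _ hx _ hy => hmul _ _ _ hx _ hy)
      (fun _ _ _ hx _ hy => (simplexAlg J).mul_mem hx hy) ha hb
  exact koszulBilin_mem (fun _ => le_rfl) (fun _ => le_rfl)
    (fun _ _ _ hx _ hy => G.br_mem hx hy) h hx hy

lemma part_eq_zero {Q : ℤ → Submodule ℝ C} (hQ : ∀ n, ∀ x ∈ Q n, x = 0) {n : ℤ}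
    {x : L ⊗[ℝ] (C ⊗[ℝ] SimplexForms J)} (hx : x ∈ G.part Q J n) : x = 0 := by
  refine gradedTensor_induction (M := fun w => w = 0) (fun p q _ x _ y hy => ?_)
    (fun x y hx hy => by rw [hx, hy, add_zero]) hx
  have : y = 0 := gradedTensor_induction (M := fun w => w = 0) (fun p q _ x hx y _ => by
      rw [hQ _ x hx, TensorProduct.zero_tmul])
    (fun x y hx hy => by rw [hx, hy, add_zero]) hy
  rw [this, TensorProduct.tmul_zero]

lemma part_mono {Q Q' : ℤ → Submodule ℝ C} (hQ : ∀ n, Q n ≤ Q' n) (n : ℤ) :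
    G.part Q J n ≤ G.part Q' J n :=
  gradedTensor_mono (fun _ => le_rfl) (fun q => gradedTensor_mono hQ (fun _ => le_rfl) q) n

/-- Lifting of a Maurer–Cartan element along a surjection of coefficients, relative to some faces. -/
lemma exists_mc_lift {φ : C →ₗ[ℝ] C'} (hφ : S.IsHom S' φ) {u : C' →ₗ[ℝ] C}
    (hu : ∀ {n x}, x ∈ S'.gr n → u x ∈ S.gr n) (hφu : ∀ x, φ (u x) = x) {N : ℕ}
    (Q : ℕ → ℤ → Submodule ℝ C) (hQgr : ∀ s n, Q s n ≤ S.gr n) (hQφ : ∀ s n, ∀ x ∈ Q s n, φ x = 0)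
    (hQ0 : ∀ n, ∀ x ∈ S.gr n, φ x = 0 → x ∈ Q 0 n) (hanti : ∀ s n, Q (s + 1) n ≤ Q s n)
    (hmul : ∀ s p n, ∀ c ∈ S.gr p, ∀ x ∈ Q s n, S.mul c x ∈ Q (s + 1) (p + n))
    (hQN : ∀ n, Q N n = ⊥) {ι : Type*} (θ : ι → J' → J)
    (η : ℕ → L ⊗[ℝ] (C ⊗[ℝ] SimplexForms J) →ₗ[ℝ] L ⊗[ℝ] (C ⊗[ℝ] SimplexForms J))
    (hη : ∀ s n, ∀ x ∈ G.part (Q s) J (n + 1), η s x ∈ G.part (Q s) J n)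
    (hη' : ∀ s n, ∀ x ∈ G.part (Q (s + 1)) J (n + 1), η s x ∈ G.part (Q (s + 1)) J n)
    (hηθ : ∀ s x, (∀ i, coeffMap L (LinearMap.id : C →ₗ[ℝ] C) (θ i) x = 0) →
      ∀ i, coeffMap L (LinearMap.id : C →ₗ[ℝ] C) (θ i) (η s x) = 0)
    (hηd : ∀ s, ∀ x ∈ G.part (Q s) J 2,
      (∀ i, coeffMap L (LinearMap.id : C →ₗ[ℝ] C) (θ i) x = 0) →
        x - (G.onSimplex S J).d (η s x) - η s ((G.onSimplex S J).d x) ∈ G.part (Q (s + 1)) J 2)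
    {w : L ⊗[ℝ] (C ⊗[ℝ] SimplexForms J)} (hw : w ∈ (G.onSimplex S J).gr 1)
    (hwθ : ∀ i, (G.onSimplex S J').curv (coeffMap L LinearMap.id (θ i) w) = 0)
    {β : L ⊗[ℝ] (C' ⊗[ℝ] SimplexForms J)} (hβ : β ∈ (G.onSimplex S' J).gr 1)
    (hβ' : (G.onSimplex S' J).curv β = 0)
    (hwβ : ∀ i, coeffMap L φ id (coeffMap L LinearMap.id (θ i) w) =
      coeffMap L LinearMap.id (θ i) β) :
    ∃ y ∈ (G.onSimplex S J).gr 1, (G.onSimplex S J).curv y = 0 ∧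
      (∀ i, coeffMap L (LinearMap.id : C →ₗ[ℝ] C) (θ i) y = coeffMap L LinearMap.id (θ i) w) ∧
      coeffMap L φ id y = β := by
  -- The linear lift corrects `w` by the image under `u` of the difference between `β` and the image
  -- of `w`. That difference vanishes on the faces, so the values there are kept.
  obtain ⟨x, hx, hxw, hxβ⟩ : ∃ x ∈ (G.onSimplex S J).gr 1,
      (∀ i, coeffMap L (LinearMap.id : C →ₗ[ℝ] C) (θ i) x = coeffMap L LinearMap.id (θ i) w) ∧
      coeffMap L φ id x = β := by
    refine ⟨w + coeffMap L u id (β - coeffMap L φ id w), Submodule.add_mem _ hw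
      (coeffMap_mem G (fun _ _ h => hu h) _ (Submodule.sub_mem _ hβ
        ((coeffMap_isHom G hφ id).map_gr hw))), fun i => ?_, ?_⟩
    · have h := coeffMap_comp (L := L) u LinearMap.id (id : J → J) (θ i)
        (β - coeffMap L φ id w)
      have h' := coeffMap_comp (L := L) LinearMap.id u (θ i) (id : J' → J')
        (β - coeffMap L φ id w)
      have h₁ := coeffMap_comp (L := L) φ LinearMap.id (id : J → J) (θ i) w
      have h₂ := coeffMap_comp (L := L) LinearMap.id φ (θ i) (id : J' → J') w
      have h₃ : coeffMap L LinearMap.id (θ i) (β - coeffMap L φ id w) = 0 := by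
        rw [map_sub, ← hwβ, sub_eq_zero]
        exact h₂.trans h₁.symm
      rw [map_add]
      refine (congrArg _ (h.trans h'.symm)).trans ?_
      rw [h₃, map_zero, add_zero]
    · have h := coeffMap_comp (L := L) u φ (id : J → J) (id : J → J) (β - coeffMap L φ id w)
      have hid : φ ∘ₗ u = LinearMap.id := LinearMap.ext hφu
      rw [hid] at h
      have h' := h.trans (coeffMap_id (L := L) _)
      rw [map_add, h', add_sub_cancel]
  have hxθ : ∀ i, (G.onSimplex S J').curv (coeffMap L LinearMap.id (θ i) x) = 0 := fun i => by
    rw [hxw, hwθ]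
  have hxφ : (G.onSimplex S' J).curv (coeffMap L φ id x) = 0 := by rw [hxβ, hβ']
  have hpart : ∀ s n, G.part (Q s) J n ≤ (G.onSimplex S J).gr n := fun s n =>
    part_mono G (hQgr s) n
  have hker : ∀ s n, ∀ z ∈ G.part (Q s) J n, coeffMap L φ id z = 0 := fun s n z hz =>
    part_eq_zero G (Q := fun _ => (⊥ : Submodule ℝ C')) (fun n x hx => (Submodule.mem_bot ℝ).1 hx)
      (coeffMap_mem G (fun n x hx => (Submodule.mem_bot ℝ).2 (hQφ s n x hx)) id hz)
  -- Corrections must not alter the faces. So the filtration is intersected with the subcomplex `F`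
  -- of elements that vanish on all of them.
  let F : Submodule ℝ (L ⊗[ℝ] (C ⊗[ℝ] SimplexForms J)) :=
    ⨅ i, LinearMap.ker (coeffMap L (LinearMap.id : C →ₗ[ℝ] C) (θ i))
  have hF : ∀ z, z ∈ F ↔ ∀ i, coeffMap L (LinearMap.id : C →ₗ[ℝ] C) (θ i) z = 0 := fun z => by
    simp only [F, Submodule.mem_iInf, LinearMap.mem_ker]
  have hFd : ∀ z ∈ F, (G.onSimplex S J).d z ∈ F := fun z hz => (hF _).2 fun i => by
    rw [(coeffMap_isHom G S.isHom_id (θ i)).map_d, (hF z).1 hz i, map_zero]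
  obtain ⟨y, hy, hy'⟩ := (G.onSimplex S J).exists_curv_sub_eq_zero (N := N)
    (fun s n => G.part (Q s) J n ⊓ F) (fun s => inf_le_left.trans (hpart s 1))
    (fun s => inf_le_inf_right _ (part_mono G (hanti s) 1))
    (fun s _ z hz n _ y hy => ⟨by
      rw [add_comm n 1]
      exact br_mem_part G (hQgr s) (hmul s) hz hy.1,
      (hF _).2 fun i => by
        rw [coeffMap_br G S.isHom_id, (hF y).1 hy.2 i, map_zero]⟩)
    (fun s _ z hz hdz => by
      have h₁ : η s z ∈ F := (hF _).2 (hηθ s z ((hF z).1 hz.2))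
      have h₂ : η s ((G.onSimplex S J).d z) ∈ F := (hF _).2 (hηθ s _ ((hF _).1 hdz.2))
      refine ⟨η s z, ⟨hη s 1 z hz.1, h₁⟩, ?_, Submodule.sub_mem _ hz.2 (hFd _ h₁)⟩
      -- Since `d z` lies in the next step, so does `η (d z)`; adding it back shows that `z - d (η
      -- z)` does too.
      have h := Submodule.add_mem _ (hηd s z hz.1 ((hF z).1 hz.2)) (hη' s 2 _ hdz.1)
      rwa [sub_add_cancel] at h)
    (eq_bot_iff.2 fun z hz => (Submodule.mem_bot ℝ).2 (part_eq_zero G (fun n x hx => by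
      rwa [hQN, Submodule.mem_bot] at hx) hz.1))
    hx ⟨by
      -- The operator `1 - u φ` maps homogeneous coefficients into the kernel of `φ`, and it fixes
      -- the curvature because `φ` kills it.
      have h := coeffMap_mem G (Q := S.gr) (Q' := Q 0) (f := LinearMap.id - u ∘ₗ φ)
        (fun n x hx => hQ0 n _ (Submodule.sub_mem _ hx (hu (hφ.map_gr hx))) (by
          rw [LinearMap.sub_apply, map_sub, LinearMap.comp_apply, hφu, LinearMap.id_apply,
            sub_self])) (id : J → J) ((G.onSimplex S J).curv_mem hx)
      have h' : coeffMap L (u ∘ₗ φ) (id : J → J) ((G.onSimplex S J).curv x) = 0 := by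
        have := coeffMap_comp (L := L) φ u (id : J → J) (id : J → J) ((G.onSimplex S J).curv x)
        rw [coeffMap_curv G hφ, hxφ, map_zero] at this
        exact this.symm
      rwa [coeffMap_sub, coeffMap_id, h', sub_zero] at h,
    (hF _).2 fun i => by rw [coeffMap_curv G S.isHom_id, hxθ]⟩
  refine ⟨x - y, Submodule.sub_mem _ hx (hpart 0 1 hy.1), hy', fun i => ?_, ?_⟩
  · rw [map_sub, (hF y).1 hy.2 i, sub_zero, hxw]
  · rw [map_sub, hker 0 1 y hy.1, sub_zero, hxβ]

end SimplexTensor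

/-! ### Extension of simplicial cochains from horns and boundaries. -/

section FaceExtension

/-- Systems of groups contravariant in maps of finite sets satisfy the horn extension property. -/
lemma exists_horn_extension {V : ℕ → Type*} [∀ n, AddCommGroup (V n)] (E : ∀ n, AddSubgroup (V n))
    (pull : ∀ {m n : ℕ}, (Fin m → Fin n) → V n →+ V m)
    (pull_id : ∀ {n} (x : V n), pull id x = x)
    (pull_comp : ∀ {l m n} (f : Fin l → Fin m) (g : Fin m → Fin n) (x : V n),
      pull f (pull g x) = pull (g ∘ f) x)
    (hE : ∀ {m n} (f : Fin m → Fin n), ∀ x ∈ E n, pull f x ∈ E m) {n : ℕ} (k : Fin (n + 2))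
    (α : Fin (n + 2) → V (n + 1)) (hα : ∀ i ≠ k, α i ∈ E (n + 1))
    (hc : ∀ i ≠ k, ∀ j ≠ k, ∀ f f' : Fin (n + 1) → Fin (n + 1),
      i.succAbove ∘ f = j.succAbove ∘ f' → pull f (α i) = pull f' (α j)) :
    ∃ x ∈ E (n + 2), ∀ i ≠ k, pull i.succAbove x = α i := by
  -- The retraction of the simplex onto its `i`-th face sends the vertex `i` to `k`. It need not be
  -- monotone, and for this reason `pull` is defined for all maps of vertices.
  have hr : ∀ i : Fin (n + 2), i ≠ k → ∃ r : Fin (n + 2) → Fin (n + 1),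
      ∀ y, i.succAbove (r y) = if y = i then k else y := fun i hi => by
    have h : ∀ y, ∃ z, i.succAbove z = if y = i then k else y := fun y => by
      apply Fin.exists_succAbove_eq
      split_ifs with h
      · exact hi.symm
      · exact h
    exact ⟨fun y => (h y).choose, fun y => (h y).choose_spec⟩
  -- The faces are corrected one at a time; each correction is pulled back along a retraction and
  -- must leave the earlier faces alone.
  suffices h : ∀ F : Finset (Fin (n + 2)), k ∉ F →
      ∃ x ∈ E (n + 2), ∀ i ∈ F, pull i.succAbove x = α i by
    obtain ⟨x, hx, h⟩ := h ({k}ᶜ) (by simp)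
    exact ⟨x, hx, fun i hi => h i (by simpa using hi)⟩
  intro F
  induction F using Finset.induction_on with
  | empty => exact fun _ => ⟨0, (E _).zero_mem, by simp⟩
  | insert i F hiF ih =>
    intro hk
    rw [Finset.mem_insert, not_or] at hk
    obtain ⟨x, hx, hxF⟩ := ih hk.2
    have hik : i ≠ k := fun h => hk.1 h.symm
    obtain ⟨r, hr'⟩ := hr i hik
    have hri : r ∘ i.succAbove = id := by
      funext y
      apply Fin.succAbove_right_injective (p := i)
      rw [Function.comp_apply, hr', if_neg (Fin.succAbove_ne i y), id]
    refine ⟨x + pull r (α i - pull i.succAbove x), (E _).add_mem hx (hE _ _ ((E _).sub_mem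
      (hα i hik) (hE _ _ hx))), fun j hj => ?_⟩
    rw [map_add, pull_comp]
    by_cases hji : j = i
    · subst hji
      rw [hri, pull_id, add_sub_cancel]
    · have hjF : j ∈ F := (Finset.mem_insert.1 hj).resolve_left hji
      have hjk : j ≠ k := fun h => hk.2 (h ▸ hjF)
      obtain ⟨r', hr''⟩ := hr j hjk
      -- On an earlier face `j` the retraction stays inside the face, because the vertex `i` goes to
      -- `k ≠ j`. There the correction only sees the common face of `i` and `j`, where the data
      -- agree.
      have hf : i.succAbove ∘ (r ∘ j.succAbove) =
          j.succAbove ∘ (r' ∘ i.succAbove ∘ r ∘ j.succAbove) := by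
        funext y
        have hne : i.succAbove (r (j.succAbove y)) ≠ j := by
          rw [hr']
          split_ifs
          · exact hjk.symm
          · exact Fin.succAbove_ne j y
        simp only [Function.comp_apply]
        rw [hr'', if_neg hne]
      have hx' : pull (r ∘ j.succAbove) (pull i.succAbove x) =
          pull (r' ∘ i.succAbove ∘ r ∘ j.succAbove) (α j) :=
        (pull_comp _ _ x).trans ((congrArg (fun f => pull f x) hf).trans
          ((pull_comp _ _ x).symm.trans (congrArg _ (hxF j hjF))))
      rw [map_sub, hc i hik j hjk _ _ hf, hx', sub_self, add_zero, hxF j hjF]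

/-- If the system of groups has multiplications by barycentric coordinates, it is extendable. -/
lemma exists_boundary_extension {V : ℕ → Type*} [∀ n, AddCommGroup (V n)]
    (E : ∀ n, AddSubgroup (V n)) (pull : ∀ {m n : ℕ}, (Fin m → Fin n) → V n →+ V m)
    (pull_id : ∀ {n} (x : V n), pull id x = x)
    (pull_comp : ∀ {l m n} (f : Fin l → Fin m) (g : Fin m → Fin n) (x : V n),
      pull f (pull g x) = pull (g ∘ f) x)
    (hE : ∀ {m n} (f : Fin m → Fin n), ∀ x ∈ E n, pull f x ∈ E m)
    (coord : ∀ {n}, Fin n → V n →+ V n) (coord_mem : ∀ {n} (j : Fin n), ∀ x ∈ E n, coord j x ∈ E n)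
    (sum_coord : ∀ {n} (x : V n), ∑ j, coord j x = x)
    (pull_coord : ∀ {m n} (f : Fin m → Fin n) (j : Fin n) (x : V n),
      pull f (coord j x) = ∑ i, if f i = j then coord i (pull f x) else 0) {n : ℕ}
    (α : Fin (n + 2) → V (n + 1)) (hα : ∀ i, α i ∈ E (n + 1))
    (hc : ∀ i j, ∀ f f' : Fin (n + 1) → Fin (n + 1),
      i.succAbove ∘ f = j.succAbove ∘ f' → pull f (α i) = pull f' (α j)) :
    ∃ x ∈ E (n + 2), ∀ i, pull i.succAbove x = α i := by
  obtain ⟨y, hy, hyα⟩ := exists_horn_extension E pull pull_id pull_comp hE 0 α (fun i _ => hα i)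
    (fun i _ j _ => hc i j)
  -- The map `c i` collapses the vertex `0` onto the vertex `i` of the opposite face and fixes that
  -- face.
  let c : Fin (n + 1) → Fin (n + 2) → Fin (n + 1) := fun i => Fin.cons i id
  set z := α 0 - pull (Fin.succAbove 0) y with hz
  have hzE : z ∈ E (n + 1) := (E _).sub_mem (hα 0) (hE _ _ hy)
  -- The defect `z` on the face `0` vanishes on the faces of that face, because the filling of the
  -- horn is right on the other faces.
  have hz0 : ∀ (j : Fin (n + 1)) (f : Fin (n + 1) → Fin (n + 1)), (∀ x, f x ≠ j) →
      pull f z = 0 := by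
    intro j f hf
    have h : ∀ x, ∃ w, (Fin.succ j).succAbove w = Fin.succ (f x) := fun x =>
      Fin.exists_succAbove_eq fun h => hf x (Fin.succ_injective _ h)
    choose w hw using h
    have hw' : Fin.succAbove 0 ∘ f = (Fin.succ j).succAbove ∘ w := by
      funext x
      rw [Function.comp_apply, Function.comp_apply, hw, Fin.succAbove_zero]
    rw [hz, map_sub, hc 0 (Fin.succ j) f w hw', pull_comp, hw', ← pull_comp,
      hyα _ (Fin.succ_ne_zero j), sub_self]
  -- On the face `0` every `c i` is the identity and the coordinates sum to one, so the correction
  -- is `z`. On the face `j + 1` the term of `j` vanishes with its coordinate; for another `i` the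
  -- map `c i` avoids the vertex `j`, so `z` pulls back to zero.
  refine ⟨y + ∑ i, coord (Fin.succ i) (pull (c i) z), (E _).add_mem hy ((E _).sum_mem
    fun i _ => coord_mem _ _ (hE _ _ hzE)), fun i => ?_⟩
  rw [map_add, map_sum]
  simp only [pull_coord, pull_comp]
  induction i using Fin.cases with
  | zero =>
    have h : ∀ i : Fin (n + 1), (∑ l, if Fin.succAbove 0 l = Fin.succ i then
        coord l (pull (c i ∘ Fin.succAbove 0) z) else 0) = coord i z := fun i => by
      have hci : c i ∘ Fin.succAbove 0 = id := by
        funext x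
        simp [c]
      rw [Finset.sum_eq_single i]
      · rw [if_pos (by simp), hci, pull_id]
      · intro l _ hl
        rw [if_neg]
        simpa using hl
      · simp
    rw [Finset.sum_congr rfl fun i _ => h i, sum_coord, hz, add_sub_cancel]
  | succ j =>
    rw [hyα _ (Fin.succ_ne_zero j), Finset.sum_eq_zero, add_zero]
    intro i _
    refine Finset.sum_eq_zero fun l _ => ?_
    split_ifs with h
    · rw [hz0 j, map_zero]
      intro x hx
      rw [Function.comp_apply] at hx
      have hij : i ≠ j := fun hij => Fin.succAbove_ne (Fin.succ j) l (by rw [h, hij])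
      generalize hw : (Fin.succ j).succAbove x = w at hx
      induction w using Fin.cases with
      | zero => exact hij (by simpa [c] using hx)
      | succ w =>
        have : w = j := by simpa [c] using hx
        exact Fin.succAbove_ne (Fin.succ j) x (by rw [hw, this])
    · rfl

end FaceExtension

/-! ### The simplicial set of Maurer–Cartan elements with coefficients in a non-unital algebra. -/

section Nerve

variable {L C C' C'' : Type u} [AddCommGroup L] [Module ℝ L] [AddCommGroup C] [Module ℝ C]
  [AddCommGroup C'] [Module ℝ C'] [AddCommGroup C''] [Module ℝ C''] (G : DGLie L)
  {S : DGComm C} {S' : DGComm C'} {S'' : DGComm C''}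

lemma coeffMap_pull_pull {J J' J'' : Type} [Fintype J] [DecidableEq J] [Fintype J'] [DecidableEq J']
    [Fintype J''] [DecidableEq J''] (θ : J' → J) (θ' : J'' → J')
    (x : L ⊗[ℝ] (C ⊗[ℝ] SimplexForms J)) : coeffMap L (LinearMap.id : C →ₗ[ℝ] C) θ'
      (coeffMap L (LinearMap.id : C →ₗ[ℝ] C) θ x) = coeffMap L LinearMap.id (θ ∘ θ') x :=
  coeffMap_comp _ _ θ θ' x

lemma coeffMap_comm {J J' : Type} [Fintype J] [DecidableEq J] [Fintype J'] [DecidableEq J']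
    (f : C →ₗ[ℝ] C') (θ : J' → J) (x : L ⊗[ℝ] (C ⊗[ℝ] SimplexForms J)) :
    coeffMap L f (id : J' → J') (coeffMap L LinearMap.id θ x) =
      coeffMap L LinearMap.id θ (coeffMap L f (id : J → J) x) :=
  (coeffMap_comp _ _ _ _ x).trans (coeffMap_comp f LinearMap.id (id : J → J) θ x).symm

variable (S) in
/-- The Maurer–Cartan elements of `g ⊗ C ⊗ Ω*(Δ)`. -/
def DGLie.mcElements (J : Type) [Fintype J] [DecidableEq J] :
    Set (L ⊗[ℝ] (C ⊗[ℝ] SimplexForms J)) :=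
  {x | x ∈ (G.onSimplex S J).gr 1 ∧ (G.onSimplex S J).curv x = 0}

lemma coeffMap_mem_mcElements {f : C →ₗ[ℝ] C'} (hf : S.IsHom S' f) {J J' : Type} [Fintype J]
    [DecidableEq J] [Fintype J'] [DecidableEq J'] (θ : J' → J) {x : L ⊗[ℝ] (C ⊗[ℝ] SimplexForms J)}
    (hx : x ∈ G.mcElements S J) : coeffMap L f θ x ∈ G.mcElements S' J' :=
  ⟨(coeffMap_isHom G hf θ).map_gr hx.1, by rw [← coeffMap_curv G hf, hx.2, map_zero]⟩

/-- The map on Maurer–Cartan elements induced by a map of coefficients and a map of simplices. -/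
def mcElementsMap {f : C →ₗ[ℝ] C'} (hf : S.IsHom S' f) {J J' : Type} [Fintype J]
    [DecidableEq J] [Fintype J'] [DecidableEq J'] (θ : J' → J) (x : G.mcElements S J) :
    G.mcElements S' J' :=
  ⟨coeffMap L f θ x.1, coeffMap_mem_mcElements G hf θ x.2⟩

variable (S) in
/-- The simplicial set of Maurer–Cartan elements of `g ⊗ C ⊗ Ω*(Δⁿ)`. -/
def DGLie.mcSpace : SSet.{u} where
  obj n := G.mcElements S (Fin (n.unop.len + 1))
  map θ := TypeCat.ofHom (mcElementsMap G S.isHom_id θ.unop.toOrderHom)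
  map_id n := by
    ext x
    exact coeffMap_id x.1
  map_comp θ θ' := by
    ext x
    exact (coeffMap_pull_pull θ.unop.toOrderHom θ'.unop.toOrderHom x.1).symm

/-- The map of simplicial sets of Maurer–Cartan elements induced by a map of coefficients. -/
def mcSpaceMap {f : C →ₗ[ℝ] C'} (hf : S.IsHom S' f) : G.mcSpace S ⟶ G.mcSpace S' where
  app n := TypeCat.ofHom (mcElementsMap G hf id)
  naturality n n' θ := by
    ext x
    exact Subtype.ext (coeffMap_comm f θ.unop.toOrderHom x.1)

lemma mcSpaceMap_comp {f : C →ₗ[ℝ] C'} (hf : S.IsHom S' f) {f' : C' →ₗ[ℝ] C''}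
    (hf' : S'.IsHom S'' f') (hf'' : S.IsHom S'' (f' ∘ₗ f)) :
    mcSpaceMap G hf ≫ mcSpaceMap G hf' = mcSpaceMap G hf'' := by
  ext n x
  exact Subtype.ext (coeffMap_comp f f' id id x.1)

lemma mcSpaceMap_id : mcSpaceMap G S.isHom_id = 𝟙 (G.mcSpace S) := by
  ext n x
  exact Subtype.ext (coeffMap_id x.1)

/-- Compatibility is given for monotone maps and needed for all maps of vertices. Two maps into
different faces that agree in the simplex factor through the common face, whose two inclusions are
monotone. -/
lemma compatible_of_isCompatibleFamily {n : ℕ} {F : Set (Fin (n + 2))}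
    {a : Fin (n + 2) → (G.mcSpace S).obj (Opposite.op (SimplexCategory.mk n))}
    (ha : IsCompatibleFamily (G.mcSpace S) F a) {i j : Fin (n + 2)} (hi : i ∈ F) (hj : j ∈ F)
    (f f' : Fin (n + 1) → Fin (n + 1)) (hf : i.succAbove ∘ f = j.succAbove ∘ f') :
    coeffMap L (LinearMap.id : C →ₗ[ℝ] C) f (a i).1 = coeffMap L LinearMap.id f' (a j).1 := by
  by_cases hij : i = j
  · subst hij
    rw [show f = f' from funext fun x => Fin.succAbove_right_injective (congrFun hf x)]
  · obtain ⟨j₀, rfl⟩ := Fin.exists_succAbove_eq (Ne.symm hij)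
    have hfj : ∀ x, f x ≠ j₀ := fun x hx => Fin.succAbove_ne (i.succAbove j₀) (f' x)
      ((congrFun hf x).symm.trans (congrArg i.succAbove hx))
    cases n with
    -- Different faces of the `1`-simplex are disjoint vertices, so the situation cannot occur.
    | zero => exact absurd (Fin.ext (by omega)) (hfj 0)
    | succ n =>
      choose q hq using fun x => Fin.exists_succAbove_eq (hfj x)
      have hcomp : ∀ x, i.succAbove (j₀.succAbove x) =
          (i.succAbove j₀).succAbove ((j₀.predAbove i).succAbove x) := fun x =>
        (Fin.succAbove_succAbove_succAbove_predAbove i j₀ x).symm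
      have hq' : f' = (j₀.predAbove i).succAbove ∘ q := by
        funext x
        apply Fin.succAbove_right_injective (p := i.succAbove j₀)
        have := congrFun hf x
        simp only [Function.comp_apply] at this ⊢
        rw [← this, ← hcomp, hq]
      have hfq : f = j₀.succAbove ∘ q := funext fun x => (hq x).symm
      have h := ha i hi (i.succAbove j₀) hj n (SimplexCategory.δ j₀)
        (SimplexCategory.δ (j₀.predAbove i)) (by
          ext x : 3
          exact hcomp x)
      have h' : coeffMap L (LinearMap.id : C →ₗ[ℝ] C) j₀.succAbove (a i).1 =
          coeffMap L LinearMap.id (j₀.predAbove i).succAbove (a (i.succAbove j₀)).1 :=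
        congrArg Subtype.val h
      rw [hfq, hq']
      have h₁ := coeffMap_comp (L := L) (LinearMap.id : C →ₗ[ℝ] C) LinearMap.id j₀.succAbove q (a i).1
      have h₂ := coeffMap_comp (L := L) (LinearMap.id : C →ₗ[ℝ] C) LinearMap.id
        (j₀.predAbove i).succAbove q (a (i.succAbove j₀)).1
      rw [h'] at h₁
      exact h₁.symm.trans h₂

end Nerve

/-! ### Bounded nilpotent coefficient algebras and graded sections. -/

section Artin

variable {C C' : Type*} [AddCommGroup C] [Module ℝ C] [AddCommGroup C'] [Module ℝ C']

/-- Bounded complexes in non-positive degrees, with independent homogeneous parts. -/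
structure DGModule.IsBounded (S : DGModule C) : Prop where
  nonpos : ∀ n, 0 < n → ∀ x ∈ S.gr n, x = 0
  bounded : ∃ M : ℕ, ∀ n : ℤ, n < -M → ∀ x ∈ S.gr n, x = 0
  proj : ∃ π : ℤ → C →ₗ[ℝ] C, (∀ n, ∀ x ∈ S.gr n, π n x = x) ∧
    ∀ m n, m ≠ n → ∀ x ∈ S.gr m, π n x = 0

namespace DGComm

/-- The subspace spanned by products of `s + 1` elements. -/
def mpow (S : DGComm C) : ℕ → Submodule ℝ C
  | 0 => ⊤
  | s + 1 => Submodule.map₂ S.mul ⊤ (S.mpow s)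

lemma mul_mem_mpow (S : DGComm C) {s : ℕ} (c : C) {x : C} (hx : x ∈ S.mpow s) :
    S.mul c x ∈ S.mpow (s + 1) :=
  Submodule.apply_mem_map₂ _ Submodule.mem_top hx

lemma mpow_succ_le (S : DGComm C) (s : ℕ) : S.mpow (s + 1) ≤ S.mpow s := by
  induction s with
  | zero => exact le_top
  | succ s ih => exact Submodule.map₂_le_map₂_right ih

lemma mpow_antitone (S : DGComm C) : Antitone S.mpow := antitone_nat_of_succ_le S.mpow_succ_le

/-- Bounded nilpotent algebras in non-positive degrees. -/
structure IsArtin (S : DGComm C) : Prop extends S.toDGModule.IsBounded where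
  nilpotent : ∃ N : ℕ, S.mpow N = ⊥

end DGComm

lemma proj_mem {S : DGModule C} {π : ℤ → C →ₗ[ℝ] C} (h : ∀ n, ∀ x ∈ S.gr n, π n x = x)
    (h' : ∀ m n, m ≠ n → ∀ x ∈ S.gr m, π n x = 0) (n : ℤ) (x : C) : π n x ∈ S.gr n := by
  induction x using S.induction with
  | hadd x y hx hy => rw [map_add]; exact Submodule.add_mem _ hx hy
  | h m x hx =>
    by_cases hmn : m = n
    · subst hmn
      rwa [h m x hx]
    · rw [h' m n hmn x hx]
      exact Submodule.zero_mem _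

lemma map_proj {S : DGModule C} {S' : DGModule C'} {π : ℤ → C →ₗ[ℝ] C} {π' : ℤ → C' →ₗ[ℝ] C'}
    (h : ∀ n, ∀ x ∈ S.gr n, π n x = x) (h' : ∀ m n, m ≠ n → ∀ x ∈ S.gr m, π n x = 0)
    (k : ∀ n, ∀ x ∈ S'.gr n, π' n x = x) (k' : ∀ m n, m ≠ n → ∀ x ∈ S'.gr m, π' n x = 0)
    {φ : C →ₗ[ℝ] C'} (a : ℤ) (hφ : ∀ n, ∀ x ∈ S.gr n, φ x ∈ S'.gr (n + a)) (n : ℤ) (x : C) :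
    φ (π n x) = π' (n + a) (φ x) := by
  induction x using S.induction with
  | hadd x y hx hy => simp only [map_add, hx, hy]
  | h m x hx =>
    by_cases hmn : m = n
    · subst hmn
      rw [h m x hx, k _ _ (hφ m x hx)]
    · rw [h' m n hmn x hx, map_zero, k' (m + a) (n + a) (by omega) _ (hφ m x hx)]

/-- Surjections of bounded complexes have graded sections. -/
lemma DGModule.IsBounded.exists_graded_section {S : DGModule C} {S' : DGModule C'}
    (hS' : S'.IsBounded) {φ : C →ₗ[ℝ] C'} (hφ : S.IsHom S' φ) (hsurj : ∀ n, ∀ y ∈ S'.gr n, ∃ x ∈ S.gr n, φ x = y) :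
    ∃ u : C' →ₗ[ℝ] C, (∀ n, ∀ y ∈ S'.gr n, u y ∈ S.gr n) ∧ ∀ y, φ (u y) = y := by
  obtain ⟨π, h, h'⟩ := hS'.proj
  obtain ⟨M, hM⟩ := hS'.bounded
  have hs : ∀ n, ∃ s : S'.gr n →ₗ[ℝ] S.gr n, ∀ y, φ (s y) = y := fun n => by
    let f : S.gr n →ₗ[ℝ] S'.gr n := φ.restrict fun x hx => hφ.map_gr hx
    have hf : Function.Surjective f := fun y => by
      obtain ⟨x, hx, hxy⟩ := hsurj n y y.2
      exact ⟨⟨x, hx⟩, Subtype.ext hxy⟩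
    obtain ⟨s, hs⟩ := f.exists_rightInverse_of_surjective (LinearMap.range_eq_top.2 hf)
    exact ⟨s, fun y => congrArg Subtype.val (LinearMap.congr_fun hs y)⟩
  choose s hs using hs
  let u : C' →ₗ[ℝ] C := ∑ n ∈ Finset.Icc (-M : ℤ) 0, (S.gr n).subtype ∘ₗ s n ∘ₗ
    (π n).codRestrict (S'.gr n) (proj_mem h h' n)
  have hu : ∀ n, ∀ y, (hy : y ∈ S'.gr n) → u y = s n ⟨y, hy⟩ := fun n y hy => by
    rw [LinearMap.sum_apply]
    by_cases hn : n ∈ Finset.Icc (-M : ℤ) 0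
    · rw [Finset.sum_eq_single_of_mem n hn]
      · simp only [LinearMap.comp_apply, Submodule.subtype_apply]
        congr 2
        exact Subtype.ext (h n y hy)
      · intro m _ hmn
        have : (π m).codRestrict (S'.gr m) (proj_mem h h' m) y = 0 :=
          Subtype.ext (h' n m hmn.symm y hy)
        rw [LinearMap.comp_apply, LinearMap.comp_apply, this, map_zero, map_zero]
    · have hy0 : y = 0 := by
        rw [Finset.mem_Icc, not_and_or] at hn
        rcases hn with hn | hn
        · exact hM n (by omega) y hy
        · exact hS'.nonpos n (by omega) y hy
      subst hy0
      have : (⟨0, hy⟩ : S'.gr n) = 0 := rfl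
      rw [this, map_zero]
      simp
  refine ⟨u, fun n y hy => ?_, fun y => ?_⟩
  · rw [hu n y hy]
    exact Subtype.property _
  · induction y using S'.induction with
    | hadd x y hx hy => rw [map_add, map_add, hx, hy]
    | h n y hy => rw [hu n y hy, hs]

/-- The graded pieces of a filtration of the kernel of a map of dg algebras. -/
def kernelPiece (S : DGComm C) (φ : C →ₗ[ℝ] C') (N s : ℕ) (n : ℤ) : Submodule ℝ C :=
  LinearMap.ker φ ⊓ S.gr n ⊓ S.mpow (s + N * n).toNat

/-- A filtration of the kernel of a map of dg algebras; its subquotients are acyclic if the kernel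
is. -/
def kernelFiltration (S : DGComm C) (φ : C →ₗ[ℝ] C') (N s : ℕ) (n : ℤ) : Submodule ℝ C :=
  kernelPiece S φ N s n ⊔ (kernelPiece S φ N s (n - 1)).map S.d

/-! ### A multiplicative filtration of an acyclic kernel with contractible subquotients. -/

section KernelFiltration

variable {S : DGComm C} {S' : DGComm C'} {φ : C →ₗ[ℝ] C'} {N : ℕ}

lemma kernelPiece_succ_le (s : ℕ) (n : ℤ) : kernelPiece S φ N (s + 1) n ≤ kernelPiece S φ N s n :=
  inf_le_inf_left _ (S.mpow_antitone (Int.toNat_le_toNat (by push_cast; omega)))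

lemma kernelFiltration_succ_le (s : ℕ) (n : ℤ) :
    kernelFiltration S φ N (s + 1) n ≤ kernelFiltration S φ N s n :=
  sup_le_sup (kernelPiece_succ_le s n) (Submodule.map_mono (kernelPiece_succ_le s (n - 1)))

lemma kernelFiltration_le (s : ℕ) (n : ℤ) : kernelFiltration S φ N s n ≤ S.gr n := by
  refine sup_le (inf_le_left.trans inf_le_right) ?_
  rintro _ ⟨x, hx, rfl⟩
  have := S.d_mem hx.1.2
  rwa [sub_add_cancel] at this

lemma kernelFiltration_map (hφ : S.IsHom S' φ) (s : ℕ) (n : ℤ) : kernelFiltration S φ N s n ≤ LinearMap.ker φ := by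
  refine sup_le (inf_le_left.trans inf_le_left) ?_
  rintro _ ⟨x, hx, rfl⟩
  rw [LinearMap.mem_ker, hφ.map_d, LinearMap.mem_ker.1 hx.1.1, map_zero]

lemma mem_kernelFiltration_zero (hS : S.IsArtin) {n : ℤ} {x : C} (hx : x ∈ S.gr n)
    (hx' : φ x = 0) : x ∈ kernelFiltration S φ N 0 n := by
  rcases lt_or_ge 0 n with hn | hn
  · rw [hS.nonpos n hn x hx]
    exact Submodule.zero_mem _
  · refine Submodule.mem_sup_left ⟨⟨hx', hx⟩, ?_⟩
    have : ((0 : ℕ) + N * n : ℤ).toNat = 0 := by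
      rw [Int.toNat_eq_zero]
      push_cast
      nlinarith
    rw [this]
    exact Submodule.mem_top

/-- Multiplication raises the power by one. The shift by `N p` only lowers the power that is
required, since `p ≤ 0`. -/
lemma mul_mem_kernelPiece (hφ : S.IsHom S' φ) (hS : S.IsArtin) {s : ℕ} {p n : ℤ}
    {c x : C} (hc : c ∈ S.gr p) (hx : x ∈ kernelPiece S φ N s n) : S.mul c x ∈ kernelPiece S φ N (s + 1) (p + n) := by
  rcases lt_or_ge 0 p with hp | hp
  · rw [hS.nonpos p hp c hc, map_zero, LinearMap.zero_apply]
    exact Submodule.zero_mem _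
  · refine ⟨⟨?_, S.mul_mem hc hx.1.2⟩, S.mpow_antitone ?_ (S.mul_mem_mpow c hx.2)⟩
    · rw [SetLike.mem_coe, LinearMap.mem_ker, hφ.map_mul, LinearMap.mem_ker.1 hx.1.1, map_zero]
    · have : (N : ℤ) * p ≤ 0 := mul_nonpos_of_nonneg_of_nonpos (Int.natCast_nonneg N) hp
      rw [mul_add]
      omega

/-- By the Leibniz rule `c · db` is, up to sign, `d(cb) - dc · b`. So adding the differentials of
the pieces, which makes the filtration a complex, keeps it multiplicative. -/
lemma mul_mem_kernelFiltration (hφ : S.IsHom S' φ) (hS : S.IsArtin) {s : ℕ} {p n : ℤ}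
    {c x : C} (hc : c ∈ S.gr p) (hx : x ∈ kernelFiltration S φ N s n) :
    S.mul c x ∈ kernelFiltration S φ N (s + 1) (p + n) := by
  obtain ⟨a, ha, _, ⟨b, hb, rfl⟩, rfl⟩ := Submodule.mem_sup.1 hx
  rw [map_add]
  refine Submodule.add_mem _ (Submodule.mem_sup_left (mul_mem_kernelPiece hφ hS hc ha)) ?_
  have h₁ := mul_mem_kernelPiece hφ hS hc hb
  have h₂ := mul_mem_kernelPiece hφ hS (S.d_mem hc) hb
  have h : S.mul c (S.d b) = (-1 : ℝ) ^ p • (S.d (S.mul c b) - S.mul (S.d c) b) := by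
    rw [S.leibniz hc, add_sub_cancel_left, smul_smul, neg_one_zpow_sq, one_smul]
  rw [h]
  refine Submodule.smul_mem _ _ (Submodule.sub_mem _ (Submodule.mem_sup_right ⟨_, ?_, rfl⟩)
    (Submodule.mem_sup_left ?_))
  · rwa [add_sub_assoc]
  · rwa [add_assoc, add_sub_cancel] at h₂

/-- In the degrees where the exponent reaches `N` the piece vanishes. -/
lemma kernelPiece_eq_bot (hN : S.mpow N = ⊥) {s : ℕ} {n : ℤ} (h : (N : ℤ) ≤ s + N * n) {x : C}
    (hx : x ∈ kernelPiece S φ N s n) : x = 0 := by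
  have := S.mpow_antitone (show N ≤ (s + N * n : ℤ).toNat by omega) hx.2
  rwa [hN, Submodule.mem_bot] at this

/-- In the degrees where the exponent is not positive the piece is the whole kernel. As the exponent
moves by `N` per degree, only one degree lies between the two regimes, which makes each step a
truncation of the kernel. -/
lemma mem_kernelPiece_of_nonpos {s : ℕ} {n : ℤ} (h : (s : ℤ) + N * n ≤ 0) {x : C} (hx : x ∈ S.gr n)
    (hx' : φ x = 0) : x ∈ kernelPiece S φ N s n := by
  refine ⟨⟨hx', hx⟩, ?_⟩
  rw [Int.toNat_eq_zero.2 h]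
  exact Submodule.mem_top

lemma kernelFiltration_eq_bot (hS : S.IsArtin) (hN : S.mpow N = ⊥) :
    ∃ s, ∀ n, kernelFiltration S φ N s n = ⊥ := by
  obtain ⟨M, hM⟩ := hS.bounded
  -- With `s = N (M + 1)` the exponent is at least `N` in every degree from `-M` on, and there is
  -- nothing below.
  have h : ∀ n, ∀ x ∈ kernelPiece S φ N (N * (M + 1)) n, x = 0 := fun n x hx => by
    rcases lt_or_ge n (-M) with hn | hn
    · exact hM n hn x hx.1.2
    · refine kernelPiece_eq_bot hN ?_ hx
      push_cast
      nlinarith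
  refine ⟨N * (M + 1), fun n => eq_bot_iff.2 (sup_le (fun x hx => h n x hx) ?_)⟩
  rintro _ ⟨x, hx, rfl⟩
  rw [h _ x hx, map_zero]
  exact Submodule.zero_mem _

/-- If the kernel of a map of dg algebras is acyclic, so are the subquotients of its filtration: they
have contractions. -/
lemma exists_kernelFiltration_contraction (hS : S.IsArtin) (hN : S.mpow N = ⊥) (hN0 : 0 < N)
    (hac : ∀ n, ∀ x ∈ S.gr n, φ x = 0 → S.d x = 0 → ∃ y ∈ S.gr (n - 1), φ y = 0 ∧ S.d y = x)
    (s : ℕ) : ∃ σ : C →ₗ[ℝ] C, (∀ n, ∀ x ∈ S.gr n, σ x ∈ S.gr (n - 1)) ∧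
      (∀ n, ∀ x ∈ kernelFiltration S φ N s n, σ x ∈ kernelFiltration S φ N s (n - 1)) ∧
      (∀ n, ∀ x ∈ kernelFiltration S φ N (s + 1) n, σ x ∈ kernelFiltration S φ N (s + 1) (n - 1)) ∧
      ∀ n, ∀ x ∈ kernelFiltration S φ N s n,
        x - S.d (σ x) - σ (S.d x) ∈ kernelFiltration S φ N (s + 1) n := by
  obtain ⟨π, hπ, hπ'⟩ := hS.proj
  -- The degree `q = -⌊s / N⌋` is the transitional one: the pieces are the whole kernel below it and
  -- zero above it.
  obtain ⟨q, hq₀, hq₁⟩ : ∃ q : ℤ, 0 ≤ s + N * q ∧ s + N * q < N := by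
    refine ⟨-((s : ℤ) / N), ?_, ?_⟩
    · have := Int.mul_ediv_self_le (x := (s : ℤ)) (k := N) (by omega)
      rw [mul_neg]
      omega
    · have := Int.lt_mul_ediv_self_add (x := (s : ℤ)) (k := N) (by omega)
      rw [mul_neg]
      omega
  have hmul : ∀ a b : ℤ, a ≤ b → (N : ℤ) * a ≤ N * b := fun a b h =>
    mul_le_mul_of_nonneg_left h (Int.natCast_nonneg N)
  set V := kernelPiece S φ N s q with hV
  -- The map `r` is a linear section of `d` on `V`, extended arbitrarily to `C`. The contraction
  -- applies it in degree `q + 1` and is zero elsewhere.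
  obtain ⟨r, hr⟩ : ∃ r : C →ₗ[ℝ] V, ∀ v ∈ V, S.d (r (S.d v)) = S.d v := by
    let f : V →ₗ[ℝ] C := S.d.domRestrict V
    obtain ⟨r₀, hr₀⟩ := f.rangeRestrict.exists_rightInverse_of_surjective f.range_rangeRestrict
    obtain ⟨r, hr⟩ := r₀.exists_extend
    refine ⟨r, fun v hv => ?_⟩
    have h₁ : r (S.d v) = r₀ (f.rangeRestrict ⟨v, hv⟩) := LinearMap.congr_fun hr (f.rangeRestrict ⟨v, hv⟩)
    rw [h₁]
    exact congrArg Subtype.val (LinearMap.congr_fun hr₀ (f.rangeRestrict ⟨v, hv⟩))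
  let σ : C →ₗ[ℝ] C := V.subtype ∘ₗ r ∘ₗ π (q + 1)
  have hσ : ∀ n, n ≠ q + 1 → ∀ x ∈ S.gr n, σ x = 0 := fun n hn x hx => by
    simp only [σ, LinearMap.comp_apply, hπ' n _ hn x hx, map_zero]
  have hσ' : ∀ x ∈ S.gr (q + 1), σ x = r x := fun x hx => by
    simp only [σ, LinearMap.comp_apply, hπ _ x hx, Submodule.subtype_apply]
  -- The element `v - r (d v)` is closed and in the kernel, so it is exact; the primitive has degree
  -- `q - 1`, where no power condition is imposed.
  have hex : ∀ v ∈ V, ∃ y ∈ S.gr (q - 1), φ y = 0 ∧ v - r (S.d v) = S.d y := fun v hv => by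
    obtain ⟨y, hy, hy', h⟩ := hac q (v - r (S.d v)) (Submodule.sub_mem _ hv.1.2 (r (S.d v)).2.1.2)
      (LinearMap.mem_ker.1 (Submodule.sub_mem _ hv.1.1 (r (S.d v)).2.1.1))
      (by rw [map_sub, hr v hv, sub_self])
    exact ⟨y, hy, hy', h.symm⟩
  -- In degree `q + 1` the piece itself is zero, so only differentials from degree `q` remain.
  have htop : ∀ t : ℕ, s ≤ t → ∀ x ∈ kernelFiltration S φ N t (q + 1),
      ∃ b ∈ kernelPiece S φ N t q, x = S.d b := fun t ht x hx => by
    obtain ⟨a, ha, _, ⟨b, hb, rfl⟩, rfl⟩ := Submodule.mem_sup.1 hx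
    rw [add_sub_cancel_right] at hb
    refine ⟨b, hb, ?_⟩
    rw [kernelPiece_eq_bot hN (by rw [mul_add]; omega) ha, zero_add]
  have hpres : ∀ t : ℕ, s ≤ t → t ≤ s + 1 → (kernelPiece S φ N t q ≤ V) → ∀ n,
      ∀ x ∈ kernelFiltration S φ N t n, σ x ∈ kernelFiltration S φ N t (n - 1) := by
    intro t hst hts hle n x hx
    by_cases hn : n = q + 1
    · subst hn
      obtain ⟨b, hb, rfl⟩ := htop t hst x hx
      obtain ⟨y, hy, hy', h⟩ := hex b (hle hb)
      rw [hσ' _ (S.d_mem hb.1.2), add_sub_cancel_right, ← sub_sub_cancel b (r (S.d b) : C), h]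
      refine Submodule.sub_mem _ (Submodule.mem_sup_left hb) (Submodule.mem_sup_right
        ⟨y, mem_kernelPiece_of_nonpos ?_ hy hy', rfl⟩)
      rw [mul_sub]
      omega
    · rw [hσ n hn x (kernelFiltration_le _ _ hx)]
      exact Submodule.zero_mem _
  refine ⟨σ, fun n x hx => ?_, hpres s le_rfl (by omega) le_rfl,
    hpres (s + 1) (by omega) le_rfl (kernelPiece_succ_le s q), fun n x hx => ?_⟩
  · by_cases hn : n = q + 1
    · subst hn
      rw [hσ' x hx, add_sub_cancel_right]
      exact (r x).2.1.2
    · rw [hσ n hn x hx]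
      exact Submodule.zero_mem _
  · have hxn := kernelFiltration_le _ _ hx
    have hlow : ∀ m, m < q → ∀ z ∈ kernelPiece S φ N s m, z ∈ kernelPiece S φ N (s + 1) m :=
      fun m hm z hz => mem_kernelPiece_of_nonpos (by
        have := hmul m (q - 1) (by omega)
        rw [mul_sub] at this
        push_cast
        omega) hz.1.2 hz.1.1
    -- Below `q` the two consecutive steps coincide. In degree `q` the error is a closed element of
    -- the kernel, hence exact. In degree `q + 1` the map `r` inverts `d`, and above that the step
    -- is zero.
    rcases lt_trichotomy n q with hn | hn | hn
    · rw [hσ n (by omega) x hxn, hσ (n + 1) (by omega) _ (S.d_mem hxn), map_zero, sub_zero, sub_zero]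
      obtain ⟨a, ha, _, ⟨b, hb, rfl⟩, rfl⟩ := Submodule.mem_sup.1 hx
      exact Submodule.add_mem _ (Submodule.mem_sup_left (hlow n hn a ha))
        (Submodule.mem_sup_right ⟨b, hlow (n - 1) (by omega) b hb, rfl⟩)
    · subst hn
      obtain ⟨v, hv, _, ⟨b, hb, rfl⟩, rfl⟩ := Submodule.mem_sup.1 hx
      obtain ⟨y, hy, hy', h⟩ := hex v hv
      rw [hσ n (by omega) _ hxn, hσ' _ (S.d_mem hxn), map_zero, sub_zero, map_add, S.d_d, add_zero,
        add_sub_right_comm, h]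
      refine Submodule.add_mem _ (Submodule.mem_sup_right ⟨y, mem_kernelPiece_of_nonpos ?_ hy hy',
        rfl⟩) (Submodule.mem_sup_right ⟨b, hlow _ (by omega) b hb, rfl⟩)
      rw [mul_sub]
      push_cast
      omega
    · by_cases hn' : n = q + 1
      · subst hn'
        obtain ⟨b, hb, rfl⟩ := htop s le_rfl x hx
        rw [hσ' _ hxn, hr b hb, S.d_d, map_zero, sub_self, sub_zero]
        exact Submodule.zero_mem _
      · have : x = 0 := by
          obtain ⟨a, ha, _, ⟨b, hb, rfl⟩, rfl⟩ := Submodule.mem_sup.1 hx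
          have h₁ := hmul (q + 1) n (by omega)
          have h₂ := hmul (q + 1) (n - 1) (by omega)
          rw [mul_add] at h₁ h₂
          rw [kernelPiece_eq_bot hN (by omega) ha, kernelPiece_eq_bot hN (by omega) hb, map_zero,
            add_zero]
        rw [this, map_zero, map_zero, map_zero, sub_zero, sub_zero]
        exact Submodule.zero_mem _

end KernelFiltration

end Artin

/-! ### Homotopy operators on tensor products. -/

section Homotopy

variable {V V' : Type*} [AddCommGroup V] [Module ℝ V] [AddCommGroup V'] [Module ℝ V']
  (S : DGModule V) (S' : DGModule V')

/-- The involution on the first factor gives the cross terms with `d` of that factor opposite signs.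
-/
lemma tensor_homotopy_right (h : V' →ₗ[ℝ] V') (z : V ⊗[ℝ] V') :
    (S.tensor S').d (TensorProduct.map S.sgn h z) + TensorProduct.map S.sgn h ((S.tensor S').d z) =
      TensorProduct.map LinearMap.id (S'.d ∘ₗ h + h ∘ₗ S'.d) z := by
  induction z using TensorProduct.induction_on with
  | zero => simp only [map_zero, add_zero]
  | add x y hx hy => simp only [map_add] at hx hy ⊢; rw [← hx, ← hy]; abel
  | tmul x y =>
    simp only [DGModule.tensor_d_tmul, TensorProduct.map_tmul, map_add, S.sgn_sgn, S.sgn_d,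
      TensorProduct.neg_tmul, LinearMap.id_apply, LinearMap.add_apply, LinearMap.comp_apply,
      TensorProduct.tmul_add]
    abel

/-- An odd operator on the first factor anticommutes with the sign in front of the second
differential, so the cross terms cancel. -/
lemma tensor_homotopy_left {σ : V →ₗ[ℝ] V} (hσ : ∀ x, S.sgn (σ x) = -σ (S.sgn x))
    (z : V ⊗[ℝ] V') : (S.tensor S').d (TensorProduct.map σ LinearMap.id z) +
      TensorProduct.map σ LinearMap.id ((S.tensor S').d z) =
        TensorProduct.map (S.d ∘ₗ σ + σ ∘ₗ S.d) LinearMap.id z := by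
  induction z using TensorProduct.induction_on with
  | zero => simp only [map_zero, add_zero]
  | add x y hx hy => simp only [map_add] at hx hy ⊢; rw [← hx, ← hy]; abel
  | tmul x y =>
    simp only [DGModule.tensor_d_tmul, TensorProduct.map_tmul, map_add, hσ,
      TensorProduct.neg_tmul, LinearMap.id_apply, LinearMap.add_apply, LinearMap.comp_apply,
      TensorProduct.add_tmul]
    abel

variable {S}

lemma sgn_map_of_degree_neg_one {σ : V →ₗ[ℝ] V} (hσ : ∀ n, ∀ x ∈ S.gr n, σ x ∈ S.gr (n - 1))
    (x : V) : S.sgn (σ x) = -σ (S.sgn x) := by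
  induction x using S.induction with
  | hadd x y hx hy => simp only [map_add, hx, hy, neg_add]
  | h n x hx =>
    rw [S.sgn_of_mem (hσ n x hx), S.sgn_of_mem hx, map_smul, ← neg_smul, ← neg_one_zpow_succ]
    congr 1
    exact neg_one_zpow_congr (by rw [Int.even_sub_one, Int.even_add_one])

end Homotopy

/-! ### Barycentric coordinates as forms of degree zero. -/

section CoordForm

set_option linter.unusedSectionVars false

variable {J J' : Type} [Fintype J] [DecidableEq J] [Fintype J'] [DecidableEq J']

/-- Functions on the simplex as forms of degree zero. -/
def funForm : simplexFun J →ₗ[ℝ] SimplexForms J :=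
  (TensorProduct.mk ℝ (ExteriorAlgebra ℝ (Cotangent J)) (simplexFun J) 1 :
    simplexFun J →ₗ[ℝ] Forms (Cotangent J) (simplexFun J))

lemma funForm_one : funForm (1 : simplexFun J) = 1 := rfl

lemma funForm_mem (a : simplexFun J) : funForm a ∈ simplexGrading J 0 :=
  tmul_mem_formsGrading one_mem_extGrading a

lemma simplexPullback_funForm (θ : J' → J) (a : simplexFun J) :
    simplexPullback θ (funForm a) = funForm (simplexComp θ a) := by
  rw [simplexPullback_eq_formsMap]
  refine (formsMap_tmul θ 1 a).trans ?_
  rw [map_one]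
  rfl

/-- A barycentric coordinate as a form of degree zero. -/
def coordForm (j : J) : SimplexForms J := funForm (baryCoord j)

lemma coordForm_mem (j : J) : coordForm j ∈ simplexGrading J 0 := funForm_mem _

lemma sum_coordForm : ∑ j : J, coordForm j = 1 := by
  have : ∑ j : J, coordForm j = funForm (∑ j : J, baryCoord j) := (map_sum funForm _ _).symm
  rw [this, sum_baryCoord, funForm_one]

lemma simplexPullback_coordForm (θ : J' → J) (j : J) :
    simplexPullback θ (coordForm j) = ∑ i, if θ i = j then coordForm i else 0 := by
  rw [coordForm, simplexPullback_funForm, simplexComp_baryCoord, map_sum]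
  refine Finset.sum_congr rfl fun i _ => ?_
  split_ifs
  · rfl
  · exact map_zero _

end CoordForm

/-! ### Kan fibrations and trivial fibrations from surjections of coefficients. -/

section Lifting

variable {L C C' : Type u} [AddCommGroup L] [Module ℝ L] [AddCommGroup C] [Module ℝ C]
  [AddCommGroup C'] [Module ℝ C'] (G : DGLie L) {S : DGComm C} {S' : DGComm C'}
  {φ : C →ₗ[ℝ] C'}

section CoordMul

variable {J J' : Type} [Fintype J] [DecidableEq J] [Fintype J'] [DecidableEq J']

variable (L C) in
/-- Multiplication by a barycentric coordinate. -/
def coordMul (j : J) : L ⊗[ℝ] (C ⊗[ℝ] SimplexForms J) →ₗ[ℝ] L ⊗[ℝ] (C ⊗[ℝ] SimplexForms J) :=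
  TensorProduct.map LinearMap.id (TensorProduct.map LinearMap.id
    (LinearMap.mulLeft ℝ (coordForm j)))

variable (S) in
lemma coordMul_mem (j : J) {n : ℤ} {x : L ⊗[ℝ] (C ⊗[ℝ] SimplexForms J)}
    (hx : x ∈ (G.onSimplex S J).gr n) : coordMul L C j x ∈ (G.onSimplex S J).gr n :=
  map_mem_gradedTensor (a := 0) (b := 0) (fun p x hx => by simpa using hx)
    (fun p x hx => map_mem_gradedTensor (a := 0) (b := 0) (fun q y hy => by simpa using hy)
      (fun q y hy => by
        rw [add_comm]
        exact mul_mem_simplexGrading (coordForm_mem j) hy) (by omega) hx) (by omega) hx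

lemma sum_coordMul (x : L ⊗[ℝ] (C ⊗[ℝ] SimplexForms J)) : ∑ j, coordMul L C j x = x := by
  have h : ∑ j : J, coordMul L C j = LinearMap.id := by
    ext x a w
    simp only [coordMul, LinearMap.sum_apply, TensorProduct.AlgebraTensorModule.curry_apply,
      LinearMap.restrictScalars_self, TensorProduct.curry_apply, 
      TensorProduct.map_tmul, LinearMap.id_apply,
      LinearMap.mulLeft_apply, ← TensorProduct.tmul_sum, ← Finset.sum_mul, sum_coordForm, one_mul]
  rw [← LinearMap.sum_apply, h, LinearMap.id_apply]

lemma coeffMap_coordMul (θ : J' → J) (j : J) (x : L ⊗[ℝ] (C ⊗[ℝ] SimplexForms J)) :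
    coeffMap L (LinearMap.id : C →ₗ[ℝ] C) θ (coordMul L C j x) =
      ∑ i, if θ i = j then coordMul L C i (coeffMap L (LinearMap.id : C →ₗ[ℝ] C) θ x) else 0 := by
  have h : coeffMap L (LinearMap.id : C →ₗ[ℝ] C) θ ∘ₗ coordMul L C j = ∑ i, if θ i = j then
      coordMul L C i ∘ₗ coeffMap L (LinearMap.id : C →ₗ[ℝ] C) θ else 0 := by
    ext x a w
    simp only [coordMul, coeffMap, LinearMap.sum_apply, TensorProduct.AlgebraTensorModule.curry_apply,
      LinearMap.restrictScalars_self, TensorProduct.curry_apply, LinearMap.comp_apply,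
      TensorProduct.map_tmul, LinearMap.id_apply, LinearMap.mulLeft_apply, AlgHom.toLinearMap_apply,
      map_mul, simplexPullback_coordForm, Finset.sum_mul, TensorProduct.tmul_sum]
    refine Finset.sum_congr rfl fun i _ => ?_
    split_ifs
    · simp only [LinearMap.comp_apply, TensorProduct.map_tmul, LinearMap.id_apply,
        LinearMap.mulLeft_apply, AlgHom.toLinearMap_apply]
    · rw [zero_mul, TensorProduct.tmul_zero, TensorProduct.tmul_zero, LinearMap.zero_apply]
  refine (LinearMap.congr_fun h x).trans ?_
  rw [LinearMap.sum_apply]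
  refine Finset.sum_congr rfl fun i _ => ?_
  split_ifs <;> rfl

end CoordMul

section Poincare

set_option linter.unusedSectionVars false

variable {J J' : Type} [Fintype J] [DecidableEq J] [Fintype J'] [DecidableEq J']

variable (S) in
-- The contraction to a vertex is compatible with every face that contains the vertex. Therefore it
-- preserves the elements that vanish on a horn at this vertex.
lemma coeffMap_map_poincare (θ : J' → J) {k : J} (k' : J') (hk : θ k' = k)
    (x : L ⊗[ℝ] (C ⊗[ℝ] SimplexForms J)) : coeffMap L (LinearMap.id : C →ₗ[ℝ] C) θ
      (TensorProduct.map G.sgn (TensorProduct.map S.sgn (poincare k)) x) =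
        TensorProduct.map G.sgn (TensorProduct.map S.sgn (poincare k'))
          (coeffMap L (LinearMap.id : C →ₗ[ℝ] C) θ x) := by
  subst hk
  have h : coeffMap L (LinearMap.id : C →ₗ[ℝ] C) θ ∘ₗ
      TensorProduct.map G.sgn (TensorProduct.map S.sgn (poincare (θ k'))) =
        TensorProduct.map G.sgn (TensorProduct.map S.sgn (poincare k')) ∘ₗ
          coeffMap L (LinearMap.id : C →ₗ[ℝ] C) θ := by
    ext x a w
    simp [coeffMap, poincare_pullback]
  exact LinearMap.congr_fun h x

variable (S) in
lemma tensor_poincare_homotopy (k : J) : (S.tensor (simplexAlg J)).d ∘ₗ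
    TensorProduct.map S.sgn (poincare k) + TensorProduct.map S.sgn (poincare k) ∘ₗ
      (S.tensor (simplexAlg J)).d = LinearMap.id - TensorProduct.map LinearMap.id
        (simplexPullback (fun _ : J => k)).toLinearMap := by
  ext z w
  refine (tensor_homotopy_right S.toDGModule (simplexAlg J).toDGModule (poincare k)
    (z ⊗ₜ w)).trans ?_
  have h := simplexD_poincare k w
  rw [TensorProduct.map_tmul]
  refine (congrArg (z ⊗ₜ[ℝ] ·) h).trans ?_
  rw [TensorProduct.tmul_sub]
  rfl

variable (S) in
lemma map_poincare_homotopy (k : J) (x : L ⊗[ℝ] (C ⊗[ℝ] SimplexForms J)) :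
    (G.onSimplex S J).d (TensorProduct.map G.sgn (TensorProduct.map S.sgn (poincare k)) x) +
      TensorProduct.map G.sgn (TensorProduct.map S.sgn (poincare k)) ((G.onSimplex S J).d x) =
        x - coeffMap L (LinearMap.id : C →ₗ[ℝ] C) (fun _ : J => k) x := by
  refine (tensor_homotopy_right G.toDGModule (S.tensor (simplexAlg J)).toDGModule _ x).trans ?_
  rw [tensor_poincare_homotopy]
  have h' : TensorProduct.map LinearMap.id (LinearMap.id - TensorProduct.map LinearMap.id
      (simplexPullback (fun _ : J => k)).toLinearMap) =
      LinearMap.id - coeffMap L (LinearMap.id : C →ₗ[ℝ] C) (fun _ : J => k) := by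
    ext x z w
    simp [coeffMap, TensorProduct.tmul_sub]
  exact LinearMap.congr_fun h' x

lemma coeffMap_map_sgn (σ : C →ₗ[ℝ] C) (θ : J' → J) (x : L ⊗[ℝ] (C ⊗[ℝ] SimplexForms J)) :
    coeffMap L (LinearMap.id : C →ₗ[ℝ] C) θ
      (TensorProduct.map G.sgn (TensorProduct.map σ LinearMap.id) x) =
        TensorProduct.map G.sgn (TensorProduct.map σ LinearMap.id)
          (coeffMap L (LinearMap.id : C →ₗ[ℝ] C) θ x) := by
  have h : coeffMap L (LinearMap.id : C →ₗ[ℝ] C) θ ∘ₗ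
      TensorProduct.map G.sgn (TensorProduct.map σ LinearMap.id) =
        TensorProduct.map G.sgn (TensorProduct.map σ LinearMap.id) ∘ₗ
          coeffMap L (LinearMap.id : C →ₗ[ℝ] C) θ := by
    ext x a w
    simp [coeffMap]
  exact LinearMap.congr_fun h x

lemma map_left_homotopy {σ : C →ₗ[ℝ] C} (hσ : ∀ n, ∀ x ∈ S.gr n, σ x ∈ S.gr (n - 1))
    (x : L ⊗[ℝ] (C ⊗[ℝ] SimplexForms J)) :
    (G.onSimplex S J).d (TensorProduct.map G.sgn (TensorProduct.map σ LinearMap.id) x) +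
      TensorProduct.map G.sgn (TensorProduct.map σ LinearMap.id) ((G.onSimplex S J).d x) =
        coeffMap L (S.d ∘ₗ σ + σ ∘ₗ S.d) id x := by
  refine (tensor_homotopy_right G.toDGModule (S.tensor (simplexAlg J)).toDGModule _ x).trans ?_
  have h : (S.tensor (simplexAlg J)).d ∘ₗ TensorProduct.map σ LinearMap.id +
      TensorProduct.map σ LinearMap.id ∘ₗ (S.tensor (simplexAlg J)).d =
        TensorProduct.map (S.d ∘ₗ σ + σ ∘ₗ S.d) (simplexPullback (id : J → J)).toLinearMap := by
    ext z w
    refine (tensor_homotopy_left S.toDGModule (simplexAlg J).toDGModule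
      (sgn_map_of_degree_neg_one hσ) (z ⊗ₜ w)).trans ?_
    simp [simplexPullback_id]
  rw [h]
  rfl

end Poincare

lemma exists_homogeneous_preimage {T : DGModule C} {T' : DGModule C'} (hT : T.IsBounded)
    (hT' : T'.IsBounded) (hφ : T.IsHom T' φ) (hsurj : Function.Surjective φ) (n : ℤ) (y : C')
    (hy : y ∈ T'.gr n) : ∃ x ∈ T.gr n, φ x = y := by
  obtain ⟨π, h, h'⟩ := hT.proj
  obtain ⟨π', k, k'⟩ := hT'.proj
  obtain ⟨x, rfl⟩ := hsurj y
  refine ⟨π n x, proj_mem h h' n x, ?_⟩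
  have := map_proj h h' k k' 0 (fun n x hx => by rw [add_zero]; exact hφ.map_gr hx) n x
  rwa [add_zero, k n _ hy] at this

/-- Surjections of coefficients induce Kan fibrations. -/
theorem mcSpaceMap_isKanFibration (hS : S.IsArtin) (hS' : S'.IsArtin) (hφ : S.IsHom S' φ)
    (hsurj : Function.Surjective φ) : IsKanFibration (mcSpaceMap G hφ) := by
  obtain ⟨u, hu, hφu⟩ := hS'.exists_graded_section hφ.toIsHom
    (exists_homogeneous_preimage hS.toIsBounded hS'.toIsBounded hφ.toIsHom hsurj)
  obtain ⟨N, hN⟩ := hS.nilpotent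
  refine isKanFibration_of_exists _ fun n k a b ha hab => ?_
  let α : Fin (n + 2) → L ⊗[ℝ] (C ⊗[ℝ] SimplexForms (Fin (n + 1))) := fun i => (a i).1
  let β : L ⊗[ℝ] (C' ⊗[ℝ] SimplexForms (Fin (n + 2))) := b.1
  have hβ : β ∈ G.mcElements S' (Fin (n + 2)) := b.2
  have hα : ∀ i, α i ∈ G.mcElements S (Fin (n + 1)) := fun i => (a i).2
  have hαβ : ∀ i ≠ k, coeffMap L φ id (α i) = coeffMap L LinearMap.id i.succAbove β :=
    fun i hi => congrArg Subtype.val (hab i hi)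
  obtain ⟨w, hw, hwα⟩ := exists_horn_extension
    (V := fun n => L ⊗[ℝ] (C ⊗[ℝ] SimplexForms (Fin n)))
    (fun n => ((G.onSimplex S (Fin n)).gr 1).toAddSubgroup)
    (fun f => (coeffMap L LinearMap.id f).toAddMonoidHom) coeffMap_id
    (fun f g x => coeffMap_pull_pull g f x)
    (fun f x hx => (coeffMap_isHom G S.isHom_id f).map_gr hx) k α
    (fun i _ => (hα i).1) (fun i hi j hj f f' hf => compatible_of_isCompatibleFamily G ha hi hj f f' hf)
  replace hwα : ∀ i ≠ k, coeffMap L (LinearMap.id : C →ₗ[ℝ] C) i.succAbove w = α i := hwα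
  let ι := {i : Fin (n + 2) // i ≠ k}
  have hk : ∀ i : ι, ∃ k' : Fin (n + 1), i.1.succAbove k' = k := fun i =>
    Fin.exists_succAbove_eq i.2.symm
  -- The Poincaré contraction leaves the coefficients alone up to sign, so the plain filtration of
  -- the kernel by powers is enough.
  let Q : ℕ → ℤ → Submodule ℝ C := fun s m => LinearMap.ker φ ⊓ S.gr m ⊓ S.mpow s
  have hη : ∀ s m, ∀ x ∈ G.part (Q s) (Fin (n + 2)) (m + 1),
      TensorProduct.map G.sgn (TensorProduct.map S.sgn (poincare k)) x ∈
        G.part (Q s) (Fin (n + 2)) m := fun s m x hx =>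
    map_mem_gradedTensor (a := 0) (b := -1)
      (fun p x hx => by rw [add_zero]; exact G.sgn_mem hx)
      (fun p x hx => map_mem_gradedTensor (a := 0) (b := -1)
        (fun q y hy => by
          rw [add_zero, S.sgn_of_mem hy.1.2]
          exact Submodule.smul_mem _ _ hy)
        (fun q y hy => poincare_mem k hy) (by omega) hx) (by omega) hx
  have hηk : ∀ (i : ι) (k' : Fin (n + 1)), i.1.succAbove k' = k → ∀ x,
      coeffMap L (LinearMap.id : C →ₗ[ℝ] C) i.1.succAbove
        (TensorProduct.map G.sgn (TensorProduct.map S.sgn (poincare k)) x) =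
      TensorProduct.map G.sgn (TensorProduct.map S.sgn (poincare k'))
        (coeffMap L (LinearMap.id : C →ₗ[ℝ] C) i.1.succAbove x) := fun i k' hk' x =>
    coeffMap_map_poincare G S i.1.succAbove k' hk' x
  obtain ⟨y, hy, hyc, hyw, hyβ⟩ := exists_mc_lift G hφ (fun {n x} h => hu n x h) hφu (N := N) Q
    (fun s m => inf_le_left.trans inf_le_right)
    (fun s m x hx => LinearMap.mem_ker.1 hx.1.1)
    (fun m x hx hx' => ⟨⟨hx', hx⟩, Submodule.mem_top⟩)
    (fun s m => inf_le_inf_left _ (S.mpow_succ_le s))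
    (fun s p m c hc x hx => ⟨⟨by
      rw [SetLike.mem_coe, LinearMap.mem_ker, hφ.map_mul, LinearMap.mem_ker.1 hx.1.1, map_zero],
      S.mul_mem hc hx.1.2⟩, S.mul_mem_mpow c hx.2⟩)
    (fun m => eq_bot_iff.2 fun x hx => by
      have := hx.2
      rwa [hN] at this)
    (ι := ι) (fun i => i.1.succAbove)
    (fun _ => TensorProduct.map G.sgn (TensorProduct.map S.sgn (poincare k)))
    hη (fun s => hη (s + 1))
    (fun s x hx i => by
      obtain ⟨k', hk'⟩ := hk i
      rw [hηk i k' hk', hx i, map_zero])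
    (fun s x hx hx' => by
      obtain ⟨i, hi⟩ := exists_ne k
      obtain ⟨k', hk'⟩ := hk ⟨i, hi⟩
      -- The error term of the Poincaré lemma is the value at the vertex `k`. This vertex lies on a
      -- face of the horn, where `x` vanishes.
      have h : coeffMap L (LinearMap.id : C →ₗ[ℝ] C) (fun _ : Fin (n + 2) => k) x = 0 := by
        have h₁ := coeffMap_pull_pull (C := C) (L := L) i.succAbove (fun _ : Fin (n + 2) => k') x
        rw [hx' ⟨i, hi⟩, map_zero] at h₁
        rw [show (fun _ : Fin (n + 2) => k) = i.succAbove ∘ fun _ => k' from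
          funext fun _ => hk'.symm, ← h₁]
      rw [sub_sub, map_poincare_homotopy G S k x, h, sub_zero, sub_self]
      exact Submodule.zero_mem _)
    hw (fun i => by rw [hwα i.1 i.2]; exact (hα i.1).2) hβ.1 hβ.2
    (fun i => by rw [hwα i.1 i.2]; exact hαβ i.1 i.2)
  refine ⟨⟨y, hy, hyc⟩, fun i hi => Subtype.ext ((hyw ⟨i, hi⟩).trans (hwα i hi)),
    Subtype.ext hyβ⟩

/-- Surjections of coefficients with acyclic kernel induce trivial fibrations. -/
theorem mcSpaceMap_rlp_boundary (hS : S.IsArtin) (hS' : S'.IsArtin) (hφ : S.IsHom S' φ)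
    (hsurj : Function.Surjective φ)
    (hac : ∀ n, ∀ x ∈ S.gr n, φ x = 0 → S.d x = 0 → ∃ y ∈ S.gr (n - 1), φ y = 0 ∧ S.d y = x) :
    SSet.modelCategoryQuillen.I.rlp (mcSpaceMap G hφ) := by
  obtain ⟨u, hu, hφu⟩ := hS'.exists_graded_section hφ.toIsHom
    (exists_homogeneous_preimage hS.toIsBounded hS'.toIsBounded hφ.toIsHom hsurj)
  obtain ⟨N₀, hN₀⟩ := hS.nilpotent
  -- The degree shift of the filtration is found by division by `N`, so `N` is made positive.
  obtain ⟨N, hN0, hN⟩ : ∃ N, 0 < N ∧ S.mpow N = ⊥ :=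
    ⟨N₀ + 1, N₀.succ_pos, eq_bot_iff.2 ((S.mpow_succ_le N₀).trans hN₀.le)⟩
  obtain ⟨N', hN'⟩ := kernelFiltration_eq_bot (φ := φ) hS hN
  choose σ hσgr hσ hσ' hσd using exists_kernelFiltration_contraction (φ := φ) hS hN hN0 hac
  have key : ∀ {n : ℕ} {ι : Type} {J' : Type} [Fintype J'] [DecidableEq J']
      (θ : ι → J' → Fin n) {w : L ⊗[ℝ] (C ⊗[ℝ] SimplexForms (Fin n))},
      w ∈ (G.onSimplex S (Fin n)).gr 1 →
      (∀ i, (G.onSimplex S J').curv (coeffMap L LinearMap.id (θ i) w) = 0) →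
      ∀ {β : L ⊗[ℝ] (C' ⊗[ℝ] SimplexForms (Fin n))}, β ∈ (G.onSimplex S' (Fin n)).gr 1 →
      (G.onSimplex S' (Fin n)).curv β = 0 →
      (∀ i, coeffMap L φ id (coeffMap L LinearMap.id (θ i) w) =
        coeffMap L LinearMap.id (θ i) β) →
      ∃ y ∈ (G.onSimplex S (Fin n)).gr 1, (G.onSimplex S (Fin n)).curv y = 0 ∧
        (∀ i, coeffMap L (LinearMap.id : C →ₗ[ℝ] C) (θ i) y = coeffMap L LinearMap.id (θ i) w) ∧
        coeffMap L φ id y = β := by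
    intro n ι J' _ _ θ w hw hwθ β hβ hβ' hwβ
    have hη : ∀ (σ : C →ₗ[ℝ] C) (Q : ℤ → Submodule ℝ C), (∀ n, ∀ x ∈ Q n, σ x ∈ Q (n - 1)) →
        ∀ m, ∀ x ∈ G.part Q (Fin n) (m + 1), TensorProduct.map G.sgn
          (TensorProduct.map σ LinearMap.id) x ∈ G.part Q (Fin n) m := fun σ Q hQ m x hx =>
      map_mem_gradedTensor (a := 0) (b := -1)
        (fun p x hx => by rw [add_zero]; exact G.sgn_mem hx)
        (fun p x hx => map_mem_gradedTensor (a := -1) (b := 0) (fun q y hy => hQ q y hy)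
          (fun q y hy => by rwa [add_zero]) (by omega) hx) (by omega) hx
    refine exists_mc_lift G hφ (fun {n x} h => hu n x h) hφu (N := N')
      (fun s m => kernelFiltration S φ N s m)
      (fun s m => kernelFiltration_le s m)
      (fun s m x hx => LinearMap.mem_ker.1 (kernelFiltration_map hφ s m hx))
      (fun m x hx hx' => mem_kernelFiltration_zero hS hx hx')
      (fun s m => kernelFiltration_succ_le s m)
      (fun s p m c hc x hx => mul_mem_kernelFiltration hφ hS hc hx)
      hN' θ (fun s => TensorProduct.map G.sgn (TensorProduct.map (σ s) LinearMap.id))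
      (fun s => hη (σ s) _ (hσ s)) (fun s => hη (σ s) _ (hσ' s))
      -- The contraction acts on coefficients only and commutes with restriction to any set of
      -- faces, in particular to the full boundary.
      (fun s x hx i => by
        rw [coeffMap_map_sgn, hx i, map_zero])
      (fun s x hx _ => ?_) hw hwθ hβ hβ' hwβ
    rw [sub_sub, map_left_homotopy G (hσgr s)]
    have h := coeffMap_mem G (f := LinearMap.id - (S.d ∘ₗ σ s + σ s ∘ₗ S.d)) (fun m x hx => by
      have := hσd s m x hx
      rwa [sub_sub] at this) (id : Fin n → Fin n) hx
    rwa [coeffMap_sub, coeffMap_id] at h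
  refine rlp_boundary_of_exists _ (fun b => ?_) fun n a b ha hab => ?_
  -- On the `0`-simplex there are no faces to respect: the index type is empty and the lift starts
  -- from zero.
  · obtain ⟨y, hy, hyc, -, hyβ⟩ := key (ι := PEmpty) (J' := Fin 1) (fun i => i.elim)
      (Submodule.zero_mem _) (fun i => i.elim) b.2.1 b.2.2 (fun i => i.elim)
    exact ⟨⟨y, hy, hyc⟩, Subtype.ext hyβ⟩
  · let α : Fin (n + 2) → L ⊗[ℝ] (C ⊗[ℝ] SimplexForms (Fin (n + 1))) := fun i => (a i).1
    have hα : ∀ i, α i ∈ G.mcElements S (Fin (n + 1)) := fun i => (a i).2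
    have hαβ : ∀ i, coeffMap L φ id (α i) = coeffMap L LinearMap.id i.succAbove b.1 :=
      fun i => congrArg Subtype.val (hab i)
    obtain ⟨w, hw, hwα⟩ := exists_boundary_extension
      (V := fun n => L ⊗[ℝ] (C ⊗[ℝ] SimplexForms (Fin n)))
      (fun n => ((G.onSimplex S (Fin n)).gr 1).toAddSubgroup)
      (fun f => (coeffMap L LinearMap.id f).toAddMonoidHom) coeffMap_id
      (fun f g x => coeffMap_pull_pull g f x)
      (fun f x hx => (coeffMap_isHom G S.isHom_id f).map_gr hx)
      (fun j => (coordMul L C j).toAddMonoidHom) (fun j x hx => coordMul_mem G S j hx)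
      sum_coordMul coeffMap_coordMul α
      (fun i => (hα i).1) (fun i j f f' hf => compatible_of_isCompatibleFamily G ha
        (Set.mem_univ i) (Set.mem_univ j) f f' hf)
    replace hwα : ∀ i, coeffMap L (LinearMap.id : C →ₗ[ℝ] C) i.succAbove w = α i := hwα
    obtain ⟨y, hy, hyc, hyw, hyβ⟩ := key
      (fun i : Fin (n + 2) => i.succAbove) hw
      (fun i => by rw [hwα i]; exact (hα i).2) b.2.1 b.2.2 (fun i => by rw [hwα i]; exact hαβ i)
    exact ⟨⟨y, hy, hyc⟩, fun i => Subtype.ext ((hyw i).trans (hwα i)), Subtype.ext hyβ⟩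

end Lifting

/-! ### Dg subalgebras spanned by homogeneous subspaces. -/

section OfGraded

variable {C C' : Type*} [AddCommGroup C] [Module ℝ C] [AddCommGroup C'] [Module ℝ C']

/-- The dg subalgebra spanned by a family of homogeneous subspaces. -/
def DGComm.ofGraded (S : DGComm C) (K : ℤ → Submodule ℝ C) (hK : ∀ n, K n ≤ S.gr n)
    (hd : ∀ n, ∀ x ∈ K n, S.d x ∈ K (n + 1))
    (hmul : ∀ p q, ∀ x ∈ K p, ∀ y ∈ K q, S.mul x y ∈ K (p + q)) : DGComm ↥(⨆ n, K n) :=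
  have hind : ∀ {M : C → Prop}, (∀ n, ∀ x ∈ K n, M x) → (∀ x y, M x → M y → M (x + y)) →
      ∀ x ∈ ⨆ n, K n, M x := fun {M} h hadd x hx =>
    Submodule.iSup_induction K (motive := M) hx h (h 0 0 (Submodule.zero_mem _)) hadd
  have hle : ∀ n, K n ≤ ⨆ n, K n := le_iSup K
  { gr := fun n => (K n).comap (⨆ n, K n).subtype
    iSup_gr := by
      refine eq_top_iff.2 fun x _ => ?_
      obtain ⟨x, hx⟩ := x
      obtain ⟨h, h'⟩ := hind (M := fun x => ∃ h : x ∈ ⨆ n, K n, (⟨x, h⟩ : ↥(⨆ n, K n)) ∈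
          ⨆ n, (K n).comap (⨆ n, K n).subtype)
        (fun n x hx => ⟨hle n hx, Submodule.mem_iSup_of_mem n hx⟩)
        (fun x y ⟨hx, hx'⟩ ⟨hy, hy'⟩ => ⟨Submodule.add_mem _ hx hy, Submodule.add_mem _ hx' hy'⟩) x hx
      exact h'
    sgn := S.sgn.restrict (hind (fun n x hx => by
      rw [S.sgn_of_mem (hK n hx)]
      exact Submodule.smul_mem _ _ (hle n hx)) fun x y hx hy => by
        rw [map_add]
        exact Submodule.add_mem _ hx hy)
    sgn_of_mem := fun {n x} hx => Subtype.ext (S.sgn_of_mem (hK n hx))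
    d := S.d.restrict (hind (fun n x hx => hle _ (hd n x hx)) fun x y hx hy => by
        rw [map_add]
        exact Submodule.add_mem _ hx hy)
    d_mem := fun {n x} hx => hd n x.1 hx
    d_d := fun x => Subtype.ext (S.d_d x.1)
    mul := LinearMap.mk₂ ℝ (fun x y => ⟨S.mul x.1 y.1, by
        refine hind (M := fun x => S.mul x y.1 ∈ ⨆ n, K n) (fun p x hx => ?_) (fun x y hx hy => by
          rw [map_add]
          exact Submodule.add_mem _ hx hy) x.1 x.2
        exact hind (M := fun y => S.mul x y ∈ ⨆ n, K n)
          (fun q y hy => hle _ (hmul p q x hx y hy)) (fun y y' hy hy' => by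
            rw [map_add]
            exact Submodule.add_mem _ hy hy') y.1 y.2⟩)
      (fun x x' y => Subtype.ext (LinearMap.map_add₂ S.mul x.1 x'.1 y.1))
      (fun r x y => Subtype.ext (LinearMap.map_smul₂ S.mul r x.1 y.1))
      (fun x y y' => Subtype.ext (map_add (S.mul x.1) y.1 y'.1))
      (fun r x y => Subtype.ext (map_smul (S.mul x.1) r y.1))
    mul_mem := fun {p q x y} hx hy => hmul p q x.1 hx y.1 hy
    leibniz := fun {p x} hx y => Subtype.ext (S.leibniz (hK p hx) y.1)
    comm := fun {p q x y} hx hy => Subtype.ext (S.comm (hK p hx) (hK q hy))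
    assoc := fun x y z => Subtype.ext (S.assoc x.1 y.1 z.1) }

section

variable {S : DGComm C} {S' : DGComm C'} {K : ℤ → Submodule ℝ C} {hK : ∀ n, K n ≤ S.gr n}
  {hd : ∀ n, ∀ x ∈ K n, S.d x ∈ K (n + 1)}
  {hmul : ∀ p q, ∀ x ∈ K p, ∀ y ∈ K q, S.mul x y ∈ K (p + q)}

lemma ofGraded_subtype_isHom :
    (S.ofGraded K hK hd hmul).IsHom S (⨆ n, K n).subtype where
  map_gr {n _} hx := hK n hx
  map_d _ := rfl
  map_mul _ _ := rfl

lemma exists_proj_ofGraded {π : ℤ → C →ₗ[ℝ] C} (h : ∀ n, ∀ x ∈ S.gr n, π n x = x)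
    (h' : ∀ m n, m ≠ n → ∀ x ∈ S.gr m, π n x = 0) :
    ∃ π' : ℤ → ↥(⨆ n, K n) →ₗ[ℝ] ↥(⨆ n, K n),
      (∀ n, ∀ x ∈ (S.ofGraded K hK hd hmul).gr n, π' n x = x) ∧
      ∀ m n, m ≠ n → ∀ x ∈ (S.ofGraded K hK hd hmul).gr m, π' n x = 0 := by
  have hπ : ∀ n, ∀ x ∈ ⨆ n, K n, π n x ∈ ⨆ n, K n := fun n x hx => by
    refine Submodule.iSup_induction K (motive := fun x => π n x ∈ ⨆ n, K n) hx (fun m x hx => ?_)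
      (by rw [map_zero]; exact Submodule.zero_mem _)
      (fun x y hx hy => by rw [map_add]; exact Submodule.add_mem _ hx hy)
    by_cases hmn : m = n
    · subst hmn
      rw [h m x (hK m hx)]
      exact le_iSup K m hx
    · rw [h' m n hmn x (hK m hx)]
      exact Submodule.zero_mem _
  exact ⟨fun n => (π n).restrict (hπ n), fun n x hx => Subtype.ext (h n x.1 (hK n hx)),
    fun m n hmn x hx => Subtype.ext (h' m n hmn x.1 (hK m hx))⟩

/-- Any filtration of the ambient space that multiplication raises bounds the powers of the
subalgebra; nilpotency is read off from a convenient one. -/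
lemma mpow_ofGraded_le {P : ℕ → Submodule ℝ C} (h₀ : ∀ x ∈ ⨆ n, K n, x ∈ P 0)
    (h : ∀ s, ∀ x ∈ ⨆ n, K n, ∀ y ∈ P s, S.mul x y ∈ P (s + 1)) (s : ℕ) :
    (S.ofGraded K hK hd hmul).mpow s ≤ (P s).comap (⨆ n, K n).subtype := by
  induction s with
  | zero => exact fun x _ => h₀ x.1 x.2
  | succ s ih => exact Submodule.map₂_le.2 fun x _ y hy => h s x.1 x.2 y.1 (ih hy)

end

end OfGraded

lemma exists_proj_of_decomposition {V : Type*} [AddCommGroup V] [Module ℝ V]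
    (𝒱 : ℤ → Submodule ℝ V) [DirectSum.Decomposition 𝒱] : ∃ π : ℤ → V →ₗ[ℝ] V,
      (∀ n, ∀ x ∈ 𝒱 n, π n x = x) ∧ ∀ m n, m ≠ n → ∀ x ∈ 𝒱 m, π n x = 0 :=
  ⟨fun n => (𝒱 n).subtype ∘ₗ DirectSum.component ℝ ℤ (fun n => 𝒱 n) n ∘ₗ
      (DirectSum.decomposeLinearEquiv 𝒱).toLinearMap,
    fun _ _ hx => DirectSum.decompose_of_mem_same 𝒱 hx,
    fun _ _ hmn _ hx => DirectSum.decompose_of_mem_ne 𝒱 hx hmn⟩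

/-- A differential graded Lie algebra as a structure on its total space. -/
def DGLie.ofData {g : DGLAData.{u}} (hg : g.IsDGLA) : DGLie g.carrier where
  gr := g.gr
  iSup_gr := iSup_of_decomposition _
  sgn := parity g.gr
  sgn_of_mem hx := parity_of_mem _ hx
  d := g.d
  d_mem hx := hg.d_mem _ _ hx
  d_d := hg.d_d
  br := g.br
  br_mem hx hy := hg.br_mem _ _ _ hx _ hy
  leibniz hx y := hg.leibniz _ _ hx y
  antisymm hx hy := hg.antisymm _ _ _ hx _ hy
  jacobi hx hy z := hg.jacobi _ _ _ hx _ hy z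

/-! ### The maximal ideal of a dg Artinian algebra as coefficient algebra. -/

namespace DGArt

variable (A : DGArt.{u})

/-- The graded commutative dg algebra underlying a dg Artinian algebra. -/
def alg : DGComm A.carrier where
  gr := A.gr
  iSup_gr := iSup_of_decomposition _
  sgn := parity A.gr
  sgn_of_mem hx := parity_of_mem _ hx
  d := A.d
  d_mem hx := A.d_mem _ _ hx
  d_d := A.d_d
  mul := LinearMap.mul ℝ A.carrier
  mul_mem hx hy := SetLike.mul_mem_graded hx hy
  leibniz hx y := A.leibniz _ _ hx y
  comm hx hy := A.graded_comm _ _ _ hx _ hy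
  assoc := mul_assoc

/-- The homogeneous elements of the maximal ideal. -/
def maxGr (n : ℤ) : Submodule ℝ A.carrier := A.gr n ⊓ A.m.restrictScalars ℝ

/-- The maximal ideal of a dg Artinian algebra. -/
abbrev Max : Type u := ↥(⨆ n, A.maxGr n)

/-- The maximal ideal of a dg Artinian algebra as a graded commutative dg algebra. -/
def maxAlg : DGComm A.Max :=
  A.alg.ofGraded A.maxGr (fun _ => inf_le_left)
    (fun n x hx => ⟨A.d_mem n x hx.1, A.d_mem_m x hx.2⟩)
    (fun _ _ x hx _ hy => ⟨SetLike.mul_mem_graded hx.1 hy.1, A.m.mul_mem_left x hy.2⟩)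

variable {A}

/-- One inclusion suffices: `degreeOne` is spanned by tensors whose middle factor is a homogeneous
element of the maximal ideal. -/
lemma mem_m_of_mem_iSup {x : A.carrier} (hx : x ∈ ⨆ n, A.maxGr n) : x ∈ A.m := by
  have : ⨆ n, A.maxGr n ≤ A.m.restrictScalars ℝ := iSup_le fun _ => inf_le_right
  exact this hx

lemma algebraMap_mem_m {c : ℝ} (h : algebraMap ℝ A.carrier c ∈ A.m) : c = 0 := by
  by_contra hne
  refine A.isMaximal.ne_top ((Ideal.eq_top_iff_one _).2 ?_)
  have h := A.m.mul_mem_left (algebraMap ℝ A.carrier c⁻¹) h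
  rwa [← map_mul, inv_mul_cancel₀ hne, map_one] at h

/-- If `c` is the residue of `a`, then `a^N - c^N` is a multiple of `a - c` and lies in the ideal.
So `c^N` lies in it, and `c = 0`. -/
lemma mem_m_of_pow_eq_zero {a : A.carrier} {N : ℕ} (h : a ^ N = 0) : a ∈ A.m := by
  obtain ⟨c, hc⟩ := A.residue a
  have h₁ := (Algebra.commute_algebraMap_right c a).geom_sum₂_mul N
  have h₂ := A.m.mul_mem_left (∑ i ∈ Finset.range N, a ^ i *
    algebraMap ℝ A.carrier c ^ (N - 1 - i)) hc
  rw [h₁, h, zero_sub, ← map_pow] at h₂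
  have h₃ := algebraMap_mem_m (neg_mem_iff.1 h₂)
  have hc0 : c = 0 := by
    by_contra hne
    exact pow_ne_zero N hne h₃
  rwa [hc0, map_zero, sub_zero] at hc

lemma mem_m_of_mem_gr {n : ℤ} (hn : n ≠ 0) {x : A.carrier} (hx : x ∈ A.gr n) : x ∈ A.m := by
  rcases lt_or_gt_of_ne hn with hn | hn
  · obtain ⟨N, hN⟩ := A.bounded
    -- In negative degree this power falls below the bound `N`, so the element is nilpotent.
    have h : x ^ (N.natAbs + 1) ∈ A.gr ((N.natAbs + 1) • n) := SetLike.pow_mem_graded _ hx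
    rw [hN, Submodule.mem_bot] at h
    · exact mem_m_of_pow_eq_zero h
    · rw [nsmul_eq_mul]
      push_cast
      nlinarith [neg_abs_le N, abs_nonneg N]
  · rw [A.nonpos n hn, Submodule.mem_bot] at hx
    rw [hx]
    exact A.m.zero_mem

/-- A homogeneous element with image in the maximal ideal is in the maximal ideal. -/
lemma mem_m_of_algHom_mem {B : DGArt.{u}} (f : A ⟶ B) {x : A.carrier} (h : algHom f x ∈ B.m) :
    x ∈ A.m := by
  obtain ⟨c, hc⟩ := A.residue x
  have h₁ := algHom_mem_m f hc
  rw [map_sub, AlgHom.commutes] at h₁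
  have h₂ := B.m.sub_mem h h₁
  rw [sub_sub_cancel] at h₂
  rwa [algebraMap_mem_m h₂, map_zero, sub_zero] at hc

variable (A) in
lemma maxAlg_isArtin : A.maxAlg.IsArtin where
  nonpos n hn x hx := Subtype.ext ((Submodule.mem_bot ℝ).1 (by
    have : x.1 ∈ A.gr n := hx.1
    rwa [A.nonpos n hn] at this))
  bounded := by
    obtain ⟨N, hN⟩ := A.bounded
    refine ⟨N.natAbs, fun n hn x hx => Subtype.ext ((Submodule.mem_bot ℝ).1 ?_)⟩
    have : x.1 ∈ A.gr n := hx.1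
    rwa [hN n (by omega)] at this
  proj := by
    obtain ⟨π, h, h'⟩ := exists_proj_of_decomposition A.gr
    exact exists_proj_ofGraded h h'
  nilpotent := by
    obtain ⟨N, hN⟩ := A.nilpotent
    -- The step `P s` consists of the elements killed from the left by all products of `N - s`
    -- elements of the ideal. It is everything for `s = 0`, and for `s = N` the empty product shows
    -- that it is zero.
    let P : ℕ → Submodule ℝ A.carrier := fun s =>
      ⨅ l : {l : List A.carrier // l.length + s = N ∧ ∀ a ∈ l, a ∈ A.m},
        LinearMap.ker (LinearMap.mulLeft ℝ l.1.prod)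
    have hP : ∀ s x, x ∈ P s ↔ ∀ l : List A.carrier, l.length + s = N → (∀ a ∈ l, a ∈ A.m) →
        l.prod * x = 0 := fun s x => by
      simp only [P, Submodule.mem_iInf, LinearMap.mem_ker, LinearMap.mulLeft_apply, Subtype.forall,
        and_imp]
    refine ⟨N, eq_bot_iff.2 fun x hx => (Submodule.mem_bot ℝ).2 (Subtype.ext ?_)⟩
    have := mpow_ofGraded_le (P := P) (fun x hx => (hP 0 x).2 fun l hl hm => ?_)
      (fun s x hx y hy => (hP (s + 1) _).2 fun l hl hm => ?_) N hx
    · have := (hP N x.1).1 this [] (by simp) (by simp)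
      rwa [List.prod_nil, one_mul] at this
    · rw [hN l (by simpa using hl) hm, zero_mul]
    · have h := (hP s y).1 hy (l ++ [x]) (by simp; omega) (fun a ha => by
        rcases List.mem_append.1 ha with ha | ha
        · exact hm a ha
        · rw [List.mem_singleton.1 ha]
          exact mem_m_of_mem_iSup hx)
      rw [List.prod_append, List.prod_singleton, mul_assoc] at h
      exact h

/-- The map of maximal ideals induced by a map of dg Artinian algebras. -/
def maxMap {B : DGArt.{u}} (f : A ⟶ B) : A.Max →ₗ[ℝ] B.Max :=
  (algHom f).toLinearMap.restrict fun x hx => by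
    refine Submodule.iSup_induction A.maxGr (motive := fun x => algHom f x ∈ ⨆ n, B.maxGr n) hx
      (fun n x hx => le_iSup B.maxGr n ⟨algHom_mem f hx.1, algHom_mem_m f hx.2⟩)
      (by rw [map_zero]; exact Submodule.zero_mem _)
      (fun x y hx hy => by rw [map_add]; exact Submodule.add_mem _ hx hy)

lemma maxMap_isHom {B : DGArt.{u}} (f : A ⟶ B) : A.maxAlg.IsHom B.maxAlg (maxMap f) where
  map_gr hx := ⟨algHom_mem f hx.1, algHom_mem_m f hx.2⟩
  map_d x := Subtype.ext (algHom_d f x.1)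
  map_mul x y := Subtype.ext (map_mul (algHom f) x.1 y.1)

/-- The residue field is the same on both sides, so every preimage of an element of the maximal
ideal is in the maximal ideal; projecting makes it homogeneous. -/
lemma maxMap_surjective {B : DGArt.{u}} (f : A ⟶ B) (hf : Function.Surjective (algHom f)) :
    Function.Surjective (maxMap f) := by
  obtain ⟨π, h, h'⟩ := exists_proj_of_decomposition A.gr
  obtain ⟨π', k, k'⟩ := exists_proj_of_decomposition B.gr
  intro y
  induction y using B.maxAlg.induction with
  | hadd x y hx hy =>
    obtain ⟨x, rfl⟩ := hx
    obtain ⟨y, rfl⟩ := hy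
    exact ⟨x + y, map_add _ _ _⟩
  | h n y hy =>
    obtain ⟨x, hx⟩ := hf y.1
    have h₁ : algHom f (π n x) = y.1 := by
      have := map_proj (S := A.alg.toDGModule) (S' := B.alg.toDGModule) h h' k k'
        (φ := (algHom f).toLinearMap) 0 (fun n x hx => by rw [add_zero]; exact algHom_mem f hx) n x
      rw [add_zero, AlgHom.toLinearMap_apply, AlgHom.toLinearMap_apply, hx, k n y.1 hy.1] at this
      exact this
    exact ⟨⟨π n x, le_iSup A.maxGr n ⟨proj_mem (S := A.alg.toDGModule) h h' n x,
      mem_m_of_algHom_mem f (by rw [h₁]; exact hy.2)⟩⟩, Subtype.ext h₁⟩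

end DGArt

/-! ### Quasi-isomorphisms on maximal ideals. -/

section QuasiIso

variable {C C' : Type*} [AddCommGroup C] [Module ℝ C] [AddCommGroup C'] [Module ℝ C']

/-- Quasi-isomorphisms, in terms of homogeneous elements. -/
structure DGModule.IsQuasiIso (S : DGModule C) (S' : DGModule C') (f : C →ₗ[ℝ] C') : Prop where
  inj : ∀ n, ∀ x ∈ S.gr n, S.d x = 0 → ∀ y ∈ S'.gr (n - 1), f x = S'.d y →
    ∃ x' ∈ S.gr (n - 1), S.d x' = x
  surj : ∀ n, ∀ y ∈ S'.gr n, S'.d y = 0 → ∃ x ∈ S.gr n, S.d x = 0 ∧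
    ∃ z ∈ S'.gr (n - 1), y = f x + S'.d z

end QuasiIso

lemma DGArt.isQuasiIso_maxMap {A B : DGArt.{u}} {f : A ⟶ B} (hf : IsQuasiIso f) :
    A.maxAlg.toDGModule.IsQuasiIso B.maxAlg.toDGModule (maxMap f) := by
  obtain ⟨π, h, h'⟩ := exists_proj_of_decomposition A.gr
  obtain ⟨π', k, k'⟩ := exists_proj_of_decomposition B.gr
  have hA : ∀ n x, A.d (π n x) = π (n + 1) (A.d x) := map_proj (S := A.alg.toDGModule)
    (S' := A.alg.toDGModule) h h' h h' (φ := A.d) 1 A.d_mem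
  have hB : ∀ n x, B.d (π' n x) = π' (n + 1) (B.d x) := map_proj (S := B.alg.toDGModule)
    (S' := B.alg.toDGModule) k k' k k' (φ := B.d) 1 B.d_mem
  have hAB : ∀ n x, algHom f (π n x) = π' n (algHom f x) := fun n x => by
    have := map_proj (S := A.alg.toDGModule) (S' := B.alg.toDGModule) h h' k k'
      (φ := (algHom f).toLinearMap) 0 (fun n x hx => by rw [add_zero]; exact algHom_mem f hx) n x
    rwa [add_zero] at this
  have hπ : ∀ n x, π n x ∈ A.gr n := proj_mem (S := A.alg.toDGModule) h h'
  have hπ' : ∀ n x, π' n x ∈ B.gr n := proj_mem (S := B.alg.toDGModule) k k'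
  refine ⟨fun n x hx hdx y hy hxy => ?_, fun n y hy hdy => ?_⟩
  · rcases lt_or_ge 0 n with hn | hn
    · refine ⟨0, Submodule.zero_mem _, ?_⟩
      rw [map_zero, A.maxAlg_isArtin.nonpos n hn x hx]
    · obtain ⟨z, hz⟩ := hf.1 x.1 (congrArg Subtype.val hdx) ⟨y.1, congrArg Subtype.val hxy⟩
      -- For `n ≤ 0` the degree `n - 1` is negative, where every element lies in the maximal ideal.
      -- So primitives need no adjustment.
      have hm : π (n - 1) z ∈ A.maxGr (n - 1) :=
        ⟨hπ _ _, mem_m_of_mem_gr (by omega) (hπ (n - 1) z)⟩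
      refine ⟨⟨π (n - 1) z, le_iSup A.maxGr _ hm⟩, hm, Subtype.ext ((hA (n - 1) z).trans ?_)⟩
      rw [sub_add_cancel, ← hz, h n x.1 hx.1]
  · rcases lt_or_ge 0 n with hn | hn
    · refine ⟨0, Submodule.zero_mem _, map_zero _, 0, Submodule.zero_mem _, ?_⟩
      rw [map_zero, map_zero, add_zero, B.maxAlg_isArtin.nonpos n hn y hy]
    · obtain ⟨a, ha, b, hab⟩ := hf.2 y.1 (congrArg Subtype.val hdy)
      have hy' : y.1 = algHom f (π n a) + B.d (π' (n - 1) b) := by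
        rw [hB, hAB, sub_add_cancel, ← map_add, ← hab, k n y.1 hy.1]
      have hbm : π' (n - 1) b ∈ B.maxGr (n - 1) :=
        ⟨hπ' _ _, mem_m_of_mem_gr (by omega) (hπ' (n - 1) b)⟩
      have ham : π n a ∈ A.maxGr n := ⟨hπ n a, mem_m_of_algHom_mem f (by
        rw [← add_sub_cancel_right (algHom f (π n a)) (B.d (π' (n - 1) b)), ← hy']
        exact B.m.sub_mem hy.2 (B.d_mem_m _ hbm.2))⟩
      refine ⟨⟨π n a, le_iSup A.maxGr _ ham⟩, ham, Subtype.ext ?_,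
        ⟨π' (n - 1) b, le_iSup B.maxGr _ hbm⟩, hbm, Subtype.ext hy'⟩
      exact (hA n a).trans (by rw [ha, map_zero]; rfl)

/-! ### Comparison of `maurerCartan` with Maurer–Cartan elements over the maximal ideal. -/

section Comparison

variable {g : DGLAData.{u}} (hg : g.IsDGLA) {A B : DGArt.{u}}

section

variable {J : Type} [Fintype J] [DecidableEq J]

lemma onSimplex_d (x : Triple g A J) :
    ((DGLie.ofData hg).onSimplex A.alg J).d x = totalD g A J x := by
  have h : ((DGLie.ofData hg).onSimplex A.alg J).d = totalD g A J := by
    refine TensorProduct.ext' fun x z => ?_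
    induction z using TensorProduct.induction_on with
    | zero => rw [TensorProduct.tmul_zero, map_zero, map_zero]
    | add z w hz hw => rw [TensorProduct.tmul_add, map_add, map_add, hz, hw]
    | tmul a w =>
      change g.d x ⊗ₜ[ℝ] (a ⊗ₜ[ℝ] w) + parity g.gr x ⊗ₜ[ℝ] (A.d a ⊗ₜ[ℝ] w +
        parity A.gr a ⊗ₜ[ℝ] simplexD J w) = g.d x ⊗ₜ[ℝ] (a ⊗ₜ[ℝ] w) +
          parity g.gr x ⊗ₜ[ℝ] (A.d a ⊗ₜ[ℝ] w) +
            parity g.gr x ⊗ₜ[ℝ] (parity A.gr a ⊗ₜ[ℝ] simplexD J w)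
      rw [TensorProduct.tmul_add, add_assoc]
  exact LinearMap.congr_fun h x

lemma onSimplex_br (x y : Triple g A J) :
    ((DGLie.ofData hg).onSimplex A.alg J).br x y = totalBr g A J (x ⊗ₜ y) := by
  have h : (A.alg.tensor (simplexAlg J)).mul = TensorProduct.curry (coeffMul A J) := rfl
  have h' : TensorProduct.lift (TensorProduct.curry (coeffMul A J)) = coeffMul A J :=
    TensorProduct.ext' fun _ _ => rfl
  change koszulBilin _ _ _ _ x y = _
  rw [h, koszulBilin, h']
  rfl

lemma onSimplex_curv (x : Triple g A J) : ((DGLie.ofData hg).onSimplex A.alg J).curv x =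
    totalD g A J x + (1 / 2 : ℝ) • totalBr g A J (x ⊗ₜ x) := by
  rw [DGLie.curv, onSimplex_d, onSimplex_br]

variable (g A J) in
/-- The inclusion of `g ⊗ m ⊗ Ω*(Δ)` in `g ⊗ A ⊗ Ω*(Δ)`. -/
def maxInclusion : g.carrier ⊗[ℝ] (A.Max ⊗[ℝ] SimplexForms J) →ₗ[ℝ] Triple g A J :=
  coeffMap g.carrier (⨆ n, A.maxGr n).subtype (id : J → J)

/-- Vector spaces are flat. Injectivity allows the Maurer–Cartan equation to be checked in the
larger space. -/
lemma maxInclusion_injective : Function.Injective (maxInclusion g A J) := by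
  have h : TensorProduct.map (⨆ n, A.maxGr n).subtype
      (simplexPullback (id : J → J)).toLinearMap =
        LinearMap.rTensor (SimplexForms J) (⨆ n, A.maxGr n).subtype := by
    rw [simplexPullback_id]
    rfl
  rw [maxInclusion, coeffMap, h]
  exact Module.Flat.lTensor_preserves_injective_linearMap _
    (Module.Flat.rTensor_preserves_injective_linearMap _ (Submodule.subtype_injective _))

lemma maxInclusion_tmul (x : g.carrier) (a : A.Max) (w : SimplexForms J) :
    maxInclusion g A J (x ⊗ₜ[ℝ] (a ⊗ₜ[ℝ] w)) = x ⊗ₜ[ℝ] (a.1 ⊗ₜ[ℝ] w) := by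
  have h := DFunLike.congr_fun (simplexPullback_id (J := J)) w
  exact congrArg (fun v => x ⊗ₜ[ℝ] (a.1 ⊗ₜ[ℝ] v)) h

lemma maxInclusion_mem {x : g.carrier ⊗[ℝ] (A.Max ⊗[ℝ] SimplexForms J)}
    (hx : x ∈ ((DGLie.ofData hg).onSimplex A.maxAlg J).gr 1) :
    maxInclusion g A J x ∈ degreeOne g A J := by
  refine gradedTensor_induction (M := fun x => maxInclusion g A J x ∈ degreeOne g A J)
    (fun p n hpn x hx z hz => ?_) (fun x y hx hy => ?_) hx
  · refine gradedTensor_induction (M := fun z => maxInclusion g A J (x ⊗ₜ z) ∈ degreeOne g A J)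
      (fun q r hqr a ha w hw => ?_) (fun z w hz hw => ?_) hz
    · rw [maxInclusion_tmul]
      exact Submodule.subset_span ⟨p, q, r, by omega, x, hx, a.1, ha.1, ha.2, w, hw, rfl⟩
    · rw [TensorProduct.tmul_add, map_add]
      exact Submodule.add_mem _ hz hw
  · rw [map_add]
    exact Submodule.add_mem _ hx hy

lemma exists_maxInclusion_eq {y : Triple g A J} (hy : y ∈ degreeOne g A J) :
    ∃ x ∈ ((DGLie.ofData hg).onSimplex A.maxAlg J).gr 1, maxInclusion g A J x = y := by
  have h : degreeOne g A J ≤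
      (((DGLie.ofData hg).onSimplex A.maxAlg J).gr 1).map (maxInclusion g A J) := by
    refine Submodule.span_le.2 ?_
    rintro _ ⟨p, q, r, hpqr, x, hx, a, ha, ham, w, hw, rfl⟩
    have ha' : a ∈ A.maxGr q := ⟨ha, ham⟩
    have ha'' : (⟨a, le_iSup A.maxGr q ha'⟩ : A.Max) ∈ A.maxAlg.gr q := ha'
    exact ⟨_, tmul_mem_gradedTensor (q := q + r) (by omega) hx
      (tmul_mem_gradedTensor rfl ha'' hw), maxInclusion_tmul _ _ _⟩
  exact h hy

lemma maxInclusion_curv (x : g.carrier ⊗[ℝ] (A.Max ⊗[ℝ] SimplexForms J)) :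
    maxInclusion g A J (((DGLie.ofData hg).onSimplex A.maxAlg J).curv x) =
      totalD g A J (maxInclusion g A J x) +
        (1 / 2 : ℝ) • totalBr g A J (maxInclusion g A J x ⊗ₜ maxInclusion g A J x) :=
  (coeffMap_curv (DGLie.ofData hg) ofGraded_subtype_isHom id x).trans (onSimplex_curv hg _)

/-- Maurer–Cartan elements of `g ⊗ m ⊗ Ω*(Δ)` inside `g ⊗ A ⊗ Ω*(Δ)`. -/
def mcElementsInclusion (x : (DGLie.ofData hg).mcElements A.maxAlg J) : maurerCartan g A J :=
  ⟨maxInclusion g A J x.1, maxInclusion_mem hg x.2.1, by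
    rw [← maxInclusion_curv hg, x.2.2, map_zero]⟩

lemma mcElementsInclusion_bijective :
    Function.Bijective (mcElementsInclusion hg (A := A) (J := J)) := by
  refine ⟨fun x y h => Subtype.ext (maxInclusion_injective (congrArg Subtype.val h)), fun y => ?_⟩
  obtain ⟨x, hx, hxy⟩ := exists_maxInclusion_eq hg y.2.1
  refine ⟨⟨x, hx, maxInclusion_injective ?_⟩, Subtype.ext hxy⟩
  rw [maxInclusion_curv, hxy, y.2.2, map_zero]

end

variable (A) in
/-- Comparison of the two descriptions of the simplicial set of Maurer–Cartan elements. -/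
def mcSpaceInclusion : (DGLie.ofData hg).mcSpace A.maxAlg ⟶ (mcFunctor g).obj A where
  app n := TypeCat.ofHom (mcElementsInclusion hg)
  naturality n n' θ := by
    ext x
    exact Subtype.ext (coeffMap_comm (⨆ n, A.maxGr n).subtype θ.unop.toOrderHom x.1)

instance : IsIso (mcSpaceInclusion hg A) := by
  rw [NatTrans.isIso_iff_isIso_app]
  intro n
  rw [isIso_iff_bijective]
  exact mcElementsInclusion_bijective hg

lemma mcSpaceInclusion_naturality (f : A ⟶ B) :
    CategoryStruct.comp (mcSpaceMap (DGLie.ofData hg) (DGArt.maxMap_isHom f))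
      (mcSpaceInclusion hg B) =
      CategoryStruct.comp (mcSpaceInclusion hg A) ((mcFunctor g).map f) := by
  ext n x
  refine Subtype.ext ?_
  refine (coeffMap_comp (L := g.carrier) (DGArt.maxMap f) (⨆ n, B.maxGr n).subtype id id x.1).trans ?_
  exact (coeffMap_comp (L := g.carrier) (⨆ n, A.maxGr n).subtype (DGArt.algHom f).toLinearMap id id
    x.1).symm

end Comparison

/-! ### The fibration axiom and contractibility over the ground field. -/

section Axioms

variable {g : DGLAData.{u}} {A B : DGArt.{u}}

lemma mcFunctor_map_eq (hg : g.IsDGLA) (f : A ⟶ B) : (mcFunctor g).map f =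
    CategoryStruct.comp (inv (mcSpaceInclusion hg A)) (CategoryStruct.comp
      (mcSpaceMap (DGLie.ofData hg) (DGArt.maxMap_isHom f)) (mcSpaceInclusion hg B)) := by
  rw [mcSpaceInclusion_naturality, IsIso.inv_hom_id_assoc]

/-- Surjections induce Kan fibrations of simplicial sets of Maurer–Cartan elements. -/
theorem mcFunctor_map_isKanFibration (hg : g.IsDGLA) (f : B ⟶ A) (hf : Function.Surjective (DGArt.algHom f)) :
    IsKanFibration ((mcFunctor g).map f) := by
  have h := mcSpaceMap_isKanFibration (DGLie.ofData hg) B.maxAlg_isArtin A.maxAlg_isArtin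
    (DGArt.maxMap_isHom f) (DGArt.maxMap_surjective f hf)
  rw [mcFunctor_map_eq hg]
  exact (MorphismProperty.cancel_left_of_respectsIso SSet.modelCategoryQuillen.J.rlp _ _).2
    ((MorphismProperty.cancel_right_of_respectsIso SSet.modelCategoryQuillen.J.rlp _ _).2 h)

/-- The simplicial set of Maurer–Cartan elements over the ground field is a point. -/
theorem isContractible_mcFunctor (hA : Function.Bijective (algebraMap ℝ A.carrier)) :
    IsContractible ((mcFunctor g).obj A) := by
  have hm : ∀ a ∈ A.m, a = 0 := fun a ha => by
    obtain ⟨c, rfl⟩ := hA.2 a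
    rw [DGArt.algebraMap_mem_m ha, map_zero]
  have h0 : ∀ (J : Type) [Fintype J] [DecidableEq J] (x : maurerCartan g A J), x.1 = 0 := by
    intro J _ _ x
    have : degreeOne g A J ≤ ⊥ := by
      refine Submodule.span_le.2 ?_
      rintro _ ⟨p, q, r, hpqr, x, hx, a, ha, ham, w, hw, rfl⟩
      rw [hm a ham, TensorProduct.zero_tmul, TensorProduct.tmul_zero]
      exact Submodule.zero_mem _
    exact (Submodule.mem_bot ℝ).1 (this x.2.1)
  have hz : ∀ (J : Type) [Fintype J] [DecidableEq J], (0 : Triple g A J) ∈ maurerCartan g A J :=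
    fun J _ _ => ⟨Submodule.zero_mem _, by
      rw [TensorProduct.zero_tmul, map_zero, map_zero, smul_zero, add_zero]⟩
  have ht : Limits.IsTerminal ((mcFunctor g).obj A) := Limits.IsTerminal.ofUniqueHom
    (fun X => { app := fun n => TypeCat.ofHom fun _ => (⟨0, hz _⟩ : maurerCartan g A _)
                naturality := fun n n' θ => by
                  ext x
                  exact Subtype.ext (map_zero _).symm })
    (fun X f => by
      ext n x
      exact Subtype.ext (h0 _ _))
  have : IsIso (Limits.terminal.from ((mcFunctor g).obj A)) :=
    Limits.isIso_of_isTerminal ht Limits.terminalIsTerminal _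
  exact isWeakEquivalence_of_isIso _

end Axioms

/-! ### Values of forms at a vertex. -/

section VertexEval

set_option linter.unusedSectionVars false

variable {J J' : Type} [Fintype J] [DecidableEq J] [Fintype J'] [DecidableEq J']

/-- The value of a form at a vertex of the simplex. -/
def vertexEval (j : J) : SimplexForms J →ₐ[ℝ] ℝ :=
  (Algebra.TensorProduct.lift ExteriorAlgebra.algebraMapInv
    ((Pi.evalAlgHom ℝ (fun _ : stdSimplex ℝ J => ℝ) ⟨Pi.single j 1, single_mem_stdSimplex ℝ j⟩).comp
      (simplexFun J).val) (fun _ _ => Commute.all _ _) :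
    Forms (Cotangent J) (simplexFun J) →ₐ[ℝ] ℝ)

lemma vertexEval_funForm (j : J) (a : simplexFun J) : vertexEval j (funForm a) =
    a.1 ⟨Pi.single j 1, single_mem_stdSimplex ℝ j⟩ := by
  refine (Algebra.TensorProduct.lift_tmul _ _ _ _ _).trans ?_
  rw [map_one, one_mul]
  rfl

lemma vertexEval_coordForm (j i : J) : vertexEval j (coordForm i) = if i = j then 1 else 0 := by
  refine (vertexEval_funForm j _).trans ?_
  change (Pi.single j 1 : J → ℝ) i = _
  rw [Pi.single_apply]

/-- The constant map factors through a point. Both sides are algebra maps, and on generators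
one-forms go to zero and functions to their value at the vertex. -/
lemma simplexPullback_const (j : J) (x : SimplexForms J) :
    simplexPullback (fun _ : J' => j) x = algebraMap ℝ (SimplexForms J') (vertexEval j x) := by
  have h : simplexPullback (fun _ : J' => j) =
      (Algebra.ofId ℝ (SimplexForms J')).comp (vertexEval j) := by
    refine Algebra.TensorProduct.ext (ExteriorAlgebra.hom_ext ?_) ?_
    · refine LinearMap.ext fun v => ?_
      obtain ⟨v, rfl⟩ := Submodule.mkQ_surjective _ v
      have h₁ : cotangentMap (fun _ : J' => j) (Submodule.Quotient.mk v) = 0 := by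
        rw [cotangentMap_mk, Submodule.Quotient.mk_eq_zero, Submodule.mem_span_singleton]
        exact ⟨v j, by ext; simp⟩
      have h₂ : vertexEval j ((ExteriorAlgebra.ι ℝ ((Submodule.span ℝ {(1 : J → ℝ)}).mkQ v) ⊗ₜ[ℝ]
          (1 : simplexFun J) : Forms (Cotangent J) (simplexFun J)) : SimplexForms J) = 0 := by
        refine (Algebra.TensorProduct.lift_tmul _ _ _ _ _).trans ?_
        rw [ExteriorAlgebra.algebraMapInv, ExteriorAlgebra.lift_ι_apply, LinearMap.zero_apply,
          zero_mul]
      refine (formsPullback_ι _ _ _).trans ?_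
      refine Eq.trans ?_ (congrArg (algebraMap ℝ (SimplexForms J')) h₂.symm)
      rw [map_zero, LinearMap.comp_apply]
      refine (congrArg (fun z => oneForm
        ((TensorProduct.mk ℝ (Cotangent J') (simplexFun J')).flip 1 z)) h₁).trans ?_
      rw [map_zero, map_zero]
      rfl
    · ext1 a
      refine (simplexPullback_funForm (fun _ : J' => j) a).trans ?_
      refine Eq.trans ?_ (congrArg (algebraMap ℝ (SimplexForms J'))
        (vertexEval_funForm j a)).symm
      have h₁ : simplexComp (fun _ : J' => j) a = a.1 ⟨Pi.single j 1, single_mem_stdSimplex ℝ j⟩ •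
          (1 : simplexFun J') := by
        ext y
        have : stdSimplex.map (fun _ : J' => j) y = ⟨Pi.single j 1, single_mem_stdSimplex ℝ j⟩ := by
          ext i
          rw [stdSimplex.map_coe, FunOnFinite.linearMap_apply_apply]
          by_cases hi : i = j
          · subst hi
            simp
          · simp [hi, Ne.symm hi]
        rw [simplexComp_apply, this]
        exact (mul_one _).symm
      rw [h₁, map_smul, Algebra.algebraMap_eq_smul_one, funForm_one]
  exact DFunLike.congr_fun h x

/-- Pullback along the constant map preserves the degree, yet yields a multiple of the unit, which
has degree zero. -/
lemma vertexEval_of_mem (j : J) {r : ℤ} (hr : r ≠ 0) {x : SimplexForms J}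
    (hx : x ∈ simplexGrading J r) : vertexEval j x = 0 := by
  have h := simplexPullback_mem (fun _ : J => j) hx
  rw [simplexPullback_const, Algebra.algebraMap_eq_smul_one] at h
  have h' : vertexEval j x • (1 : SimplexForms J) ∈ simplexGrading J 0 :=
    Submodule.smul_mem _ _ (funForm_mem 1)
  have h₀ := (DirectSum.decompose_of_mem_same _ h).symm.trans
    (DirectSum.decompose_of_mem_ne _ h' hr.symm)
  have := congrArg (vertexEval j) h₀
  rwa [map_smul, map_one, smul_eq_mul, mul_one, map_zero] at this

lemma simplexD_one : simplexD J 1 = 0 := by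
  refine (extD_tmul dt simplexDeriv 1 1).trans (Finset.sum_eq_zero fun j _ => ?_)
  rw [Derivation.map_one_eq_zero, TensorProduct.tmul_zero]

lemma vertexEval_simplexD (j : J) (x : SimplexForms J) : vertexEval j (simplexD J x) = 0 := by
  have h := simplexD_pullback (fun _ : J => j) x
  rw [simplexPullback_const, simplexPullback_const, Algebra.algebraMap_eq_smul_one,
    Algebra.algebraMap_eq_smul_one, map_smul, simplexD_one, smul_zero] at h
  have := congrArg (vertexEval j) h
  rw [map_smul, map_one, smul_eq_mul, mul_one, map_zero] at this
  exact this.symm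

/-- By naturality along the constant map the value is a multiple of the value of the homotopy at the
unit, which has degree `-1`. -/
lemma vertexEval_poincare (j : J) (x : SimplexForms J) : vertexEval j (poincare j x) = 0 := by
  have h := poincare_pullback (fun _ : J => j) j x
  rw [simplexPullback_const, simplexPullback_const, Algebra.algebraMap_eq_smul_one,
    Algebra.algebraMap_eq_smul_one, map_smul] at h
  have h' : vertexEval j (poincare j (1 : SimplexForms J)) = 0 :=
    vertexEval_of_mem j (r := 0 - 1) (by norm_num) (poincare_mem j (funForm_mem 1))
  have := congrArg (vertexEval j) h
  rw [map_smul, h', smul_zero, map_smul, map_one, smul_eq_mul, mul_one] at this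
  exact this.symm

end VertexEval

/-! ### Products of commutative dg algebras. -/

section Product

variable {C C' : Type*} [AddCommGroup C] [Module ℝ C] [AddCommGroup C'] [Module ℝ C']

/-- The product of graded commutative dg algebras. -/
def DGComm.prod (S : DGComm C) (S' : DGComm C') : DGComm (C × C') where
  gr n := (S.gr n).prod (S'.gr n)
  iSup_gr := by
    refine eq_top_iff.2 fun x _ => ?_
    have h₁ : ∀ y : C, ((y, 0) : C × C') ∈ ⨆ n, (S.gr n).prod (S'.gr n) := fun y => by
      induction y using S.induction with
      | h n y hy => exact Submodule.mem_iSup_of_mem n ⟨hy, Submodule.zero_mem _⟩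
      | hadd y z hy hz =>
        have := Submodule.add_mem _ hy hz
        rwa [Prod.mk_add_mk, add_zero] at this
    have h₂ : ∀ y : C', ((0, y) : C × C') ∈ ⨆ n, (S.gr n).prod (S'.gr n) := fun y => by
      induction y using S'.induction with
      | h n y hy => exact Submodule.mem_iSup_of_mem n ⟨Submodule.zero_mem _, hy⟩
      | hadd y z hy hz =>
        have := Submodule.add_mem _ hy hz
        rwa [Prod.mk_add_mk, add_zero] at this
    have := Submodule.add_mem _ (h₁ x.1) (h₂ x.2)
    rwa [Prod.mk_add_mk, add_zero, zero_add] at this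
  sgn := LinearMap.prodMap S.sgn S'.sgn
  sgn_of_mem hx := Prod.ext (S.sgn_of_mem hx.1) (S'.sgn_of_mem hx.2)
  d := LinearMap.prodMap S.d S'.d
  d_mem hx := ⟨S.d_mem hx.1, S'.d_mem hx.2⟩
  d_d x := Prod.ext (S.d_d x.1) (S'.d_d x.2)
  mul := LinearMap.mk₂ ℝ (fun x y => (S.mul x.1 y.1, S'.mul x.2 y.2))
    (fun x x' y => Prod.ext (LinearMap.map_add₂ _ _ _ _) (LinearMap.map_add₂ _ _ _ _))
    (fun r x y => Prod.ext (LinearMap.map_smul₂ _ _ _ _) (LinearMap.map_smul₂ _ _ _ _))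
    (fun x y y' => Prod.ext (map_add _ _ _) (map_add _ _ _))
    (fun r x y => Prod.ext (map_smul _ _ _) (map_smul _ _ _))
  mul_mem hx hy := ⟨S.mul_mem hx.1 hy.1, S'.mul_mem hx.2 hy.2⟩
  leibniz hx y := Prod.ext (S.leibniz hx.1 y.1) (S'.leibniz hx.2 y.2)
  comm hx hy := Prod.ext (S.comm hx.1 hy.1) (S'.comm hx.2 hy.2)
  assoc x y z := Prod.ext (S.assoc x.1 y.1 z.1) (S'.assoc x.2 y.2 z.2)

end Product

/-! ### Evaluation and constants for forms with coefficients. -/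

section EvalMap

variable {J : Type} [Fintype J] [DecidableEq J] {C : Type*} [AddCommGroup C] [Module ℝ C]
  (S : DGComm C)

variable (C) in
/-- Evaluation of forms with coefficients at a vertex. -/
def evalMap (j : J) : C ⊗[ℝ] SimplexForms J →ₗ[ℝ] C :=
  (TensorProduct.rid ℝ C).toLinearMap ∘ₗ (vertexEval j).toLinearMap.lTensor C

lemma evalMap_tmul (j : J) (c : C) (w : SimplexForms J) :
    evalMap C j (c ⊗ₜ w) = vertexEval j w • c := rfl

lemma evalMap_isHom (j : J) : (S.tensor (simplexAlg J)).IsHom S (evalMap C j) where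
  map_gr {n z} hz := by
    refine gradedTensor_induction (M := fun z => evalMap C j z ∈ S.gr n)
      (fun p q hpq x hx w hw => ?_) (fun x y hx hy => by
        rw [map_add]; exact Submodule.add_mem _ hx hy) hz
    rw [evalMap_tmul]
    by_cases hq : q = 0
    · subst hq
      rw [add_zero] at hpq
      subst hpq
      exact Submodule.smul_mem _ _ hx
    · rw [vertexEval_of_mem j hq hw, zero_smul]
      exact Submodule.zero_mem _
  map_d z := by
    induction z using TensorProduct.induction_on with
    | zero => simp only [map_zero]
    | add x y hx hy => simp only [map_add, hx, hy]
    | tmul x w =>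
      refine (congrArg (evalMap C j) (DGModule.tensor_d_tmul _ _ x w)).trans ?_
      have h : vertexEval j ((simplexAlg J).d w) = 0 := vertexEval_simplexD j w
      rw [map_add, evalMap_tmul, evalMap_tmul, evalMap_tmul, h, zero_smul, add_zero, map_smul]
  map_mul z z' := by
    induction z using S.tensor_induction (simplexAlg J).toDGModule with
    | hadd x y hx hy => simp only [map_add, LinearMap.add_apply, hx, hy]
    | h p q x hx w hw =>
      induction z' using S.tensor_induction (simplexAlg J).toDGModule with
      | hadd x y hx hy => simp only [map_add, hx, hy]
      | h p' q' y hy v hv =>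
        refine (congrArg (evalMap C j) (koszulBilin_tmul x hw hy v)).trans ?_
        have h : vertexEval j ((simplexAlg J).mul w v) = vertexEval j w * vertexEval j v :=
          map_mul _ _ _
        rw [map_smul, evalMap_tmul, evalMap_tmul, evalMap_tmul, h, map_smul,
          LinearMap.map_smul₂, smul_smul, smul_smul]
        by_cases hq : q = 0
        · subst hq
          rw [zero_mul, zpow_zero, one_mul, mul_comm]
        · rw [vertexEval_of_mem j hq hw, zero_mul, mul_zero, mul_zero]

/-- The inclusion of constant forms with coefficients. -/
def constMap (C : Type*) [AddCommGroup C] [Module ℝ C] (J : Type) [Fintype J] [DecidableEq J] :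
    C →ₗ[ℝ] C ⊗[ℝ] SimplexForms J :=
  (TensorProduct.mk ℝ C (SimplexForms J)).flip 1

lemma constMap_isHom : S.IsHom (S.tensor (simplexAlg J)) (constMap C J) where
  map_gr hx := tmul_mem_gradedTensor (add_zero _) hx (funForm_mem 1)
  map_d x := by
    refine Eq.trans ?_ (DGModule.tensor_d_tmul _ _ x 1).symm
    have h : (simplexAlg J).d 1 = 0 := simplexD_one
    rw [h, TensorProduct.tmul_zero, add_zero]
    rfl
  map_mul x y := by
    induction y using S.induction with
    | hadd y z hy hz => simp only [map_add, hy, hz]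
    | h n y hy =>
      refine Eq.trans ?_ (koszulBilin_tmul x (S' := (simplexAlg J).toDGModule)
        (q := 0) (funForm_mem 1) hy 1).symm
      rw [zero_mul, zpow_zero, one_smul]
      exact congrArg (S.mul x y ⊗ₜ[ℝ] ·) (one_mul (1 : SimplexForms J)).symm

lemma evalMap_constMap (j : J) (c : C) : evalMap C j (constMap C J c) = c := by
  refine (evalMap_tmul j c 1).trans ?_
  rw [map_one, one_smul]

end EvalMap

/-! ### Nilpotency and boundedness for forms with coefficients. -/

section TensorArtin

variable {C C' : Type*} [AddCommGroup C] [Module ℝ C] [AddCommGroup C'] [Module ℝ C']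

lemma DGComm.sgn_mul (S : DGComm C) (x y : C) : S.sgn (S.mul x y) = S.mul (S.sgn x) (S.sgn y) := by
  induction x using S.induction with
  | hadd x x' hx hx' => simp only [map_add, LinearMap.add_apply, hx, hx']
  | h p x hx =>
    induction y using S.induction with
    | hadd y y' hy hy' => simp only [map_add, hy, hy']
    | h q y hy =>
      rw [S.sgn_of_mem hx, S.sgn_of_mem hy, S.sgn_of_mem (S.mul_mem hx hy), map_smul,
        LinearMap.map_smul₂, smul_smul, ← neg_one_zpow_mul, mul_comm]

lemma DGComm.sgn_mem_mpow (S : DGComm C) (s : ℕ) : S.mpow s ≤ (S.mpow s).comap S.sgn := by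
  induction s with
  | zero => exact fun _ _ => Submodule.mem_top
  | succ s ih =>
    refine Submodule.map₂_le.2 fun x _ y hy => ?_
    rw [Submodule.mem_comap, S.sgn_mul]
    exact S.mul_mem_mpow _ (ih hy)

/-- Forms on a simplex are unital and not nilpotent, so the powers are measured in the first factor
alone. -/
lemma tensor_mul_mem_mpow (S : DGComm C) (S' : DGComm C') (s : ℕ) (z : C ⊗[ℝ] C') :
    Submodule.map₂ (TensorProduct.mk ℝ C C') (S.mpow s) ⊤ ≤
      (Submodule.map₂ (TensorProduct.mk ℝ C C') (S.mpow (s + 1)) ⊤).comap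
        ((S.tensor S').mul z) := by
  refine Submodule.map₂_le.2 fun y hy y' _ => ?_
  rw [Submodule.mem_comap]
  induction z using S.tensor_induction S'.toDGModule with
  | hadd z w hz hw =>
    rw [map_add, LinearMap.add_apply]
    exact Submodule.add_mem _ hz hw
  | h p q x hx x' hx' =>
    -- The element `y` need not be homogeneous, so the Koszul sign is expressed by the involution,
    -- which preserves the powers.
    have key : (S.tensor S').mul (x ⊗ₜ x') (y ⊗ₜ y') =
        S.mul x (if Even q then y else S.sgn y) ⊗ₜ[ℝ] S'.mul x' y' := by
      clear hy
      induction y using S.induction with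
      | hadd y z hy hz =>
        rw [TensorProduct.add_tmul, map_add, hy, hz, ← TensorProduct.add_tmul, ← map_add]
        split_ifs
        · rfl
        · rw [map_add S.sgn, map_add]
      | h r y hy =>
        refine (koszulBilin_tmul x hx' hy y').trans ?_
        split_ifs with h
        · rw [(h.mul_right r).neg_one_zpow, one_smul]
        · rw [S.sgn_of_mem hy, map_smul, ← TensorProduct.smul_tmul']
          congr 1
          refine neg_one_zpow_congr ?_
          rw [Int.even_mul]
          tauto
    rw [TensorProduct.mk_apply, key]
    refine Submodule.apply_mem_map₂ _ (S.mul_mem_mpow x ?_) Submodule.mem_top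
    split_ifs
    · exact hy
    · exact S.sgn_mem_mpow s hy

/-- The projection to degree `n` is the sum of the `πᵢ ⊗ π'ₙ₋ᵢ`, which is finite because the first
factor is bounded. -/
lemma exists_proj_tensor {S : DGModule C} {S' : DGModule C'} {M : ℕ}
    (hM : ∀ n : ℤ, n < -M → ∀ x ∈ S.gr n, x = 0) (hS : ∀ n, 0 < n → ∀ x ∈ S.gr n, x = 0)
    {π : ℤ → C →ₗ[ℝ] C} (h : ∀ n, ∀ x ∈ S.gr n, π n x = x)
    (h' : ∀ m n, m ≠ n → ∀ x ∈ S.gr m, π n x = 0) {π' : ℤ → C' →ₗ[ℝ] C'}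
    (k : ∀ n, ∀ x ∈ S'.gr n, π' n x = x) (k' : ∀ m n, m ≠ n → ∀ x ∈ S'.gr m, π' n x = 0) :
    ∃ ρ : ℤ → C ⊗[ℝ] C' →ₗ[ℝ] C ⊗[ℝ] C', (∀ n, ∀ x ∈ (S.tensor S').gr n, ρ n x = x) ∧
      ∀ m n, m ≠ n → ∀ x ∈ (S.tensor S').gr m, ρ n x = 0 := by
  have key : ∀ n p q, ∀ x ∈ S.gr p, ∀ y ∈ S'.gr q,
      (∑ i ∈ Finset.Icc (-M : ℤ) 0, TensorProduct.map (π i) (π' (n - i))) (x ⊗ₜ[ℝ] y) =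
        x ⊗ₜ[ℝ] π' (n - p) y := fun n p q x hx y hy => by
    rw [LinearMap.sum_apply]
    by_cases hp : p ∈ Finset.Icc (-M : ℤ) 0
    · rw [Finset.sum_eq_single_of_mem p hp fun i _ hip => by
        rw [TensorProduct.map_tmul, h' p i hip.symm x hx, TensorProduct.zero_tmul],
        TensorProduct.map_tmul, h p x hx]
    · have hx0 : x = 0 := by
        rw [Finset.mem_Icc, not_and_or] at hp
        rcases hp with hp | hp
        · exact hM p (by omega) x hx
        · exact hS p (by omega) x hx
      simp [hx0]
  refine ⟨fun n => ∑ i ∈ Finset.Icc (-M : ℤ) 0, TensorProduct.map (π i) (π' (n - i)),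
    fun n x hx => ?_, fun m n hmn x hx => ?_⟩
  · refine gradedTensor_induction (M := fun x => (∑ i ∈ Finset.Icc (-M : ℤ) 0,
      TensorProduct.map (π i) (π' (n - i))) x = x) (fun p q hpq x hx y hy => ?_)
      (fun x y hx hy => by rw [map_add, hx, hy]) hx
    rw [key n p q x hx y hy, ← hpq, add_sub_cancel_left, k q y hy]
  · refine gradedTensor_induction (M := fun x => (∑ i ∈ Finset.Icc (-M : ℤ) 0,
      TensorProduct.map (π i) (π' (n - i))) x = 0) (fun p q hpq x hx y hy => ?_)
      (fun x y hx hy => by rw [map_add, hx, hy, add_zero]) hx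
    rw [key n p q x hx y hy, k' q (n - p) (by omega) y hy, TensorProduct.tmul_zero]

end TensorArtin

lemma simplexGrading_eq_zero {J : Type} [Fintype J] {r : ℤ} (hr : r < 0)
    {x : SimplexForms J} (hx : x ∈ simplexGrading J r) : x = 0 := by
  obtain ⟨x, rfl⟩ := hx
  cases r with
  | ofNat r => exact absurd hr (by simp)
  | negSucc r =>
    induction x using TensorProduct.induction_on with
    | zero => exact map_zero _
    | add x y hx hy => exact (map_add _ x y).trans ((congrArg₂ (· + ·) hx hy).trans (add_zero 0))
    | tmul a b =>
      have : a = 0 := Subtype.ext ((Submodule.mem_bot ℝ).1 a.2)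
      rw [this, TensorProduct.zero_tmul]
      exact map_zero _

/-! ### The mapping path algebra and invariance under quasi-isomorphisms. -/

section PathObject

variable {C C' : Type u} [AddCommGroup C] [Module ℝ C] [AddCommGroup C'] [Module ℝ C']
  {S : DGComm C} {S' : DGComm C'} {f : C →ₗ[ℝ] C'}

variable (S S' f) in
/-- Pairs of an element of `S` and a path in `S'` which starts at its image, of degree `n`. -/
def pathGr (n : ℤ) : Submodule ℝ (C × (C' ⊗[ℝ] SimplexForms (Fin 2))) where
  carrier := {x | (x.1 ∈ S.gr n ∧ x.2 ∈ (S'.tensor (simplexAlg (Fin 2))).gr n) ∧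
    f x.1 = evalMap C' 0 x.2 ∧ (0 < n → x.2 = 0) ∧
      (n = 0 → (S'.tensor (simplexAlg (Fin 2))).d x.2 = 0)}
  zero_mem' := ⟨⟨Submodule.zero_mem _, Submodule.zero_mem _⟩, by
    simp only [Prod.fst_zero, Prod.snd_zero, map_zero], fun _ => rfl, fun _ => map_zero _⟩
  add_mem' {x y} hx hy := ⟨⟨Submodule.add_mem _ hx.1.1 hy.1.1, Submodule.add_mem _ hx.1.2 hy.1.2⟩, by
    rw [Prod.fst_add, Prod.snd_add, map_add, map_add, hx.2.1, hy.2.1], fun h => by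
    rw [Prod.snd_add, hx.2.2.1 h, hy.2.2.1 h, add_zero], fun h => by
    rw [Prod.snd_add, map_add, hx.2.2.2 h, hy.2.2.2 h, add_zero]⟩
  smul_mem' r x hx := ⟨⟨Submodule.smul_mem _ _ hx.1.1, Submodule.smul_mem _ _ hx.1.2⟩, by
    rw [Prod.smul_fst, Prod.smul_snd, map_smul, map_smul, hx.2.1], fun h => by
    rw [Prod.smul_snd, hx.2.2.1 h, smul_zero], fun h => by
    rw [Prod.smul_snd, map_smul, hx.2.2.2 h, smul_zero]⟩

/-- The mapping path algebra of a map of algebras. -/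
def pathAlg (hf : S.IsHom S' f) : DGComm ↥(⨆ n, pathGr S S' f n) :=
  (S.prod (S'.tensor (simplexAlg (Fin 2)))).ofGraded (pathGr S S' f) (fun _ _ hx => hx.1)
    (fun n x hx => ⟨⟨S.d_mem hx.1.1, DGModule.d_mem _ hx.1.2⟩, by
      refine (hf.map_d x.1).trans ?_
      rw [hx.2.1, ← (evalMap_isHom S' 0).map_d]
      rfl, fun h => by
      rcases lt_or_eq_of_le (show 0 ≤ n by omega) with h | h
      · exact (congrArg (S'.tensor (simplexAlg (Fin 2))).d (hx.2.2.1 h)).trans (map_zero _)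
      · exact hx.2.2.2 h.symm, fun _ => DGModule.d_d _ _⟩)
    (fun p q x hx y hy => ⟨⟨S.mul_mem hx.1.1 hy.1.1, DGComm.mul_mem _ hx.1.2 hy.1.2⟩, by
      refine (hf.map_mul x.1 y.1).trans ?_
      rw [hx.2.1, hy.2.1, ← (evalMap_isHom S' 0).map_mul]
      rfl, fun h => by
      by_cases hp : 0 < p
      · refine (congrArg (fun z => (S'.tensor (simplexAlg (Fin 2))).mul z y.2)
          (hx.2.2.1 hp)).trans ?_
        rw [map_zero, LinearMap.zero_apply]
      · exact (congrArg ((S'.tensor (simplexAlg (Fin 2))).mul x.2)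
          (hy.2.2.1 (by omega))).trans (map_zero _), fun h => by
      change (S'.tensor (simplexAlg (Fin 2))).d ((S'.tensor (simplexAlg (Fin 2))).mul x.2 y.2) = 0
      rw [(S'.tensor (simplexAlg (Fin 2))).leibniz hx.1.2]
      by_cases hp : 0 < p
      · rw [hx.2.2.1 hp]
        simp only [map_zero, LinearMap.zero_apply, smul_zero, add_zero]
      by_cases hq : 0 < q
      · rw [hy.2.2.1 hq]
        simp only [map_zero, smul_zero, add_zero]
      rw [hx.2.2.2 (by omega), hy.2.2.2 (by omega)]
      simp only [map_zero, LinearMap.zero_apply, smul_zero, add_zero]⟩)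

/-- One-forms on the interval can give paths of degree one. Therefore `pathGr` is truncated: zero in
positive degrees and closed paths in degree zero. In negative degrees it imposes only the condition
on the starting point. -/
lemma pathAlg_isArtin (hf : S.IsHom S' f) (hS : S.IsArtin) (hS' : S'.IsArtin) :
    (pathAlg hf).IsArtin where
  nonpos n hn x hx := Subtype.ext (Prod.ext (hS.nonpos n hn _ hx.1.1) (hx.2.2.1 hn))
  bounded := by
    obtain ⟨M, hM⟩ := hS.bounded
    obtain ⟨M', hM'⟩ := hS'.bounded
    refine ⟨max M M', fun n hn x hx => Subtype.ext (Prod.ext (hM n (by omega) _ hx.1.1) ?_)⟩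
    refine gradedTensor_induction (M := fun z => z = 0) (fun p q hpq y hy w hw => ?_)
      (fun x y hx hy => by rw [hx, hy, add_zero]) hx.1.2
    by_cases hp : p < -M'
    · rw [hM' p hp y hy, TensorProduct.zero_tmul]
    · have : w = 0 :=
        simplexGrading_eq_zero (by omega) hw
      rw [this, TensorProduct.tmul_zero]
  proj := by
    obtain ⟨π, h, h'⟩ := hS.proj
    obtain ⟨π', k, k'⟩ := hS'.proj
    obtain ⟨τ, l, l'⟩ := exists_proj_of_decomposition (simplexGrading (Fin 2))
    obtain ⟨M', hM'⟩ := hS'.bounded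
    obtain ⟨ρ, m, m'⟩ := exists_proj_tensor (S := S'.toDGModule)
      (S' := (simplexAlg (Fin 2)).toDGModule) hM' hS'.nonpos k k' l l'
    exact exists_proj_ofGraded (π := fun n => LinearMap.prodMap (π n) (ρ n))
      (fun n x hx => Prod.ext (h n _ hx.1) (m n _ hx.2))
      (fun n n' hn x hx => Prod.ext (h' n n' hn _ hx.1) (m' n n' hn _ hx.2))
  nilpotent := by
    obtain ⟨N, hN⟩ := hS.nilpotent
    obtain ⟨N', hN'⟩ := hS'.nilpotent
    let P : ℕ → Submodule ℝ (C × (C' ⊗[ℝ] SimplexForms (Fin 2))) := fun s =>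
      (S.mpow s).prod (Submodule.map₂ (TensorProduct.mk ℝ C' (SimplexForms (Fin 2))) (S'.mpow s) ⊤)
    refine ⟨max N N', eq_bot_iff.2 fun x hx => (Submodule.mem_bot ℝ).2 (Subtype.ext ?_)⟩
    have h := mpow_ofGraded_le (S := S.prod (S'.tensor (simplexAlg (Fin 2)))) (P := P)
      (fun x _ => ⟨Submodule.mem_top, by
        rw [show S'.mpow 0 = ⊤ from rfl, TensorProduct.map₂_mk_top_top_eq_top]
        exact Submodule.mem_top⟩)
      (fun s x _ y hy => ⟨S.mul_mem_mpow _ hy.1, tensor_mul_mem_mpow S' (simplexAlg (Fin 2)) s x.2 hy.2⟩) _ hx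
    have h₁ : S.mpow (max N N') = ⊥ := eq_bot_iff.2 ((S.mpow_antitone (le_max_left _ _)).trans hN.le)
    have h₂ : S'.mpow (max N N') = ⊥ :=
      eq_bot_iff.2 ((S'.mpow_antitone (le_max_right _ _)).trans hN'.le)
    obtain ⟨h, h'⟩ := h
    rw [SetLike.mem_coe, h₁] at h
    rw [SetLike.mem_coe, h₂, Submodule.map₂_bot_left] at h'
    exact Prod.ext h h'

/-- The projection of the mapping path algebra to the source. -/
def pathFst (S : DGComm C) (S' : DGComm C') (f : C →ₗ[ℝ] C') : ↥(⨆ n, pathGr S S' f n) →ₗ[ℝ] C :=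
  LinearMap.fst ℝ C _ ∘ₗ (⨆ n, pathGr S S' f n).subtype

/-- The end point of a path. -/
def pathEnd (S : DGComm C) (S' : DGComm C') (f : C →ₗ[ℝ] C') : ↥(⨆ n, pathGr S S' f n) →ₗ[ℝ] C' :=
  evalMap C' 1 ∘ₗ LinearMap.snd ℝ C _ ∘ₗ (⨆ n, pathGr S S' f n).subtype

lemma pathFst_isHom (hf : S.IsHom S' f) : (pathAlg hf).IsHom S (pathFst S S' f) where
  map_gr hx := hx.1.1
  map_d _ := rfl
  map_mul _ _ := rfl

lemma pathEnd_isHom (hf : S.IsHom S' f) : (pathAlg hf).IsHom S' (pathEnd S S' f) where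
  map_gr hx := (evalMap_isHom S' 1).map_gr hx.1.2
  map_d x := (evalMap_isHom S' 1).map_d x.1.2
  map_mul x y := (evalMap_isHom S' 1).map_mul x.1.2 y.1.2

lemma constPath_mem (hf : S.IsHom S' f) (hS : S.IsArtin) (n : ℤ) {x : C} (hx : x ∈ S.gr n) :
    (x, constMap C' (Fin 2) (f x)) ∈ pathGr S S' f n :=
  ⟨⟨hx, (constMap_isHom S').map_gr (hf.map_gr hx)⟩, (evalMap_constMap 0 _).symm, fun hn => by
    rw [hS.nonpos n hn x hx, map_zero, map_zero], fun hn => by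
    rw [← (constMap_isHom S').map_d, ← hf.map_d, hS.nonpos (n + 1) (by omega) _ (S.d_mem hx),
      map_zero, map_zero]⟩

/-- The inclusion of the constant paths. -/
def constPath (hf : S.IsHom S' f) (hS : S.IsArtin) : C →ₗ[ℝ] ↥(⨆ n, pathGr S S' f n) :=
  (LinearMap.id.prod (constMap C' (Fin 2) ∘ₗ f)).codRestrict _ fun x => by
    induction x using S.induction with
    | h n x hx => exact le_iSup (pathGr S S' f) n (constPath_mem hf hS n hx)
    | hadd x y hx hy =>
      rw [map_add]
      exact Submodule.add_mem _ hx hy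

lemma constPath_isHom (hf : S.IsHom S' f) (hS : S.IsArtin) :
    S.IsHom (pathAlg hf) (constPath hf hS) where
  map_gr hx := constPath_mem hf hS _ hx
  map_d x := Subtype.ext (Prod.ext rfl
    ((congrArg _ (hf.map_d x)).trans ((constMap_isHom S').map_d (f x))))
  map_mul x y := Subtype.ext (Prod.ext rfl
    ((congrArg _ (hf.map_mul x y)).trans ((constMap_isHom S').map_mul (f x) (f y))))

lemma pathFst_constPath (hf : S.IsHom S' f) (hS : S.IsArtin) :
    pathFst S S' f ∘ₗ constPath hf hS = LinearMap.id := rfl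

lemma pathEnd_constPath (hf : S.IsHom S' f) (hS : S.IsArtin) :
    pathEnd S S' f ∘ₗ constPath hf hS = f :=
  LinearMap.ext fun x => evalMap_constMap 1 (f x)

/-- The contraction of paths to their value at a vertex. -/
def pathContraction (S' : DGComm C') (j : Fin 2) :
    C' ⊗[ℝ] SimplexForms (Fin 2) →ₗ[ℝ] C' ⊗[ℝ] SimplexForms (Fin 2) :=
  TensorProduct.map S'.sgn (poincare j)

lemma pathContraction_mem (j : Fin 2) {n : ℤ} {x : C' ⊗[ℝ] SimplexForms (Fin 2)}
    (hx : x ∈ (S'.tensor (simplexAlg (Fin 2))).gr n) :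
    pathContraction S' j x ∈ (S'.tensor (simplexAlg (Fin 2))).gr (n - 1) :=
  map_mem_gradedTensor (a := 0) (b := -1)
    (fun p x hx => by rw [add_zero]; exact S'.sgn_mem hx) (fun q y hy => poincare_mem j hy)
    (by omega) hx

lemma evalMap_pathContraction (j : Fin 2) (x : C' ⊗[ℝ] SimplexForms (Fin 2)) :
    evalMap C' j (pathContraction S' j x) = 0 := by
  induction x using TensorProduct.induction_on with
  | zero => simp only [map_zero]
  | add x y hx hy => simp only [map_add, hx, hy, add_zero]
  | tmul c w =>
    refine (evalMap_tmul j _ _).trans ?_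
    rw [vertexEval_poincare, zero_smul]

lemma d_pathContraction (j : Fin 2) {x : C' ⊗[ℝ] SimplexForms (Fin 2)}
    (hx : (S'.tensor (simplexAlg (Fin 2))).d x = 0) (hx' : evalMap C' j x = 0) :
    (S'.tensor (simplexAlg (Fin 2))).d (pathContraction S' j x) = x := by
  have h := LinearMap.congr_fun (tensor_poincare_homotopy S' j) x
  have h' : TensorProduct.map LinearMap.id (simplexPullback (fun _ : Fin 2 => j)).toLinearMap =
      constMap C' (Fin 2) ∘ₗ evalMap C' j := by
    ext c w
    refine (congrArg (c ⊗ₜ[ℝ] ·) ((simplexPullback_const j w).trans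
      (Algebra.algebraMap_eq_smul_one _))).trans ?_
    rw [TensorProduct.tmul_smul, TensorProduct.smul_tmul']
    rfl
  rw [h', LinearMap.add_apply, LinearMap.comp_apply, LinearMap.comp_apply, hx, map_zero, add_zero,
    LinearMap.sub_apply, LinearMap.comp_apply, hx', map_zero, sub_zero] at h
  exact h

/-- The path `c t_j`, where `t_j` is the coordinate which is `1` at `j`. -/
lemma coordPath_mem (j : Fin 2) {n : ℤ} {c : C'} (hc : c ∈ S'.gr n) :
    c ⊗ₜ[ℝ] coordForm j ∈ (S'.tensor (simplexAlg (Fin 2))).gr n :=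
  tmul_mem_gradedTensor (add_zero n) hc (coordForm_mem j)

lemma evalMap_coordPath (i j : Fin 2) (c : C') :
    evalMap C' i (c ⊗ₜ[ℝ] coordForm j) = if j = i then c else 0 := by
  rw [evalMap_tmul, vertexEval_coordForm]
  split_ifs
  · exact one_smul ℝ c
  · exact zero_smul ℝ c

/-- The kernel consists of the paths that start at zero, and these are contracted to their starting
point. For `n ≤ 0` the primitive has negative degree, where the truncation imposes nothing. -/
lemma pathFst_acyclic (hf : S.IsHom S' f) (n : ℤ) (x : ↥(⨆ n, pathGr S S' f n))
    (hx : x ∈ (pathAlg hf).gr n) (hx' : pathFst S S' f x = 0) (hdx : (pathAlg hf).d x = 0) :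
    ∃ y ∈ (pathAlg hf).gr (n - 1), pathFst S S' f y = 0 ∧ (pathAlg hf).d y = x := by
  obtain ⟨⟨a, β⟩, hmem⟩ := x
  obtain rfl : a = 0 := hx'
  replace hx : ((0 : C), β) ∈ pathGr S S' f n := hx
  have hdβ : (S'.tensor (simplexAlg (Fin 2))).d β = 0 := congrArg (fun z => z.1.2) hdx
  have hβ : evalMap C' 0 β = 0 := hx.2.1.symm.trans (map_zero f)
  rcases lt_or_ge 0 n with hn | hn
  · refine ⟨0, Submodule.zero_mem _, map_zero _, ?_⟩
    rw [map_zero]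
    exact Subtype.ext (Prod.ext rfl (hx.2.2.1 hn).symm)
  · have h : ((0 : C), pathContraction S' 0 β) ∈ pathGr S S' f (n - 1) :=
      ⟨⟨Submodule.zero_mem _, pathContraction_mem 0 hx.1.2⟩,
        (map_zero f).trans (evalMap_pathContraction 0 β).symm, fun h => by omega, fun h => by omega⟩
    exact ⟨⟨_, le_iSup (pathGr S S' f) _ h⟩, h, rfl,
      Subtype.ext (Prod.ext (map_zero S.d) (d_pathContraction 0 hdβ hβ))⟩

/-- In negative degree `c t₁` is a path from zero to `c`. In degree zero the path must be closed: `c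
= f a + db` by surjectivity on cohomology, and `f a + d(b t₁)` is a closed path from `f a` to `c`.
-/
lemma pathEnd_surjective (hf : S.IsHom S' f) (hS' : S'.IsArtin)
    (hq : S.toDGModule.IsQuasiIso S'.toDGModule f) : Function.Surjective (pathEnd S S' f) := by
  intro c
  induction c using S'.induction with
  | hadd x y hx hy =>
    obtain ⟨x, rfl⟩ := hx
    obtain ⟨y, rfl⟩ := hy
    exact ⟨x + y, map_add _ _ _⟩
  | h n c hc =>
    rcases lt_trichotomy n 0 with hn | rfl | hn
    · have h : ((0 : C), c ⊗ₜ[ℝ] coordForm (1 : Fin 2)) ∈ pathGr S S' f n :=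
        ⟨⟨Submodule.zero_mem _, coordPath_mem 1 hc⟩, by
          rw [map_zero]
          exact ((evalMap_coordPath 0 1 c).trans (if_neg (by decide))).symm,
          fun h => by omega, fun h => by omega⟩
      exact ⟨⟨_, le_iSup (pathGr S S' f) _ h⟩, (evalMap_coordPath 1 1 c).trans (if_pos rfl)⟩
    · obtain ⟨a, ha, hda, b, hb, rfl⟩ := hq.surj 0 c hc (hS'.nonpos 1 one_pos _ (S'.d_mem hc))
      have h₁ := (evalMap_isHom S' (0 : Fin 2)).map_d (b ⊗ₜ[ℝ] coordForm 1)
      have h₂ := (evalMap_isHom S' (1 : Fin 2)).map_d (b ⊗ₜ[ℝ] coordForm 1)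
      rw [evalMap_coordPath, if_neg (by decide), map_zero] at h₁
      rw [evalMap_coordPath, if_pos rfl] at h₂
      have h : (a, constMap C' (Fin 2) (f a) + (S'.tensor (simplexAlg (Fin 2))).d
          (b ⊗ₜ[ℝ] coordForm 1)) ∈ pathGr S S' f 0 := by
        have hd : (S'.tensor (simplexAlg (Fin 2))).d (b ⊗ₜ[ℝ] coordForm 1) ∈
            (S'.tensor (simplexAlg (Fin 2))).gr 0 := by
          have := (S'.tensor (simplexAlg (Fin 2))).d_mem (coordPath_mem 1 hb)
          rwa [sub_add_cancel] at this
        refine ⟨⟨ha, Submodule.add_mem _ ((constMap_isHom S').map_gr (hf.map_gr ha)) hd⟩, ?_,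
          fun h => absurd h (lt_irrefl 0), fun _ => ?_⟩
        · rw [map_add, evalMap_constMap, h₁, add_zero]
        · rw [map_add, DGModule.d_d, ← (constMap_isHom S').map_d, ← hf.map_d, hda, map_zero, map_zero,
            add_zero]
      refine ⟨⟨_, le_iSup (pathGr S S' f) _ h⟩, ?_⟩
      have h₃ := map_add (evalMap C' (1 : Fin 2)) (constMap C' (Fin 2) (f a))
        ((S'.tensor (simplexAlg (Fin 2))).d (b ⊗ₜ[ℝ] coordForm 1))
      rw [evalMap_constMap, h₂] at h₃
      exact h₃
    · exact ⟨0, by rw [map_zero, hS'.nonpos n hn c hc]⟩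

lemma pathEnd_acyclic (hf : S.IsHom S' f) (hS : S.IsArtin)
    (hq : S.toDGModule.IsQuasiIso S'.toDGModule f) (n : ℤ) (x : ↥(⨆ n, pathGr S S' f n))
    (hx : x ∈ (pathAlg hf).gr n) (hx' : pathEnd S S' f x = 0) (hdx : (pathAlg hf).d x = 0) :
    ∃ y ∈ (pathAlg hf).gr (n - 1), pathEnd S S' f y = 0 ∧ (pathAlg hf).d y = x := by
  rcases lt_or_ge 0 n with hn | hn
  · refine ⟨0, Submodule.zero_mem _, map_zero _, ?_⟩
    rw [map_zero]
    exact Subtype.ext (Prod.ext (hS.nonpos n hn _ hx.1.1).symm (hx.2.2.1 hn).symm)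
  obtain ⟨⟨a, β⟩, hmem⟩ := x
  replace hx : (a, β) ∈ pathGr S S' f n := hx
  have hda : S.d a = 0 := congrArg (fun z => z.1.1) hdx
  have hdβ : (S'.tensor (simplexAlg (Fin 2))).d β = 0 := congrArg (fun z => z.1.2) hdx
  have hβ : evalMap C' 1 β = 0 := hx'
  -- Contracting to the end point, where `β` vanishes, gives a primitive `γ` with end point zero.
  -- Its starting point is a primitive of `f a`, so `a = d a'` by injectivity on cohomology.
  have hdh := d_pathContraction 1 hdβ hβ
  have hmem' := pathContraction_mem (S' := S') 1 hx.1.2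
  set γ := pathContraction S' 1 β with hγ
  have hγ₁ : evalMap C' 1 γ = 0 := evalMap_pathContraction 1 β
  have hc := (evalMap_isHom S' (0 : Fin 2)).map_gr hmem'
  have hdc : S'.d (evalMap C' 0 γ) = f a := by
    rw [← (evalMap_isHom S' 0).map_d, hdh]
    exact hx.2.1.symm
  obtain ⟨a', ha', rfl⟩ := hq.inj n a hx.1.1 hda _ hc hdc.symm
  -- The pair of `a'` and `γ` may fail to match at the starting point. The mismatch is closed, so it
  -- is `f z + dw`, and it is removed by subtracting `z` and adding `d(w t₀)`; neither changes the
  -- differential or the end point.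
  obtain ⟨z, hz, hdz, w, hw, hzw⟩ := hq.surj (n - 1) (f a' - evalMap C' 0 γ)
    (Submodule.sub_mem _ (hf.map_gr ha') hc) (by rw [map_sub, hdc, hf.map_d, sub_self])
  have h₁ := (evalMap_isHom S' (0 : Fin 2)).map_d (w ⊗ₜ[ℝ] coordForm 0)
  have h₂ := (evalMap_isHom S' (1 : Fin 2)).map_d (w ⊗ₜ[ℝ] coordForm 0)
  rw [evalMap_coordPath, if_pos rfl] at h₁
  rw [evalMap_coordPath, if_neg (by decide), map_zero] at h₂
  have hd : (S'.tensor (simplexAlg (Fin 2))).d (w ⊗ₜ[ℝ] coordForm 0) ∈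
      (S'.tensor (simplexAlg (Fin 2))).gr (n - 1) := by
    have := (S'.tensor (simplexAlg (Fin 2))).d_mem (coordPath_mem 0 hw)
    rwa [sub_add_cancel] at this
  have h : (a' - z, γ + (S'.tensor (simplexAlg (Fin 2))).d (w ⊗ₜ[ℝ] coordForm 0)) ∈
      pathGr S S' f (n - 1) := by
    refine ⟨⟨Submodule.sub_mem _ ha' hz, Submodule.add_mem _ hmem' hd⟩, ?_, fun h => by omega,
      fun h => by omega⟩
    rw [map_sub, map_add, h₁, sub_eq_iff_eq_add, add_assoc, add_comm (S'.d w), ← hzw]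
    abel
  refine ⟨⟨_, le_iSup (pathGr S S' f) _ h⟩, h, ?_, Subtype.ext (Prod.ext ?_ ?_)⟩
  · change evalMap C' 1 (γ + _) = 0
    rw [map_add, hγ₁, h₂, add_zero]
  · change S.d (a' - z) = S.d a'
    rw [map_sub, hdz, sub_zero]
  · change (S'.tensor (simplexAlg (Fin 2))).d (γ + _) = β
    rw [map_add, DGModule.d_d, add_zero, hdh]

variable {L : Type u} [AddCommGroup L] [Module ℝ L] (G : DGLie L)

/-- Quasi-isomorphisms of coefficients induce weak homotopy equivalences. -/
theorem mcSpaceMap_isWeakEquivalence (hf : S.IsHom S' f) (hS : S.IsArtin) (hS' : S'.IsArtin)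
    (hq : S.toDGModule.IsQuasiIso S'.toDGModule f) : IsWeakEquivalence (mcSpaceMap G hf) := by
  have hP := pathAlg_isArtin hf hS hS'
  have h₁ := isWeakEquivalence_of_rlp (mcSpaceMap_rlp_boundary G hP hS (pathFst_isHom hf)
    (fun x => ⟨constPath hf hS x, LinearMap.congr_fun (pathFst_constPath hf hS) x⟩)
    (pathFst_acyclic hf))
  have h₂ := isWeakEquivalence_of_rlp (mcSpaceMap_rlp_boundary G hP hS' (pathEnd_isHom hf)
    (pathEnd_surjective hf hS' hq) (pathEnd_acyclic hf hS hq))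
  -- The inclusion of the constant paths is a section of the first projection, and followed by the
  -- end point it is `f`.
  have h₃ := h₁.of_section (s := mcSpaceMap G (constPath_isHom hf hS))
    ((mcSpaceMap_comp G _ _ S.isHom_id).trans (mcSpaceMap_id G))
  have h₄ := h₃.comp h₂
  have h₅ : S.IsHom S' (pathEnd S S' f ∘ₗ constPath hf hS) := by
    rwa [pathEnd_constPath]
  rw [mcSpaceMap_comp G _ _ h₅] at h₄
  simpa only [pathEnd_constPath] using h₄

end PathObject

/-! ### Fibre products of dg Artinian algebras. -/

/-- Homogeneous parts with projections form a decomposition. -/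
@[reducible] def decompositionOfProj {V : Type*} [AddCommGroup V] [Module ℝ V]
    (𝒱 : ℤ → Submodule ℝ V) (hsup : ⨆ n, 𝒱 n = ⊤) (π : ℤ → V →ₗ[ℝ] V)
    (h : ∀ n, ∀ x ∈ 𝒱 n, π n x = x) (h' : ∀ m n, m ≠ n → ∀ x ∈ 𝒱 m, π n x = 0) :
    DirectSum.Decomposition 𝒱 :=
  ((DirectSum.isInternal_submodule_iff_iSupIndep_and_iSup_eq_top 𝒱).2 ⟨fun n => by
    rw [Submodule.disjoint_def]
    intro x hx hx'
    have : ⨆ m, ⨆ (_ : m ≠ n), 𝒱 m ≤ LinearMap.ker (π n) :=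
      iSup₂_le fun m hmn x hx => LinearMap.mem_ker.2 (h' m n hmn x hx)
    rw [← h n x hx]
    exact this hx', hsup⟩).chooseDecomposition

namespace DGArt

variable {A B C : DGArt.{u}} (f : B ⟶ A) (f' : C ⟶ A)

/-- The fibre product of the underlying algebras. -/
abbrev FibreProduct : Type u :=
  AlgHom.equalizer ((algHom f).comp (AlgHom.fst ℝ B.carrier C.carrier))
    ((algHom f').comp (AlgHom.snd ℝ B.carrier C.carrier))

/-- The first projection of the fibre product. -/
def FibreProduct.fst : FibreProduct f f' →ₐ[ℝ] B.carrier :=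
  (AlgHom.fst ℝ B.carrier C.carrier).comp (AlgHom.equalizer
    ((algHom f).comp (AlgHom.fst ℝ B.carrier C.carrier))
    ((algHom f').comp (AlgHom.snd ℝ B.carrier C.carrier))).val

/-- The second projection of the fibre product. -/
def FibreProduct.snd : FibreProduct f f' →ₐ[ℝ] C.carrier :=
  (AlgHom.snd ℝ B.carrier C.carrier).comp (AlgHom.equalizer
    ((algHom f).comp (AlgHom.fst ℝ B.carrier C.carrier))
    ((algHom f').comp (AlgHom.snd ℝ B.carrier C.carrier))).val

variable {f f'} in
lemma FibreProduct.cond (x : FibreProduct f f') : algHom f x.1.1 = algHom f' x.1.2 := x.2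

/-- The homogeneous parts of the fibre product. -/
def fibreGr (n : ℤ) : Submodule ℝ (FibreProduct f f') where
  carrier := {x | x.1.1 ∈ B.gr n ∧ x.1.2 ∈ C.gr n}
  zero_mem' := ⟨Submodule.zero_mem _, Submodule.zero_mem _⟩
  add_mem' hx hy := ⟨Submodule.add_mem _ hx.1 hy.1, Submodule.add_mem _ hx.2 hy.2⟩
  smul_mem' r _ hx := ⟨Submodule.smul_mem _ r hx.1, Submodule.smul_mem _ r hx.2⟩

lemma sum_proj {π : ℤ → A.carrier →ₗ[ℝ] A.carrier} (h : ∀ n, ∀ x ∈ A.gr n, π n x = x)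
    (h' : ∀ m n, m ≠ n → ∀ x ∈ A.gr m, π n x = 0) {N : ℤ} (hN : ∀ q < N, A.gr q = ⊥)
    (x : A.carrier) : ∑ n ∈ Finset.Icc N 0, π n x = x := by
  induction x using A.alg.induction with
  | hadd x y hx hy => simp only [map_add, Finset.sum_add_distrib, hx, hy]
  | h m x hx =>
    by_cases hm : m ∈ Finset.Icc N 0
    · rw [Finset.sum_eq_single_of_mem m hm fun n _ hn => h' m n hn.symm x hx, h m x hx]
    · have hx0 : x = 0 := by
        rw [Finset.mem_Icc, not_and_or] at hm
        have hx : x ∈ A.gr m := hx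
        rcases hm with hm | hm
        · rwa [hN m (by omega), Submodule.mem_bot] at hx
        · rwa [A.nonpos m (by omega), Submodule.mem_bot] at hx
      simp [hx0]

/-- The projections of `B` and `C` are compatible with those of `A`, so they preserve the condition
that defines the fibre product. -/
lemma exists_fibre_proj : ∃ π : ℤ → FibreProduct f f' →ₗ[ℝ] FibreProduct f f',
    (∀ n, ∀ x ∈ fibreGr f f' n, π n x = x) ∧
      (∀ m n, m ≠ n → ∀ x ∈ fibreGr f f' m, π n x = 0) ∧ ⨆ n, fibreGr f f' n = ⊤ := by
  obtain ⟨α, hα, hα'⟩ := exists_proj_of_decomposition A.gr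
  obtain ⟨β, hβ, hβ'⟩ := exists_proj_of_decomposition B.gr
  obtain ⟨γ, hγ, hγ'⟩ := exists_proj_of_decomposition C.gr
  have h₁ : ∀ n x, algHom f (β n x) = α n (algHom f x) := fun n x => by
    have := map_proj (S := B.alg.toDGModule) (S' := A.alg.toDGModule) hβ hβ' hα hα'
      (φ := (algHom f).toLinearMap) 0 (fun n x hx => by rw [add_zero]; exact algHom_mem f hx) n x
    rwa [add_zero] at this
  have h₂ : ∀ n x, algHom f' (γ n x) = α n (algHom f' x) := fun n x => by
    have := map_proj (S := C.alg.toDGModule) (S' := A.alg.toDGModule) hγ hγ' hα hα'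
      (φ := (algHom f').toLinearMap) 0 (fun n x hx => by rw [add_zero]; exact algHom_mem f' hx) n x
    rwa [add_zero] at this
  let π : ℤ → FibreProduct f f' →ₗ[ℝ] FibreProduct f f' := fun n =>
    { toFun := fun x => ⟨(β n x.1.1, γ n x.1.2), ((h₁ n _).trans (by rw [x.cond])).trans (h₂ n _).symm⟩
      map_add' := fun x y => Subtype.ext (Prod.ext (map_add _ _ _) (map_add _ _ _))
      map_smul' := fun r x => Subtype.ext (Prod.ext (map_smul _ _ _) (map_smul _ _ _)) }
  refine ⟨π, fun n x hx => Subtype.ext (Prod.ext (hβ n _ hx.1) (hγ n _ hx.2)),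
    fun m n hmn x hx => Subtype.ext (Prod.ext (hβ' m n hmn _ hx.1) (hγ' m n hmn _ hx.2)),
    eq_top_iff.2 fun x _ => ?_⟩
  obtain ⟨N, hN⟩ := B.bounded
  obtain ⟨N', hN'⟩ := C.bounded
  have hx : x = ∑ n ∈ Finset.Icc (min N N') 0, π n x := by
    refine Subtype.ext (Prod.ext ?_ ?_)
    · exact (sum_proj (N := min N N') hβ hβ'
        (fun q hq => hN q (lt_of_lt_of_le hq (min_le_left _ _))) x.1.1).symm.trans
        (map_sum (FibreProduct.fst f f') (fun n => π n x) _).symm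
    · exact (sum_proj (N := min N N') hγ hγ'
        (fun q hq => hN' q (lt_of_lt_of_le hq (min_le_right _ _))) x.1.2).symm.trans
        (map_sum (FibreProduct.snd f f') (fun n => π n x) _).symm
  rw [hx]
  exact Submodule.sum_mem _ fun n _ => Submodule.mem_iSup_of_mem n
    ⟨proj_mem (S := B.alg.toDGModule) hβ hβ' n _, proj_mem (S := C.alg.toDGModule) hγ hγ' n _⟩

instance fibreDecomposition : DirectSum.Decomposition (fibreGr f f') :=
  decompositionOfProj _ (exists_fibre_proj f f').choose_spec.2.2 _
    (exists_fibre_proj f f').choose_spec.1 (exists_fibre_proj f f').choose_spec.2.1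

instance fibreGraded : GradedAlgebra (fibreGr f f') where
  one_mem := ⟨SetLike.one_mem_graded B.gr, SetLike.one_mem_graded C.gr⟩
  mul_mem _ _ _ _ hx hy := ⟨SetLike.mul_mem_graded hx.1 hy.1, SetLike.mul_mem_graded hx.2 hy.2⟩

/-- The maximal ideal of the fibre product. -/
def fibreIdeal : Ideal (FibreProduct f f') where
  carrier := {x | x.1.1 ∈ B.m}
  zero_mem' := B.m.zero_mem
  add_mem' hx hy := B.m.add_mem hx hy
  smul_mem' c _ hx := B.m.mul_mem_left c.1.1 hx

variable {f f'}

/-- The two components have the same image in `A`, and maps of dg Artinian algebras detect the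
maximal ideal. So the condition on the first component controls the second. -/
lemma snd_mem_m {x : FibreProduct f f'} (hx : x ∈ fibreIdeal f f') : x.1.2 ∈ C.m :=
  mem_m_of_algHom_mem f' (by
    rw [← x.cond]
    exact algHom_mem_m f hx)

lemma isMaximal_of_residue {R : Type*} [Ring R] [Algebra ℝ R] {I : Ideal R}
    (h : ∀ a, ∃ c : ℝ, a - algebraMap ℝ R c ∈ I) (h₁ : (1 : R) ∉ I) : I.IsMaximal := by
  refine Ideal.isMaximal_def.2 ⟨(Ideal.ne_top_iff_one I).2 h₁, fun K hK => ?_⟩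
  obtain ⟨x, hx, hxI⟩ := SetLike.exists_of_lt hK
  obtain ⟨c, hc⟩ := h x
  have hcK : algebraMap ℝ R c ∈ K := by
    have := K.sub_mem hx (hK.le hc)
    rwa [sub_sub_cancel] at this
  have hc0 : c ≠ 0 := fun h => hxI (by rwa [h, map_zero, sub_zero] at hc)
  refine (Ideal.eq_top_iff_one K).2 ?_
  have := K.mul_mem_left (algebraMap ℝ R c⁻¹) hcK
  rwa [← map_mul, inv_mul_cancel₀ hc0, map_one] at this

lemma eq_of_isMaximal_of_isNilpotent {R : Type*} [Ring R] {I K : Ideal R} (hI : I.IsMaximal)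
    (h : ∀ x ∈ I, IsNilpotent x) (hK : K.IsMaximal) : K = I := by
  refine (hI.eq_of_le hK.ne_top fun x hx => ?_).symm
  by_contra hxK
  -- If `x` were outside `K`, then `1 = y x + z` with `z` in `K`; but `y x` is nilpotent, so `z`
  -- would be a unit.
  obtain ⟨y, z, hz, hyz⟩ := hK.exists_inv hxK
  have hu : IsUnit z := by
    rw [← add_sub_cancel_left (y * x) z, hyz]
    exact (h _ (I.mul_mem_left y hx)).isUnit_one_sub
  exact hK.ne_top (Ideal.eq_top_of_isUnit_mem _ hz hu)

lemma fibre_nilpotent : ∃ N : ℕ, ∀ l : List (FibreProduct f f'), l.length = N →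
    (∀ a ∈ l, a ∈ fibreIdeal f f') → l.prod = 0 := by
  obtain ⟨N, hN⟩ := B.nilpotent
  obtain ⟨N', hN'⟩ := C.nilpotent
  -- The first `N` factors annihilate the first component and the remaining `N'` the second.
  refine ⟨N + N', fun l hl h => ?_⟩
  have h₁ : (l.take N).prod.1.1 = 0 := by
    refine (map_list_prod (FibreProduct.fst f f') (l.take N)).trans (hN _ (by simp [hl]) ?_)
    intro a ha
    obtain ⟨x, hx, rfl⟩ := List.mem_map.1 ha
    exact h x (List.mem_of_mem_take hx)
  have h₂ : (l.drop N).prod.1.2 = 0 := by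
    refine (map_list_prod (FibreProduct.snd f f') (l.drop N)).trans (hN' _ (by simp [hl]) ?_)
    intro a ha
    obtain ⟨x, hx, rfl⟩ := List.mem_map.1 ha
    exact snd_mem_m (h x (List.mem_of_mem_drop hx))
  rw [← List.prod_take_mul_prod_drop l N]
  refine Subtype.ext (Prod.ext ?_ ?_)
  · exact (congrArg (· * _) h₁).trans (zero_mul _)
  · exact (congrArg (_ * ·) h₂).trans (mul_zero _)

variable (f f') in
/-- The fibre product of dg Artinian algebras. -/
def fibre : DGArt.{u} where
  carrier := FibreProduct f f'
  gr := fibreGr f f'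
  d :=
    { toFun := fun x => ⟨(B.d x.1.1, C.d x.1.2), by
        refine (algHom_d f _).trans (Eq.trans ?_ (algHom_d f' _).symm)
        rw [x.cond]⟩
      map_add' := fun x y => Subtype.ext (Prod.ext (map_add _ _ _) (map_add _ _ _))
      map_smul' := fun r x => Subtype.ext (Prod.ext (map_smul _ _ _) (map_smul _ _ _)) }
  d_mem n x hx := ⟨B.d_mem n _ hx.1, C.d_mem n _ hx.2⟩
  d_d x := Subtype.ext (Prod.ext (B.d_d _) (C.d_d _))
  leibniz n x hx y := Subtype.ext (Prod.ext (B.leibniz n _ hx.1 _) (C.leibniz n _ hx.2 _))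
  graded_comm m n x hx y hy := Subtype.ext (Prod.ext (B.graded_comm m n _ hx.1 _ hy.1)
    (C.graded_comm m n _ hx.2 _ hy.2))
  nonpos n hn := eq_bot_iff.2 fun x hx => (Submodule.mem_bot ℝ).2 (by
    have h := hx.1
    have h' := hx.2
    rw [B.nonpos n hn, Submodule.mem_bot] at h
    rw [C.nonpos n hn, Submodule.mem_bot] at h'
    exact Subtype.ext (Prod.ext h h'))
  finite n := by
    have := B.finite n
    have := C.finite n
    let j : fibreGr f f' n →ₗ[ℝ] B.gr n × C.gr n :=
      { toFun := fun x => (⟨x.1.1.1, x.2.1⟩, ⟨x.1.1.2, x.2.2⟩)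
        map_add' := fun _ _ => rfl
        map_smul' := fun _ _ => rfl }
    refine FiniteDimensional.of_injective j fun x y h => Subtype.ext (Subtype.ext (Prod.ext ?_ ?_))
    · exact congrArg (fun z => z.1.1) h
    · exact congrArg (fun z => z.2.1) h
  bounded := by
    obtain ⟨N, hN⟩ := B.bounded
    obtain ⟨N', hN'⟩ := C.bounded
    refine ⟨min N N', fun n hn => eq_bot_iff.2 fun x hx => (Submodule.mem_bot ℝ).2 ?_⟩
    have h := hx.1
    have h' := hx.2
    rw [hN n (lt_of_lt_of_le hn (min_le_left _ _)), Submodule.mem_bot] at h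
    rw [hN' n (lt_of_lt_of_le hn (min_le_right _ _)), Submodule.mem_bot] at h'
    exact Subtype.ext (Prod.ext h h')
  m := fibreIdeal f f'
  isMaximal := isMaximal_of_residue (fun x => B.residue x.1.1)
    fun h => (Ideal.ne_top_iff_one _).1 B.isMaximal.ne_top h
  eq_of_isMaximal K hK := eq_of_isMaximal_of_isNilpotent
    (isMaximal_of_residue (fun x => B.residue x.1.1)
      fun h => (Ideal.ne_top_iff_one _).1 B.isMaximal.ne_top h)
    (fun x hx => by
      obtain ⟨N, hN⟩ := fibre_nilpotent (f := f) (f' := f')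
      refine ⟨N, ?_⟩
      rw [← List.prod_replicate]
      exact hN _ (by simp) fun b hb => by rwa [List.eq_of_mem_replicate hb]) hK
  residue x := B.residue x.1.1
  nilpotent := fibre_nilpotent
  d_mem_m x hx := B.d_mem_m _ hx

variable (f f') in
/-- The first projection of the fibre product. -/
def fibreFst : fibre f f' ⟶ B :=
  (⟨FibreProduct.fst f f', fun _ _ h => h.1, fun _ => rfl⟩ : Hom (fibre f f') B)

variable (f f') in
/-- The second projection of the fibre product. -/
def fibreSnd : fibre f f' ⟶ C :=
  (⟨FibreProduct.snd f f', fun _ _ h => h.2, fun _ => rfl⟩ : Hom (fibre f f') C)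

lemma fibre_isPullback : IsPullback (fibreFst f f') (fibreSnd f f') f f' where
  w := Hom.ext (AlgHom.ext fun x => FibreProduct.cond x)
  isLimit' := ⟨Limits.PullbackCone.IsLimit.mk _
    (fun s => (⟨((algHom s.fst).prod (algHom s.snd)).codRestrict _ (fun x =>
        congrArg (fun φ : s.pt ⟶ A => algHom φ x) s.condition),
      fun _ _ h => ⟨algHom_mem s.fst h, algHom_mem s.snd h⟩,
      fun x => Subtype.ext (Prod.ext (algHom_d s.fst x) (algHom_d s.snd x))⟩ : Hom s.pt (fibre f f')))
    (fun _ => rfl) (fun _ => rfl)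
    (fun _ _ h h' => Hom.ext (AlgHom.ext fun x => Subtype.ext (Prod.ext
      (congrArg (fun φ => algHom φ x) h) (congrArg (fun φ => algHom φ x) h'))))⟩

end DGArt

/-! ### The Maurer–Cartan functor on fibre products and the formal moduli problem. -/

section FibreProducts

variable {A B C : DGArt.{u}}

lemma DGArt.alg_isBounded (A : DGArt.{u}) : A.alg.toDGModule.IsBounded where
  nonpos n hn x hx := (Submodule.mem_bot ℝ).1 (A.nonpos n hn ▸ hx)
  bounded := by
    obtain ⟨N, hN⟩ := A.bounded
    exact ⟨N.natAbs, fun n hn x hx => (Submodule.mem_bot ℝ).1 (hN n (by omega) ▸ hx)⟩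
  proj := exists_proj_of_decomposition A.gr

lemma DGArt.algHom_isHom (f : A ⟶ B) :
    A.alg.toDGModule.IsHom B.alg.toDGModule (DGArt.algHom f).toLinearMap where
  map_gr h := DGArt.algHom_mem f h
  map_d _ := DGArt.algHom_d f _

lemma coeffMap_degreeOne {g : DGLAData.{u}} {J : Type} [Fintype J] [DecidableEq J]
    (φ : A.carrier →ₗ[ℝ] B.carrier) (h : ∀ n, ∀ a ∈ A.gr n, φ a ∈ B.gr n)
    (hm : ∀ a ∈ A.m, φ a ∈ B.m) {x : Triple g A J} (hx : x ∈ degreeOne g A J) :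
    (coeffMap g.carrier φ (id : J → J) x : Triple g B J) ∈ degreeOne g B J := by
  induction hx using Submodule.span_induction with
  | mem α hα =>
    obtain ⟨p, q, r, hpqr, x, hx, a, ha, ham, w, hw, rfl⟩ := hα
    exact Submodule.subset_span ⟨p, q, r, hpqr, x, hx, φ a, h q a ha, hm a ham,
      simplexPullback id w, simplexPullback_mem id hw, rfl⟩
  | zero => rw [map_zero]; exact Submodule.zero_mem _
  | add α β _ _ hα hβ => rw [map_add]; exact Submodule.add_mem _ hα hβ
  | smul c α _ hα => rw [map_smul]; exact Submodule.smul_mem _ c hα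

open DGArt in
/-- Maurer–Cartan elements over a fibre product. -/
lemma existsUnique_maurerCartan_fibre (g : DGLAData.{u}) (f : B ⟶ A) (f' : C ⟶ A)
    (hf' : Function.Surjective (algHom f')) {J : Type} [Fintype J] [DecidableEq J] :
    (∀ x y : Triple g (fibre f f') J,
      tripleMap g (fibreFst f f') id x = tripleMap g (fibreFst f f') (id : J → J) y →
      tripleMap g (fibreSnd f f') id x = tripleMap g (fibreSnd f f') (id : J → J) y → x = y) ∧
    ∀ (β : maurerCartan g B J) (γ : maurerCartan g C J),
      tripleMap g f (id : J → J) β.1 = tripleMap g f' (id : J → J) γ.1 →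
      ∃ x : maurerCartan g (fibre f f') J, tripleMap g (fibreFst f f') (id : J → J) x.1 = β.1 ∧
        tripleMap g (fibreSnd f f') (id : J → J) x.1 = γ.1 := by
  obtain ⟨u, hu, huf⟩ := A.alg_isBounded.exists_graded_section (algHom_isHom f')
    (exists_homogeneous_preimage C.alg_isBounded A.alg_isBounded (algHom_isHom f') hf')
  have huf : ∀ y, algHom f' (u y) = y := huf
  have hum : ∀ a ∈ A.m, u a ∈ C.m := fun a ha => mem_m_of_algHom_mem f' (by rwa [huf])
  -- With the section `u` of `f'`, the maps `b ↦ (b, u (f b))` and `c ↦ (0, c - u (f' c))`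
  -- reconstruct an element of the fibre product linearly from its components. Being linear, they
  -- extend to the tensor products.
  let φ : B.carrier →ₗ[ℝ] (fibre f f').carrier :=
    { toFun := fun b => (⟨(b, u (algHom f b)), (huf _).symm⟩ : FibreProduct f f')
      map_add' := fun x y => Subtype.ext (Prod.ext rfl (by
        change u (algHom f (x + y)) = u (algHom f x) + u (algHom f y)
        rw [map_add, map_add]))
      map_smul' := fun r x => Subtype.ext (Prod.ext rfl (by
        change u (algHom f (r • x)) = r • u (algHom f x)
        rw [map_smul, map_smul])) }
  let ψ : C.carrier →ₗ[ℝ] (fibre f f').carrier :=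
    { toFun := fun c => (⟨(0, c - u (algHom f' c)), by
        change algHom f 0 = algHom f' (c - u (algHom f' c))
        rw [map_zero, map_sub, huf, sub_self]⟩ : FibreProduct f f')
      map_add' := fun x y => Subtype.ext (Prod.ext (add_zero 0).symm (by
        change x + y - u (algHom f' (x + y)) = x - u (algHom f' x) + (y - u (algHom f' y))
        rw [map_add, map_add]
        abel))
      map_smul' := fun r x => Subtype.ext (Prod.ext (smul_zero r).symm (by
        change r • x - u (algHom f' (r • x)) = r • (x - u (algHom f' x))
        rw [map_smul, map_smul, smul_sub])) }
  let p := (algHom (fibreFst f f')).toLinearMap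
  let p' := (algHom (fibreSnd f f')).toLinearMap
  have h₁ : φ ∘ₗ p + ψ ∘ₗ p' = LinearMap.id := LinearMap.ext fun x => Subtype.ext (Prod.ext
    (add_zero _) (by
      change u (algHom f x.1.1) + (x.1.2 - u (algHom f' x.1.2)) = x.1.2
      rw [FibreProduct.cond x]
      abel))
  have hinj : ∀ x y : Triple g (fibre f f') J,
      tripleMap g (fibreFst f f') id x = tripleMap g (fibreFst f f') (id : J → J) y →
      tripleMap g (fibreSnd f f') id x = tripleMap g (fibreSnd f f') (id : J → J) y → x = y := by
    have h (x : Triple g (fibre f f') J) : x =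
        coeffMap g.carrier φ (id : J → J) (tripleMap g (fibreFst f f') (id : J → J) x) +
          coeffMap g.carrier ψ (id : J → J) (tripleMap g (fibreSnd f f') (id : J → J) x) := by
      have := coeffMap_id (L := g.carrier) (C := (fibre f f').carrier) (J := J) x
      rw [← h₁, coeffMap_add] at this
      refine this.symm.trans (congrArg₂ (· + ·) ?_ ?_)
      · exact (coeffMap_comp (L := g.carrier) p φ id id x).symm
      · exact (coeffMap_comp (L := g.carrier) p' ψ id id x).symm
    intro x y h₂ h₃
    rw [h x, h y, h₂, h₃]
  refine ⟨hinj, fun β γ hβγ => ?_⟩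
  let x : Triple g (fibre f f') J :=
    coeffMap g.carrier φ (id : J → J) β.1 + coeffMap g.carrier ψ (id : J → J) γ.1
  have hx₁ : tripleMap g (fibreFst f f') (id : J → J) x = β.1 := by
    refine (map_add _ _ _).trans ?_
    have e₁ : p ∘ₗ φ = LinearMap.id := rfl
    have e₂ : p ∘ₗ ψ = 0 := rfl
    have k₁ := coeffMap_comp (L := g.carrier) φ p (id : J → J) id β.1
    have k₂ := coeffMap_comp (L := g.carrier) ψ p (id : J → J) id γ.1
    rw [e₁] at k₁
    rw [e₂] at k₂
    have k₃ := coeffMap_id (L := g.carrier) (C := B.carrier) (J := J) β.1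
    have k₄ : coeffMap g.carrier (0 : C.carrier →ₗ[ℝ] B.carrier) (id : J → J) γ.1 = 0 := by
      rw [coeffMap, TensorProduct.map_zero_left, TensorProduct.map_zero_right, LinearMap.zero_apply]
    exact (congrArg₂ (· + ·) (k₁.trans k₃) (k₂.trans k₄)).trans (add_zero _)
  have hx₂ : tripleMap g (fibreSnd f f') (id : J → J) x = γ.1 := by
    refine (map_add _ _ _).trans ?_
    have e₁ : p' ∘ₗ φ = u ∘ₗ (algHom f).toLinearMap := rfl
    have e₂ : p' ∘ₗ ψ = LinearMap.id - u ∘ₗ (algHom f').toLinearMap := rfl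
    have k₁ := coeffMap_comp (L := g.carrier) φ p' (id : J → J) id β.1
    have k₂ := coeffMap_comp (L := g.carrier) ψ p' (id : J → J) id γ.1
    have k₃ := coeffMap_id (L := g.carrier) (C := C.carrier) (J := J) γ.1
    have k₄ := coeffMap_comp (L := g.carrier) (algHom f).toLinearMap u (id : J → J) id β.1
    have k₅ := coeffMap_comp (L := g.carrier) (algHom f').toLinearMap u (id : J → J) id γ.1
    have k₆ := congrArg (coeffMap g.carrier u (id : J → J)) hβγ
    rw [e₁] at k₁
    rw [e₂] at k₂
    refine (congrArg₂ (· + ·) (k₁.trans (k₄.symm.trans (k₆.trans k₅))) (k₂.trans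
      ((coeffMap_sub _ _ _ _).trans (congrArg₂ (· - ·) k₃ rfl)))).trans ?_
    exact add_sub_cancel _ _
  refine ⟨⟨x, Submodule.add_mem _ (coeffMap_degreeOne φ ?_ ?_ β.2.1)
    (coeffMap_degreeOne ψ ?_ ?_ γ.2.1), ?_⟩, hx₁, hx₂⟩
  · exact fun n b hb => ⟨hb, hu n _ (algHom_mem f hb)⟩
  · exact fun b hb => hb
  · exact fun n c hc => ⟨Submodule.zero_mem _,
      Submodule.sub_mem _ hc (hu n _ (algHom_mem f' hc))⟩
  · exact fun c _ => B.m.zero_mem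
  -- The reconstruction is not multiplicative, so the Maurer–Cartan equation is checked after the
  -- two projections, which are jointly injective.
  · refine hinj _ _ ?_ ?_
    · rw [map_add, map_smul, ← totalD_tripleMap, ← totalBr_tripleMap, hx₁, β.2.2, map_zero]
    · rw [map_add, map_smul, ← totalD_tripleMap, ← totalBr_tripleMap, hx₂, γ.2.2, map_zero]

/-- Pullbacks of simplicial sets are computed in each degree. The square is a strict pullback, so
the comparison map is an isomorphism. -/
lemma mcFunctor_map_fibre_isPullback (g : DGLAData.{u}) (f : B ⟶ A) (f' : C ⟶ A)
    (hf' : Function.Surjective (DGArt.algHom f')) :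
    IsPullback ((mcFunctor g).map (DGArt.fibreFst f f')) ((mcFunctor g).map (DGArt.fibreSnd f f'))
      ((mcFunctor g).map f) ((mcFunctor g).map f') := by
  refine IsPullback.of_forall_isPullback_app fun n => (Limits.Types.isPullback_iff _ _ _ _).2 ?_
  have h := existsUnique_maurerCartan_fibre g f f' hf' (J := Fin (n.unop.len + 1))
  refine ⟨?_, fun x y hxy => Subtype.ext (h.1 _ _ (congrArg Subtype.val hxy.1)
    (congrArg Subtype.val hxy.2)), fun β γ hβγ => ?_⟩
  · exact congrArg (fun k => NatTrans.app k n) (((mcFunctor g).map_comp _ _).symm.trans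
      ((congrArg (mcFunctor g).map DGArt.fibre_isPullback.w).trans ((mcFunctor g).map_comp _ _)))
  · obtain ⟨x, hx, hx'⟩ := h.2 β γ (congrArg Subtype.val hβγ)
    exact ⟨x, Subtype.ext hx, Subtype.ext hx'⟩

lemma mcFunctor_map_isPullback (g : DGLAData.{u}) {P : DGArt.{u}} {f : B ⟶ A} {f' : C ⟶ A}
    {p : P ⟶ B} {p' : P ⟶ C} (hf' : Function.Surjective (DGArt.algHom f'))
    (h : IsPullback p p' f f') : IsPullback ((mcFunctor g).map p) ((mcFunctor g).map p')
      ((mcFunctor g).map f) ((mcFunctor g).map f') := by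
  refine IsPullback.of_iso (mcFunctor_map_fibre_isPullback g f f' hf')
    ((mcFunctor g).mapIso (DGArt.fibre_isPullback.isoIsPullback _ _ h)) (Iso.refl _) (Iso.refl _)
    (Iso.refl _) ?_ ?_ ?_ ?_
  · simp [← Functor.map_comp]
  · simp [← Functor.map_comp]
  · simp
  · simp

/-- The Maurer–Cartan functor of a dg Lie algebra is a formal moduli problem. -/
theorem isFormalModuliProblem_mcFunctor {g : DGLAData.{u}} (hg : g.IsDGLA) :
    IsFormalModuliProblem (mcFunctor g) where
  map_quasiIso {A B} f hf := by
    rw [mcFunctor_map_eq hg]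
    exact (isWeakEquivalence_of_isIso _).comp ((mcSpaceMap_isWeakEquivalence (DGLie.ofData hg)
      (DGArt.maxMap_isHom f) A.maxAlg_isArtin B.maxAlg_isArtin
      (DGArt.isQuasiIso_maxMap hf)).comp (isWeakEquivalence_of_isIso _))
  contractible A hA := isContractible_mcFunctor hA
  fibration f hf := mcFunctor_map_isKanFibration hg f hf
  exists_pullback f f' _ _ := ⟨_, _, _, DGArt.fibre_isPullback⟩
  pullback f f' p p' _ hf' h := by
    have := (mcFunctor_map_isPullback g hf' h)
    have e : Limits.pullback.lift ((mcFunctor g).map p) ((mcFunctor g).map p')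
        (by rw [← Functor.map_comp, ← Functor.map_comp, h.w]) = this.isoPullback.hom := by
      apply Limits.pullback.hom_ext
      · exact (Limits.pullback.lift_fst _ _ _).trans this.isoPullback_hom_fst.symm
      · exact (Limits.pullback.lift_snd _ _ _).trans this.isoPullback_hom_snd.symm
    rw [e]
    exact isWeakEquivalence_of_isIso _

end FibreProducts

/-! ### The dg algebra of differential forms on a manifold. -/

section DeRham

variable {n : ℕ} {M : Type u} [TopologicalSpace M] [ChartedSpace (Euc n) M] [IsManifold (𝓡 n) ∞ M]

variable (M) in
/-- The expression of a differential form in charts. -/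
def inCharts : DeRham (n := n) M →ₐ[ℝ] ∀ e : atlas (Euc n) M, OpenForms (chartOpen M e) :=
  DirectSum.coeAlgHom (manifoldForms (n := n) M)

lemma inCharts_of (p : ℤ) (α : manifoldForms (n := n) M p) :
    inCharts M (DirectSum.lof ℝ ℤ (fun p => manifoldForms (n := n) M p) p α) = α.1 :=
  DirectSum.coeAlgHom_of (manifoldForms (n := n) M) p α

lemma inCharts_mem {p : ℤ} {x : DeRham (n := n) M} (hx : x ∈ deRhamGrading M p)
    (e : atlas (Euc n) M) : inCharts M x e ∈ openGrading (chartOpen M e) p := by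
  obtain ⟨α, rfl⟩ := hx
  exact (congrFun (inCharts_of p α) e) ▸ α.2.1 e

/-- A form of one fixed degree is its family of chart expressions, so identities between forms of
the same degree can be checked in charts. -/
lemma eq_of_inCharts_eq {p : ℤ} {x y : DeRham (n := n) M} (hx : x ∈ deRhamGrading M p)
    (hy : y ∈ deRhamGrading M p) (h : ∀ e, inCharts M x e = inCharts M y e) : x = y := by
  obtain ⟨α, rfl⟩ := hx
  obtain ⟨β, rfl⟩ := hy
  refine congrArg _ (Subtype.ext (funext fun e => ?_))
  exact ((congrFun (inCharts_of p α) e).symm.trans (h e)).trans (congrFun (inCharts_of p β) e)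

lemma deRham_mul_mem {p q : ℤ} {x y : DeRham (n := n) M} (hx : x ∈ deRhamGrading M p)
    (hy : y ∈ deRhamGrading M q) : x * y ∈ deRhamGrading M (p + q) := by
  obtain ⟨α, rfl⟩ := hx
  obtain ⟨β, rfl⟩ := hy
  have h := DirectSum.of_mul_of (A := fun p => manifoldForms (n := n) M p) α β
  rw [← DirectSum.lof_eq_of ℝ, ← DirectSum.lof_eq_of ℝ, ← DirectSum.lof_eq_of ℝ] at h
  exact ⟨_, h.symm⟩

lemma deRhamD_of (p : ℤ) (α : manifoldForms (n := n) M p) :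
    deRhamD (n := n) M (DirectSum.lof ℝ ℤ (fun p => manifoldForms (n := n) M p) p α) =
      DirectSum.lof ℝ ℤ (fun p => manifoldForms (n := n) M p) (p + 1) (manifoldD M p α) :=
  DirectSum.toModule_lof (R := ℝ) (M := fun p => manifoldForms (n := n) M p)
    (N := ⨁ p : ℤ, manifoldForms (n := n) M p) p α

lemma deRhamD_mem {p : ℤ} {x : DeRham (n := n) M} (hx : x ∈ deRhamGrading M p) :
    deRhamD M x ∈ deRhamGrading M (p + 1) := by
  obtain ⟨α, rfl⟩ := hx
  exact ⟨manifoldD M p α, (deRhamD_of p α).symm⟩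

lemma deRham_induction {P : DeRham (n := n) M → Prop} (x : DeRham (n := n) M) (h₀ : P 0)
    (hadd : ∀ x y, P x → P y → P (x + y)) (h : ∀ p, ∀ x ∈ deRhamGrading M p, P x) : P x :=
  DirectSum.induction_on (motive := P) x h₀ (fun p α => h p _ ⟨α, rfl⟩) hadd

lemma inCharts_deRhamD (x : DeRham (n := n) M) (e : atlas (Euc n) M) :
    inCharts M (deRhamD M x) e = openD (chartOpen M e) (inCharts M x e) := by
  induction x using deRham_induction with
  | h₀ =>
    rw [map_zero, map_zero, Pi.zero_apply, map_zero]
  | hadd x y hx hy => rw [map_add, map_add, map_add, Pi.add_apply, Pi.add_apply, map_add, hx, hy]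
  | h p x hx =>
    obtain ⟨α, rfl⟩ := hx
    have h₁ := congrArg (inCharts M) (deRhamD_of p α)
    have h₂ := h₁.trans (inCharts_of (p + 1) (manifoldD M p α))
    exact (congrFun h₂ e).trans (congrArg (openD (chartOpen M e)) (congrFun (inCharts_of p α) e).symm)

lemma deRhamD_deRhamD (x : DeRham (n := n) M) : deRhamD M (deRhamD M x) = 0 := by
  induction x using deRham_induction with
  | h₀ => rw [map_zero, map_zero]
  | hadd x y hx hy => rw [map_add, map_add, hx, hy, add_zero]
  | h p x hx =>
    refine eq_of_inCharts_eq (deRhamD_mem (deRhamD_mem hx)) (Submodule.zero_mem _) fun e => ?_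
    rw [inCharts_deRhamD, inCharts_deRhamD, openD_openD, map_zero, Pi.zero_apply]

lemma deRham_mul_comm {p q : ℤ} {x y : DeRham (n := n) M} (hx : x ∈ deRhamGrading M p)
    (hy : y ∈ deRhamGrading M q) : x * y = ((-1 : ℝ) ^ (p * q)) • (y * x) := by
  refine eq_of_inCharts_eq (deRham_mul_mem hx hy)
    (Submodule.smul_mem _ _ (add_comm q p ▸ deRham_mul_mem hy hx)) fun e => ?_
  rw [map_smul, map_mul, map_mul, Pi.smul_apply, Pi.mul_apply, Pi.mul_apply]
  exact openForms_mul_comm (inCharts_mem hx e) (inCharts_mem hy e)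

lemma deRhamD_mul {p : ℤ} {x : DeRham (n := n) M} (hx : x ∈ deRhamGrading M p)
    (y : DeRham (n := n) M) :
    deRhamD M (x * y) = deRhamD M x * y + ((-1 : ℝ) ^ p) • (x * deRhamD M y) := by
  induction y using deRham_induction with
  | h₀ => simp only [mul_zero, map_zero, smul_zero, add_zero]
  | hadd y z hy hz =>
    simp only [mul_add, map_add, hy, hz, smul_add]
    abel
  | h q y hy =>
    have h₁ : deRhamD M x * y ∈ deRhamGrading M (p + q + 1) := by
      have := deRham_mul_mem (deRhamD_mem hx) hy
      rwa [add_right_comm] at this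
    have h₂ : x * deRhamD M y ∈ deRhamGrading M (p + q + 1) := by
      have := deRham_mul_mem hx (deRhamD_mem hy)
      rwa [← add_assoc] at this
    refine eq_of_inCharts_eq (deRhamD_mem (deRham_mul_mem hx hy))
      (Submodule.add_mem _ h₁ (Submodule.smul_mem _ _ h₂)) fun e => ?_
    rw [inCharts_deRhamD, map_add, map_smul, map_mul, map_mul, map_mul, Pi.add_apply,
      Pi.smul_apply, Pi.mul_apply, Pi.mul_apply, Pi.mul_apply, inCharts_deRhamD, inCharts_deRhamD]
    exact openD_leibniz (inCharts_mem hx e) _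

end DeRham

/-! ### Vector valued forms and the twisted differential. -/

section FormsIn

variable {M : Type u} [TopologicalSpace M] [ChartedSpace (Euc 3) M] [IsManifold (𝓡 3) ∞ M]
  {h h₁ h₂ h₃ : Type} [LieRing h] [LieAlgebra ℝ h] [AddCommGroup h₁] [Module ℝ h₁]
  [AddCommGroup h₂] [Module ℝ h₂] [AddCommGroup h₃] [Module ℝ h₃]

lemma formsInGrading_induction {P : FormsIn M h₁ → Prop} {p : ℤ} {x : FormsIn M h₁}
    (hx : x ∈ formsInGrading M h₁ p) (h₀ : P 0) (hadd : ∀ x y, P x → P y → P (x + y))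
    (htmul : ∀ α ∈ deRhamGrading M p, ∀ X, P (α ⊗ₜ[ℝ] X)) : P x := by
  obtain ⟨x, rfl⟩ := hx
  induction x using TensorProduct.induction_on with
  | zero => rwa [map_zero]
  | add x y hx hy => rw [map_add]; exact hadd _ _ hx hy
  | tmul α X => exact htmul α.1 α.2 X

lemma tmul_mem_formsInGrading {p : ℤ} {α : DeRham (n := 3) M} (hα : α ∈ deRhamGrading M p)
    (X : h₁) : α ⊗ₜ[ℝ] X ∈ formsInGrading M h₁ p :=
  ⟨⟨α, hα⟩ ⊗ₜ[ℝ] X, rfl⟩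

lemma wedge_tmul (b : h₁ →ₗ[ℝ] h₂ →ₗ[ℝ] h₃) (α β : DeRham (n := 3) M) (X : h₁) (Y : h₂) :
    wedge M b (α ⊗ₜ[ℝ] X) (β ⊗ₜ[ℝ] Y) = (α * β) ⊗ₜ[ℝ] b X Y := rfl

lemma formsInD_tmul (α : DeRham (n := 3) M) (X : h₁) :
    formsInD M h₁ (α ⊗ₜ[ℝ] X) = deRhamD M α ⊗ₜ[ℝ] X := rfl

lemma wedge_mem (b : h₁ →ₗ[ℝ] h₂ →ₗ[ℝ] h₃) {p q : ℤ} {x : FormsIn M h₁} {y : FormsIn M h₂}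
    (hx : x ∈ formsInGrading M h₁ p) (hy : y ∈ formsInGrading M h₂ q) :
    wedge M b x y ∈ formsInGrading M h₃ (p + q) := by
  refine formsInGrading_induction (P := fun x => wedge M b x y ∈ formsInGrading M h₃ (p + q)) hx
    ?_ (fun x x' hx hx' => ?_) fun α hα X => ?_
  · rw [map_zero, LinearMap.zero_apply]
    exact Submodule.zero_mem _
  · rw [map_add, LinearMap.add_apply]
    exact Submodule.add_mem _ hx hx'
  · refine formsInGrading_induction
      (P := fun y => wedge M b (α ⊗ₜ[ℝ] X) y ∈ formsInGrading M h₃ (p + q)) hy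
      ?_ (fun y y' hy hy' => ?_) fun β hβ Y => ?_
    · rw [map_zero]
      exact Submodule.zero_mem _
    · rw [map_add]
      exact Submodule.add_mem _ hy hy'
    · exact tmul_mem_formsInGrading (deRham_mul_mem hα hβ) _

lemma wedge_swap (b : h₁ →ₗ[ℝ] h₂ →ₗ[ℝ] h₃) {p q : ℤ} {x : FormsIn M h₁} {y : FormsIn M h₂}
    (hx : x ∈ formsInGrading M h₁ p) (hy : y ∈ formsInGrading M h₂ q) :
    wedge M b x y = ((-1 : ℝ) ^ (p * q)) • wedge M b.flip y x := by
  refine formsInGrading_induction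
    (P := fun x => wedge M b x y = ((-1 : ℝ) ^ (p * q)) • wedge M b.flip y x) hx
    ?_ (fun x x' hx hx' => ?_) fun α hα X => ?_
  · rw [map_zero, map_zero, LinearMap.zero_apply, smul_zero]
  · rw [map_add, map_add, LinearMap.add_apply, hx, hx', smul_add]
  · refine formsInGrading_induction (P := fun y => wedge M b (α ⊗ₜ[ℝ] X) y =
      ((-1 : ℝ) ^ (p * q)) • wedge M b.flip y (α ⊗ₜ[ℝ] X)) hy
      ?_ (fun y y' hy hy' => ?_) fun β hβ Y => ?_
    · rw [map_zero, map_zero, LinearMap.zero_apply, smul_zero]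
    · rw [map_add, map_add, LinearMap.add_apply, hy, hy', smul_add]
    · rw [wedge_tmul, wedge_tmul, deRham_mul_comm hα hβ, TensorProduct.smul_tmul']
      rfl

lemma wedge_neg_left (b : h₁ →ₗ[ℝ] h₂ →ₗ[ℝ] h₃) (x : FormsIn M h₁) (y : FormsIn M h₂) :
    wedge M (-b) x y = -wedge M b x y := by
  induction x using TensorProduct.induction_on with
  | zero => rw [map_zero, map_zero, LinearMap.zero_apply, neg_zero]
  | add x x' hx hx' => rw [map_add, map_add, LinearMap.add_apply, LinearMap.add_apply, hx, hx',
      neg_add]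
  | tmul α X =>
    induction y using TensorProduct.induction_on with
    | zero => rw [map_zero, map_zero, neg_zero]
    | add y y' hy hy' => rw [map_add, map_add, hy, hy', neg_add]
    | tmul β Y => rw [wedge_tmul, wedge_tmul, ← TensorProduct.tmul_neg]; rfl

lemma lieBilin_flip : (lieBilin h).flip = -lieBilin h :=
  LinearMap.ext₂ fun x y => (lie_skew y x).symm

lemma wedgeLie_swap {p q : ℤ} {x y : FormsIn M h} (hx : x ∈ formsInGrading M h p)
    (hy : y ∈ formsInGrading M h q) :
    wedgeLie M h x y = -((-1 : ℝ) ^ (p * q)) • wedgeLie M h y x := by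
  rw [wedge_swap _ hx hy, lieBilin_flip, wedge_neg_left, smul_neg]
  exact (neg_smul _ _).symm

lemma formsInD_mem {p : ℤ} {x : FormsIn M h₁} (hx : x ∈ formsInGrading M h₁ p) :
    formsInD M h₁ x ∈ formsInGrading M h₁ (p + 1) := by
  refine formsInGrading_induction (P := fun x => formsInD M h₁ x ∈ formsInGrading M h₁ (p + 1)) hx
    ?_ (fun x x' hx hx' => ?_) fun α hα X => ?_
  · rw [map_zero]
    exact Submodule.zero_mem _
  · rw [map_add]
    exact Submodule.add_mem _ hx hx'
  · exact tmul_mem_formsInGrading (deRhamD_mem hα) X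

lemma formsInD_formsInD (x : FormsIn M h₁) : formsInD M h₁ (formsInD M h₁ x) = 0 := by
  induction x using TensorProduct.induction_on with
  | zero => rw [map_zero, map_zero]
  | add x x' hx hx' => rw [map_add, map_add, hx, hx', add_zero]
  | tmul α X => rw [formsInD_tmul, formsInD_tmul, deRhamD_deRhamD, TensorProduct.zero_tmul]

lemma formsInD_wedge (b : h₁ →ₗ[ℝ] h₂ →ₗ[ℝ] h₃) {p : ℤ} {x : FormsIn M h₁}
    (hx : x ∈ formsInGrading M h₁ p) (y : FormsIn M h₂) :
    formsInD M h₃ (wedge M b x y) = wedge M b (formsInD M h₁ x) y +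
      ((-1 : ℝ) ^ p) • wedge M b x (formsInD M h₂ y) := by
  refine formsInGrading_induction (P := fun x => formsInD M h₃ (wedge M b x y) =
      wedge M b (formsInD M h₁ x) y + ((-1 : ℝ) ^ p) • wedge M b x (formsInD M h₂ y)) hx
    ?_ (fun x x' hx hx' => ?_) fun α hα X => ?_
  · simp only [map_zero, LinearMap.zero_apply, smul_zero, add_zero]
  · simp only [map_add, LinearMap.add_apply, hx, hx', smul_add]
    abel
  · induction y using TensorProduct.induction_on with
    | zero => simp only [map_zero, smul_zero, add_zero]
    | add y y' hy hy' =>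
      simp only [map_add, hy, hy', smul_add]
      abel
    | tmul β Y =>
      rw [wedge_tmul, formsInD_tmul, formsInD_tmul, formsInD_tmul, wedge_tmul, wedge_tmul,
        deRhamD_mul hα, TensorProduct.add_tmul, TensorProduct.smul_tmul']

lemma wedgeLie_jacobi {p q : ℤ} {x y : FormsIn M h} (hx : x ∈ formsInGrading M h p)
    (hy : y ∈ formsInGrading M h q) (z : FormsIn M h) :
    wedgeLie M h x (wedgeLie M h y z) = wedgeLie M h (wedgeLie M h x y) z +
      ((-1 : ℝ) ^ (p * q)) • wedgeLie M h y (wedgeLie M h x z) := by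
  refine formsInGrading_induction (P := fun x => wedgeLie M h x (wedgeLie M h y z) =
      wedgeLie M h (wedgeLie M h x y) z +
        ((-1 : ℝ) ^ (p * q)) • wedgeLie M h y (wedgeLie M h x z)) hx
    ?_ (fun x x' hx hx' => ?_) fun α hα X => ?_
  · simp only [map_zero, LinearMap.zero_apply, smul_zero, add_zero]
  · simp only [map_add, LinearMap.add_apply, hx, hx', smul_add]
    abel
  refine formsInGrading_induction (P := fun y => wedgeLie M h (α ⊗ₜ[ℝ] X) (wedgeLie M h y z) =
      wedgeLie M h (wedgeLie M h (α ⊗ₜ[ℝ] X) y) z +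
        ((-1 : ℝ) ^ (p * q)) • wedgeLie M h y (wedgeLie M h (α ⊗ₜ[ℝ] X) z)) hy
    ?_ (fun y y' hy hy' => ?_) fun β hβ Y => ?_
  · simp only [map_zero, LinearMap.zero_apply, smul_zero, add_zero]
  · simp only [map_add, LinearMap.add_apply, hy, hy', smul_add]
    abel
  induction z using TensorProduct.induction_on with
  | zero => simp only [map_zero, smul_zero, add_zero]
  | add z z' hz hz' =>
    simp only [map_add, hz, hz', smul_add]
    abel
  | tmul γ Z =>
    simp only [wedge_tmul]
    rw [← mul_assoc β α γ, TensorProduct.smul_tmul', ← smul_mul_assoc, ← deRham_mul_comm hα hβ,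
      ← mul_assoc, ← TensorProduct.tmul_add]
    exact congrArg _ (leibniz_lie X Y Z)

/-- The differential twisted by a flat connection squares to zero. -/
lemma twisted_d_d {conn : FormsIn M h} (hconn : IsFlatConnection M h conn) (x : FormsIn M h) :
    (formsInD M h + wedgeLie M h conn) ((formsInD M h + wedgeLie M h conn) x) = 0 := by
  have hneg (z : FormsIn M h) : (-1 : ℝ) ^ (1 : ℤ) • z = -z := by
    rw [zpow_one]
    exact neg_one_smul ℝ z
  have h₁ := (formsInD_wedge (lieBilin h) hconn.mem x).trans (congrArg _ (hneg _))
  have h₂ := (wedgeLie_jacobi hconn.mem hconn.mem x).trans (congrArg _ (hneg _))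
  have h₃ := LinearMap.congr_fun (congrArg (wedgeLie M h) hconn.flat) x
  rw [curvature, map_add, map_smul, map_zero, LinearMap.zero_apply, LinearMap.add_apply,
    LinearMap.smul_apply] at h₃
  -- The Jacobi identity for `∇, ∇, x` shows that the square of `[∇, ·]` is the bracket with `½[∇,
  -- ∇]`. Together with `[d∇, ·]` this is the bracket with the curvature.
  have h₄ : wedgeLie M h (wedgeLie M h conn conn) x =
      (2 : ℝ) • wedgeLie M h conn (wedgeLie M h conn x) := by
    rw [two_smul]
    nth_rewrite 2 [h₂]
    abel
  rw [h₄, smul_smul, one_div, inv_mul_cancel₀ two_ne_zero, one_smul] at h₃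
  rw [LinearMap.add_apply, LinearMap.add_apply, map_add, map_add, formsInD_formsInD, h₁]
  refine Eq.trans ?_ h₃
  abel

/-- The bracket with an element of degree one is a derivation of degree one; this is the Jacobi
identity. -/
lemma twisted_leibniz {conn : FormsIn M h} (hconn : conn ∈ formsInGrading M h 1) {p : ℤ}
    {x : FormsIn M h} (hx : x ∈ formsInGrading M h p) (y : FormsIn M h) :
    (formsInD M h + wedgeLie M h conn) (wedgeLie M h x y) =
      wedgeLie M h ((formsInD M h + wedgeLie M h conn) x) y +
        (-1 : ℝ) ^ p • wedgeLie M h x ((formsInD M h + wedgeLie M h conn) y) := by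
  have h₁ := formsInD_wedge (lieBilin h) hx y
  have h₂ := wedgeLie_jacobi hconn hx y
  rw [one_mul] at h₂
  simp only [LinearMap.add_apply, map_add, h₁, h₂, smul_add]
  abel

end FormsIn

/-! ### The dg Lie algebra of the theorem. -/

section Gravity

variable {M : Type u} [TopologicalSpace M] [ChartedSpace (Euc 3) M] [IsManifold (𝓡 3) ∞ M]

/-- Forms with values in the Poincaré algebra, with the differential twisted by a flat connection,
are a dg Lie algebra. -/
theorem isDGLA_gravity {conn : FormsIn M Iso21} (hconn : IsFlatConnection M Iso21 conn) :
    (gravity M conn).IsDGLA where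
  d_mem p x hx := by
    have h := wedge_mem (lieBilin Iso21) hconn.mem hx
    rw [add_comm] at h
    exact Submodule.add_mem _ (formsInD_mem hx) h
  d_d := twisted_d_d hconn
  br_mem _ _ _ hx _ hy := wedge_mem _ hx hy
  antisymm _ _ _ hx _ hy := wedgeLie_swap hx hy
  leibniz _ _ hx := twisted_leibniz hconn.mem hx
  jacobi _ _ _ hx _ hy := wedgeLie_jacobi hx hy

end Gravity

/-! ### Lorentz and translation components of the curvature. -/

section Parts

variable {M : Type u} [TopologicalSpace M] [ChartedSpace (Euc 3) M] [IsManifold (𝓡 3) ∞ M]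

lemma lorentzPart_formsInD (A : FormsIn M Iso21) :
    lorentzPart M (formsInD M Iso21 A) = formsInD M Lorentz (lorentzPart M A) := by
  induction A using TensorProduct.induction_on with
  | zero => simp only [map_zero]
  | add x y hx hy => simp only [map_add, hx, hy]
  | tmul α X => rfl

lemma translationPart_formsInD (A : FormsIn M Iso21) :
    translationPart M (formsInD M Iso21 A) = formsInD M Translation (translationPart M A) := by
  induction A using TensorProduct.induction_on with
  | zero => simp only [map_zero]
  | add x y hx hy => simp only [map_add, hx, hy]
  | tmul α X => rfl

lemma lorentzPart_wedgeLie (A B : FormsIn M Iso21) : lorentzPart M (wedgeLie M Iso21 A B) =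
    wedgeLie M Lorentz (lorentzPart M A) (lorentzPart M B) := by
  induction A using TensorProduct.induction_on with
  | zero => simp only [map_zero, LinearMap.zero_apply]
  | add x y hx hy => simp only [map_add, LinearMap.add_apply, hx, hy]
  | tmul α X =>
    induction B using TensorProduct.induction_on with
    | zero => simp only [map_zero]
    | add x y hx hy => simp only [map_add, hx, hy]
    | tmul β Y => rfl

/-- Translations commute, so only the two actions of the Lorentz parts contribute. -/
lemma translation_lie (X Y : Iso21) :
    (⁅X, Y⁆ : Iso21).left = lorentzMulVec X.right Y.left - lorentzMulVec Y.right X.left :=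
  congrArg (· - lorentzMulVec Y.right X.left) (zero_add (lorentzMulVec X.right Y.left))

/-- One-forms anticommute, which turns the difference of the two actions into a sum. For `A = B` the
terms agree and cancel the factor `½` of the curvature. -/
lemma translationPart_wedgeLie {A B : FormsIn M Iso21} (hA : A ∈ formsInGrading M Iso21 1)
    (hB : B ∈ formsInGrading M Iso21 1) : translationPart M (wedgeLie M Iso21 A B) =
      wedge M lorentzMulVec (lorentzPart M A) (translationPart M B) +
        wedge M lorentzMulVec (lorentzPart M B) (translationPart M A) := by
  refine formsInGrading_induction (P := fun A => translationPart M (wedgeLie M Iso21 A B) =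
      wedge M lorentzMulVec (lorentzPart M A) (translationPart M B) +
        wedge M lorentzMulVec (lorentzPart M B) (translationPart M A)) hA
    ?_ (fun x y hx hy => ?_) fun α hα X => ?_
  · simp only [map_zero, LinearMap.zero_apply, add_zero]
  · simp only [map_add, LinearMap.add_apply, hx, hy]
    abel
  refine formsInGrading_induction (P := fun B => translationPart M (wedgeLie M Iso21 (α ⊗ₜ[ℝ] X) B) =
      wedge M lorentzMulVec (lorentzPart M (α ⊗ₜ[ℝ] X)) (translationPart M B) +
        wedge M lorentzMulVec (lorentzPart M B) (translationPart M (α ⊗ₜ[ℝ] X))) hB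
    ?_ (fun x y hx hy => ?_) fun β hβ Y => ?_
  · simp only [map_zero, LinearMap.zero_apply, add_zero]
  · simp only [map_add, LinearMap.add_apply, hx, hy]
    abel
  have h : β * α = -(α * β) := by
    rw [deRham_mul_comm hβ hα, mul_one, zpow_one]
    exact neg_one_smul ℝ _
  change (α * β) ⊗ₜ[ℝ] (⁅X, Y⁆ : Iso21).left = (α * β) ⊗ₜ[ℝ] lorentzMulVec X.right Y.left +
    (β * α) ⊗ₜ[ℝ] lorentzMulVec Y.right X.left
  rw [h, translation_lie, TensorProduct.tmul_sub, TensorProduct.neg_tmul, sub_eq_add_neg]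

/-- A form with values in the Poincaré algebra is the sum of its two parts. -/
lemma eq_inl_add_inr (A : FormsIn M Iso21) :
    A = ((LieAlgebra.SemiDirectSum.inl lorentzAction : Translation →ₗ⁅ℝ⁆ Iso21) :
        Translation →ₗ[ℝ] Iso21).lTensor (DeRham (n := 3) M) (translationPart M A) +
      ((LieAlgebra.SemiDirectSum.inr lorentzAction : Lorentz →ₗ⁅ℝ⁆ Iso21) :
        Lorentz →ₗ[ℝ] Iso21).lTensor (DeRham (n := 3) M) (lorentzPart M A) := by
  induction A using TensorProduct.induction_on with
  | zero => simp only [map_zero, add_zero]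
  | add x y hx hy =>
    rw [map_add, map_add, map_add, map_add]
    nth_rewrite 1 [hx, hy]
    abel
  | tmul α X =>
    have h : X = (LieAlgebra.SemiDirectSum.inl lorentzAction X.left +
        LieAlgebra.SemiDirectSum.inr lorentzAction X.right : Iso21) :=
      LieAlgebra.SemiDirectSum.ext (add_zero X.left).symm (zero_add X.right).symm
    exact (congrArg (fun Z => α ⊗ₜ[ℝ] Z) h).trans (TensorProduct.tmul_add α _ _)

lemma eq_zero_iff_parts (A : FormsIn M Iso21) :
    A = 0 ↔ lorentzPart M A = 0 ∧ translationPart M A = 0 := by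
  refine ⟨fun h => by rw [h, map_zero, map_zero]; exact ⟨rfl, rfl⟩, fun h => ?_⟩
  rw [eq_inl_add_inr A, h.1, h.2, map_zero, map_zero, add_zero]

/-- A connection with values in the Poincaré algebra is flat if and only if its Lorentz part is flat
and its torsion vanishes. -/
theorem curvature_eq_zero_iff {A : FormsIn M Iso21} (hA : A ∈ formsInGrading M Iso21 1) :
    curvature M Iso21 A = 0 ↔ curvature M Lorentz (lorentzPart M A) = 0 ∧
      torsion M (lorentzPart M A) (translationPart M A) = 0 := by
  have h₁ : lorentzPart M (curvature M Iso21 A) = curvature M Lorentz (lorentzPart M A) := by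
    rw [curvature, curvature, map_add, map_smul, lorentzPart_formsInD, lorentzPart_wedgeLie]
  have h₂ : translationPart M (curvature M Iso21 A) =
      torsion M (lorentzPart M A) (translationPart M A) := by
    rw [curvature, torsion, map_add, map_smul, translationPart_formsInD,
      translationPart_wedgeLie hA hA]
    refine congrArg _ ?_
    module
  rw [eq_zero_iff_parts, h₁, h₂]

end Parts

/-! ### Connections with coefficients in an Artinian algebra. -/

section Coefficients

variable {M : Type u} [TopologicalSpace M] [ChartedSpace (Euc 3) M] [IsManifold (𝓡 3) ∞ M]
  {R : DGArt.{u}}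

lemma DGArt.IsOrdinary.mul_comm (hR : R.IsOrdinary) (a b : R.carrier) : a * b = b * a := by
  have h (x : R.carrier) : x ∈ R.gr 0 := hR ▸ Submodule.mem_top
  have := R.graded_comm 0 0 a (h a) b (h b)
  rwa [mul_zero, zpow_zero, one_smul] at this

lemma oneFormsCoeff_induction {h : Type} [AddCommGroup h] [Module ℝ h]
    {I : Submodule ℝ R.carrier} {P : FormsIn M h ⊗[ℝ] R.carrier → Prop}
    {A : FormsIn M h ⊗[ℝ] R.carrier} (hA : A ∈ oneFormsCoeff M R h I) (h₀ : P 0)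
    (hadd : ∀ A B, P A → P B → P (A + B))
    (htmul : ∀ x ∈ formsInGrading M h 1, ∀ a ∈ I, P (x ⊗ₜ[ℝ] a)) : P A := by
  obtain ⟨A, rfl⟩ := hA
  induction A using TensorProduct.induction_on with
  | zero => rwa [map_zero]
  | add x y hx hy => rw [map_add]; exact hadd _ _ hx hy
  | tmul x a => exact htmul x.1 x.2 a.1 a.2

lemma wedgeCoeff_tmul {h₁ h₂ h₃ : Type} [AddCommGroup h₁] [Module ℝ h₁] [AddCommGroup h₂]
    [Module ℝ h₂] [AddCommGroup h₃] [Module ℝ h₃] (b : h₁ →ₗ[ℝ] h₂ →ₗ[ℝ] h₃) (x : FormsIn M h₁)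
    (y : FormsIn M h₂) (r s : R.carrier) :
    wedgeCoeff M R b (x ⊗ₜ[ℝ] r) (y ⊗ₜ[ℝ] s) = wedge M b x y ⊗ₜ[ℝ] (r * s) := rfl

lemma lorentzPart_wedgeCoeff (A B : FormsIn M Iso21 ⊗[ℝ] R.carrier) :
    (lorentzPart M).rTensor R.carrier (wedgeCoeff M R (lieBilin Iso21) A B) =
      wedgeCoeff M R (lieBilin Lorentz) ((lorentzPart M).rTensor R.carrier A)
        ((lorentzPart M).rTensor R.carrier B) := by
  induction A using TensorProduct.induction_on with
  | zero => simp only [map_zero, LinearMap.zero_apply]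
  | add x y hx hy => simp only [map_add, LinearMap.add_apply, hx, hy]
  | tmul x r =>
    induction B using TensorProduct.induction_on with
    | zero => simp only [map_zero]
    | add x y hx hy => simp only [map_add, hx, hy]
    | tmul y s =>
      simp only [wedgeCoeff_tmul, LinearMap.rTensor_tmul]
      exact congrArg (· ⊗ₜ[ℝ] (r * s)) (lorentzPart_wedgeLie x y)

/-- Exchanging the two one-forms also exchanges their coefficients, and these commute because `R` is
concentrated in degree zero. -/
lemma translationPart_wedgeCoeff (hR : R.IsOrdinary) {A B : FormsIn M Iso21 ⊗[ℝ] R.carrier}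
    {I : Submodule ℝ R.carrier} (hA : A ∈ oneFormsCoeff M R Iso21 I)
    (hB : B ∈ oneFormsCoeff M R Iso21 I) :
    (translationPart M).rTensor R.carrier (wedgeCoeff M R (lieBilin Iso21) A B) =
      wedgeCoeff M R lorentzMulVec ((lorentzPart M).rTensor R.carrier A)
        ((translationPart M).rTensor R.carrier B) +
      wedgeCoeff M R lorentzMulVec ((lorentzPart M).rTensor R.carrier B)
        ((translationPart M).rTensor R.carrier A) := by
  refine oneFormsCoeff_induction (P := fun A =>
      (translationPart M).rTensor R.carrier (wedgeCoeff M R (lieBilin Iso21) A B) =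
      wedgeCoeff M R lorentzMulVec ((lorentzPart M).rTensor R.carrier A)
        ((translationPart M).rTensor R.carrier B) +
      wedgeCoeff M R lorentzMulVec ((lorentzPart M).rTensor R.carrier B)
        ((translationPart M).rTensor R.carrier A)) hA ?_ (fun x y hx hy => ?_) fun x hx r _ => ?_
  · simp only [map_zero, LinearMap.zero_apply, add_zero]
  · simp only [map_add, LinearMap.add_apply, hx, hy]
    abel
  refine oneFormsCoeff_induction (P := fun B =>
      (translationPart M).rTensor R.carrier (wedgeCoeff M R (lieBilin Iso21) (x ⊗ₜ[ℝ] r) B) =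
      wedgeCoeff M R lorentzMulVec ((lorentzPart M).rTensor R.carrier (x ⊗ₜ[ℝ] r))
        ((translationPart M).rTensor R.carrier B) +
      wedgeCoeff M R lorentzMulVec ((lorentzPart M).rTensor R.carrier B)
        ((translationPart M).rTensor R.carrier (x ⊗ₜ[ℝ] r))) hB
    ?_ (fun x y hx hy => ?_) fun y hy s _ => ?_
  · simp only [map_zero, LinearMap.zero_apply, add_zero]
  · simp only [map_add, LinearMap.add_apply, hx, hy]
    abel
  · simp only [wedgeCoeff_tmul, LinearMap.rTensor_tmul]
    rw [hR.mul_comm s r, ← TensorProduct.add_tmul]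
    exact congrArg (· ⊗ₜ[ℝ] (r * s)) (translationPart_wedgeLie hx hy)

lemma coeff_eq_zero_iff_parts (A : FormsIn M Iso21 ⊗[ℝ] R.carrier) :
    A = 0 ↔ (lorentzPart M).rTensor R.carrier A = 0 ∧
      (translationPart M).rTensor R.carrier A = 0 := by
  refine ⟨fun h => by rw [h, map_zero, map_zero]; exact ⟨rfl, rfl⟩, fun h => ?_⟩
  have key : A = (((LieAlgebra.SemiDirectSum.inl lorentzAction : Translation →ₗ⁅ℝ⁆ Iso21) :
        Translation →ₗ[ℝ] Iso21).lTensor (DeRham (n := 3) M)).rTensor R.carrier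
          ((translationPart M).rTensor R.carrier A) +
      (((LieAlgebra.SemiDirectSum.inr lorentzAction : Lorentz →ₗ⁅ℝ⁆ Iso21) :
        Lorentz →ₗ[ℝ] Iso21).lTensor (DeRham (n := 3) M)).rTensor R.carrier
          ((lorentzPart M).rTensor R.carrier A) := by
    clear h
    induction A using TensorProduct.induction_on with
    | zero => simp only [map_zero, add_zero]
    | add x y hx hy =>
      rw [map_add, map_add, map_add, map_add]
      nth_rewrite 1 [hx, hy]
      abel
    | tmul x r =>
      simp only [LinearMap.rTensor_tmul]
      rw [← TensorProduct.add_tmul, ← eq_inl_add_inr]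
  rw [key, h.1, h.2, map_zero, map_zero, add_zero]

lemma rTensor_formsInD_comm {h h' : Type} [AddCommGroup h] [Module ℝ h] [AddCommGroup h']
    [Module ℝ h'] {φ : FormsIn M h →ₗ[ℝ] FormsIn M h'}
    (hφ : ∀ x, φ (formsInD M h x) = formsInD M h' (φ x)) (A : FormsIn M h ⊗[ℝ] R.carrier) :
    φ.rTensor R.carrier ((formsInD M h).rTensor R.carrier A) =
      (formsInD M h').rTensor R.carrier (φ.rTensor R.carrier A) := by
  rw [← LinearMap.rTensor_comp_apply, ← LinearMap.rTensor_comp_apply]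
  exact congrArg (fun ψ => LinearMap.rTensor R.carrier ψ A) (LinearMap.ext hφ)

/-- A connection with coefficients in an ordinary Artinian algebra is flat if and only if its Lorentz
part is flat and its torsion vanishes. -/
theorem curvatureCoeff_eq_zero_iff (hR : R.IsOrdinary) {A : FormsIn M Iso21 ⊗[ℝ] R.carrier}
    {I : Submodule ℝ R.carrier} (hA : A ∈ oneFormsCoeff M R Iso21 I) :
    curvatureCoeff M R Iso21 A = 0 ↔
      curvatureCoeff M R Lorentz ((lorentzPart M).rTensor R.carrier A) = 0 ∧
        torsionCoeff M R ((lorentzPart M).rTensor R.carrier A)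
          ((translationPart M).rTensor R.carrier A) = 0 := by
  have h₁ : (lorentzPart M).rTensor R.carrier (curvatureCoeff M R Iso21 A) =
      curvatureCoeff M R Lorentz ((lorentzPart M).rTensor R.carrier A) := by
    rw [curvatureCoeff, curvatureCoeff, map_add, map_smul,
      rTensor_formsInD_comm lorentzPart_formsInD, lorentzPart_wedgeCoeff]
  have h₂ : (translationPart M).rTensor R.carrier (curvatureCoeff M R Iso21 A) =
      torsionCoeff M R ((lorentzPart M).rTensor R.carrier A)
        ((translationPart M).rTensor R.carrier A) := by
    rw [curvatureCoeff, torsionCoeff, map_add, map_smul,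
      rTensor_formsInD_comm translationPart_formsInD, translationPart_wedgeCoeff hR hA hA]
    refine congrArg _ ?_
    module
  rw [coeff_eq_zero_iff_parts, h₁, h₂]

lemma wedgeCoeff_tmul_one_left (conn : FormsIn M Iso21) (A : FormsIn M Iso21 ⊗[ℝ] R.carrier) :
    wedgeCoeff M R (lieBilin Iso21) (conn ⊗ₜ[ℝ] (1 : R.carrier)) A =
      (wedgeLie M Iso21 conn).rTensor R.carrier A := by
  induction A using TensorProduct.induction_on with
  | zero => simp only [map_zero]
  | add x y hx hy => simp only [map_add, hx, hy]
  | tmul x r => rw [wedgeCoeff_tmul, one_mul, LinearMap.rTensor_tmul]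

lemma wedgeCoeff_tmul_one_right {conn : FormsIn M Iso21} (hconn : conn ∈ formsInGrading M Iso21 1)
    {I : Submodule ℝ R.carrier} {A : FormsIn M Iso21 ⊗[ℝ] R.carrier}
    (hA : A ∈ oneFormsCoeff M R Iso21 I) :
    wedgeCoeff M R (lieBilin Iso21) A (conn ⊗ₜ[ℝ] (1 : R.carrier)) =
      (wedgeLie M Iso21 conn).rTensor R.carrier A := by
  refine oneFormsCoeff_induction (P := fun A =>
    wedgeCoeff M R (lieBilin Iso21) A (conn ⊗ₜ[ℝ] (1 : R.carrier)) =
      (wedgeLie M Iso21 conn).rTensor R.carrier A) hA ?_ (fun x y hx hy => ?_) fun x hx r _ => ?_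
  · simp only [map_zero, LinearMap.zero_apply]
  · simp only [map_add, LinearMap.add_apply, hx, hy]
  · have h := wedgeLie_swap hx hconn
    rw [mul_one, zpow_one, neg_neg] at h
    rw [wedgeCoeff_tmul, mul_one, LinearMap.rTensor_tmul]
    exact congrArg (· ⊗ₜ[ℝ] r) (h.trans (one_smul ℝ _))

lemma curvatureCoeff_tmul_one (conn : FormsIn M Iso21) :
    curvatureCoeff M R Iso21 (conn ⊗ₜ[ℝ] (1 : R.carrier)) =
      curvature M Iso21 conn ⊗ₜ[ℝ] (1 : R.carrier) := by
  rw [curvatureCoeff, wedgeCoeff_tmul, mul_one, LinearMap.rTensor_tmul, TensorProduct.smul_tmul',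
    ← TensorProduct.add_tmul]
  rfl

/-- Polarisation: the two mixed terms agree and absorb the factor `½`. -/
lemma quadratic_add {V W : Type*} [AddCommGroup V] [Module ℝ V] [AddCommGroup W] [Module ℝ W]
    (d : V →ₗ[ℝ] W) (b : V →ₗ[ℝ] V →ₗ[ℝ] W) {x y : V} (h : b y x = b x y) :
    d (x + y) + (1 / 2 : ℝ) • b (x + y) (x + y) =
      d x + (1 / 2 : ℝ) • b x x + (d y + b x y + (1 / 2 : ℝ) • b y y) := by
  rw [map_add, map_add, map_add, LinearMap.add_apply, LinearMap.add_apply, h]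
  module

/-- The curvature of a deformation of a flat connection. -/
lemma curvatureCoeff_add {conn : FormsIn M Iso21} (hconn : IsFlatConnection M Iso21 conn)
    {I : Submodule ℝ R.carrier} {A : FormsIn M Iso21 ⊗[ℝ] R.carrier}
    (hA : A ∈ oneFormsCoeff M R Iso21 I) :
    curvatureCoeff M R Iso21 (conn ⊗ₜ[ℝ] (1 : R.carrier) + A) =
      twistedD M R conn A + (1 / 2 : ℝ) • wedgeCoeff M R (lieBilin Iso21) A A := by
  have h₁ := wedgeCoeff_tmul_one_left (R := R) conn A
  have h₂ := wedgeCoeff_tmul_one_right hconn.mem hA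
  have h₃ := curvatureCoeff_tmul_one (R := R) conn
  rw [hconn.flat, TensorProduct.zero_tmul] at h₃
  have h := quadratic_add (V := FormsIn M Iso21 ⊗[ℝ] R.carrier) (W := FormsIn M Iso21 ⊗[ℝ] R.carrier)
    ((formsInD M Iso21).rTensor R.carrier) (wedgeCoeff M R (lieBilin Iso21)) (h₂.trans h₁.symm)
  refine h.trans ?_
  rw [h₁, twistedD, LinearMap.rTensor_add, LinearMap.add_apply]
  exact (congrArg (· + _) h₃).trans (zero_add _)

end Coefficients

/-! ### Maurer–Cartan elements on the point. -/

section Point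

variable {g : DGLAData.{u}} {R : DGArt.{u}}

lemma toPoint_tmul (x : g.carrier) (a : R.carrier) :
    toPoint R g (x ⊗ₜ[ℝ] a) = x ⊗ₜ[ℝ] (a ⊗ₜ[ℝ] (1 : SimplexForms (Fin 1))) := rfl

variable (g R) in
/-- The inverse of the inclusion `toPoint`: evaluation of functions on the point. -/
def evalPoint : Triple g R (Fin 1) →ₗ[ℝ] g.carrier ⊗[ℝ] R.carrier :=
  ((TensorProduct.rid ℝ R.carrier).toLinearMap ∘ₗ
    (vertexEval (0 : Fin 1)).toLinearMap.lTensor R.carrier).lTensor g.carrier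

lemma evalPoint_tmul (x : g.carrier) (a : R.carrier) (w : SimplexForms (Fin 1)) :
    evalPoint g R (x ⊗ₜ[ℝ] (a ⊗ₜ[ℝ] w)) = x ⊗ₜ[ℝ] (vertexEval (0 : Fin 1) w • a) := rfl

lemma evalPoint_toPoint (A : g.carrier ⊗[ℝ] R.carrier) : evalPoint g R (toPoint R g A) = A := by
  induction A using TensorProduct.induction_on with
  | zero => simp only [map_zero]
  | add x y hx hy => simp only [map_add, hx, hy]
  | tmul x a => rw [toPoint_tmul, evalPoint_tmul, map_one, one_smul]

/-- On the point the identity is a constant map, so every form is its value times the unit. -/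
lemma eq_vertexEval_smul_one (w : SimplexForms (Fin 1)) :
    w = vertexEval (0 : Fin 1) w • (1 : SimplexForms (Fin 1)) := by
  have h := simplexPullback_const (J' := Fin 1) (0 : Fin 1) w
  have h₀ : (fun _ : Fin 1 => (0 : Fin 1)) = id := funext fun i => (Subsingleton.elim _ _)
  rw [h₀, simplexPullback_id, Algebra.algebraMap_eq_smul_one] at h
  exact h

lemma toPoint_evalPoint (α : Triple g R (Fin 1)) : toPoint R g (evalPoint g R α) = α := by
  induction α using TensorProduct.induction_on with
  | zero => simp only [map_zero]
  | add x y hx hy => simp only [map_add, hx, hy]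
  | tmul x z =>
    induction z using TensorProduct.induction_on with
    | zero => simp only [TensorProduct.tmul_zero, map_zero]
    | add z z' hz hz' => simp only [TensorProduct.tmul_add, map_add, hz, hz']
    | tmul a w =>
      rw [evalPoint_tmul, toPoint_tmul, TensorProduct.smul_tmul, ← eq_vertexEval_smul_one]

lemma DGArt.IsOrdinary.mem_gr_zero (hR : R.IsOrdinary) (a : R.carrier) : a ∈ R.gr 0 :=
  hR ▸ Submodule.mem_top

lemma DGArt.IsOrdinary.d_eq_zero (hR : R.IsOrdinary) (a : R.carrier) : R.d a = 0 := by
  have h := R.d_mem 0 a (hR.mem_gr_zero a)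
  rwa [R.nonpos _ (by norm_num), Submodule.mem_bot] at h

lemma DGArt.IsOrdinary.eq_zero_of_mem (hR : R.IsOrdinary) {q : ℤ} (hq : q ≠ 0) {a : R.carrier}
    (ha : a ∈ R.gr q) : a = 0 := by
  obtain ⟨π, h, h'⟩ := exists_proj_of_decomposition R.gr
  rw [← h 0 a (hR.mem_gr_zero a), h' q 0 hq a ha]

lemma DGArt.IsOrdinary.parity_eq (hR : R.IsOrdinary) (a : R.carrier) : parity R.gr a = a := by
  rw [parity_of_mem R.gr (hR.mem_gr_zero a), zpow_zero, one_smul]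

lemma totalD_toPoint (hR : R.IsOrdinary) (A : g.carrier ⊗[ℝ] R.carrier) :
    totalD g R (Fin 1) (toPoint R g A) = toPoint R g (g.d.rTensor R.carrier A) := by
  induction A using TensorProduct.induction_on with
  | zero => simp only [map_zero]
  | add x y hx hy => simp only [map_add, hx, hy]
  | tmul x a =>
    change g.d x ⊗ₜ[ℝ] (a ⊗ₜ[ℝ] (1 : SimplexForms (Fin 1))) +
      parity g.gr x ⊗ₜ[ℝ] (R.d a ⊗ₜ[ℝ] (1 : SimplexForms (Fin 1))) +
        parity g.gr x ⊗ₜ[ℝ] (parity R.gr a ⊗ₜ[ℝ] simplexD (Fin 1) 1) = _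
    rw [hR.d_eq_zero, simplexD_one, TensorProduct.tmul_zero, TensorProduct.zero_tmul,
      TensorProduct.tmul_zero, add_zero, add_zero]
    rfl

/-- An even first factor produces no sign; coefficients in an ordinary `R` and constant functions
are even. -/
lemma koszul_tmul_of_fixed {U V : Type*} [AddCommGroup U] [Module ℝ U] [AddCommGroup V]
    [Module ℝ V] (ε : U →ₗ[ℝ] U) (ε' : V →ₗ[ℝ] V) {x : U} (hx : ε x = x) (y : V) :
    koszul ε ε' (x ⊗ₜ[ℝ] y) = x ⊗ₜ[ℝ] y := by
  simp only [koszul, LinearMap.smul_apply, LinearMap.sub_apply, LinearMap.add_apply,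
    LinearMap.id_apply, TensorProduct.map_tmul, hx]
  module

lemma parity_one_simplexForms : parity (simplexGrading (Fin 1)) 1 = 1 := by
  have h : (1 : SimplexForms (Fin 1)) ∈ simplexGrading (Fin 1) 0 :=
    tmul_mem_formsGrading one_mem_extGrading 1
  rw [parity_of_mem _ h, zpow_zero, one_smul]

lemma totalBr_toPoint (hR : R.IsOrdinary) (A B : g.carrier ⊗[ℝ] R.carrier) :
    totalBr g R (Fin 1) (toPoint R g A ⊗ₜ[ℝ] toPoint R g B) =
      toPoint R g (TensorProduct.map₂ g.br (LinearMap.mul ℝ R.carrier) A B) := by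
  induction A using TensorProduct.induction_on with
  | zero => simp only [map_zero, LinearMap.zero_apply, TensorProduct.zero_tmul]
  | add x y hx hy => simp only [map_add, LinearMap.add_apply, TensorProduct.add_tmul, hx, hy]
  | tmul x a =>
    induction B using TensorProduct.induction_on with
    | zero => simp only [map_zero, TensorProduct.tmul_zero]
    | add z z' hz hz' => simp only [map_add, TensorProduct.tmul_add, hz, hz']
    | tmul y b =>
      rw [toPoint_tmul, toPoint_tmul, totalBr, LinearMap.comp_apply, LinearMap.comp_apply,
        koszul_tmul_of_fixed]
      · change g.br x y ⊗ₜ[ℝ] coeffMul R (Fin 1) ((a ⊗ₜ[ℝ] 1) ⊗ₜ[ℝ] (b ⊗ₜ[ℝ] 1)) = _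
        rw [coeffMul, LinearMap.comp_apply, LinearMap.comp_apply, koszul_tmul_of_fixed]
        · change g.br x y ⊗ₜ[ℝ] ((a * b) ⊗ₜ[ℝ] ((1 : SimplexForms (Fin 1)) * 1)) = _
          rw [mul_one]
          rfl
        · rw [TensorProduct.map_tmul, parity_one_simplexForms, LinearMap.id_apply]
      · rw [TensorProduct.map_tmul, TensorProduct.map_tmul, parity_one_simplexForms,
          LinearMap.id_apply, hR.parity_eq]

lemma toPoint_mem_degreeOne (hR : R.IsOrdinary) {A : g.carrier ⊗[ℝ] R.carrier}
    (hA : A ∈ LinearMap.range (TensorProduct.map (g.gr 1).subtype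
      (R.m.restrictScalars ℝ).subtype)) : toPoint R g A ∈ degreeOne g R (Fin 1) := by
  obtain ⟨A, rfl⟩ := hA
  induction A using TensorProduct.induction_on with
  | zero => rw [map_zero, map_zero]; exact Submodule.zero_mem _
  | add x y hx hy => rw [map_add, map_add]; exact Submodule.add_mem _ hx hy
  | tmul x a =>
    exact Submodule.subset_span ⟨1, 0, 0, rfl, x.1, x.2, a.1, hR.mem_gr_zero _, a.2, 1,
      tmul_mem_formsGrading one_mem_extGrading 1, rfl⟩

/-- Evaluation kills forms of nonzero degree, and `R` has nothing outside degree zero. So only `q =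
r = 0` survives, which forces `p = 1`. -/
lemma evalPoint_mem (hR : R.IsOrdinary) {α : Triple g R (Fin 1)}
    (hα : α ∈ degreeOne g R (Fin 1)) : evalPoint g R α ∈ LinearMap.range
      (TensorProduct.map (g.gr 1).subtype (R.m.restrictScalars ℝ).subtype) := by
  induction hα using Submodule.span_induction with
  | mem α hα =>
    obtain ⟨p, q, r, hpqr, x, hx, a, ha, ham, w, hw, rfl⟩ := hα
    rw [evalPoint_tmul]
    by_cases hq : q = 0
    · by_cases hr : r = 0
      · obtain rfl : p = 1 := by omega
        exact ⟨(⟨x, hx⟩ : g.gr 1) ⊗ₜ[ℝ] (⟨_, (R.m.restrictScalars ℝ).smul_mem _ ham⟩ :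
          R.m.restrictScalars ℝ), rfl⟩
      · rw [vertexEval_of_mem 0 hr hw, zero_smul, TensorProduct.tmul_zero]
        exact Submodule.zero_mem _
    · rw [hR.eq_zero_of_mem hq ha, smul_zero, TensorProduct.tmul_zero]
      exact Submodule.zero_mem _
  | zero => rw [map_zero]; exact Submodule.zero_mem _
  | add α β _ _ hα hβ => rw [map_add]; exact Submodule.add_mem _ hα hβ
  | smul c α _ hα => rw [map_smul]; exact Submodule.smul_mem _ c hα

lemma toPoint_mem_maurerCartan_iff (hR : R.IsOrdinary) (A : g.carrier ⊗[ℝ] R.carrier) :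
    toPoint R g A ∈ maurerCartan g R (Fin 1) ↔
      A ∈ LinearMap.range (TensorProduct.map (g.gr 1).subtype
        (R.m.restrictScalars ℝ).subtype) ∧ g.d.rTensor R.carrier A +
          (1 / 2 : ℝ) • TensorProduct.map₂ g.br (LinearMap.mul ℝ R.carrier) A A = 0 := by
  have h : totalD g R (Fin 1) (toPoint R g A) +
      (1 / 2 : ℝ) • totalBr g R (Fin 1) (toPoint R g A ⊗ₜ[ℝ] toPoint R g A) =
        toPoint R g (g.d.rTensor R.carrier A +
          (1 / 2 : ℝ) • TensorProduct.map₂ g.br (LinearMap.mul ℝ R.carrier) A A) := by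
    rw [totalD_toPoint hR, totalBr_toPoint hR, map_add, map_smul]
  constructor
  · rintro ⟨h₁, h₂⟩
    refine ⟨evalPoint_toPoint A ▸ evalPoint_mem hR h₁, ?_⟩
    rw [h] at h₂
    rw [← evalPoint_toPoint (_ + _), h₂, map_zero]
  · rintro ⟨h₁, h₂⟩
    exact ⟨toPoint_mem_degreeOne hR h₁, by rw [h, h₂, map_zero]⟩

end Point

/-! ### Vertices of the Maurer–Cartan simplicial set as flat deformations. -/

section Vertices

variable {M : Type u} [TopologicalSpace M] [ChartedSpace (Euc 3) M] [IsManifold (𝓡 3) ∞ M]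

/-- Over an ordinary Artinian algebra, the vertices of the Maurer–Cartan simplicial set are the flat
deformations of the connection. -/
def flatDeformationsEquiv {R : DGArt.{u}} (hR : R.IsOrdinary) (conn : FormsIn M Iso21) :
    flatDeformations M R conn ≃ maurerCartan (gravity M conn) R (Fin 1) where
  toFun A := ⟨toPoint R (gravity M conn) A.1, (toPoint_mem_maurerCartan_iff hR _).2 A.2⟩
  invFun α := ⟨evalPoint (gravity M conn) R α.1,
    (toPoint_mem_maurerCartan_iff (g := gravity M conn) hR _).1 ((toPoint_evalPoint α.1).symm ▸ α.2)⟩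
  left_inv A := Subtype.ext (evalPoint_toPoint (g := gravity M conn) A.1)
  right_inv α := Subtype.ext (toPoint_evalPoint α.1)

end Vertices

end Gravity

end

theorem mainTheorem4 {M : Type u} [TopologicalSpace M] [ChartedSpace (Euc 3) M]
    [IsManifold (𝓡 3) ∞ M] (conn : FormsIn M Iso21) (hconn : IsFlatConnection M Iso21 conn) :
    (gravity M conn).IsDGLA ∧
    IsFormalModuliProblem (mcFunctor (gravity M conn)) ∧
    (∀ R : DGArt.{u}, R.IsOrdinary →
      (∃ φ : flatDeformations M R conn ≃
          ((mcFunctor (gravity M conn)).obj R).obj (Opposite.op (SimplexCategory.mk 0)),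
        ∀ A : flatDeformations M R conn,
          (φ A : maurerCartan (gravity M conn) R (Fin 1)).1 = toPoint R (gravity M conn) A.1) ∧
      (∀ A ∈ oneFormsCoeff M R Iso21 (R.m.restrictScalars ℝ), A ∈ flatDeformations M R conn ↔
          curvatureCoeff M R Iso21 (conn ⊗ₜ[ℝ] (1 : R.carrier) + A) = 0) ∧
      (∀ A ∈ oneFormsCoeff M R Iso21 ⊤, curvatureCoeff M R Iso21 A = 0 ↔
          curvatureCoeff M R Lorentz ((lorentzPart M).rTensor R.carrier A) = 0 ∧
          torsionCoeff M R ((lorentzPart M).rTensor R.carrier A)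
            ((translationPart M).rTensor R.carrier A) = 0)) ∧
    (∀ A ∈ formsInGrading M Iso21 1, curvature M Iso21 A = 0 ↔
      curvature M Lorentz (lorentzPart M A) = 0 ∧
      torsion M (lorentzPart M A) (translationPart M A) = 0) := by
  have hg := isDGLA_gravity hconn
  refine ⟨hg, isFormalModuliProblem_mcFunctor hg, fun R hR => ⟨⟨flatDeformationsEquiv hR conn,
    fun _ => rfl⟩, fun A hA => ?_, fun A hA => curvatureCoeff_eq_zero_iff hR hA⟩,
    fun A hA => curvature_eq_zero_iff hA⟩
  -- Expanded around the flat `∇`, the curvature of `∇ + A` is exactly the left side of the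
  -- deformation equation.
  rw [curvatureCoeff_add hconn hA]
  exact ⟨fun h => h.2, fun h => ⟨hA, h⟩⟩
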